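/- Let $\mathbf{k}$ be an algebraically closed field of characteristic $0$. Let $\mathbf{s}$ be a skew-symmetric seed: a lattice $N$ of finite rank $n$ with basis $(e_i)_{i\in\overline I}$, an integral skew-symmetric form $\{\cdot,\cdot\}$ on $N$, and a subset $I\subset\overline I$ of unfrozen indices, such that $v_i:=\{e_i,\cdot\}\in M:=\mathrm{Hom}(N,\mathbb{Z})$ is nonzero for $i\in I$. Put $p_1(n)=\{n,\cdot\}$, $N^{\oplus}_{\mathrm{uf}}=\bigoplus_{i\in I}\mathbb{N}e_i$, $t_i=t^{e_i}$, and let $\mathfrak m$ be generated by the monomials $t^\beta$, $\beta\neq 0$. **Scattering diagrams.** A wall in $M_{\mathbb R}$ over $\mathbf{k}[\![N_{\mathrm{uf}}^\oplus]\!]$ is a codimension one rational polyhedral cone $\mathfrak d\subset M_{\mathbb R}$, with a direction $m_0\in M$ tangent to $\mathfrak d$, primitive or zero, and a function $f_{\mathfrak d}=1+\sum_{\beta\neq 0,\,r\ge 1}c_{\beta,r}t^\beta z^{-rm_0}\in\mathbf{k}[M][\![N_{\mathrm{uf}}^\oplus]\!]$; it is incoming if $-m_0\in\mathfrak d$, and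 outgoing otherwise. A scattering diagram is a set of walls, finitely many of which are nontrivial modulo $\mathfrak m^j$ for each $j$. Crossing a wall acts by $z^m\mapsto f_{\mathfrak d}^{\langle n_{\mathfrak d,\gamma},m\rangle}z^m$, where $n_{\mathfrak d,\gamma}$ is the primitive normal vector of $\mathfrak d$ with $\langle n_{\mathfrak d,\gamma},\gamma'\rangle<0$; path ordered products $\theta_s\circ\cdots\circ\theta_1$ are taken order by order, for $C^1$ paths transversal to the walls with endpoints off the walls, avoiding the singular locus (the relative boundaries of the walls and the intersections of codimension at least two of pairs of walls). A diagram is consistent if its path ordered products depend only on the endpoints of the path. Two diagrams are equivalent if the products of the functions of the walls through $x$ agree for all $x$ outside of both singular loci, order by order. **$C$-scattering diagrams.** Let $\tilde{\mathbf s}$ be the seed with principal coefficients: the lattice $N\oplus M$ with the form $\{(n_1,m_1),(n_2,m_2)\}=\{n_1,n_2\}+\langle n_1,m_2\rangle-\langle n_2,m_1\rangle$, with the basis given by the $(e_i,0)$ and by the $(0,e_i^\star)$, where $(e_i^\star)$ is the dual basis, and with unfrozen vectors $(e_i,0)$, $i\in I$; thus $\tilde p_1((n,0))=(p_1(n),n)$,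 and $\tilde v_i=(v_i,e_i)$ for $i\in I$. A $C$-wall in $M_{\mathbb R}\oplus N_{\mathbb R}$ is a codimension one rational polyhedral cone $\mathfrak d\subset (n,0)^\perp$ with $n\in N_{\mathrm{uf}}^\oplus$ primitive, together with a function $1+\sum_{r\ge1}c_rz^{r(p_1(n),n)}$; it is incoming if $(p_1(n),n)\in\mathfrak d$, and outgoing otherwise. $C$-scattering diagrams are sets of $C$-walls with the same finiteness condition. Wall crossing automorphisms $z^{m}\mapsto f_{\mathfrak d}^{\epsilon\langle (n,0),m\rangle}z^m$ with $\epsilon=-\mathrm{sgn}\langle(n,0),\gamma'\rangle$ act on all monomials $z^m$, $m\in M\oplus N$, and consistency is defined in the same way; two $C$-scattering diagrams are equivalent if they have the same path ordered products. A $C_{\mathrm{prin}}$-scattering diagram is a $C$-scattering diagram all of whose walls are invariant under translation by $N_{\mathbb R}$. In both settings, a consistent completion $S(\mathfrak D_{\mathrm{in}})$ of $\mathfrak D_{\mathrm{in}}$ is a consistent diagram containing $\mathfrak D_{\mathrm{in}}$ all of whose other walls are outgoing. The $\mathcal A_{\mathrm{prin}}$ cluster scattering diagram $\mathfrak D^{\mathcal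 A_{\mathrm{prin}}}_{\mathbf s}$ is a consistent completion of $\{((e_i,0)^\perp,1+z^{(v_i,e_i)})\}_{i\in I}$. **The HDTV scattering diagram.** The $\mathcal X$ assumptions say that $v_i$ is primitive for all $i\in I$, and that $\mathbb R_{\ge0}v_i\ne\mathbb R_{\ge 0}v_j$ for $i\neq j$. A toric model $(X_\Sigma,H)$ of a log Calabi--Yau compactification of the $\mathcal X$ cluster variety is given by a smooth projective complete fan $\Sigma$ in $M_{\mathbb R}$ which contains the rays $\mathbb R_{\ge0}v_i$, for which every $e_i^\perp$, $i\in I$, is a union of codimension one cones, and no cone of which contains two distinct rays of the form $\mathbb R_{\ge0}v_i$; $H$ is the union of the closures $H_i$ of $\{1+z^{e_i}=0\}$ in the toric divisors $D_i$ of these rays. The HDTV scattering diagram $\mathfrak D_{(X_\Sigma,H)}$ is the consistent completion of the set of walls $(\sigma,(1+t_iz^{v_i})^{D_\sigma\cdot H_i})$ of direction $-v_i$, where $i\in I$, $\sigma\ni v_i$ is a codimension one cone of $\Sigma$ with $D_\sigma\cdot H_i>0$, $D_\sigma\subset D_i$ is the corresponding toric curve, and the intersection number is taken in $D_i$. **Theorem.**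 For a $C_{\mathrm{prin}}$-scattering diagram $\mathfrak D$ put $\Psi(\mathfrak D)=\{(\mathfrak d/N_{\mathbb R},f_{\mathfrak d})\}$, where $z^{(p_1(n),n)}$ is viewed as $t^nz^{p_1(n)}$, and where the direction of $\mathfrak d/N_{\mathbb R}$, for $\mathfrak d\subset(n,0)^\perp$, is the primitive vector positively proportional to $-p_1(n)$ (zero if $p_1(n)=0$). 1. $\Psi(\mathfrak D)$ is a scattering diagram in $M_{\mathbb R}$ over $\mathbf{k}[\![N_{\mathrm{uf}}^\oplus]\!]$, and a $C$-wall of $\mathfrak D$ is incoming if and only if its image is. 2. Two $C_{\mathrm{prin}}$-scattering diagrams are equivalent if and only if their images under $\Psi$ are, so $\Psi$ induces a well-defined injective map on equivalence classes. 3. $\mathfrak D$ is consistent if and only if $\Psi(\mathfrak D)$ is consistent. 4. Let $\mathfrak D_{\mathrm{in}}$ be a $C_{\mathrm{prin}}$-scattering diagram whose walls are full hyperplanes. Then $S(\Psi(\mathfrak D_{\mathrm{in}}))=\Psi(S(\mathfrak D_{\mathrm{in}}))$ up to equivalence: every consistent completion $\mathfrak D_0$ of $\mathfrak D_{\mathrm{in}}$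 is equivalent to a $C_{\mathrm{prin}}$-scattering diagram, and for every $C_{\mathrm{prin}}$-scattering diagram $\mathfrak D$ equivalent to $\mathfrak D_0$, $\Psi(\mathfrak D)$ is equivalent to a consistent completion of $\Psi(\mathfrak D_{\mathrm{in}})$, and to all of them. 5. If $\mathbf s$ satisfies the $\mathcal X$ assumptions and $(X_\Sigma,H)$ is a toric model as above, then $\Psi(\mathfrak D^{\mathcal A_{\mathrm{prin}}}_{\mathbf s})=\mathfrak D_{(X_\Sigma,H)}$ up to equivalence: every $\mathcal A_{\mathrm{prin}}$ cluster scattering diagram $\mathfrak D_0$ is equivalent to a $C_{\mathrm{prin}}$-scattering diagram, and for every $C_{\mathrm{prin}}$-scattering diagram $\mathfrak D$ equivalent to $\mathfrak D_0$, $\Psi(\mathfrak D)$ is equivalent to a consistent completion of the initial HDTV scattering diagram, and to all of them. -/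

import Mathlib

open scoped BigOperators

noncomputable section

namespace HDTVCluster

/-! ## Lattices, cones, power series

A lattice with a chosen basis indexed by a finite type `ι` is `ι → ℤ`.  Its dual lattice is again
`ι → ℤ`, with the dot product as duality pairing, and the real vector space of the dual lattice is
`ι → ℝ`. -/

/-- A nonzero lattice vector which is not a proper multiple of a lattice vector. -/
def IsPrimitive {ι : Type*} [Fintype ι] (n : ι → ℤ) : Prop :=
  Finset.univ.gcd n = 1

/-- The primitive lattice vector positively proportional to `m` (and `0` if `m = 0`). -/
def primitivePart {ι : Type*} [Fintype ι] (m : ι → ℤ) : ι → ℤ :=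
  fun j => m j / Finset.univ.gcd m

/-- The real vector attached to a lattice vector. -/
def toReal {ι : Type*} (m : ι → ℤ) : ι → ℝ := fun j => (m j : ℝ)

/-- The pairing of a lattice vector with a real vector of the dual space. -/
def pair {ι : Type*} [Fintype ι] (n : ι → ℤ) (x : ι → ℝ) : ℝ := ∑ j, (n j : ℝ) * x j

/-- The hyperplane `n^⊥`. -/
def perp {ι : Type*} [Fintype ι] (n : ι → ℤ) : Set (ι → ℝ) := {x | pair n x = 0}

/-- Rational polyhedral cones: finite intersections of rational half-spaces. -/
def IsRationalPolyhedralCone {ι : Type*} [Fintype ι] (d : Set (ι → ℝ)) : Prop :=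
  ∃ A : Finset (ι → ℤ), d = {x | ∀ n ∈ A, 0 ≤ pair n x}

/-- The dimension of a cone is the dimension of its linear span. -/
def coneDim {ι : Type*} (d : Set (ι → ℝ)) : ℕ := Module.finrank ℝ (Submodule.span ℝ d)

/-- Codimension one cones. -/
def IsCodimOne {ι : Type*} [Fintype ι] (d : Set (ι → ℝ)) : Prop :=
  coneDim d + 1 = Fintype.card ι

/-- Congruence of two power series modulo `𝔪 ^ j`, where `𝔪` is generated by the monomials
`t^β`, `β ≠ 0`. -/
def CongrMod {I R : Type*} [Semiring R] (j : ℕ) (f g : MvPowerSeries I R) : Prop :=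
  ∀ β : I →₀ ℕ, β.degree < j → MvPowerSeries.coeff β f = MvPowerSeries.coeff β g

/-- Integral powers of a power series with constant coefficient `1`. -/
def intPow {I R : Type*} [Ring R] (f : MvPowerSeries I R) (z : ℤ) : MvPowerSeries I R :=
  if 0 ≤ z then f ^ z.toNat else (MvPowerSeries.invOfUnit f 1) ^ (-z).toNat

/-! ## Paths

The following notions only use the supports of the walls, so they are set up for an arbitrary
type `W` of walls with a support map `cone`. -/

/-- The singular locus of a set of walls: the relative boundaries of the walls, and the
intersections of codimension at least two of pairs of walls. -/
def singularLocus {ι W : Type*} [Fintype ι] (cone : W → Set (ι → ℝ)) (D : Set W) :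
    Set (ι → ℝ) :=
  {x | (∃ w ∈ D, x ∈ intrinsicFrontier ℝ (cone w)) ∨
    ∃ w ∈ D, ∃ w' ∈ D, x ∈ cone w ∩ cone w' ∧ coneDim (cone w ∩ cone w') + 2 ≤ Fintype.card ι}

/-- A continuously differentiable path `[0,1] → M_ℝ` which avoids the singular locus, whose endpoints are not on walls, and
which crosses the walls transversally. -/
structure IsTransversalPath {ι W : Type*} [Fintype ι] (cone : W → Set (ι → ℝ)) (D : Set W)
    (γ : ℝ → ι → ℝ) : Prop where
  contDiff : ContDiff ℝ 1 γ
  avoids : ∀ t ∈ Set.Icc (0 : ℝ) 1, γ t ∉ singularLocus cone D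
  crosses : ∀ t ∈ Set.Icc (0 : ℝ) 1, ∀ w ∈ D, γ t ∈ cone w →
    t ∈ Set.Ioo (0 : ℝ) 1 ∧ deriv γ t ∉ Submodule.span ℝ (cone w)

/-- `L` lists, in order of time, all pairs of a time `t` and a wall of `D` crossed at time `t`. -/
def IsCrossingList {ι W : Type*} (cone : W → Set (ι → ℝ)) (D : Set W) (γ : ℝ → ι → ℝ)
    (L : List (ℝ × W)) : Prop :=
  L.Nodup ∧ L.Pairwise (fun a b => a.1 ≤ b.1) ∧
    ∀ c : ℝ × W, c ∈ L ↔ c.1 ∈ Set.Icc (0 : ℝ) 1 ∧ c.2 ∈ D ∧ γ c.1 ∈ cone c.2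

/-! ## Scattering diagrams in `M_ℝ` over `k⟦ℕ^I⟧`

The ring `k[M]⟦ℕ^I⟧` is `MvPowerSeries I k[M]`, with variables `t_i`, where the group algebra
`k[M]` is `AddMonoidAlgebra k (ι → ℤ)`. -/

/-- The data of a wall: its support, its direction `m₀` and the attached function. -/
structure Wall (k I ι : Type*) [Field k] where
  cone : Set (ι → ℝ)
  dir : ι → ℤ
  func : MvPowerSeries I (AddMonoidAlgebra k (ι → ℤ))

/-- Walls in `M_ℝ` over `k⟦ℕ^I⟧`: the support is a codimension one rational polyhedral cone, the
direction `m₀` is tangent to it and is either primitive or `0`, and the attached function is of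
the form `1 + ∑ c_{β,r} t^β z^{-r m₀}`, the sum being over `β ≠ 0` and `r ≥ 1`.  (For `m₀ = 0`
this says that the function is an element of `k⟦ℕ^I⟧` with constant term `1`.) -/
structure IsWall {k I ι : Type*} [Field k] [Fintype ι] (w : Wall k I ι) : Prop where
  rational : IsRationalPolyhedralCone w.cone
  codim_one : IsCodimOne w.cone
  dir_eq : w.dir = 0 ∨ IsPrimitive w.dir
  dir_tangent : toReal w.dir ∈ Submodule.span ℝ w.cone
  coeff_zero : MvPowerSeries.coeff 0 w.func = 1
  coeff_ne_zero : ∀ β : I →₀ ℕ, β ≠ 0 → ∀ m : ι → ℤ,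
    (MvPowerSeries.coeff β w.func).coeff m ≠ 0 → ∃ r : ℕ, 1 ≤ r ∧ m = -((r : ℤ) • w.dir)

/-- A wall is incoming if `-m₀` lies in its support; otherwise it is outgoing. -/
def Wall.Incoming {k I ι : Type*} [Field k] (w : Wall k I ι) : Prop :=
  toReal (-w.dir) ∈ w.cone

/-- The walls of `D` which are not trivial modulo `𝔪 ^ j`. -/
def trunc {k I ι : Type*} [Field k] (D : Set (Wall k I ι)) (j : ℕ) : Set (Wall k I ι) :=
  {w ∈ D | ¬ CongrMod j w.func 1}

/-- Scattering diagrams in `M_ℝ` over `k⟦ℕ^I⟧`. -/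
def IsScatteringDiagram {k I ι : Type*} [Field k] [Fintype ι] (D : Set (Wall k I ι)) : Prop :=
  (∀ w ∈ D, IsWall w) ∧ ∀ j, (trunc D j).Finite

/-- The function `f_x` modulo `𝔪 ^ j`: the product of the functions of the walls through `x`. -/
def funcAt {k I ι : Type*} [Field k] (D : Set (Wall k I ι)) (j : ℕ) (x : ι → ℝ) :
    MvPowerSeries I (AddMonoidAlgebra k (ι → ℤ)) :=
  ∏ᶠ w ∈ {w ∈ trunc D j | x ∈ w.cone}, w.func

/-- Equivalence of scattering diagrams: `f_x = f'_x` at all `x` outside of the singular loci (order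
by order). -/
def Equivalent {k I ι : Type*} [Field k] [Fintype ι] (D D' : Set (Wall k I ι)) : Prop :=
  ∀ (j : ℕ) (x : ι → ℝ), x ∉ singularLocus Wall.cone (trunc D j) →
    x ∉ singularLocus Wall.cone (trunc D' j) → CongrMod j (funcAt D j x) (funcAt D' j x)

open Classical in
/-- The primitive normal vector of the hyperplane spanned by `d` which is negative on the
velocity `u`, that is, positive on the side from which the path comes. -/
def signedNormal {ι : Type*} [Fintype ι] (d : Set (ι → ℝ)) (u : ι → ℝ) : ι → ℤ :=
  if h : ∃ n : ι → ℤ, IsPrimitive n ∧ d ⊆ perp n ∧ pair n u < 0 then h.choose else 0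

/-- The continuous `k⟦ℕ^I⟧`-algebra endomorphism `z^m ↦ f^⟨n, m⟩ z^m` of `k[M]⟦ℕ^I⟧`, given by its
coefficients. -/
def wallCrossing {k I ι : Type*} [Field k] [Fintype ι]
    (f : MvPowerSeries I (AddMonoidAlgebra k (ι → ℤ))) (n : ι → ℤ)
    (g : MvPowerSeries I (AddMonoidAlgebra k (ι → ℤ))) :
    MvPowerSeries I (AddMonoidAlgebra k (ι → ℤ)) :=
  open Classical in
  fun β => ∑ p ∈ Finset.HasAntidiagonal.antidiagonal β, (MvPowerSeries.coeff p.1 g).coeff.sum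
    fun m c => AddMonoidAlgebra.single m c * MvPowerSeries.coeff p.2 (intPow f (dotProduct n m))

/-- The path ordered product `θ_s ∘ ⋯ ∘ θ_1` along `γ`, for the list `L` of crossings. -/
def pathProduct {k I ι : Type*} [Field k] [Fintype ι] (γ : ℝ → ι → ℝ)
    (L : List (ℝ × Wall k I ι)) (g : MvPowerSeries I (AddMonoidAlgebra k (ι → ℤ))) :
    MvPowerSeries I (AddMonoidAlgebra k (ι → ℤ)) :=
  L.foldl (fun g c => wallCrossing c.2.func (signedNormal c.2.cone (deriv γ c.1)) g) g

/-- Consistency: order by order, the path ordered products only depend on the endpoints. -/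
def IsConsistent {k I ι : Type*} [Field k] [Fintype ι] (D : Set (Wall k I ι)) : Prop :=
  ∀ (j : ℕ) (γ γ' : ℝ → ι → ℝ), IsTransversalPath Wall.cone (trunc D j) γ →
    IsTransversalPath Wall.cone (trunc D j) γ' → γ 0 = γ' 0 → γ 1 = γ' 1 →
    ∀ L L', IsCrossingList Wall.cone (trunc D j) γ L →
      IsCrossingList Wall.cone (trunc D j) γ' L' →
      ∀ g, CongrMod j (pathProduct γ L g) (pathProduct γ' L' g)

/-- `D` is a consistent completion `S(Din)` of `Din`. -/
def IsCompletion {k I ι : Type*} [Field k] [Fintype ι] (Din D : Set (Wall k I ι)) : Prop :=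
  IsScatteringDiagram D ∧ Din ⊆ D ∧ IsConsistent D ∧ ∀ w ∈ D \ Din, ¬ w.Incoming

/-! ## Seeds -/

/-- A skew-symmetric seed: the lattice `N = ℤ^ι` with its standard basis `e_j`, an integral
skew-symmetric form given by its matrix in this basis, and the injective map `uf` from the set `I`
of unfrozen indices to `ι`.  It is part of the definition that `v_i = {e_i, ·}` is nonzero for
`i` unfrozen. -/
structure Seed (I ι : Type*) where
  form : Matrix ι ι ℤ
  skew : form.transpose = -form
  uf : I ↪ ι
  v_ne_zero : ∀ i, form (uf i) ≠ 0

namespace Seed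

variable {I ι : Type*}

/-- The map `p₁ : N → M`, `n ↦ {n, ·}`. -/
def p1 [Fintype ι] (s : Seed I ι) (n : ι → ℤ) : ι → ℤ := fun j => ∑ i, n i * s.form i j

/-- The vector `v_i = {e_i, ·}` in `M`. -/
def v (s : Seed I ι) (i : I) : ι → ℤ := s.form (s.uf i)

/-- The basis vector `e_i` of `N`, for `i` unfrozen. -/
def e [DecidableEq ι] (s : Seed I ι) (i : I) : ι → ℤ := Pi.single (s.uf i) 1

/-- The inclusion in `N` of the monoid `N^⊕` generated by the unfrozen `e_i`, where `N^⊕` is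
identified with `I →₀ ℕ`. -/
def incl [Fintype I] [DecidableEq ι] (s : Seed I ι) (n : I →₀ ℕ) : ι → ℤ :=
  ∑ i, (n i : ℤ) • s.e i

/-- The seed with principal coefficients.  The lattice is `N ⊕ M = ℤ^(ι ⊕ ι)`, its dual is
`M ⊕ N`, and the form is `{(n₁,m₁),(n₂,m₂)} = {n₁,n₂} + ⟨n₁,m₂⟩ - ⟨n₂,m₁⟩`. -/
def prin [DecidableEq ι] (s : Seed I ι) : Seed I (ι ⊕ ι) where
  form := Matrix.fromBlocks s.form 1 (-1) 0
  skew := by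
    rw [Matrix.fromBlocks_transpose, Matrix.fromBlocks_neg, s.skew]
    simp
  uf := s.uf.trans Function.Embedding.inl
  v_ne_zero := fun i h => by
    have := congrFun h (Sum.inr (s.uf i))
    simp [Matrix.fromBlocks] at this

/-- For the seed with principal coefficients, `p₁` is injective on `N^⊕`. -/
theorem prin_injective [Fintype I] [Fintype ι] [DecidableEq ι] (s : Seed I ι) :
    Function.Injective fun n : I →₀ ℕ => s.prin.p1 (s.prin.incl n) := by
  classical
  intro n n' h
  have key : ∀ (n : I →₀ ℕ) (i : I),
      s.prin.p1 (s.prin.incl n) (Sum.inr (s.uf i)) = n i := by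
    intro n i
    simp [p1, incl, e, prin, Finset.sum_apply, Matrix.fromBlocks, Pi.single_apply,
      Matrix.one_apply]
  ext i
  have := congrFun h (Sum.inr (s.uf i))
  simp only [key] at this
  exact_mod_cast this

/-- The assumptions on a seed under which the log Calabi--Yau compactification of the
`𝒳` cluster variety is smooth. -/
structure XAssumptions [Fintype ι] (s : Seed I ι) : Prop where
  primitive : ∀ i, IsPrimitive (s.v i)
  rays_ne : ∀ i j, i ≠ j →
    {x | ∃ a : ℝ, 0 ≤ a ∧ x = a • toReal (s.v i)} ≠ {x | ∃ a : ℝ, 0 ≤ a ∧ x = a • toReal (s.v j)}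

end Seed

/-! ## `C`-scattering diagrams

Let `s` be a seed such that `p₁` is injective on the unfrozen part of `N`, and let
`P = p₁(N^⊕)`.  Then `n ↦ z^{p₁(n)}` identifies `k⟦P⟧` with `MvPowerSeries I k`. -/

/-- The data of a `C`-wall: its support, its primitive normal vector in `N^⊕`, and the attached
function in `k⟦P⟧`. -/
structure CWall (k I ι : Type*) where
  cone : Set (ι → ℝ)
  normal : I →₀ ℕ
  func : MvPowerSeries I k

/-- `C`-walls: the normal vector `n` is primitive in `N`, the support is a codimension one rational
polyhedral cone in `n^⊥`, and the attached function is `1 + ∑_{r ≥ 1} c_r z^{r p₁(n)}`. -/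
structure IsCWall {k I ι : Type*} [Field k] [Fintype I] [Fintype ι] [DecidableEq ι] (s : Seed I ι)
    (w : CWall k I ι) : Prop where
  rational : IsRationalPolyhedralCone w.cone
  codim_one : IsCodimOne w.cone
  primitive : IsPrimitive (s.incl w.normal)
  subset_perp : w.cone ⊆ perp (s.incl w.normal)
  coeff_zero : MvPowerSeries.coeff 0 w.func = 1
  coeff_ne_zero : ∀ β : I →₀ ℕ, β ≠ 0 → MvPowerSeries.coeff β w.func ≠ 0 →
    ∃ r : ℕ, 1 ≤ r ∧ β = r • w.normal

/-- A `C`-wall is incoming if `p₁(n)` lies in its support; otherwise it is outgoing. -/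
def CWall.Incoming {k I ι : Type*} [Fintype I] [Fintype ι] [DecidableEq ι] (s : Seed I ι)
    (w : CWall k I ι) : Prop :=
  toReal (s.p1 (s.incl w.normal)) ∈ w.cone

/-- The walls of `D` which are not trivial modulo `𝔪_P ^ j`. -/
def ctrunc {k I ι : Type*} [Field k] (D : Set (CWall k I ι)) (j : ℕ) : Set (CWall k I ι) :=
  {w ∈ D | ¬ CongrMod j w.func 1}

/-- `C`-scattering diagrams for the seed `s`. -/
def IsCScatteringDiagram {k I ι : Type*} [Field k] [Fintype I] [Fintype ι] [DecidableEq ι]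
    (s : Seed I ι) (D : Set (CWall k I ι)) : Prop :=
  (∀ w ∈ D, IsCWall s w) ∧ ∀ j, (ctrunc D j).Finite

/-- The automorphism `z^m ↦ f^⟨ε n, m⟩ z^m`.  It acts on `k[M] ⊗_{k[P]} k⟦P⟧`, which is the sum of
the submodules `z^m k⟦P⟧` for `m ∈ M`, and it preserves each of them: it maps `z^m h`, for
`h = ∑ h_p z^{p₁(p)}`, to `z^m ∑_p h_p z^{p₁(p)} f^⟨ε n, m + p₁(p)⟩`.  The definition gives the
effect on `h`.  (For `m = 0` this is the automorphism of `k⟦P⟧`.) -/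
def CWall.cross {k I ι : Type*} [Field k] [Fintype I] [Fintype ι] [DecidableEq ι]
    (s : Seed I ι) (w : CWall k I ι) (ε : ℤ) (m : ι → ℤ) (h : MvPowerSeries I k) :
    MvPowerSeries I k :=
  open Classical in
  fun β => ∑ p ∈ Finset.HasAntidiagonal.antidiagonal β, MvPowerSeries.coeff p.1 h *
    MvPowerSeries.coeff p.2
      (intPow w.func (ε * dotProduct (s.incl w.normal) (m + s.p1 (s.incl p.1))))

/-- The sign `ε = -sgn ⟨n, γ'(t)⟩` of the crossing of `w` by `γ` at time `t`. -/
def CWall.crossSign {k I ι : Type*} [Fintype I] [Fintype ι] [DecidableEq ι] (s : Seed I ι)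
    (w : CWall k I ι) (γ : ℝ → ι → ℝ) (t : ℝ) : ℤ :=
  -((SignType.sign (pair (s.incl w.normal) (deriv γ t)) : SignType) : ℤ)

/-- The path ordered product `𝔭_s ∘ ⋯ ∘ 𝔭_1` along `γ`, for the list `L` of crossings, restricted
to `z^m k⟦P⟧`. -/
def cpathProduct {k I ι : Type*} [Field k] [Fintype I] [Fintype ι] [DecidableEq ι] (s : Seed I ι)
    (γ : ℝ → ι → ℝ) (L : List (ℝ × CWall k I ι)) (m : ι → ℤ) (h : MvPowerSeries I k) :
    MvPowerSeries I k :=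
  L.foldl (fun g c => c.2.cross s (c.2.crossSign s γ c.1) m g) h

/-- Two `C`-scattering diagrams are equivalent if they have the same path ordered products. -/
def CEquivalent {k I ι : Type*} [Field k] [Fintype I] [Fintype ι] [DecidableEq ι] (s : Seed I ι)
    (D D' : Set (CWall k I ι)) : Prop :=
  ∀ (j : ℕ) (γ : ℝ → ι → ℝ), IsTransversalPath CWall.cone (ctrunc D j) γ →
    IsTransversalPath CWall.cone (ctrunc D' j) γ →
    ∀ L L', IsCrossingList CWall.cone (ctrunc D j) γ L →
      IsCrossingList CWall.cone (ctrunc D' j) γ L' →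
      ∀ m h, CongrMod j (cpathProduct s γ L m h) (cpathProduct s γ L' m h)

/-- Consistency: order by order, the path ordered products only depend on the endpoints. -/
def IsCConsistent {k I ι : Type*} [Field k] [Fintype I] [Fintype ι] [DecidableEq ι] (s : Seed I ι)
    (D : Set (CWall k I ι)) : Prop :=
  ∀ (j : ℕ) (γ γ' : ℝ → ι → ℝ), IsTransversalPath CWall.cone (ctrunc D j) γ →
    IsTransversalPath CWall.cone (ctrunc D j) γ' → γ 0 = γ' 0 → γ 1 = γ' 1 →
    ∀ L L', IsCrossingList CWall.cone (ctrunc D j) γ L →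
      IsCrossingList CWall.cone (ctrunc D j) γ' L' →
      ∀ m h, CongrMod j (cpathProduct s γ L m h) (cpathProduct s γ' L' m h)

/-- `D` is a consistent completion `S(Din)` of `Din`. -/
def IsCCompletion {k I ι : Type*} [Field k] [Fintype I] [Fintype ι] [DecidableEq ι] (s : Seed I ι)
    (Din D : Set (CWall k I ι)) : Prop :=
  IsCScatteringDiagram s D ∧ Din ⊆ D ∧ IsCConsistent s D ∧ ∀ w ∈ D \ Din, ¬ w.Incoming s

/-- The initial cluster scattering diagram, with walls `(e_i^⊥, 1 + z^{v_i})`. -/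
def clusterInitial (k : Type*) {I ι : Type*} [Field k] [Fintype ι] [DecidableEq ι]
    (s : Seed I ι) : Set (CWall k I ι) :=
  {w | ∃ i, w = ⟨perp (s.e i), Finsupp.single i 1, 1 + MvPowerSeries.X i⟩}

/-- `D` is a cluster scattering diagram of `s`: a consistent completion of the initial one. -/
def IsClusterDiagram {k I ι : Type*} [Field k] [Fintype I] [Fintype ι] [DecidableEq ι]
    (s : Seed I ι) (D : Set (CWall k I ι)) : Prop :=
  IsCCompletion s (clusterInitial k s) D

/-! ## `C_prin`-scattering diagrams and the map `Ψ` -/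

/-- `C_prin`-scattering diagrams in `M_ℝ ⊕ N_ℝ`: `C`-scattering diagrams for the seed with principal
coefficients, all of whose walls are contained in hyperplanes `(n,0)^⊥` and are invariant under
translation by `N_ℝ`, the second factor of `(ι ⊕ ι) → ℝ`.  The attached functions are power series
in the monomials `z^{(p₁(n),n)}`, `n ∈ N^⊕`, so they lie in `k[M]⟦N_uf^⊕⟧`, see `toPrin`. -/
def IsCPrinDiagram {k I ι : Type*} [Field k] [Fintype I] [Fintype ι] [DecidableEq ι]
    (s : Seed I ι) (D : Set (CWall k I (ι ⊕ ι))) : Prop :=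
  IsCScatteringDiagram s.prin D ∧ ∀ w ∈ D,
    (∃ n : ι → ℤ, n ≠ 0 ∧ w.cone ⊆ perp (Sum.elim n (0 : ι → ℤ))) ∧
    ∀ x ∈ w.cone, ∀ y : ι → ℝ, x + Sum.elim (0 : ι → ℝ) y ∈ w.cone

/-- The inclusion of `k⟦P⟧` in `k[M]⟦N_uf^⊕⟧`, for the seed with principal coefficients: the monomial
`z^{(p₁(n), n)}` is `t^n z^{p₁(n)}`. -/
def toPrin {k I ι : Type*} [Field k] [Fintype I] [Fintype ι] [DecidableEq ι] (s : Seed I ι)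
    (f : MvPowerSeries I k) : MvPowerSeries I (AddMonoidAlgebra k (ι → ℤ)) :=
  fun n => AddMonoidAlgebra.single (s.p1 (s.incl n)) (MvPowerSeries.coeff n f)

/-- The wall `(d / N_ℝ, f)` attached to `(d, f)`.  Its direction is the primitive vector positively
proportional to `-p₁(n)`, where `(n,0)` is the normal vector of `d`. -/
def psiWall {k I ι : Type*} [Field k] [Fintype I] [Fintype ι] [DecidableEq ι] (s : Seed I ι)
    (w : CWall k I (ι ⊕ ι)) : Wall k I ι where
  cone := (fun x : ι ⊕ ι → ℝ => fun j => x (Sum.inl j)) '' w.cone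
  dir := -primitivePart (s.p1 (s.incl w.normal))
  func := toPrin s w.func

/-- The map `Ψ`, which replaces every wall by its quotient by `N_ℝ`. -/
def Psi {k I ι : Type*} [Field k] [Fintype I] [Fintype ι] [DecidableEq ι] (s : Seed I ι)
    (D : Set (CWall k I (ι ⊕ ι))) : Set (Wall k I ι) :=
  psiWall s '' D

/-- `Ψ` maps the equivalence class of the `C`-scattering diagram `D₀` in `M_ℝ ⊕ N_ℝ` to the
equivalence class of the consistent completion of `Din`: the class of `D₀` contains
`C_prin`-scattering diagrams `D`, and for each of them `Ψ(D)` is, up to equivalence, the consistent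
completion of `Din`. -/
def PsiMapsToCompletion {k I ι : Type*} [Field k] [Fintype I] [Fintype ι] [DecidableEq ι]
    (s : Seed I ι) (D₀ : Set (CWall k I (ι ⊕ ι))) (Din : Set (Wall k I ι)) : Prop :=
  (∃ D, IsCPrinDiagram s D ∧ CEquivalent s.prin D D₀) ∧
  ∀ D, IsCPrinDiagram s D → CEquivalent s.prin D D₀ →
    (∃ D', IsCompletion Din D' ∧ Equivalent (Psi s D) D') ∧
    ∀ D', IsCompletion Din D' → Equivalent (Psi s D) D'

/-! ## Toric models and the HDTV scattering diagram -/

/-- `τ` is a face of the cone `σ`. -/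
def IsFace {ι : Type*} [Fintype ι] (τ σ : Set (ι → ℝ)) : Prop :=
  ∃ u : ι → ℝ, (∀ x ∈ σ, 0 ≤ dotProduct u x) ∧ τ = {x ∈ σ | dotProduct u x = 0}

/-- Smooth cones: generated by a part of a basis of the lattice. -/
def IsSmoothCone {ι : Type*} [Fintype ι] (σ : Set (ι → ℝ)) : Prop :=
  ∃ (b : Module.Basis ι ℤ (ι → ℤ)) (J : Finset ι),
    σ = {x | ∃ a : ι → ℝ, (∀ j, 0 ≤ a j) ∧ x = ∑ j ∈ J, a j • toReal (b j)}

/-- The fan of a smooth projective toric variety.  Projectivity is the existence of an integral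
piecewise linear function which is strictly convex on the fan. -/
structure IsSmoothProjectiveFan {ι : Type*} [Fintype ι] (S : Set (Set (ι → ℝ))) : Prop where
  finite : S.Finite
  smooth : ∀ σ ∈ S, IsSmoothCone σ
  face_mem : ∀ σ ∈ S, ∀ τ, IsFace τ σ → τ ∈ S
  inter_face : ∀ σ ∈ S, ∀ σ' ∈ S, IsFace (σ ∩ σ') σ
  complete : ⋃₀ S = Set.univ
  projective : ∃ φ : (ι → ℝ) → ℝ, ∀ σ ∈ S, coneDim σ = Fintype.card ι →
    ∃ n : ι → ℤ, (∀ x, pair n x ≤ φ x) ∧ ∀ x, φ x = pair n x ↔ x ∈ σ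

/-- The ray generated by a vector. -/
def ray {ι : Type*} (v : ι → ℤ) : Set (ι → ℝ) := {x | ∃ a : ℝ, 0 ≤ a ∧ x = a • toReal v}

/-- The character lattice `v^⊥ ⊂ N` of the dense torus of the toric divisor of a ray `ℝ≥0 v`. -/
def divisorChars {ι : Type*} [Fintype ι] (v : ι → ℤ) : AddSubgroup (ι → ℤ) where
  carrier := {n | dotProduct n v = 0}
  zero_mem' := by simp
  add_mem' := by
    intro a b ha hb
    simp only [Set.mem_ofPred_eq] at *
    rw [add_dotProduct, ha, hb, add_zero]
  neg_mem' := by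
    intro a ha
    simp only [Set.mem_ofPred_eq] at *
    rw [neg_dotProduct, ha, neg_zero]

/-- The monoid `v^⊥ ∩ σ^∨`.  For a cone `σ` containing `v`, its monoid algebra is the coordinate
ring of the affine chart of the toric divisor of `ℝ≥0 v` defined by `σ`. -/
def chartMonoid {ι : Type*} [Fintype ι] (v : ι → ℤ) (σ : Set (ι → ℝ)) :
    AddSubmonoid (divisorChars v) where
  carrier := {n | ∀ x ∈ σ, 0 ≤ pair n.1 x}
  zero_mem' := by intro x _; simp [pair]
  add_mem' := by
    intro a b ha hb x hx
    have h : pair (a + b).1 x = pair a.1 x + pair b.1 x := by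
      simp [pair, add_mul, Finset.sum_add_distrib]
    rw [h]
    exact add_nonneg (ha x hx) (hb x hx)

/-- The ideal, in the chart defined by `σ`, of the closure of the subscheme `g = 0` of the dense
torus of the toric divisor of `ℝ≥0 v`. -/
def hypersurfaceIdeal {k ι : Type*} [Field k] [Fintype ι] (v : ι → ℤ) (σ : Set (ι → ℝ))
    (g : AddMonoidAlgebra k (divisorChars v)) : Ideal (AddMonoidAlgebra k (chartMonoid v σ)) :=
  Ideal.comap (AddMonoidAlgebra.mapDomainRingHom k (chartMonoid v σ).subtype) (Ideal.span {g})

/-- The ideal, in the chart defined by `σ`, of the torus orbit corresponding to `σ`, which is the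
closed orbit of the chart. -/
def orbitIdeal (k : Type*) {ι : Type*} [Field k] [Fintype ι] (v : ι → ℤ) (σ : Set (ι → ℝ)) :
    Ideal (AddMonoidAlgebra k (chartMonoid v σ)) :=
  Ideal.span {a | ∃ n : chartMonoid v σ, (∃ x ∈ σ, pair n.1.1 x ≠ 0) ∧
    a = AddMonoidAlgebra.single n 1}

/-- The weight `D_σ · H`, where `σ` is a codimension one cone containing `v`, `D_σ` is the
corresponding toric curve in the toric divisor of `ℝ≥0 v`, and `H` is the closure in this divisor
of the hypersurface `g = 0` of its dense torus.  As `H` is transversal to the toric boundary,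
it does not meet the torus fixed points of `D_σ`, so that the intersection number is the length of
the scheme theoretic intersection of `H` with the one-dimensional orbit in `D_σ`. -/
def intersectionNumber {k ι : Type*} [Field k] [Fintype ι] (v : ι → ℤ) (σ : Set (ι → ℝ))
    (g : AddMonoidAlgebra k (divisorChars v)) : ℕ :=
  Module.finrank k
    (AddMonoidAlgebra k (chartMonoid v σ) ⧸ (hypersurfaceIdeal v σ g ⊔ orbitIdeal k v σ))

/-- The initial HDTV scattering diagram of the toric variety of the fan `S` and of hypersurfaces
`H_i`, each of them the closure of `g_i = 0` in the toric divisor of the ray `ℝ≥0 v_i`: the union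
over `i` of the widgets `(σ, (1 + t_i z^{v_i}) ^ (D_σ · H_i))`, where `σ` runs over the codimension
one cones of `S` which contain `v_i` and have positive weight. -/
def hdtvInitial {k I ι : Type*} [Field k] [Fintype ι] (S : Set (Set (ι → ℝ)))
    (v : I → ι → ℤ) (g : ∀ i, AddMonoidAlgebra k (divisorChars (v i))) : Set (Wall k I ι) :=
  {w | ∃ i, ∃ σ ∈ S, IsCodimOne σ ∧ toReal (v i) ∈ σ ∧ 0 < intersectionNumber (v i) σ (g i) ∧
    w = ⟨σ, -v i, (1 + MvPowerSeries.C (AddMonoidAlgebra.single (v i) 1) * MvPowerSeries.X i) ^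
      intersectionNumber (v i) σ (g i)⟩}

namespace Seed

variable {I ι : Type*}

/-- `S` is the fan of a toric model of a log Calabi--Yau compactification of the `𝒳` cluster
variety of `s`. -/
structure IsXToricModel [Fintype ι] [DecidableEq ι] (s : Seed I ι) (S : Set (Set (ι → ℝ))) :
    Prop where
  fan : IsSmoothProjectiveFan S
  ray_mem : ∀ i, ray (s.v i) ∈ S
  perp_eq : ∀ i, ∃ C ⊆ S, (∀ σ ∈ C, IsCodimOne σ) ∧ ⋃₀ C = perp (s.e i)
  ray_eq : ∀ σ ∈ S, ∀ i j, ray (s.v i) ⊆ σ → ray (s.v j) ⊆ σ → ray (s.v i) = ray (s.v j)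

theorem e_mem_divisorChars [Fintype ι] [DecidableEq ι] (s : Seed I ι) (i : I) :
    s.e i ∈ divisorChars (s.v i) := by
  change dotProduct (s.e i) (s.v i) = 0
  have h := congrFun (congrFun s.skew (s.uf i)) (s.uf i)
  simp only [Matrix.transpose_apply, Matrix.neg_apply] at h
  simp only [e, v, single_one_dotProduct]
  omega

/-- The equation `1 + z^{e_i}` of the hypersurface `H_i`. -/
def xEquation (k : Type*) [Field k] [Fintype ι] [DecidableEq ι] (s : Seed I ι) (i : I) :
    AddMonoidAlgebra k (divisorChars (s.v i)) :=
  1 + AddMonoidAlgebra.single ⟨s.e i, s.e_mem_divisorChars i⟩ 1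

/-- The initial HDTV scattering diagram of the toric model with fan `S`. -/
def xHDTVInitial (k : Type*) [Field k] [Fintype ι] [DecidableEq ι] (s : Seed I ι)
    (S : Set (Set (ι → ℝ))) : Set (Wall k I ι) :=
  hdtvInitial S s.v (s.xEquation k)

end Seed

end HDTVCluster

end

/-!
The proof rests on linearizing scattering diagrams by logarithms.  To a diagram `D` one attaches the
function `logAt D`, which maps a point `x` to the sum of the logarithmic derivatives of the functions
of all walls through `x`; in characteristic `0` it determines the product of these functions, and no
truncation is needed to define it.  Two diagrams are compared by `GenEq`: their logarithms agree
outside of a countable union of affine subspaces of codimension two.  This is the same as equivalence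
(`equivalent_iff_genEq`) and the same as having equal path ordered products
(`pathEquivalent_iff_genEq`): path ordered products do not change under small translations of the
path (`IsTransversalPath.eventually_pathProduct_add`), and a general translate of a path is
transversal to all walls and avoids a given set of codimension two.  In particular, consistency only
depends on the class of a diagram.

A `C`-wall which is invariant under the translations by some of the coordinates gives a wall in the
space of the other coordinates (`Seed.restrWall`).  For principal coefficients and `N_ℝ`, this is
`Ψ`; if all coordinates are kept, it identifies `C`-scattering diagrams with certain scattering
diagrams.  In both cases the path ordered products correspond to each other
(`Seed.pathProduct_restrWall`), paths can be projected and lifted, and this gives the comparison of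
equivalence and of consistency.

Consistent completions are unique up to equivalence (`IsCompletion.genEq`).  By induction on the
degree, suppose that two completions agree in lower degrees, and compare the coefficients with
exponent `m₀` of their logarithms at a general point of a wall.  The difference is read off from
crossing the wall along a short segment, and, by consistency, from any other path with the same
endpoints.  Crossing the hyperplane far away in the direction of `m₀`, one has left all outgoing
walls which contribute to this coefficient, and only sees the walls of the initial diagram
(`logAt_add_eq_of_lower`).  The argument works as well for a diagram and a translate of another one
(`exists_small_logAt_add_eq`).  Hence the logarithm of a completion of a diagram of hyperplanes which
contain `N_ℝ` is invariant under `N_ℝ`, although its walls need not be.  In each degree its walls are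
then replaced by cylinders over their sections by a general complement of `N_ℝ` containing the
direction of the walls, with exponentials of monomials as functions (`exists_cylinder_walls`).  This
yields a `C_prin`-scattering diagram in the class of the completion, whose image under `Ψ` is a
completion of the image of the initial diagram (`psiMapsToCompletion_psi`).

In a toric model, `e_i^⊥` is a union of cones of the fan, so that the form `e_i` has a constant sign
on every other cone, and the curve `D_σ` meets `H_i` only if `σ ⊆ e_i^⊥`, in this case transversally
in one point.  So the initial HDTV walls are the cones of codimension one inside of `e_i^⊥` which
contain `v_i`, with the function `1 + t_i z^{v_i}` (`mem_xHDTVInitial_iff`).  The other cones of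
codimension one inside of `e_i^⊥` are outgoing.  Thus cutting the hyperplanes in the image of a
cluster scattering diagram into the cones of the fan gives an equivalent diagram which is a
consistent completion of the initial HDTV diagram (`psiMapsToCompletion_xHDTVInitial`).
-/

set_option linter.unusedSectionVars false

namespace HDTVCluster

/-! ### Power series with constant term one -/

section Series

variable {I R : Type*} [CommRing R]

open MvPowerSeries

theorem CongrMod.refl (j : ℕ) (f : MvPowerSeries I R) : CongrMod j f f := fun _ _ => rfl

theorem CongrMod.symm {j : ℕ} {f g : MvPowerSeries I R} (h : CongrMod j f g) : CongrMod j g f :=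
  fun β hβ => (h β hβ).symm

theorem CongrMod.trans {j : ℕ} {f g h : MvPowerSeries I R} (h₁ : CongrMod j f g)
    (h₂ : CongrMod j g h) : CongrMod j f h :=
  fun β hβ => (h₁ β hβ).trans (h₂ β hβ)

theorem CongrMod.mono {i j : ℕ} (hij : i ≤ j) {f g : MvPowerSeries I R} (h : CongrMod j f g) :
    CongrMod i f g :=
  fun β hβ => h β (hβ.trans_le hij)

theorem CongrMod.add {j : ℕ} {f g f' g' : MvPowerSeries I R} (h₁ : CongrMod j f g)
    (h₂ : CongrMod j f' g') : CongrMod j (f + f') (g + g') := fun β hβ => by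
  rw [map_add, map_add, h₁ β hβ, h₂ β hβ]

theorem degree_le_of_add_eq {p q β : I →₀ ℕ} (h : p + q = β) :
    p.degree ≤ β.degree ∧ q.degree ≤ β.degree := by
  rw [← h, map_add]; omega

theorem CongrMod.mul {j : ℕ} {f g f' g' : MvPowerSeries I R} (h₁ : CongrMod j f g)
    (h₂ : CongrMod j f' g') : CongrMod j (f * f') (g * g') := fun β hβ => by
  classical
  rw [coeff_mul, coeff_mul]
  refine Finset.sum_congr rfl fun p hp => ?_
  have hp := degree_le_of_add_eq (Finset.HasAntidiagonal.mem_antidiagonal.1 hp)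
  rw [h₁ _ (hp.1.trans_lt hβ), h₂ _ (hp.2.trans_lt hβ)]

theorem coeff_zero_mul (f g : MvPowerSeries I R) :
    coeff 0 (f * g) = coeff 0 f * coeff 0 g := by
  simp only [coeff_zero_eq_constantCoeff, map_mul]

theorem coeff_zero_prod {α : Type*} (s : Finset α) (f : α → MvPowerSeries I R)
    (h : ∀ a ∈ s, coeff 0 (f a) = 1) : coeff 0 (∏ a ∈ s, f a) = 1 := by
  simp only [coeff_zero_eq_constantCoeff, map_prod] at *
  exact Finset.prod_eq_one h

/-- If `h` vanishes modulo `𝔪 ^ j`, its coefficients of degree `j` are multiplied by the constant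
term of `u` on multiplication by `u`. -/
theorem coeff_mul_of_lt_degree {h : MvPowerSeries I R} {β : I →₀ ℕ}
    (hh : ∀ p : I →₀ ℕ, p.degree < β.degree → coeff p h = 0) (u : MvPowerSeries I R) :
    coeff β (h * u) = coeff β h * coeff 0 u := by
  classical
  rw [coeff_mul, Finset.sum_eq_single (β, 0)]
  · rintro ⟨p, q⟩ hp hne
    have hpq := Finset.HasAntidiagonal.mem_antidiagonal.1 hp
    simp only at hpq
    have hq : q ≠ 0 := by
      rintro rfl
      exact hne (by rw [← hpq, add_zero])
    have : 0 < q.degree := Nat.pos_of_ne_zero fun h0 => hq ((Finsupp.degree_eq_zero_iff q).1 h0)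
    rw [hh p (by rw [← hpq, map_add]; omega), zero_mul]
  · intro hne
    exact absurd (Finset.HasAntidiagonal.mem_antidiagonal.2 (add_zero β)) hne

/-- A power series with constant term `1`, as a unit. -/
noncomputable def toUnit (f : MvPowerSeries I R) (hf : coeff 0 f = 1) : (MvPowerSeries I R)ˣ where
  val := f
  inv := invOfUnit f 1
  val_inv := mul_invOfUnit f 1 (by simpa using hf)
  inv_val := by rw [mul_comm]; exact mul_invOfUnit f 1 (by simpa using hf)

theorem intPow_eq_zpow {f : MvPowerSeries I R} (hf : coeff 0 f = 1) (z : ℤ) :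
    intPow f z = ((toUnit f hf ^ z : (MvPowerSeries I R)ˣ) : MvPowerSeries I R) := by
  unfold intPow
  split_ifs with h
  · obtain ⟨n, rfl⟩ := Int.eq_ofNat_of_zero_le h
    simp [toUnit]
  · obtain ⟨n, hn⟩ := Int.eq_ofNat_of_zero_le (le_of_lt (neg_pos.2 (not_le.1 h)))
    obtain rfl : z = -(n : ℤ) := by omega
    rw [neg_neg, Int.toNat_natCast, zpow_neg, zpow_natCast, ← inv_pow]
    rfl

theorem intPow_zero (f : MvPowerSeries I R) : intPow f 0 = 1 := by simp [intPow]

theorem intPow_one (f : MvPowerSeries I R) : intPow f 1 = f := by simp [intPow]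

theorem intPow_add {f : MvPowerSeries I R} (hf : coeff 0 f = 1) (a b : ℤ) :
    intPow f (a + b) = intPow f a * intPow f b := by
  simp only [intPow_eq_zpow hf, zpow_add, Units.val_mul]

theorem intPow_sub_one_mul {f : MvPowerSeries I R} (hf : coeff 0 f = 1) (z : ℤ) :
    intPow f (z - 1) * f = intPow f z := by
  have h := intPow_add hf (z - 1) 1
  rw [intPow_one, sub_add_cancel] at h
  exact h.symm

theorem mul_intPow_neg_one {f : MvPowerSeries I R} (hf : coeff 0 f = 1) :
    f * intPow f (-1) = 1 := by
  have h := intPow_add hf 1 (-1)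
  rw [intPow_one] at h
  rw [← h]
  exact intPow_zero f

theorem intPow_mul {f g : MvPowerSeries I R} (hf : coeff 0 f = 1) (hg : coeff 0 g = 1) (z : ℤ) :
    intPow (f * g) z = intPow f z * intPow g z := by
  have hfg : coeff 0 (f * g) = 1 := by rw [coeff_zero_mul, hf, hg, one_mul]
  rw [intPow_eq_zpow hf, intPow_eq_zpow hg, intPow_eq_zpow hfg, ← Units.val_mul, ← mul_zpow]
  congr 2
  exact Units.ext rfl

theorem intPow_one_left (z : ℤ) : intPow (1 : MvPowerSeries I R) z = 1 := by
  rw [intPow_eq_zpow (by simp)]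
  have : toUnit (1 : MvPowerSeries I R) (by simp) = 1 := Units.ext rfl
  rw [this, one_zpow, Units.val_one]

theorem coeff_zero_intPow {f : MvPowerSeries I R} (hf : coeff 0 f = 1) (z : ℤ) :
    coeff 0 (intPow f z) = 1 := by
  have hinv : ∀ g : MvPowerSeries I R, f * g = 1 → coeff 0 g = 1 := fun g hg => by
    have := congrArg (coeff 0) hg
    rw [coeff_zero_mul, hf, one_mul] at this
    rw [this]; simp
  unfold intPow
  split_ifs
  · rw [coeff_zero_eq_constantCoeff] at *
    rw [map_pow, hf, one_pow]
  · have := hinv _ (toUnit f hf).val_inv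
    rw [coeff_zero_eq_constantCoeff] at *
    rw [map_pow]
    exact (congrArg (· ^ _) this).trans (one_pow _)

theorem int_step_induction (P : ℤ → Prop) (h0 : P 0)
    (hadd : ∀ z, P z → P (z + 1)) (hsub : ∀ z, P z → P (z - 1)) (z : ℤ) : P z := by
  induction z using Int.induction_on with
  | zero => exact h0
  | succ n ih => exact hadd _ ih
  | pred n ih => exact hsub _ ih

theorem CongrMod.of_mul_right {j : ℕ} {f g u u' : MvPowerSeries I R} (hu : coeff 0 u = 1)
    (huu : CongrMod j u u') (h : CongrMod j (f * u) (g * u')) : CongrMod j f g := by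
  have h1 := (h.trans ((CongrMod.refl j g).mul huu.symm)).mul (CongrMod.refl j (intPow u (-1)))
  rwa [mul_assoc, mul_assoc, mul_intPow_neg_one hu, mul_one, mul_one] at h1

theorem CongrMod.intPow {j : ℕ} {f g : MvPowerSeries I R} (hf : coeff 0 f = 1)
    (hg : coeff 0 g = 1) (h : CongrMod j f g) (z : ℤ) :
    CongrMod j (intPow f z) (intPow g z) := by
  refine int_step_induction (fun z => CongrMod j (HDTVCluster.intPow f z)
    (HDTVCluster.intPow g z)) ?_ ?_ ?_ z
  · rw [intPow_zero, intPow_zero]; exact CongrMod.refl _ _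
  · intro z hz
    rw [intPow_add hf, intPow_add hg, intPow_one, intPow_one]
    exact hz.mul h
  · intro z hz
    refine CongrMod.of_mul_right hf h ?_
    rw [intPow_sub_one_mul hf, intPow_sub_one_mul hg]
    exact hz

/-- First order expansion of integral powers. -/
theorem coeff_intPow_sub {f g : MvPowerSeries I R} (hf : coeff 0 f = 1) (hg : coeff 0 g = 1)
    {β : I →₀ ℕ} (h : CongrMod β.degree f g) (z : ℤ) :
    coeff β (intPow f z) - coeff β (intPow g z) = z * (coeff β f - coeff β g) := by
  have key : ∀ a : ℤ, coeff β (intPow f (a + 1)) - coeff β (intPow g (a + 1)) =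
      (coeff β (intPow f a) - coeff β (intPow g a)) + (coeff β f - coeff β g) := by
    intro a
    have h1 : intPow f (a + 1) - intPow g (a + 1) =
        (intPow f a - intPow g a) * f + (f - g) * intPow g a := by
      rw [intPow_add hf, intPow_add hg, intPow_one, intPow_one]; ring
    rw [← map_sub, h1, map_add, coeff_mul_of_lt_degree, coeff_mul_of_lt_degree, hf,
      coeff_zero_intPow hg, mul_one, mul_one, map_sub, map_sub]
    · intro p hp
      rw [map_sub, h p hp, sub_self]
    · intro p hp
      rw [map_sub, h.intPow hf hg a p hp, sub_self]
  refine int_step_induction (fun z => coeff β (intPow f z) - coeff β (intPow g z) =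
    z * (coeff β f - coeff β g)) ?_ ?_ ?_ z
  · rw [intPow_zero, intPow_zero]; simp
  · intro z hz
    rw [key, hz]; push_cast; ring
  · intro z hz
    have := key (z - 1)
    rw [sub_add_cancel, hz] at this
    push_cast
    linear_combination -this

/-! ### The logarithmic derivative -/

/-- The Euler derivation, which multiplies `t^β` by `|β|`. -/
noncomputable def euler (f : MvPowerSeries I R) : MvPowerSeries I R :=
  fun β => (β.degree : R) * coeff β f

theorem coeff_euler (f : MvPowerSeries I R) (β : I →₀ ℕ) :
    coeff β (euler f) = (β.degree : R) * coeff β f := rfl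

theorem euler_mul (f g : MvPowerSeries I R) : euler (f * g) = euler f * g + f * euler g := by
  classical
  ext β
  rw [coeff_euler, map_add, coeff_mul, coeff_mul, coeff_mul, Finset.mul_sum,
    ← Finset.sum_add_distrib]
  refine Finset.sum_congr rfl fun p hp => ?_
  rw [coeff_euler, coeff_euler, ← Finset.HasAntidiagonal.mem_antidiagonal.1 hp, map_add]
  push_cast
  ring

/-- The logarithmic derivative of `f` with respect to the Euler derivation.  In characteristic `0`
it carries the same information as the logarithm of `f`. -/
noncomputable def logDer (f : MvPowerSeries I R) : MvPowerSeries I R :=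
  euler f * intPow f (-1)

theorem logDer_mul_self {f : MvPowerSeries I R} (hf : coeff 0 f = 1) :
    logDer f * f = euler f := by
  rw [logDer, mul_assoc, mul_comm _ f, mul_intPow_neg_one hf, mul_one]

theorem eq_logDer {f l : MvPowerSeries I R} (hf : coeff 0 f = 1) (h : l * f = euler f) :
    logDer f = l := by
  rw [logDer, ← h, mul_assoc, mul_intPow_neg_one hf, mul_one]

theorem logDer_mul {f g : MvPowerSeries I R} (hf : coeff 0 f = 1) (hg : coeff 0 g = 1) :
    logDer (f * g) = logDer f + logDer g := by
  refine eq_logDer (by rw [coeff_zero_mul, hf, hg, one_mul]) ?_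
  rw [euler_mul, ← logDer_mul_self hf, ← logDer_mul_self hg]
  ring

theorem logDer_one : logDer (1 : MvPowerSeries I R) = 0 := by
  have h1 : coeff 0 (1 : MvPowerSeries I R) = 1 := by simp
  have := logDer_mul h1 h1
  rw [mul_one] at this
  simpa using this

theorem logDer_prod {α : Type*} (s : Finset α) (f : α → MvPowerSeries I R)
    (h : ∀ a ∈ s, coeff 0 (f a) = 1) : logDer (∏ a ∈ s, f a) = ∑ a ∈ s, logDer (f a) := by
  classical
  induction s using Finset.induction_on with
  | empty => simp [logDer_one]
  | insert a s ha ih =>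
    have hs : ∀ b ∈ s, coeff 0 (f b) = 1 := fun b hb => h b (Finset.mem_insert_of_mem hb)
    rw [Finset.prod_insert ha, Finset.sum_insert ha,
      logDer_mul (h a (Finset.mem_insert_self _ _)) (coeff_zero_prod s f hs), ih hs]

theorem logDer_intPow {f : MvPowerSeries I R} (hf : coeff 0 f = 1) (z : ℤ) :
    logDer (intPow f z) = z • logDer f := by
  refine int_step_induction (fun z => logDer (intPow f z) = z • logDer f) ?_ ?_ ?_ z
  · rw [intPow_zero, logDer_one, zero_smul]
  · intro z hz
    rw [intPow_add hf, logDer_mul (coeff_zero_intPow hf z) (coeff_zero_intPow hf 1), hz,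
      intPow_one, add_smul, one_smul]
  · intro z hz
    have h1 := logDer_mul (coeff_zero_intPow hf (z - 1)) (coeff_zero_intPow hf 1)
    rw [← intPow_add hf, sub_add_cancel, hz, intPow_one] at h1
    rw [sub_smul, one_smul, h1, add_sub_cancel_right]

theorem coeff_zero_logDer (f : MvPowerSeries I R) : coeff 0 (logDer f) = 0 := by
  rw [logDer, coeff_zero_mul, coeff_euler]
  simp

theorem CongrMod.logDer {j : ℕ} {f g : MvPowerSeries I R} (hf : coeff 0 f = 1)
    (hg : coeff 0 g = 1) (h : CongrMod j f g) : CongrMod j (logDer f) (logDer g) := by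
  refine CongrMod.mul ?_ (h.intPow hf hg _)
  intro β hβ
  rw [coeff_euler, coeff_euler, h β hβ]

/-- First order expansion of the logarithmic derivative. -/
theorem coeff_logDer_sub {f g : MvPowerSeries I R} (hf : coeff 0 f = 1) (hg : coeff 0 g = 1)
    {β : I →₀ ℕ} (h : CongrMod β.degree f g) :
    coeff β (logDer f) - coeff β (logDer g) = β.degree * (coeff β f - coeff β g) := by
  have e : euler f - euler g = (logDer f - logDer g) * f + (f - g) * logDer g := by
    rw [← logDer_mul_self hf, ← logDer_mul_self hg]; ring
  have e' := congrArg (coeff β) e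
  rw [map_sub, coeff_euler, coeff_euler, map_add, coeff_mul_of_lt_degree,
    coeff_mul_of_lt_degree, hf, coeff_zero_logDer, mul_one, mul_zero, add_zero, map_sub] at e'
  · rw [← e']; ring
  · intro p hp
    rw [map_sub, h p hp, sub_self]
  · intro p hp
    rw [map_sub, h.logDer hf hg p hp, sub_self]

/-- In characteristic `0`, a power series with constant term `1` is determined, modulo every power
of `𝔪`, by its logarithmic derivative. -/
theorem congrMod_iff_logDer [IsAddTorsionFree R] {f g : MvPowerSeries I R} (hf : coeff 0 f = 1)
    (hg : coeff 0 g = 1) {j : ℕ} : CongrMod j f g ↔ CongrMod j (logDer f) (logDer g) := by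
  refine ⟨fun h => h.logDer hf hg, fun h => ?_⟩
  induction j with
  | zero => exact fun β hβ => absurd hβ (Nat.not_lt_zero _)
  | succ j ih =>
    have ih := ih (h.mono (Nat.le_succ j))
    intro β hβ
    rcases Nat.lt_succ_iff_lt_or_eq.1 hβ with hlt | heq
    · exact ih β hlt
    · by_cases h0 : β = 0
      · rw [h0, hf, hg]
      · have hd : β.degree ≠ 0 := fun h => h0 ((Finsupp.degree_eq_zero_iff β).1 h)
        have e := coeff_logDer_sub hf hg (β := β) (heq ▸ ih)
        rw [h β hβ, sub_self, ← nsmul_eq_mul] at e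
        exact sub_eq_zero.1 ((nsmul_eq_zero_iff_right hd).1 e.symm)

end Series
end HDTVCluster

namespace HDTVCluster

/-! ### Supports of power series and wall crossing automorphisms -/

instance {k M : Type*} [Field k] [CharZero k] : IsAddTorsionFree (AddMonoidAlgebra k M) where
  nsmul_right_injective n hn x y h := by
    ext m
    have := congrArg (fun z : AddMonoidAlgebra k M => z.coeff m) h
    simpa [hn] using this

section Crossing

variable {k I ι : Type*} [Field k]

open MvPowerSeries

/-- The exponents of all monomials `t^β z^m` of `f` lie in `Q`. -/
def SuppIn (Q : AddSubmonoid ((I →₀ ℕ) × (ι → ℤ)))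
    (f : MvPowerSeries I (AddMonoidAlgebra k (ι → ℤ))) : Prop :=
  ∀ β m, (coeff β f).coeff m ≠ 0 → (β, m) ∈ Q

variable {Q : AddSubmonoid ((I →₀ ℕ) × (ι → ℤ))}

theorem SuppIn.one : SuppIn Q (1 : MvPowerSeries I (AddMonoidAlgebra k (ι → ℤ))) := by
  classical
  intro β m h
  rw [coeff_one] at h
  split_ifs at h with hβ
  · rw [AddMonoidAlgebra.one_def, AddMonoidAlgebra.coeff_single, Finsupp.single_apply] at h
    split_ifs at h with hm
    · subst hβ; subst hm; exact Q.zero_mem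
    · exact absurd rfl h
  · simp at h

theorem exists_of_coeff_mul_ne_zero {x y : AddMonoidAlgebra k (ι → ℤ)} {m : ι → ℤ}
    (h : (x * y).coeff m ≠ 0) : ∃ a b, x.coeff a ≠ 0 ∧ y.coeff b ≠ 0 ∧ a + b = m := by
  classical
  have := AddMonoidAlgebra.support_coeff_mul_subset x y (Finsupp.mem_support_iff.2 h)
  obtain ⟨a, ha, b, hb, hab⟩ := Finset.mem_add.1 this
  exact ⟨a, b, Finsupp.mem_support_iff.1 ha, Finsupp.mem_support_iff.1 hb, hab⟩

theorem exists_of_coeff_sum_ne_zero {α : Type*} {s : Finset α}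
    {x : α → AddMonoidAlgebra k (ι → ℤ)} {m : ι → ℤ} (h : (∑ a ∈ s, x a).coeff m ≠ 0) :
    ∃ a ∈ s, (x a).coeff m ≠ 0 := by
  rw [AddMonoidAlgebra.coeff_sum, Finsupp.finsetSum_apply] at h
  exact Finset.exists_ne_zero_of_sum_ne_zero h

theorem SuppIn.mul {f g : MvPowerSeries I (AddMonoidAlgebra k (ι → ℤ))} (hf : SuppIn Q f)
    (hg : SuppIn Q g) : SuppIn Q (f * g) := by
  classical
  intro β m h
  rw [coeff_mul] at h
  obtain ⟨p, hp, h⟩ := exists_of_coeff_sum_ne_zero h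
  obtain ⟨a, b, ha, hb, hab⟩ := exists_of_coeff_mul_ne_zero h
  have := Q.add_mem (hf _ _ ha) (hg _ _ hb)
  rwa [Prod.mk_add_mk, Finset.HasAntidiagonal.mem_antidiagonal.1 hp, hab] at this

theorem SuppIn.of_mul_eq_one {f g : MvPowerSeries I (AddMonoidAlgebra k (ι → ℤ))}
    (hf : SuppIn Q f) (h0 : coeff 0 f = 1) (h : f * g = 1) : SuppIn Q g := by
  classical
  intro β
  induction hd : β.degree using Nat.strong_induction_on generalizing β with
  | _ d ih =>
    intro m hm
    have e := congrArg (coeff β) h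
    rw [coeff_mul, ← Finset.add_sum_erase _ _
      (Finset.HasAntidiagonal.mem_antidiagonal.2 (zero_add β) :
        ((0, β) : (I →₀ ℕ) × (I →₀ ℕ)) ∈ _)] at e
    simp only [h0, one_mul] at e
    rw [eq_sub_of_add_eq e, AddMonoidAlgebra.coeff_sub, Finsupp.sub_apply] at hm
    by_cases h1 : (coeff β (1 : MvPowerSeries I (AddMonoidAlgebra k (ι → ℤ)))).coeff m = 0
    · rw [h1, zero_sub, neg_ne_zero] at hm
      obtain ⟨p, hp, hm⟩ := exists_of_coeff_sum_ne_zero hm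
      obtain ⟨a, b, ha, hb, hab⟩ := exists_of_coeff_mul_ne_zero hm
      obtain ⟨hne, hp⟩ := Finset.mem_erase.1 hp
      have hp := Finset.HasAntidiagonal.mem_antidiagonal.1 hp
      have hp1 : p.1 ≠ 0 := by
        intro h
        rw [h, zero_add] at hp
        exact hne (Prod.ext h hp)
      have hlt : p.2.degree < d := by
        have : 0 < p.1.degree :=
          Nat.pos_of_ne_zero fun h0 => hp1 ((Finsupp.degree_eq_zero_iff _).1 h0)
        rw [← hd, ← hp, map_add]; omega
      have := Q.add_mem (hf _ _ ha) (ih _ hlt _ rfl _ hb)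
      rwa [Prod.mk_add_mk, hp, hab] at this
    · exact SuppIn.one _ _ h1

theorem SuppIn.intPow {f : MvPowerSeries I (AddMonoidAlgebra k (ι → ℤ))} (hf : SuppIn Q f)
    (h0 : coeff 0 f = 1) (z : ℤ) : SuppIn Q (intPow f z) := by
  have hpow : ∀ {g : MvPowerSeries I (AddMonoidAlgebra k (ι → ℤ))}, SuppIn Q g →
      ∀ n : ℕ, SuppIn Q (g ^ n) := fun hg n => by
    induction n with
    | zero => rw [pow_zero]; exact SuppIn.one
    | succ n ih => rw [pow_succ]; exact ih.mul hg
  unfold HDTVCluster.intPow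
  split_ifs
  · exact hpow hf _
  · exact hpow (hf.of_mul_eq_one h0 (toUnit f h0).val_inv) _

theorem SuppIn.logDer {f : MvPowerSeries I (AddMonoidAlgebra k (ι → ℤ))} (hf : SuppIn Q f)
    (h0 : coeff 0 f = 1) : SuppIn Q (logDer f) := by
  refine SuppIn.mul ?_ (hf.intPow h0 _)
  intro β m h
  refine hf β m fun h' => h ?_
  rw [coeff_euler, ← nsmul_eq_mul, AddMonoidAlgebra.coeff_smul_apply, h', smul_zero]

/-- Additive maps which are compatible with the `𝔪`-adic filtration. -/
structure IsFiltered (F : MvPowerSeries I (AddMonoidAlgebra k (ι → ℤ)) →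
    MvPowerSeries I (AddMonoidAlgebra k (ι → ℤ))) : Prop where
  add : ∀ g g', F (g + g') = F g + F g'
  congr : ∀ j g g', CongrMod j g g' → CongrMod j (F g) (F g')

theorem IsFiltered.zero {F : MvPowerSeries I (AddMonoidAlgebra k (ι → ℤ)) →
    MvPowerSeries I (AddMonoidAlgebra k (ι → ℤ))} (hF : IsFiltered F) : F 0 = 0 := by
  have := hF.add 0 0
  rw [add_zero] at this
  simpa using this

/-- Filtered additive maps are determined by their values on monomials. -/
theorem IsFiltered.congr_of_monomial [Finite I]
    {F G : MvPowerSeries I (AddMonoidAlgebra k (ι → ℤ)) →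
      MvPowerSeries I (AddMonoidAlgebra k (ι → ℤ))}
    (hF : IsFiltered F) (hG : IsFiltered G) {j : ℕ}
    (h : ∀ β m c, CongrMod j (F (monomial β (AddMonoidAlgebra.single m c)))
      (G (monomial β (AddMonoidAlgebra.single m c))))
    (g : MvPowerSeries I (AddMonoidAlgebra k (ι → ℤ))) : CongrMod j (F g) (G g) := by
  classical
  have h1 : ∀ β x, CongrMod j (F (monomial β x)) (G (monomial β x)) := by
    intro β x
    induction x using AddMonoidAlgebra.induction_linear with
    | zero => rw [map_zero, hF.zero, hG.zero]; exact CongrMod.refl _ _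
    | add x y hx hy => rw [map_add, hF.add, hG.add]; exact hx.add hy
    | single m c => exact h β m c
  have h2 : ∀ s : Finset (I →₀ ℕ), CongrMod j (F (∑ β ∈ s, monomial β (coeff β g)))
      (G (∑ β ∈ s, monomial β (coeff β g))) := by
    intro s
    induction s using Finset.induction_on with
    | empty => rw [Finset.sum_empty, hF.zero, hG.zero]; exact CongrMod.refl _ _
    | insert β s hβ ih =>
      rw [Finset.sum_insert hβ, hF.add, hG.add]
      exact (h1 _ _).add ih
  have hfin := Finsupp.finite_of_degree_lt (σ := I) j
  have h3 : CongrMod j g (∑ β ∈ hfin.toFinset, monomial β (coeff β g)) := by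
    intro β hβ
    rw [map_sum, Finset.sum_eq_single β]
    · rw [coeff_monomial_same]
    · intro b _ hb
      rw [coeff_monomial_ne hb.symm]
    · intro hβ'
      exact absurd (hfin.mem_toFinset.2 hβ) hβ'
  exact ((hF.congr j _ _ h3).trans (h2 _)).trans (hG.congr j _ _ h3.symm)

theorem IsFiltered.eq_of_monomial [Finite I]
    {F G : MvPowerSeries I (AddMonoidAlgebra k (ι → ℤ)) →
      MvPowerSeries I (AddMonoidAlgebra k (ι → ℤ))}
    (hF : IsFiltered F) (hG : IsFiltered G)
    (h : ∀ β m c, F (monomial β (AddMonoidAlgebra.single m c)) =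
      G (monomial β (AddMonoidAlgebra.single m c)))
    (g : MvPowerSeries I (AddMonoidAlgebra k (ι → ℤ))) : F g = G g := by
  ext1 β
  exact hF.congr_of_monomial hG (j := β.degree + 1)
    (fun β m c => (h β m c) ▸ CongrMod.refl _ _) g β (Nat.lt_succ_self _)

theorem coeff_monomial_single_ne_zero {β γ : I →₀ ℕ} {m m' : ι → ℤ} {c : k}
    (h : (coeff γ (monomial β (AddMonoidAlgebra.single m c))).coeff m' ≠ 0) : m' = m := by
  classical
  rw [coeff_monomial] at h
  split_ifs at h
  · rw [AddMonoidAlgebra.coeff_single, Finsupp.single_apply] at h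
    split_ifs at h with hm
    · exact hm.symm
    · exact absurd rfl h
  · simp at h

variable [Fintype ι]

/-- The exponents of the monomials `t^β z^m` with `m ∈ n^⊥`. -/
def perpSupp (I : Type*) {ι : Type*} [Fintype ι] (n : ι → ℤ) :
    AddSubmonoid ((I →₀ ℕ) × (ι → ℤ)) where
  carrier := {p | dotProduct n p.2 = 0}
  zero_mem' := by simp
  add_mem' := by
    intro a b ha hb
    simp only [Set.mem_ofPred_eq, Prod.snd_add, dotProduct_add] at *
    rw [ha, hb, add_zero]

theorem mem_perpSupp {n : ι → ℤ} {p : (I →₀ ℕ) × (ι → ℤ)} :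
    p ∈ perpSupp I n ↔ dotProduct n p.2 = 0 := Iff.rfl

open Classical in
theorem coeff_wallCrossing (f g : MvPowerSeries I (AddMonoidAlgebra k (ι → ℤ))) (n : ι → ℤ)
    (β : I →₀ ℕ) : coeff β (wallCrossing f n g) =
      ∑ p ∈ Finset.HasAntidiagonal.antidiagonal β, (coeff p.1 g).coeff.sum
        fun m c => AddMonoidAlgebra.single m c * coeff p.2 (intPow f (dotProduct n m)) := rfl

theorem wallCrossing_add (f g g' : MvPowerSeries I (AddMonoidAlgebra k (ι → ℤ))) (n : ι → ℤ) :
    wallCrossing f n (g + g') = wallCrossing f n g + wallCrossing f n g' := by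
  classical
  ext1 β
  rw [map_add, coeff_wallCrossing, coeff_wallCrossing, coeff_wallCrossing,
    ← Finset.sum_add_distrib]
  refine Finset.sum_congr rfl fun p _ => ?_
  rw [map_add, AddMonoidAlgebra.coeff_add, Finsupp.sum_add_index']
  · intro m; simp
  · intro m a b; rw [AddMonoidAlgebra.single_add, add_mul]

theorem wallCrossing_congr {f f' g g' : MvPowerSeries I (AddMonoidAlgebra k (ι → ℤ))} {j : ℕ}
    (hf : coeff 0 f = 1) (hf' : coeff 0 f' = 1) (hff : CongrMod j f f') (hg : CongrMod j g g')
    (n : ι → ℤ) : CongrMod j (wallCrossing f n g) (wallCrossing f' n g') := by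
  classical
  intro β hβ
  rw [coeff_wallCrossing, coeff_wallCrossing]
  refine Finset.sum_congr rfl fun p hp => ?_
  have hp := degree_le_of_add_eq (Finset.HasAntidiagonal.mem_antidiagonal.1 hp)
  rw [hg _ (hp.1.trans_lt hβ)]
  refine Finsupp.sum_congr fun m _ => ?_
  rw [hff.intPow hf hf' _ _ (hp.2.trans_lt hβ)]

/-- On monomials `z^m` with `⟨n, m⟩ = c`, wall crossing is multiplication by `f ^ c`. -/
theorem wallCrossing_of_weight (f : MvPowerSeries I (AddMonoidAlgebra k (ι → ℤ))) {n : ι → ℤ}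
    {c : ℤ} {g : MvPowerSeries I (AddMonoidAlgebra k (ι → ℤ))}
    (hg : ∀ β m, (coeff β g).coeff m ≠ 0 → dotProduct n m = c) :
    wallCrossing f n g = g * intPow f c := by
  classical
  ext1 β
  rw [coeff_wallCrossing, coeff_mul]
  refine Finset.sum_congr rfl fun p _ => ?_
  conv_rhs => rw [← AddMonoidAlgebra.sum_coeff_single (coeff p.1 g), Finsupp.sum, Finset.sum_mul]
  refine Finset.sum_congr rfl fun m hm => ?_
  simp only [hg _ _ (Finsupp.mem_support_iff.1 hm)]

theorem wallCrossing_one (n : ι → ℤ) (g : MvPowerSeries I (AddMonoidAlgebra k (ι → ℤ))) :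
    wallCrossing 1 n g = g := by
  classical
  ext1 β
  rw [coeff_wallCrossing, ← mul_one g, coeff_mul]
  refine Finset.sum_congr rfl fun p _ => ?_
  rw [mul_one]
  conv_rhs => rw [← AddMonoidAlgebra.sum_coeff_single (coeff p.1 g), Finsupp.sum, Finset.sum_mul]
  refine Finset.sum_congr rfl fun m hm => ?_
  simp only [intPow_one_left]

theorem isFiltered_wallCrossing {f : MvPowerSeries I (AddMonoidAlgebra k (ι → ℤ))}
    (hf : coeff 0 f = 1) (n : ι → ℤ) : IsFiltered (wallCrossing f n) where
  add g g' := wallCrossing_add f g g' n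
  congr j _ _ h := wallCrossing_congr hf hf (CongrMod.refl j f) h n

/-- Crossings of walls which lie in the same hyperplane compose by multiplication of the attached
functions. -/
theorem wallCrossing_wallCrossing [Finite I]
    {f f' : MvPowerSeries I (AddMonoidAlgebra k (ι → ℤ))} {n : ι → ℤ}
    (hf : coeff 0 f = 1) (hf' : coeff 0 f' = 1) (hs' : SuppIn (perpSupp I n) f')
    (g : MvPowerSeries I (AddMonoidAlgebra k (ι → ℤ))) :
    wallCrossing f n (wallCrossing f' n g) = wallCrossing (f' * f) n g := by
  have hff : coeff 0 (f' * f) = 1 := by rw [coeff_zero_mul, hf, hf', one_mul]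
  have h1 := isFiltered_wallCrossing hf n
  have h2 := isFiltered_wallCrossing hf' n
  refine IsFiltered.eq_of_monomial (F := fun g => wallCrossing f n (wallCrossing f' n g))
    ⟨fun g g' => by rw [h2.add, h1.add], fun j g g' h => h1.congr _ _ _ (h2.congr _ _ _ h)⟩
    (isFiltered_wallCrossing hff n) ?_ g
  intro β m c
  have hw : ∀ γ m', (coeff γ (monomial β (AddMonoidAlgebra.single m c))).coeff m' ≠ 0 →
      dotProduct n m' = dotProduct n m := fun γ m' h => by
    rw [coeff_monomial_single_ne_zero h]
  rw [wallCrossing_of_weight _ hw, wallCrossing_of_weight _ hw, intPow_mul hf' hf,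
    wallCrossing_of_weight (c := dotProduct n m), mul_assoc]
  classical
  intro γ m' h
  rw [coeff_mul] at h
  obtain ⟨p, hp, h⟩ := exists_of_coeff_sum_ne_zero h
  obtain ⟨a, b, ha, hb, rfl⟩ := exists_of_coeff_mul_ne_zero h
  have hb := mem_perpSupp.1 (hs'.intPow hf' _ _ _ hb)
  rw [dotProduct_add, hw _ _ ha, hb, add_zero]

/-! ### First order comparison of products of wall crossings -/

/-- The composition of the wall crossings with functions `f t` and normal vectors `n t`, for the
times `t` of a list. -/
noncomputable def crossFold (f : ℝ → MvPowerSeries I (AddMonoidAlgebra k (ι → ℤ)))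
    (n : ℝ → ι → ℤ) (ts : List ℝ) (g : MvPowerSeries I (AddMonoidAlgebra k (ι → ℤ))) :
    MvPowerSeries I (AddMonoidAlgebra k (ι → ℤ)) :=
  ts.foldl (fun g t => wallCrossing (f t) (n t) g) g

theorem crossFold_congr {f f' : ℝ → MvPowerSeries I (AddMonoidAlgebra k (ι → ℤ))}
    (n : ℝ → ι → ℤ) {j : ℕ} (ts : List ℝ) (hf : ∀ t ∈ ts, coeff 0 (f t) = 1)
    (hf' : ∀ t ∈ ts, coeff 0 (f' t) = 1) (hff : ∀ t ∈ ts, CongrMod j (f t) (f' t))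
    {g g' : MvPowerSeries I (AddMonoidAlgebra k (ι → ℤ))} (hg : CongrMod j g g') :
    CongrMod j (crossFold f n ts g) (crossFold f' n ts g') := by
  induction ts generalizing g g' with
  | nil => exact hg
  | cons t ts ih =>
    simp only [List.forall_mem_cons] at hf hf' hff
    exact ih hf.2 hf'.2 hff.2 (wallCrossing_congr hf.1 hf'.1 hff.1 hg _)

/-- First order comparison of two wall crossings: if the functions and the arguments agree below the
degree of `β`, the difference in degree `β` is that of the arguments, plus the contribution of the
functions applied to the leading term `z^m` of the argument. -/
theorem coeff_wallCrossing_sub {f f' g g' : MvPowerSeries I (AddMonoidAlgebra k (ι → ℤ))}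
    {β : I →₀ ℕ} (hβ : β ≠ 0) (hf : coeff 0 f = 1) (hf' : coeff 0 f' = 1)
    (hff : CongrMod β.degree f f') (hg : CongrMod β.degree g g') (n : ι → ℤ) {m : ι → ℤ}
    (hg0 : coeff 0 g = AddMonoidAlgebra.single m 1) :
    coeff β (wallCrossing f' n g') - coeff β (wallCrossing f n g) =
      (coeff β g' - coeff β g) +
      dotProduct n m • (AddMonoidAlgebra.single m 1 * (coeff β f' - coeff β f)) := by
  classical
  have hd : 0 < β.degree := Nat.pos_of_ne_zero fun h0 => hβ ((Finsupp.degree_eq_zero_iff _).1 h0)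
  have hg0' : coeff 0 g' = AddMonoidAlgebra.single m 1 := by
    rw [← hg0, hg 0 (by simpa using hd)]
  have hzero : ∀ u : MvPowerSeries I (AddMonoidAlgebra k (ι → ℤ)), coeff 0 u = 1 → ∀ x,
      ((x : AddMonoidAlgebra k (ι → ℤ)).coeff.sum fun m c =>
        AddMonoidAlgebra.single m c * coeff 0 (intPow u (dotProduct n m))) = x := by
    intro u hu x
    conv_rhs => rw [← AddMonoidAlgebra.sum_coeff_single x]
    refine Finsupp.sum_congr fun a _ => ?_
    rw [coeff_zero_intPow hu, mul_one]
  -- only the splittings `(β, 0)` and `(0, β)` of the degree `β` contribute to the difference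
  have hne : ((β, 0) : (I →₀ ℕ) × (I →₀ ℕ)) ≠ (0, β) := fun h => hβ (congrArg Prod.fst h)
  rw [coeff_wallCrossing, coeff_wallCrossing, ← Finset.sum_sub_distrib,
    Finset.sum_eq_add (β, 0) (0, β) hne]
  · simp only [hzero f hf, hzero f' hf', hg0, hg0', AddMonoidAlgebra.coeff_single]
    rw [Finsupp.sum_single_index (by simp), Finsupp.sum_single_index (by simp), ← mul_sub,
      coeff_intPow_sub hf' hf hff.symm, ← zsmul_eq_mul, mul_smul_comm]
  -- the other splittings of `β` only involve lower degrees, where everything agrees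
  · rintro ⟨p, q⟩ hp ⟨h1, h2⟩
    have hpq := Finset.HasAntidiagonal.mem_antidiagonal.1 hp
    simp only at hpq
    have hp0 : 0 < p.degree := Nat.pos_of_ne_zero fun h0 => h2 (by
      rw [(Finsupp.degree_eq_zero_iff _).1 h0, zero_add] at hpq
      rw [(Finsupp.degree_eq_zero_iff _).1 h0, hpq])
    have hq0 : 0 < q.degree := Nat.pos_of_ne_zero fun h0 => h1 (by
      rw [(Finsupp.degree_eq_zero_iff _).1 h0, add_zero] at hpq
      rw [(Finsupp.degree_eq_zero_iff _).1 h0, hpq])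
    have hdeg : p.degree + q.degree = β.degree := by rw [← hpq, map_add]
    rw [sub_eq_zero]
    simp only
    rw [hg p (by omega)]
    refine Finsupp.sum_congr fun a _ => ?_
    rw [hff.intPow hf hf' _ q (by omega)]
  · intro h
    exact absurd (Finset.HasAntidiagonal.mem_antidiagonal.2 (add_zero β)) h
  · intro h
    exact absurd (Finset.HasAntidiagonal.mem_antidiagonal.2 (zero_add β)) h

theorem coeff_zero_wallCrossing {f g : MvPowerSeries I (AddMonoidAlgebra k (ι → ℤ))}
    (hf : coeff 0 f = 1) (n : ι → ℤ) : coeff 0 (wallCrossing f n g) = coeff 0 g := by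
  have h1 : CongrMod 1 f 1 := fun β hβ => by
    rw [(Finsupp.degree_eq_zero_iff β).1 (Nat.lt_one_iff.1 hβ), hf]; simp
  have h2 := wallCrossing_congr hf (by simp) h1 (CongrMod.refl 1 g) n 0 (by simp)
  rwa [wallCrossing_one] at h2

/-- If the functions of two products of wall crossings agree modulo `𝔪 ^ j`, the terms of degree
`j` of the difference of the products are the sum of the contributions of the crossings. -/
theorem coeff_crossFold_sub {f f' : ℝ → MvPowerSeries I (AddMonoidAlgebra k (ι → ℤ))}
    (n : ℝ → ι → ℤ) {β : I →₀ ℕ} (hβ : β ≠ 0) (ts : List ℝ) (hf : ∀ t ∈ ts, coeff 0 (f t) = 1)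
    (hf' : ∀ t ∈ ts, coeff 0 (f' t) = 1) (hff : ∀ t ∈ ts, CongrMod β.degree (f t) (f' t))
    {g g' : MvPowerSeries I (AddMonoidAlgebra k (ι → ℤ))} (hg : CongrMod β.degree g g')
    {m : ι → ℤ} (hg0 : coeff 0 g = AddMonoidAlgebra.single m 1) :
    coeff β (crossFold f' n ts g') - coeff β (crossFold f n ts g) =
      (coeff β g' - coeff β g) + (ts.map fun t => dotProduct (n t) m •
        (AddMonoidAlgebra.single m 1 * (coeff β (f' t) - coeff β (f t)))).sum := by
  induction ts generalizing g g' with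
  | nil => simp [crossFold]
  | cons t ts ih =>
    simp only [List.forall_mem_cons] at hf hf' hff
    have := ih hf.2 hf'.2 hff.2 (wallCrossing_congr hf.1 hf'.1 hff.1 hg (n t))
      (by rw [coeff_zero_wallCrossing hf.1, hg0])
    rw [List.map_cons, List.sum_cons, ← add_assoc,
      ← coeff_wallCrossing_sub hβ hf.1 hf'.1 hff.1 hg (n t) hg0]
    exact this

end Crossing
end HDTVCluster

namespace HDTVCluster

/-! ### Cones of codimension one and their normal vectors -/

section Cones

open Filter Topology

variable {ι : Type*} [Fintype ι]

/-- The pairing with a lattice vector, as a linear form. -/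
def pairL (n : ι → ℤ) : (ι → ℝ) →ₗ[ℝ] ℝ where
  toFun := pair n
  map_add' x y := by simp [pair, mul_add, Finset.sum_add_distrib]
  map_smul' a x := by simp [pair, Finset.mul_sum, mul_left_comm]

theorem pairL_apply (n : ι → ℤ) (x : ι → ℝ) : pairL n x = pair n x := rfl

theorem pair_add (n : ι → ℤ) (x y : ι → ℝ) : pair n (x + y) = pair n x + pair n y :=
  (pairL n).map_add x y

theorem pair_sub (n : ι → ℤ) (x y : ι → ℝ) : pair n (x - y) = pair n x - pair n y :=
  (pairL n).map_sub x y

theorem pair_smul (n : ι → ℤ) (a : ℝ) (x : ι → ℝ) : pair n (a • x) = a * pair n x :=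
  (pairL n).map_smul a x

theorem pair_zero (n : ι → ℤ) : pair n 0 = 0 := (pairL n).map_zero

theorem pair_sum {α : Type*} (n : ι → ℤ) (s : Finset α) (x : α → ι → ℝ) :
    pair n (∑ a ∈ s, x a) = ∑ a ∈ s, pair n (x a) := map_sum (pairL n) x s

theorem neg_pair (n : ι → ℤ) (x : ι → ℝ) : pair (-n) x = -pair n x := by
  simp [pair]

theorem smul_pair (a : ℤ) (n : ι → ℤ) (x : ι → ℝ) : pair (a • n) x = a * pair n x := by
  simp [pair, Finset.mul_sum, mul_assoc]

theorem add_pair (n n' : ι → ℤ) (x : ι → ℝ) : pair (n + n') x = pair n x + pair n' x := by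
  simp [pair, add_mul, Finset.sum_add_distrib]

theorem zero_pair (x : ι → ℝ) : pair (0 : ι → ℤ) x = 0 := by simp [pair]

theorem pair_toReal (n m : ι → ℤ) : pair n (toReal m) = ((dotProduct n m : ℤ) : ℝ) := by
  simp [pair, toReal, dotProduct]

theorem continuous_pair (n : ι → ℤ) : Continuous (pair n) :=
  (pairL n).continuous_of_finiteDimensional

theorem pair_toReal_self_pos {n : ι → ℤ} (hn : n ≠ 0) : 0 < pair n (toReal n) := by
  obtain ⟨i, hi⟩ := Function.ne_iff.1 hn
  refine Finset.sum_pos' (fun j _ => mul_self_nonneg _) ⟨i, Finset.mem_univ _, ?_⟩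
  exact mul_self_pos.2 (by exact_mod_cast hi)

theorem isClosed_of_isRationalPolyhedralCone {d : Set (ι → ℝ)}
    (hd : IsRationalPolyhedralCone d) : IsClosed d := by
  obtain ⟨A, rfl⟩ := hd
  have : {x : ι → ℝ | ∀ n ∈ A, 0 ≤ pair n x} = ⋂ n ∈ A, {x | 0 ≤ pair n x} := by
    ext x; simp
  rw [this]
  exact isClosed_biInter fun n _ => isClosed_le continuous_const (continuous_pair n)

theorem zero_mem_of_isRationalPolyhedralCone {d : Set (ι → ℝ)}
    (hd : IsRationalPolyhedralCone d) : 0 ∈ d := by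
  obtain ⟨A, rfl⟩ := hd
  intro n _
  rw [pair_zero]

theorem add_mem_of_isRationalPolyhedralCone {d : Set (ι → ℝ)}
    (hd : IsRationalPolyhedralCone d) {x y : ι → ℝ} (hx : x ∈ d) (hy : y ∈ d) : x + y ∈ d := by
  obtain ⟨A, rfl⟩ := hd
  intro n hn
  rw [pair_add]
  exact add_nonneg (hx n hn) (hy n hn)

theorem smul_mem_of_isRationalPolyhedralCone {d : Set (ι → ℝ)}
    (hd : IsRationalPolyhedralCone d) {x : ι → ℝ} (hx : x ∈ d) {a : ℝ} (ha : 0 ≤ a) :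
    a • x ∈ d := by
  obtain ⟨A, rfl⟩ := hd
  intro n hn
  rw [pair_smul]
  exact mul_nonneg ha (hx n hn)

theorem smul_mem_iff_of_isRationalPolyhedralCone {d : Set (ι → ℝ)}
    (hd : IsRationalPolyhedralCone d) {x : ι → ℝ} {a : ℝ} (ha : 0 < a) :
    a • x ∈ d ↔ x ∈ d := by
  refine ⟨fun h => ?_, fun h => smul_mem_of_isRationalPolyhedralCone hd h ha.le⟩
  have := smul_mem_of_isRationalPolyhedralCone hd h (inv_pos.2 ha).le
  rwa [smul_smul, inv_mul_cancel₀ ha.ne', one_smul] at this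

/-- A convex cone on which each of finitely many linear forms takes nonnegative values and a
positive value contains a point at which all of them are positive. -/
theorem exists_forall_pair_pos {d : Set (ι → ℝ)} (h0 : 0 ∈ d)
    (hadd : ∀ x ∈ d, ∀ y ∈ d, x + y ∈ d) (B : Finset (ι → ℤ))
    (hB : ∀ l ∈ B, (∀ x ∈ d, 0 ≤ pair l x) ∧ ∃ x ∈ d, 0 < pair l x) :
    ∃ x ∈ d, ∀ l ∈ B, 0 < pair l x := by
  classical
  induction B using Finset.induction_on with
  | empty => exact ⟨0, h0, by simp⟩
  | insert l B hl ih =>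
    obtain ⟨x, hx, hxB⟩ := ih fun l' hl' => hB l' (Finset.mem_insert_of_mem hl')
    obtain ⟨hnn, y, hy, hyl⟩ := hB l (Finset.mem_insert_self _ _)
    refine ⟨x + y, hadd x hx y hy, fun l' hl' => ?_⟩
    rw [pair_add]
    rcases Finset.mem_insert.1 hl' with rfl | h
    · exact add_pos_of_nonneg_of_pos (hnn x hx) hyl
    · exact add_pos_of_pos_of_nonneg (hxB l' h) ((hB l' hl').1 y hy)

theorem eventually_forall_pair_pos {B : Finset (ι → ℤ)} {x : ι → ℝ}
    (hx : ∀ l ∈ B, 0 < pair l x) : ∀ᶠ y in 𝓝 x, ∀ l ∈ B, 0 < pair l y := by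
  rw [Filter.eventually_all_finset]
  exact fun l hl => (continuous_pair l).continuousAt.eventually (lt_mem_nhds (hx l hl))

theorem IsPrimitive.ne_zero {n : ι → ℤ} (h : IsPrimitive n) : n ≠ 0 := by
  rintro rfl
  have : (Finset.univ : Finset ι).gcd (0 : ι → ℤ) = 0 := Finset.gcd_eq_zero_iff.2 fun _ _ => rfl
  rw [IsPrimitive, this] at h
  exact zero_ne_one h

theorem IsPrimitive.neg {n : ι → ℤ} (h : IsPrimitive n) : IsPrimitive (-n) := by
  refine (?_ : Finset.univ.gcd (-n) = Finset.univ.gcd n).trans h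
  refine dvd_antisymm_of_normalize_eq Finset.normalize_gcd Finset.normalize_gcd ?_ ?_ <;>
    refine Finset.dvd_gcd fun i hi => ?_
  · exact (dvd_neg (a := Finset.univ.gcd (-n)) (b := n i)).1 (Finset.gcd_dvd (f := -n) hi)
  · exact dvd_neg.2 (Finset.gcd_dvd (f := n) hi)

theorem gcd_smul_primitivePart (m : ι → ℤ) : Finset.univ.gcd m • primitivePart m = m := by
  ext i
  exact Int.mul_ediv_cancel' (Finset.gcd_dvd (Finset.mem_univ i))

theorem gcd_pos {m : ι → ℤ} (hm : m ≠ 0) : 0 < Finset.univ.gcd m := by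
  obtain ⟨i, hi⟩ := Function.ne_iff.1 hm
  refine lt_of_le_of_ne (Finset.Int.finsetGcd_nonneg) (Ne.symm ?_)
  exact Finset.gcd_ne_zero_iff.2 ⟨i, Finset.mem_univ _, hi⟩

theorem isPrimitive_primitivePart {m : ι → ℤ} (hm : m ≠ 0) : IsPrimitive (primitivePart m) := by
  obtain ⟨i, hi⟩ := Function.ne_iff.1 hm
  exact Finset.gcd_div_eq_one (Finset.mem_univ i) hi

theorem primitivePart_zero : primitivePart (0 : ι → ℤ) = 0 := by
  ext i; simp [primitivePart]

theorem primitivePart_of_isPrimitive {m : ι → ℤ} (hm : IsPrimitive m) : primitivePart m = m := by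
  have := gcd_smul_primitivePart m
  rwa [show Finset.univ.gcd m = 1 from hm, one_smul] at this

/-- A primitive vector is determined up to sign by its orthogonal hyperplane. -/
theorem IsPrimitive.eq_or_eq_neg {n n' : ι → ℤ} (h : IsPrimitive n) (h' : IsPrimitive n')
    (hk : ∀ x, pair n x = 0 → pair n' x = 0) : n' = n ∨ n' = -n := by
  classical
  -- the vector with entries `n i` at `j` and `-n j` at `i` lies in the hyperplane
  have hcross : ∀ i j, n i * n' j = n' i * n j := by
    intro i j
    have h1 := hk (Pi.single j (n i : ℝ) - Pi.single i (n j : ℝ)) (by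
      rw [pair_sub]; simp [pair, Pi.single_apply]; ring)
    rw [pair_sub] at h1
    simp only [pair, Pi.single_apply, mul_ite, mul_zero, Finset.sum_ite_eq', Finset.mem_univ,
      if_true] at h1
    have : (n i : ℝ) * n' j = n' i * n j := by linear_combination h1
    exact_mod_cast this
  -- take the gcd over `i` of both sides of `n i * n' j = n' i * n j`
  have habs : ∀ j, normalize (n' j) = normalize (n j) := by
    intro j
    have h1 : (Finset.univ : Finset ι).gcd (fun i => n i * n' j) =
        (Finset.univ : Finset ι).gcd (fun i => n' i * n j) :=
      Finset.gcd_congr rfl fun i _ => hcross i j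
    rw [Finset.gcd_mul_right, Finset.gcd_mul_right] at h1
    rwa [show Finset.univ.gcd (fun i => n i) = 1 from h,
      show Finset.univ.gcd (fun i => n' i) = 1 from h', one_mul, one_mul] at h1
  obtain ⟨j, hj⟩ := Function.ne_iff.1 h.ne_zero
  have hj : n j ≠ 0 := hj
  have hj' := habs j
  rw [← Int.abs_eq_normalize, ← Int.abs_eq_normalize, abs_eq_abs] at hj'
  rcases hj' with e | e
  · left
    ext i
    have := hcross i j
    rw [e] at this
    exact (mul_right_cancel₀ hj this).symm
  · right
    ext i
    have := hcross i j
    rw [e] at this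
    have : n' i * n j = -n i * n j := by rw [← this]; ring
    exact mul_right_cancel₀ hj this

/-- The cone `d` spans the hyperplane orthogonal to the primitive vector `n`. -/
structure HasNormal (d : Set (ι → ℝ)) (n : ι → ℤ) : Prop where
  primitive : IsPrimitive n
  mem_span_iff : ∀ x, x ∈ Submodule.span ℝ d ↔ pair n x = 0

theorem HasNormal.neg {d : Set (ι → ℝ)} {n : ι → ℤ} (h : HasNormal d n) : HasNormal d (-n) :=
  ⟨h.primitive.neg, fun x => by rw [h.mem_span_iff, neg_pair, neg_eq_zero]⟩

theorem HasNormal.pair_eq_zero {d : Set (ι → ℝ)} {n : ι → ℤ} (h : HasNormal d n) {x : ι → ℝ}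
    (hx : x ∈ d) : pair n x = 0 :=
  (h.mem_span_iff x).1 (Submodule.subset_span hx)

theorem HasNormal.eq_or_eq_neg {d d' : Set (ι → ℝ)} {n n' : ι → ℤ} (h : HasNormal d n)
    (h' : HasNormal d' n') (hs : Submodule.span ℝ d ≤ Submodule.span ℝ d') :
    n' = n ∨ n' = -n :=
  h.primitive.eq_or_eq_neg h'.primitive fun x hx =>
    (h'.mem_span_iff x).1 (hs ((h.mem_span_iff x).2 hx))

theorem HasNormal.signedNormal_eq {d : Set (ι → ℝ)} {n : ι → ℤ} (h : HasNormal d n)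
    {u : ι → ℝ} (hu : pair n u < 0) : signedNormal d u = n := by
  have hex : ∃ n : ι → ℤ, IsPrimitive n ∧ d ⊆ perp n ∧ pair n u < 0 :=
    ⟨n, h.primitive, fun x hx => h.pair_eq_zero hx, hu⟩
  rw [signedNormal, dif_pos hex]
  obtain ⟨h1, h2, h3⟩ := hex.choose_spec
  rcases h.primitive.eq_or_eq_neg h1 (fun x hx => by
    have hle : Submodule.span ℝ d ≤ LinearMap.ker (pairL hex.choose) :=
      Submodule.span_le.2 fun y hy => h2 hy
    exact hle ((h.mem_span_iff x).2 hx)) with e | e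
  · exact e
  · rw [e, neg_pair] at h3
    linarith

theorem HasNormal.coneDim {d : Set (ι → ℝ)} {n : ι → ℤ} (h : HasNormal d n) :
    HDTVCluster.coneDim d + 1 = Fintype.card ι := by
  have e : Submodule.span ℝ d = LinearMap.ker (pairL n) := by
    ext x; rw [h.mem_span_iff, LinearMap.mem_ker, pairL_apply]
  have hne : pairL n ≠ 0 := fun h0 => by
    have := pair_toReal_self_pos h.primitive.ne_zero
    rw [← pairL_apply, h0] at this
    exact lt_irrefl _ this
  have := Module.Dual.finrank_ker_add_one_of_ne_zero (f := pairL n) hne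
  rw [HDTVCluster.coneDim, e, this, Module.finrank_fintype_fun_eq_card]

/-- A codimension one cone in `n^⊥` spans this hyperplane. -/
theorem HasNormal.of_subset_perp {d : Set (ι → ℝ)} {n : ι → ℤ} (hc : IsCodimOne d)
    (hn : IsPrimitive n) (hd : d ⊆ perp n) : HasNormal d n := by
  refine ⟨hn, fun x => ?_⟩
  have hle : Submodule.span ℝ d ≤ LinearMap.ker (pairL n) := Submodule.span_le.2 fun y hy => hd hy
  have hne : pairL n ≠ 0 := fun h0 => by
    have := pair_toReal_self_pos hn.ne_zero
    rw [← pairL_apply, h0] at this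
    exact lt_irrefl _ this
  have hfin := Module.Dual.finrank_ker_add_one_of_ne_zero (f := pairL n) hne
  rw [Module.finrank_fintype_fun_eq_card, ← hc] at hfin
  have := Submodule.eq_of_le_of_finrank_eq hle (Nat.succ_injective hfin).symm
  rw [this, LinearMap.mem_ker, pairL_apply]

/-- The cones which are supports of walls. -/
def IsWallCone (d : Set (ι → ℝ)) : Prop := IsRationalPolyhedralCone d ∧ IsCodimOne d

/-- One of the nonzero linear forms which define a cone of codimension one vanishes on it: otherwise
the cone would contain a point at which all of them are positive, hence an open set. -/
theorem IsWallCone.exists_normal {d : Set (ι → ℝ)} (hd : IsWallCone d) :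
    ∃ n, HasNormal d n := by
  classical
  obtain ⟨⟨A, hA⟩, hc⟩ := id hd
  by_contra hcon
  have hzero : ∀ l ∈ A, (∀ x ∈ d, pair l x = 0) → l = 0 := by
    intro l _ hl
    by_contra h0
    refine hcon ⟨primitivePart l, HasNormal.of_subset_perp hc (isPrimitive_primitivePart h0) ?_⟩
    intro x hx
    have h1 := hl x hx
    rw [← gcd_smul_primitivePart l, smul_pair] at h1
    exact (mul_eq_zero.1 h1).resolve_left (by exact_mod_cast (gcd_pos h0).ne')
  obtain ⟨x, hx, hpos⟩ := exists_forall_pair_pos (d := d)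
    (zero_mem_of_isRationalPolyhedralCone hd.1)
    (fun _ hx _ hy => add_mem_of_isRationalPolyhedralCone hd.1 hx hy) (A.filter (· ≠ 0)) (by
      intro l hl
      obtain ⟨hl, h0⟩ := Finset.mem_filter.1 hl
      have hnn : ∀ x ∈ d, 0 ≤ pair l x := fun x hx => by rw [hA] at hx; exact hx l hl
      refine ⟨hnn, ?_⟩
      by_contra hcon'
      push Not at hcon'
      exact h0 (hzero l hl fun x hx => le_antisymm (hcon' x hx) (hnn x hx)))
  have hint : x ∈ interior d := by
    rw [mem_interior_iff_mem_nhds]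
    filter_upwards [eventually_forall_pair_pos hpos] with y hy
    rw [hA]
    intro l hl
    by_cases h0 : l = 0
    · rw [h0, zero_pair]
    · exact (hy l (Finset.mem_filter.2 ⟨hl, h0⟩)).le
  have htop : Submodule.span ℝ d = ⊤ := by
    refine Submodule.eq_top_of_nonempty_interior' _ ⟨x, ?_⟩
    exact interior_mono Submodule.subset_span hint
  rw [IsCodimOne, coneDim, htop, finrank_top, Module.finrank_fintype_fun_eq_card] at hc
  omega

/-- A codimension one cone is cut out of its hyperplane by linear forms which take positive values
on it. -/
theorem IsWallCone.exists_forms {d : Set (ι → ℝ)} (hd : IsWallCone d) {n : ι → ℤ}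
    (hn : HasNormal d n) : ∃ B : Finset (ι → ℤ), (∀ l ∈ B, ∃ x ∈ d, 0 < pair l x) ∧
      d = {x | pair n x = 0 ∧ ∀ l ∈ B, 0 ≤ pair l x} := by
  classical
  obtain ⟨A, hA⟩ := hd.1
  refine ⟨A.filter fun l => ∃ x ∈ d, 0 < pair l x, fun l hl => (Finset.mem_filter.1 hl).2, ?_⟩
  ext x
  constructor
  · intro hx
    refine ⟨hn.pair_eq_zero hx, fun l hl => ?_⟩
    rw [hA] at hx
    exact hx l (Finset.mem_filter.1 hl).1
  · rintro ⟨hx, hB⟩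
    rw [hA]
    intro l hl
    by_cases hpos : ∃ x ∈ d, 0 < pair l x
    · exact hB l (Finset.mem_filter.2 ⟨hl, hpos⟩)
    · push Not at hpos
      have hle : Submodule.span ℝ d ≤ LinearMap.ker (pairL l) := Submodule.span_le.2 fun y hy =>
        le_antisymm (hpos y hy) (by rw [hA] at hy; exact hy l hl)
      exact le_of_eq (hle ((hn.mem_span_iff x).2 hx)).symm

/-- The relative interior of a cone, in terms of the linear subspace which it spans. -/
theorem mem_intrinsicInterior_iff {α : Type*} {d : Set (α → ℝ)} (h0 : 0 ∈ d) {x : α → ℝ}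
    (hx : x ∈ d) : x ∈ intrinsicInterior ℝ d ↔ ∀ᶠ y in 𝓝 x, y ∈ Submodule.span ℝ d → y ∈ d := by
  have hspan : ∀ y, y ∈ (affineSpan ℝ d : Set (α → ℝ)) ↔ y ∈ Submodule.span ℝ d := by
    intro y
    rw [← SetLike.mem_coe (A := Submodule ℝ (α → ℝ)), ← affineSpan_insert_zero,
      Set.insert_eq_of_mem h0]
  rw [mem_intrinsicInterior]
  constructor
  · rintro ⟨y, hy, rfl⟩
    have hy := (preimage_coe_mem_nhds_subtype (s := (affineSpan ℝ d : Set (α → ℝ)))).1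
      (mem_interior_iff_mem_nhds.1 hy)
    exact (eventually_nhdsWithin_iff.1 hy).mono fun z hz h => hz ((hspan z).2 h)
  · intro h
    refine ⟨⟨x, (hspan x).2 (Submodule.subset_span hx)⟩, ?_, rfl⟩
    refine mem_interior_iff_mem_nhds.2
      ((preimage_coe_mem_nhds_subtype (s := (affineSpan ℝ d : Set (α → ℝ)))).2 ?_)
    exact eventually_nhdsWithin_iff.2 (h.mono fun z hz h => hz ((hspan z).1 h))

theorem mem_intrinsicFrontier_iff {d : Set (ι → ℝ)} (hd : IsRationalPolyhedralCone d)
    {x : ι → ℝ} : x ∈ intrinsicFrontier ℝ d ↔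
      x ∈ d ∧ ¬ ∀ᶠ y in 𝓝 x, y ∈ Submodule.span ℝ d → y ∈ d := by
  have hcl := isClosed_of_isRationalPolyhedralCone hd
  rw [← intrinsicClosure_sdiff_intrinsicInterior,
    IsClosed.intrinsicClosure (hcl.preimage continuous_subtype_val), Set.mem_sdiff]
  refine and_congr_right fun hx => ?_
  rw [mem_intrinsicInterior_iff (zero_mem_of_isRationalPolyhedralCone hd) hx]

/-- If a neighbourhood of a point in a hyperplane lies in `d`, then `d` spans the hyperplane. -/
theorem le_span_of_eventually {α : Type*} {d : Set (α → ℝ)} {W : Submodule ℝ (α → ℝ)} {x : α → ℝ}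
    (hx : x ∈ W) (h : ∀ᶠ y in 𝓝 x, y ∈ W → y ∈ d) : W ≤ Submodule.span ℝ d := by
  intro z hz
  have htend : Tendsto (fun a : ℝ => x + a • z) (𝓝[>] 0) (𝓝 x) := by
    refine tendsto_nhdsWithin_of_tendsto_nhds ?_
    have : Continuous fun a : ℝ => x + a • z := by fun_prop
    simpa using this.tendsto 0
  obtain ⟨a, ha, ha0⟩ := ((htend.eventually h).and self_mem_nhdsWithin).exists
  have h1 := Submodule.subset_span (R := ℝ) (ha (W.add_mem hx (W.smul_mem a hz)))
  have h2 := Submodule.subset_span (R := ℝ) (h.self_of_nhds hx)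
  have h3 := Submodule.smul_mem _ a⁻¹ (Submodule.sub_mem _ h1 h2)
  rwa [add_sub_cancel_left, smul_smul, inv_mul_cancel₀ (ne_of_gt ha0), one_smul] at h3

/-- Outside of the singular locus, the walls through a point agree locally with one and the same
hyperplane. -/
theorem notMem_singularLocus_iff {W : Type*} {cone : W → Set (ι → ℝ)} {D : Set W}
    (hD : ∀ w ∈ D, IsWallCone (cone w)) {x : ι → ℝ} :
    x ∉ singularLocus cone D ↔ ∀ w ∈ D, x ∈ cone w →
      (∀ᶠ y in 𝓝 x, y ∈ Submodule.span ℝ (cone w) → y ∈ cone w) ∧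
      ∀ w' ∈ D, x ∈ cone w' → Submodule.span ℝ (cone w) = Submodule.span ℝ (cone w') := by
  simp only [singularLocus, Set.mem_ofPred_eq, not_or, not_exists, not_and]
  constructor
  · rintro ⟨h1, h2⟩ w hw hxw
    refine ⟨?_, fun w' hw' hxw' => ?_⟩
    · by_contra hcon
      exact h1 w hw ((mem_intrinsicFrontier_iff (hD w hw).1).2 ⟨hxw, hcon⟩)
    · have hdim := h2 w hw w' hw' ⟨hxw, hxw'⟩
      have hle : Submodule.span ℝ (cone w ∩ cone w') ≤ Submodule.span ℝ (cone w) :=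
        Submodule.span_mono Set.inter_subset_left
      have hle' : Submodule.span ℝ (cone w ∩ cone w') ≤ Submodule.span ℝ (cone w') :=
        Submodule.span_mono Set.inter_subset_right
      have c1 := (hD w hw).2
      have c2 := (hD w' hw').2
      unfold IsCodimOne at c1 c2
      unfold coneDim at c1 c2 hdim
      have f1 := Submodule.finrank_mono hle
      have f2 := Submodule.finrank_mono hle'
      rw [← Submodule.eq_of_le_of_finrank_eq hle (by omega),
        ← Submodule.eq_of_le_of_finrank_eq hle' (by omega)]
  · intro h
    refine ⟨fun w hw hx => ?_, fun w hw w' hw' hx => ?_⟩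
    · obtain ⟨hx1, hx2⟩ := (mem_intrinsicFrontier_iff (hD w hw).1).1 hx
      exact hx2 (h w hw hx1).1
    · intro hdim
      obtain ⟨l1, e⟩ := h w hw hx.1
      have e := e w' hw' hx.2
      have l2 := (h w' hw' hx.2).1
      rw [← e] at l2
      have hle := le_span_of_eventually (d := cone w ∩ cone w') (W := Submodule.span ℝ (cone w))
        (Submodule.subset_span hx.1)
        (by filter_upwards [l1, l2] with y h1 h2 hy using ⟨h1 hy, h2 hy⟩)
      have := Submodule.finrank_mono hle
      have c1 := (hD w hw).2
      unfold IsCodimOne at c1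
      unfold coneDim at c1 hdim
      omega

/-- Near a point outside of the singular locus, a point lies in a wall if and only if it lies in
the hyperplane and the wall passes through the given point. -/
theorem eventually_mem_cone_iff {W : Type*} {cone : W → Set (ι → ℝ)} {D : Set W} (hfin : D.Finite)
    (hD : ∀ w ∈ D, IsWallCone (cone w)) {x : ι → ℝ} (hx : x ∉ singularLocus cone D) :
    ∀ᶠ y in 𝓝 x, ∀ w ∈ D, y ∈ cone w ↔ x ∈ cone w ∧ y ∈ Submodule.span ℝ (cone w) := by
  rw [Set.Finite.eventually_all hfin]
  intro w hw
  by_cases hxw : x ∈ cone w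
  · filter_upwards [((notMem_singularLocus_iff hD).1 hx w hw hxw).1] with y hy
    exact ⟨fun h => ⟨hxw, Submodule.subset_span h⟩, fun h => hy h.2⟩
  · filter_upwards [(isClosed_of_isRationalPolyhedralCone (hD w hw).1).isOpen_compl.mem_nhds hxw]
      with y hy
    exact ⟨fun h => absurd h hy, fun h => absurd h.1 hxw⟩

end Cones
end HDTVCluster

namespace HDTVCluster

/-! ### Sets of codimension two and general position -/

section Generic

open Filter Topology MeasureTheory

variable {ι : Type*} [Fintype ι]

/-- Sets which are contained in a countable union of affine subspaces of codimension at least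
two. -/
def Small (Z : Set (ι → ℝ)) : Prop :=
  ∃ C : Set ((ι → ℝ) × Submodule ℝ (ι → ℝ)), C.Countable ∧
    (∀ p ∈ C, Module.finrank ℝ p.2 + 2 ≤ Fintype.card ι) ∧ ∀ x ∈ Z, ∃ p ∈ C, x - p.1 ∈ p.2

theorem Small.mono {Z Z' : Set (ι → ℝ)} (h : Small Z') (hZ : Z ⊆ Z') : Small Z := by
  obtain ⟨C, h1, h2, h3⟩ := h
  exact ⟨C, h1, h2, fun x hx => h3 x (hZ hx)⟩

theorem Small.iUnion {α : Sort*} [Countable α] {Z : α → Set (ι → ℝ)} (h : ∀ a, Small (Z a)) :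
    Small (⋃ a, Z a) := by
  choose C h1 h2 h3 using h
  refine ⟨⋃ a, C a, Set.countable_iUnion h1, fun p hp => ?_, fun x hx => ?_⟩
  · obtain ⟨a, ha⟩ := Set.mem_iUnion.1 hp
    exact h2 a p ha
  · obtain ⟨a, ha⟩ := Set.mem_iUnion.1 hx
    obtain ⟨p, hp, hxp⟩ := h3 a x ha
    exact ⟨p, Set.mem_iUnion.2 ⟨a, hp⟩, hxp⟩

theorem Small.biUnion {α : Type*} {s : Set α} (hs : s.Countable) {Z : α → Set (ι → ℝ)}
    (h : ∀ a ∈ s, Small (Z a)) : Small (⋃ a ∈ s, Z a) := by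
  have := hs.to_subtype
  rw [Set.biUnion_eq_iUnion]
  exact Small.iUnion fun a => h a.1 a.2

theorem Small.union {Z Z' : Set (ι → ℝ)} (h : Small Z) (h' : Small Z') : Small (Z ∪ Z') := by
  obtain ⟨C, h1, h2, h3⟩ := h
  obtain ⟨C', h1', h2', h3'⟩ := h'
  refine ⟨C ∪ C', h1.union h1', fun p hp => hp.elim (h2 p) (h2' p), fun x hx => ?_⟩
  rcases hx with hx | hx
  · obtain ⟨p, hp, hxp⟩ := h3 x hx
    exact ⟨p, Or.inl hp, hxp⟩
  · obtain ⟨p, hp, hxp⟩ := h3' x hx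
    exact ⟨p, Or.inr hp, hxp⟩

theorem small_empty : Small (∅ : Set (ι → ℝ)) :=
  ⟨∅, Set.countable_empty, fun _ h => absurd h (Set.notMem_empty _),
    fun _ h => absurd h (Set.notMem_empty _)⟩

theorem Small.preimage_add {Z : Set (ι → ℝ)} (h : Small Z) (y : ι → ℝ) :
    Small {x | x + y ∈ Z} := by
  obtain ⟨C, h1, h2, h3⟩ := h
  refine ⟨(fun p => (p.1 - y, p.2)) '' C, h1.image _, ?_, fun x hx => ?_⟩
  · rintro _ ⟨p, hp, rfl⟩
    exact h2 p hp
  · obtain ⟨p, hp, hxp⟩ := h3 _ hx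
    refine ⟨_, ⟨p, hp, rfl⟩, ?_⟩
    convert hxp using 1
    simp only
    abel

theorem small_submodule {W : Submodule ℝ (ι → ℝ)}
    (h : Module.finrank ℝ W + 2 ≤ Fintype.card ι) : Small (W : Set (ι → ℝ)) :=
  ⟨{(0, W)}, Set.countable_singleton _, by simpa using h, fun x hx => ⟨_, rfl, by simpa using hx⟩⟩

theorem pairL_ne_zero {n : ι → ℤ} (hn : n ≠ 0) : pairL n ≠ 0 := fun h0 => by
  have := pair_toReal_self_pos hn
  rw [← pairL_apply, h0] at this
  exact lt_irrefl _ this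

theorem finrank_ker_pairL {n : ι → ℤ} (hn : n ≠ 0) :
    Module.finrank ℝ (LinearMap.ker (pairL n)) + 1 = Fintype.card ι := by
  rw [Module.Dual.finrank_ker_add_one_of_ne_zero (f := pairL n) (pairL_ne_zero hn),
    Module.finrank_fintype_fun_eq_card]

/-- Intersections of nonparallel affine hyperplanes have codimension two. -/
theorem small_inter {n n' : ι → ℤ} (hn : n ≠ 0) {z : ι → ℝ} (hz : pair n z = 0)
    (hz' : pair n' z ≠ 0) (a b : ℝ) : Small {x | pair n x = a ∧ pair n' x = b} := by
  have hlt : LinearMap.ker (pairL n) ⊓ LinearMap.ker (pairL n') < LinearMap.ker (pairL n) := by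
    refine lt_of_le_of_ne inf_le_left fun h => hz' ?_
    have : z ∈ LinearMap.ker (pairL n) := hz
    rw [← h] at this
    exact this.2
  have hfin := Submodule.finrank_lt_finrank_of_lt hlt
  have := finrank_ker_pairL hn
  by_cases hne : ∃ x, pair n x = a ∧ pair n' x = b
  · obtain ⟨x₀, h1, h2⟩ := hne
    refine ⟨{(x₀, LinearMap.ker (pairL n) ⊓ LinearMap.ker (pairL n'))},
      Set.countable_singleton _, ?_, fun x hx => ⟨_, rfl, ?_⟩⟩
    · intro p hp
      rw [Set.mem_singleton_iff.1 hp]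
      simp only
      omega
    · refine ⟨?_, ?_⟩
      · exact (pair_sub n x x₀).trans (by rw [hx.1, h1, sub_self])
      · exact (pair_sub n' x x₀).trans (by rw [hx.2, h2, sub_self])
  · exact small_empty.mono fun x hx => absurd ⟨x, hx⟩ hne

/-- Two primitive vectors which are not equal up to sign have nonparallel hyperplanes. -/
theorem exists_pair_ne_zero {n n' : ι → ℤ} (hn : IsPrimitive n) (hn' : IsPrimitive n')
    (h1 : n' ≠ n) (h2 : n' ≠ -n) : ∃ z, pair n z = 0 ∧ pair n' z ≠ 0 := by
  by_contra hcon
  push Not at hcon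
  rcases hn.eq_or_eq_neg hn' hcon with h | h
  · exact h1 h
  · exact h2 h

/-- The relative boundary of a wall lies in the zero sets, inside of the hyperplane which the wall
spans, of the forms which cut the wall out of this hyperplane. -/
theorem small_singularLocus {W : Type*} {cone : W → Set (ι → ℝ)} {D : Set W} (hc : D.Countable)
    (hD : ∀ w ∈ D, IsWallCone (cone w)) : Small (singularLocus cone D) := by
  have h1 : ∀ w ∈ D, Small (intrinsicFrontier ℝ (cone w)) := by
    intro w hw
    obtain ⟨n, hn⟩ := (hD w hw).exists_normal
    obtain ⟨B, hB, he⟩ := (hD w hw).exists_forms hn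
    have hs : Small (⋃ l ∈ B, {x : ι → ℝ | pair n x = 0 ∧ pair l x = 0}) := by
      refine Small.biUnion B.countable_toSet fun l hl => ?_
      obtain ⟨z, hz, hlz⟩ := hB l hl
      exact small_inter hn.primitive.ne_zero (hn.pair_eq_zero hz) hlz.ne' 0 0
    refine hs.mono fun x hx => ?_
    obtain ⟨hx1, hx2⟩ := (mem_intrinsicFrontier_iff (hD w hw).1).1 hx
    by_contra hcon
    simp only [Set.mem_iUnion, not_exists, Set.mem_ofPred_eq, not_and] at hcon
    have hx3 := hx1
    rw [he] at hx3
    refine hx2 ?_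
    filter_upwards [eventually_forall_pair_pos (B := B) (x := x) fun l hl =>
      lt_of_le_of_ne (hx3.2 l hl) (Ne.symm (hcon l hl hx3.1))] with y hy hys
    rw [he]
    exact ⟨(hn.mem_span_iff y).1 hys, fun l hl => (hy l hl).le⟩
  have h2 : Small (⋃ w ∈ D, ⋃ w' ∈ {w' ∈ D | coneDim (cone w ∩ cone w') + 2 ≤ Fintype.card ι},
      cone w ∩ cone w') := by
    refine Small.biUnion hc fun w hw => Small.biUnion (hc.mono (Set.sep_subset _ _)) ?_
    rintro w' ⟨-, hdim⟩
    exact (small_submodule hdim).mono Submodule.subset_span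
  refine ((Small.biUnion hc h1).union h2).mono ?_
  rintro x (⟨w, hw, hx⟩ | ⟨w, hw, w', hw', hx, hdim⟩)
  · exact Or.inl (Set.mem_biUnion hw hx)
  · exact Or.inr (Set.mem_biUnion hw (Set.mem_biUnion ⟨hw', hdim⟩ hx))

/-- The complement of a set of codimension two is dense in every hyperplane. -/
theorem Small.exists_mem_hyperplane {Z : Set (ι → ℝ)} (hZ : Small Z) {n : ι → ℤ} (hn : n ≠ 0)
    {x : ι → ℝ} {U : Set (ι → ℝ)} (hU : U ∈ 𝓝 x) : ∃ y ∈ U, pair n y = pair n x ∧ y ∉ Z := by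
  obtain ⟨C, h1, h2, h3⟩ := hZ
  let H := LinearMap.ker (pairL n)
  let f : (ι → ℝ) × Submodule ℝ (ι → ℝ) → Set H := fun p => {h | x + h - p.1 ∈ p.2}ᶜ
  have hcont : ∀ p : (ι → ℝ) × Submodule ℝ (ι → ℝ), Continuous fun h : H => x + h - p.1 :=
    fun p => (continuous_const.add continuous_subtype_val).sub continuous_const
  -- by Baire, as an affine subspace of codimension two meets the hyperplane in a proper subspace
  have hdense : Dense (⋂ p ∈ C, f p) := by
    refine dense_biInter_of_isOpen (fun p _ => ?_) h1 fun p hp => ?_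
    · exact ((Submodule.closed_of_finiteDimensional p.2).preimage (hcont p)).isOpen_compl
    · rw [← interior_eq_empty_iff_dense_compl, Set.eq_empty_iff_forall_notMem]
      intro h₀ hh₀
      have hnh := mem_interior_iff_mem_nhds.1 hh₀
      have hmem := mem_of_mem_nhds hnh
      have htop : p.2.comap H.subtype = ⊤ := by
        refine Submodule.eq_top_of_nonempty_interior' _ ⟨0, ?_⟩
        rw [mem_interior_iff_mem_nhds]
        have hc : Continuous fun h : H => h + h₀ := continuous_id.add continuous_const
        have := hc.tendsto 0
        rw [zero_add] at this
        filter_upwards [this.eventually hnh] with h hh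
        have := p.2.sub_mem hh hmem
        simp only [Submodule.coe_add] at this
        change (h : ι → ℝ) ∈ p.2
        convert this using 1
        abel
      have hle : H ≤ p.2 := fun z hz => by
        have : (⟨z, hz⟩ : H) ∈ p.2.comap H.subtype := by rw [htop]; trivial
        exact this
      have := Submodule.finrank_mono hle
      have : Module.finrank ℝ H + 1 = Fintype.card ι := finrank_ker_pairL hn
      have := h2 p hp
      omega
  have hc : Continuous fun h : H => x + (h : ι → ℝ) := continuous_const.add continuous_subtype_val
  have ht := hc.tendsto 0
  rw [Submodule.coe_zero, add_zero] at ht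
  obtain ⟨h, hh, hhU⟩ := hdense.inter_nhds_nonempty (ht hU)
  refine ⟨x + h, hhU, ?_, fun hz => ?_⟩
  · rw [pair_add, show pair n (h : ι → ℝ) = 0 from h.2, add_zero]
  · obtain ⟨p, hp, hxp⟩ := h3 _ hz
    exact (Set.mem_iInter₂.1 hh p hp) hxp

/-- A general translate of a curve avoids a set of codimension two. -/
theorem Small.ae_forall_notMem {Z : Set (ι → ℝ)} (hZ : Small Z) {γ : ℝ → ι → ℝ}
    (hγ : ContDiff ℝ 1 γ) : ∀ᵐ v : ι → ℝ, ∀ t, γ t + v ∉ Z := by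
  obtain ⟨C, h1, h2, h3⟩ := hZ
  have key : ∀ p ∈ C, ∀ᵐ v : ι → ℝ, ∀ t, γ t + v - p.1 ∉ p.2 := by
    intro p hp
    -- the bad translation vectors form the image of a `C¹` map from a space of smaller dimension
    let f : p.2 × ℝ → ι → ℝ := fun q => p.1 + q.1 - γ q.2
    have hf : ContDiff ℝ 1 f :=
      (contDiff_const.add (p.2.subtypeL.contDiff.comp contDiff_fst)).sub (hγ.comp contDiff_snd)
    have hdim := hf.dimH_range_le
    have hlt : dimH (Set.range f) < ((Fintype.card ι : NNReal) : ENNReal) := by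
      refine hdim.trans_lt ?_
      rw [Module.finrank_prod, Module.finrank_self]
      have := h2 p hp
      have h : ((Module.finrank ℝ p.2 + 1 : ℕ) : ENNReal) < (Fintype.card ι : ℕ) := by
        exact_mod_cast (by omega : Module.finrank ℝ p.2 + 1 < Fintype.card ι)
      exact_mod_cast h
    have hnull := hausdorffMeasure_of_dimH_lt hlt
    have hnull : volume (Set.range f) = 0 := by
      rw [← hausdorffMeasure_pi_real]
      exact_mod_cast hnull
    refine measure_mono_null ?_ hnull
    intro v hv
    simp only [Set.mem_compl_iff, Set.mem_ofPred_eq, not_forall, not_not] at hv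
    obtain ⟨t, ht⟩ := hv
    refine ⟨(⟨_, ht⟩, t), ?_⟩
    simp only [f]
    abel
  filter_upwards [(ae_ball_iff h1).2 key] with v hv t ht
  obtain ⟨p, hp, hxp⟩ := h3 _ ht
  exact hv p hp t hxp

/-- A preimage of a null set under a nonzero linear form is a null set. -/
theorem ae_pair_notMem {n : ι → ℤ} (hn : n ≠ 0) {S : Set ℝ} (hS : volume S = 0) :
    ∀ᵐ v : ι → ℝ, pair n v ∉ S := by
  have hsurj : Function.Surjective (pairL n) := LinearMap.surjective (pairL_ne_zero hn)
  obtain ⟨c, -, hc⟩ := LinearMap.exists_map_addHaar_eq_smul_addHaar (pairL n)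
    (volume : Measure (ι → ℝ)) (volume : Measure ℝ) hsurj
  have hle := Measure.le_map_apply (μ := (volume : Measure (ι → ℝ)))
    (continuous_pair n).measurable.aemeasurable S
  change volume (pair n ⁻¹' S) ≤ (Measure.map (pairL n) volume) S at hle
  rw [hc, Measure.smul_apply, hS, smul_zero] at hle
  rw [ae_iff]
  simp only [not_not]
  exact le_antisymm hle zero_le

theorem hasDerivAt_pair {γ : ℝ → ι → ℝ} {γ' : ι → ℝ} {t : ℝ} (h : HasDerivAt γ γ' t) (n : ι → ℤ) :
    HasDerivAt (fun t => pair n (γ t)) (pair n γ') t :=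
  ((pairL n).toContinuousLinearMap.hasFDerivAt.comp_hasDerivAt t h)

theorem hasDerivAt_of_contDiff {γ : ℝ → ι → ℝ} (h : ContDiff ℝ 1 γ) (t : ℝ) :
    HasDerivAt γ (deriv γ t) t :=
  ((h.differentiable one_ne_zero) t).hasDerivAt

/-- A general translate of a curve crosses a hyperplane transversally. -/
theorem ae_forall_pair_deriv_ne_zero {n : ι → ℤ} (hn : n ≠ 0) {γ : ℝ → ι → ℝ}
    (hγ : ContDiff ℝ 1 γ) :
    ∀ᵐ v : ι → ℝ, ∀ t, pair n (γ t + v) = 0 → pair n (deriv γ t) ≠ 0 := by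
  -- the critical values of `pair n ∘ γ`, a set of measure zero by Sard
  let S : Set ℝ := (fun t => -pair n (γ t)) '' {t | pair n (deriv γ t) = 0}
  have hS : volume S = 0 := by
    refine addHaar_image_eq_zero_of_det_fderivWithin_eq_zero
      (f' := fun _ => ContinuousLinearMap.toSpanSingleton ℝ (0 : ℝ)) volume ?_ ?_
    · intro t ht
      have := (hasDerivAt_pair (hasDerivAt_of_contDiff hγ t) n).neg
      rw [show pair n (deriv γ t) = 0 from ht, neg_zero] at this
      exact this.hasFDerivAt.hasFDerivWithinAt
    · intro t _
      simp [ContinuousLinearMap.det]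
  filter_upwards [ae_pair_notMem hn hS] with v hv t ht h0
  refine hv ⟨t, h0, ?_⟩
  rw [pair_add] at ht
  simp only
  linarith

theorem ae_pair_add_ne_zero {n : ι → ℤ} (hn : n ≠ 0) (x : ι → ℝ) :
    ∀ᵐ v : ι → ℝ, pair n (x + v) ≠ 0 := by
  filter_upwards [ae_pair_notMem hn (S := {-pair n x}) (by simp)] with v hv h
  rw [pair_add] at h
  exact hv (by rw [Set.mem_singleton_iff]; linarith)

/-- A general translate of a curve is transversal to a set of walls and avoids a set of
codimension two. -/
theorem ae_isTransversalPath {W : Type*} {cone : W → Set (ι → ℝ)} {D : Set W}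
    (hc : D.Countable) (hD : ∀ w ∈ D, IsWallCone (cone w)) {γ : ℝ → ι → ℝ} (hγ : ContDiff ℝ 1 γ) :
    ∀ᵐ v : ι → ℝ, IsTransversalPath cone D (fun t => γ t + v) := by
  have h1 : ∀ w ∈ D, ∀ᵐ v : ι → ℝ, γ 0 + v ∉ cone w ∧ γ 1 + v ∉ cone w ∧
      ∀ t, γ t + v ∈ cone w → deriv γ t ∉ Submodule.span ℝ (cone w) := by
    intro w hw
    obtain ⟨n, hn⟩ := (hD w hw).exists_normal
    filter_upwards [ae_pair_add_ne_zero hn.primitive.ne_zero (γ 0),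
      ae_pair_add_ne_zero hn.primitive.ne_zero (γ 1),
      ae_forall_pair_deriv_ne_zero hn.primitive.ne_zero hγ] with v h0 h1 h2
    refine ⟨fun h => h0 (hn.pair_eq_zero h), fun h => h1 (hn.pair_eq_zero h), fun t h hs => ?_⟩
    exact h2 t (hn.pair_eq_zero h) ((hn.mem_span_iff _).1 hs)
  filter_upwards [(ae_ball_iff hc).2 h1, (small_singularLocus hc hD).ae_forall_notMem hγ]
    with v hv hZ
  refine ⟨hγ.add contDiff_const, fun t _ => hZ t, fun t ht w hw htw => ⟨?_, ?_⟩⟩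
  · refine ⟨lt_of_le_of_ne ht.1 ?_, lt_of_le_of_ne ht.2 ?_⟩
    · rintro rfl
      exact (hv w hw).1 htw
    · rintro rfl
      exact (hv w hw).2.1 htw
  · rw [deriv_add_const]
    exact (hv w hw).2.2 t htw

/-- Vectors in general position can be chosen arbitrarily small. -/
theorem exists_of_ae_of_eventually {P Q : (ι → ℝ) → Prop} {x : ι → ℝ} (hP : ∀ᵐ v, P v)
    (hQ : ∀ᶠ v in 𝓝 x, Q v) : ∃ v, P v ∧ Q v := by
  obtain ⟨v, hv, hv'⟩ := (Measure.dense_of_ae hP).inter_nhds_nonempty hQ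
  exact ⟨v, hv, hv'⟩

end Generic
end HDTVCluster

namespace HDTVCluster

/-! ### Path ordered products -/

section Paths

open Filter Topology

variable {ι : Type*} [Fintype ι]

/-- At an accumulation point of the times when a path lies in a wall, its velocity would be tangent
to the wall. -/
theorem IsTransversalPath.finite_crossings {W : Type*} {cone : W → Set (ι → ℝ)} {D : Set W}
    {γ : ℝ → ι → ℝ} (hfin : D.Finite) (hD : ∀ w ∈ D, IsWallCone (cone w))
    (hγ : IsTransversalPath cone D γ) :
    {c : ℝ × W | c.1 ∈ Set.Icc (0 : ℝ) 1 ∧ c.2 ∈ D ∧ γ c.1 ∈ cone c.2}.Finite := by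
  have h1 : ∀ w ∈ D, {t | t ∈ Set.Icc (0 : ℝ) 1 ∧ γ t ∈ cone w}.Finite := by
    intro w hw
    obtain ⟨n, hn⟩ := (hD w hw).exists_normal
    by_contra hinf
    obtain ⟨t, ht, hacc⟩ := Set.Infinite.exists_accPt_of_subset_isCompact hinf isCompact_Icc
      (fun t ht => ht.1)
    have hcl : IsClosed {t | t ∈ Set.Icc (0 : ℝ) 1 ∧ γ t ∈ cone w} :=
      isClosed_Icc.inter ((isClosed_of_isRationalPolyhedralCone (hD w hw).1).preimage
        hγ.contDiff.continuous)
    have htw : γ t ∈ cone w := (isClosed_iff_clusterPt.1 hcl t hacc.clusterPt).2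
    have hne : pair n (deriv γ t) ≠ 0 := fun h0 =>
      (hγ.crosses t ht w hw htw).2 ((hn.mem_span_iff _).2 h0)
    have hev := (hasDerivAt_pair (hasDerivAt_of_contDiff hγ.contDiff t) n).eventually_ne
      (c := 0) hne
    have hfreq := accPt_iff_frequently_nhdsNE.1 hacc
    obtain ⟨s, hs, hs'⟩ := (hfreq.and_eventually hev).exists
    exact hs' (hn.pair_eq_zero hs.2)
  refine (hfin.biUnion fun w hw => (h1 w hw).image fun t => (t, w)).subset ?_
  rintro ⟨t, w⟩ ⟨h, hw, htw⟩
  exact Set.mem_biUnion hw ⟨t, ⟨h, htw⟩, rfl⟩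

theorem IsTransversalPath.exists_crossingList {W : Type*} {cone : W → Set (ι → ℝ)} {D : Set W}
    {γ : ℝ → ι → ℝ} (hfin : D.Finite) (hD : ∀ w ∈ D, IsWallCone (cone w))
    (hγ : IsTransversalPath cone D γ) : ∃ L, IsCrossingList cone D γ L := by
  classical
  have hf := hγ.finite_crossings hfin hD
  have : Std.Total fun a b : ℝ × W => a.1 ≤ b.1 := ⟨fun a b => le_total a.1 b.1⟩
  have : IsTrans (ℝ × W) fun a b => a.1 ≤ b.1 := ⟨fun a b c => le_trans⟩
  have hp := List.perm_insertionSort (fun a b : ℝ × W => a.1 ≤ b.1) hf.toFinset.toList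
  refine ⟨hf.toFinset.toList.insertionSort fun a b => a.1 ≤ b.1, ?_, ?_, fun c => ?_⟩
  · exact hp.nodup_iff.2 (Finset.nodup_toList _)
  · exact List.pairwise_insertionSort _ _
  · rw [hp.mem_iff, Finset.mem_toList, Set.Finite.mem_toFinset]
    rfl

/-- Two walls through a point of a transversal path span the same hyperplane. -/
theorem IsTransversalPath.span_eq {W : Type*} {cone : W → Set (ι → ℝ)} {D : Set W}
    {γ : ℝ → ι → ℝ} (hD : ∀ w ∈ D, IsWallCone (cone w))
    (hγ : IsTransversalPath cone D γ) {t : ℝ} (ht : t ∈ Set.Icc (0 : ℝ) 1) {w w' : W}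
    (hw : w ∈ D) (hw' : w' ∈ D) (h : γ t ∈ cone w) (h' : γ t ∈ cone w') :
    Submodule.span ℝ (cone w) = Submodule.span ℝ (cone w') :=
  ((notMem_singularLocus_iff hD).1 (hγ.avoids t ht) w hw h).2 w' hw' h'

/-- At a crossing of a transversal path, there is a normal vector which is negative on the
velocity. -/
theorem IsTransversalPath.exists_normal {W : Type*} {cone : W → Set (ι → ℝ)} {D : Set W}
    {γ : ℝ → ι → ℝ} (hD : ∀ w ∈ D, IsWallCone (cone w))
    (hγ : IsTransversalPath cone D γ) {t : ℝ} (ht : t ∈ Set.Icc (0 : ℝ) 1) {w : W}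
    (hw : w ∈ D) (h : γ t ∈ cone w) :
    ∃ n, HasNormal (cone w) n ∧ pair n (deriv γ t) < 0 := by
  obtain ⟨n, hn⟩ := (hD w hw).exists_normal
  have hne : pair n (deriv γ t) ≠ 0 := fun h0 =>
    (hγ.crosses t ht w hw h).2 ((hn.mem_span_iff _).2 h0)
  rcases lt_or_gt_of_ne hne with hlt | hgt
  · exact ⟨n, hn, hlt⟩
  · exact ⟨-n, hn.neg, by rw [neg_pair]; linarith⟩

theorem HasNormal.of_span_eq {d d' : Set (ι → ℝ)} {n : ι → ℤ} (h : HasNormal d n)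
    (e : Submodule.span ℝ d = Submodule.span ℝ d') : HasNormal d' n :=
  ⟨h.primitive, fun x => by rw [← e, h.mem_span_iff]⟩

variable {k I : Type*} [Field k]

open MvPowerSeries

theorem IsWall.isWallCone {w : Wall k I ι} (hw : IsWall w) : IsWallCone w.cone :=
  ⟨hw.rational, hw.codim_one⟩

theorem IsWall.suppIn {w : Wall k I ι} (hw : IsWall w) {n : ι → ℤ} (hn : HasNormal w.cone n) :
    SuppIn (perpSupp I n) w.func := by
  classical
  intro β m hm
  rw [mem_perpSupp]
  by_cases hβ : β = 0
  · rw [hβ, hw.coeff_zero, AddMonoidAlgebra.one_def, AddMonoidAlgebra.coeff_single,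
      Finsupp.single_apply] at hm
    split_ifs at hm with h
    · simp [← h]
    · exact absurd rfl hm
  · obtain ⟨r, -, hr⟩ := hw.coeff_ne_zero β hβ m hm
    have h := (hn.mem_span_iff _).1 hw.dir_tangent
    rw [pair_toReal] at h
    have h : dotProduct n w.dir = 0 := by exact_mod_cast h
    rw [hr, dotProduct_neg, dotProduct_smul, h, smul_zero, neg_zero]

/-- The product of the functions of the walls of a finite set `D` which contain `x`. -/
noncomputable def prodAt (D : Set (Wall k I ι)) (x : ι → ℝ) :
    MvPowerSeries I (AddMonoidAlgebra k (ι → ℤ)) :=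
  ∏ᶠ w ∈ {w ∈ D | x ∈ w.cone}, w.func

theorem coeff_zero_prodAt {D : Set (Wall k I ι)} (hD : ∀ w ∈ D, IsWall w) (x : ι → ℝ) :
    coeff 0 (prodAt D x) = 1 := by
  refine finprod_mem_induction (fun f => coeff 0 f = 1) (by simp) ?_ ?_
  · intro f g hf hg
    rw [coeff_zero_mul, hf, hg, one_mul]
  · exact fun w hw => (hD w hw.1).coeff_zero

theorem prodAt_of_forall_notMem {D : Set (Wall k I ι)} {x : ι → ℝ} (h : ∀ w ∈ D, x ∉ w.cone) :
    prodAt D x = 1 := by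
  have : {w ∈ D | x ∈ w.cone} = ∅ := Set.eq_empty_iff_forall_notMem.2 fun w hw => h w hw.1 hw.2
  rw [prodAt, this, finprod_mem_empty]

theorem prodAt_congr {D : Set (Wall k I ι)} {x y : ι → ℝ}
    (h : ∀ w ∈ D, x ∈ w.cone ↔ y ∈ w.cone) : prodAt D x = prodAt D y := by
  have : {w ∈ D | x ∈ w.cone} = {w ∈ D | y ∈ w.cone} := by
    ext w
    exact and_congr_right fun hw => h w hw
  rw [prodAt, prodAt, this]

theorem eq_filter_append_filter {α : Type*} (key : α → ℝ) (t : ℝ) (L : List α)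
    (hs : L.Pairwise fun a b => key a ≤ key b) (ht : ∀ a ∈ L, t ≤ key a) :
    L = L.filter (fun a => key a = t) ++ L.filter (fun a => key a ≠ t) := by
  induction L with
  | nil => rfl
  | cons a L ih =>
    rw [List.pairwise_cons] at hs
    simp only [List.forall_mem_cons] at ht
    by_cases ha : key a = t
    · rw [List.filter_cons_of_pos (by simpa using ha), List.filter_cons_of_neg (by simpa using ha),
        List.cons_append, ← ih hs.2 ht.2]
    · have h1 : ∀ b ∈ a :: L, key b ≠ t := by
        intro b hb h
        rcases List.mem_cons.1 hb with rfl | hb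
        · exact ha h
        · exact ha (le_antisymm (h ▸ hs.1 b hb) ht.1)
      rw [List.filter_eq_nil_iff.2 (by simpa using h1), List.nil_append,
        List.filter_eq_self.2 (by simpa using h1)]

variable [Finite I]

/-- Simultaneous crossings of walls in the same hyperplane. -/
theorem pathProduct_block (γ : ℝ → ι → ℝ) (n : ι → ℤ) (B : List (ℝ × Wall k I ι))
    (hB : ∀ c ∈ B, coeff 0 c.2.func = 1 ∧ SuppIn (perpSupp I n) c.2.func ∧
      signedNormal c.2.cone (deriv γ c.1) = n)
    (g : MvPowerSeries I (AddMonoidAlgebra k (ι → ℤ))) :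
    coeff 0 (B.map fun c => c.2.func).prod = 1 ∧
      pathProduct γ B g = wallCrossing (B.map fun c => c.2.func).prod n g := by
  induction B generalizing g with
  | nil => exact ⟨by simp, (wallCrossing_one n g).symm⟩
  | cons c B ih =>
    simp only [List.forall_mem_cons] at hB
    obtain ⟨⟨h1, h2, h3⟩, hB⟩ := hB
    have ih := ih hB
    refine ⟨by rw [List.map_cons, List.prod_cons, coeff_zero_mul, h1, (ih g).1, one_mul], ?_⟩
    rw [List.map_cons, List.prod_cons, ← wallCrossing_wallCrossing (ih g).1 h1 h2, ← (ih _).2,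
      pathProduct, List.foldl_cons, h3]
    rfl

/-- A path ordered product, as a product over the times of crossing. -/
theorem pathProduct_eq_crossFold {D : Set (Wall k I ι)} (hD : ∀ w ∈ D, IsWall w)
    {γ : ℝ → ι → ℝ} {n : ℝ → ι → ℤ} (ts : List ℝ) (hts : ts.Pairwise (· < ·))
    (h01 : ∀ t ∈ ts, t ∈ Set.Icc (0 : ℝ) 1)
    (hn : ∀ t ∈ ts, ∀ w ∈ D, γ t ∈ w.cone → HasNormal w.cone (n t) ∧ pair (n t) (deriv γ t) < 0)
    {L : List (ℝ × Wall k I ι)} (hL : IsCrossingList Wall.cone D γ L)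
    (hLt : ∀ t ∈ Set.Icc (0 : ℝ) 1, ∀ w ∈ D, γ t ∈ w.cone → t ∈ ts)
    (g : MvPowerSeries I (AddMonoidAlgebra k (ι → ℤ))) :
    pathProduct γ L g = crossFold (fun t => prodAt D (γ t)) n ts g := by
  classical
  obtain ⟨hnd, hsort, hmem⟩ := hL
  replace hLt : ∀ c ∈ L, c.1 ∈ ts := fun c hc =>
    hLt c.1 ((hmem c).1 hc).1 c.2 ((hmem c).1 hc).2.1 ((hmem c).1 hc).2.2
  replace hmem : ∀ c : ℝ × Wall k I ι, c.1 ∈ ts → (c ∈ L ↔ c.2 ∈ D ∧ γ c.1 ∈ c.2.cone) :=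
    fun c hc => (hmem c).trans (by simp only [h01 _ hc, true_and])
  clear h01
  induction ts generalizing L g with
  | nil =>
    have : L = [] := List.eq_nil_iff_forall_not_mem.2 fun c hc => by simpa using hLt c hc
    rw [this]; rfl
  | cons t ts ih =>
    rw [List.pairwise_cons] at hts
    have hle : ∀ c ∈ L, t ≤ c.1 := fun c hc => by
      rcases List.mem_cons.1 (hLt c hc) with h | h
      · exact h.ge
      · exact (hts.1 _ h).le
    -- split off the crossings at the first time `t`, which all take place in one hyperplane
    have hsplit := eq_filter_append_filter Prod.fst t L hsort hle
    set B := L.filter fun a => a.1 = t with hBdef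
    set L' := L.filter fun a => a.1 ≠ t with hLdef
    have hB1 : ∀ c ∈ B, c ∈ L ∧ c.1 = t := fun c hc => by simpa [hBdef] using hc
    have hBmem : ∀ c ∈ B, c.2 ∈ D ∧ γ t ∈ c.2.cone := fun c hc => by
      obtain ⟨h1, h2⟩ := hB1 c hc
      have := (hmem c (by rw [h2]; exact List.mem_cons_self)).1 h1
      rwa [h2] at this
    have hblock := pathProduct_block γ (n t) B (fun c hc => by
      obtain ⟨h1, h2⟩ := hBmem c hc
      have hn' := hn t List.mem_cons_self c.2 h1 h2
      refine ⟨(hD _ h1).coeff_zero, (hD _ h1).suppIn hn'.1, ?_⟩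
      rw [(hB1 c hc).2]
      exact hn'.1.signedNormal_eq hn'.2) g
    have hprod : (B.map fun c => c.2.func).prod = prodAt D (γ t) := by
      have hndB : (B.map Prod.snd).Nodup := by
        refine List.Nodup.map_on ?_ (hnd.filter _)
        intro x hx y hy hxy
        exact Prod.ext ((hB1 x hx).2.trans (hB1 y hy).2.symm) hxy
      have hset : {w ∈ D | γ t ∈ w.cone} = ((B.map Prod.snd).toFinset : Set (Wall k I ι)) := by
        ext w
        simp only [Set.mem_ofPred_eq, Finset.mem_coe, List.mem_toFinset, List.mem_map]
        constructor
        · intro hw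
          refine ⟨(t, w), ?_, rfl⟩
          have := (hmem (t, w) List.mem_cons_self).2 hw
          simpa [hBdef] using this
        · rintro ⟨c, hc, rfl⟩
          exact hBmem c hc
      rw [prodAt, hset, finprod_mem_coe_finset, List.prod_toFinset _ hndB, List.map_map]
      rfl
    have hih := ih hts.2 (fun t' ht' => hn t' (List.mem_cons_of_mem _ ht')) (L := L')
      (wallCrossing (prodAt D (γ t)) (n t) g) (hnd.filter _) (hsort.filter _) (fun c hc => by
        obtain ⟨h1, h2⟩ : c ∈ L ∧ c.1 ≠ t := by simpa [hLdef] using hc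
        exact (List.mem_cons.1 (hLt c h1)).resolve_left h2) (fun c hc => by
        rw [← hmem c (List.mem_cons_of_mem _ hc)]
        have : c.1 ≠ t := fun h => lt_irrefl t (hts.1 t (h ▸ hc))
        simp [hLdef, this])
    rw [hsplit, pathProduct, List.foldl_append]
    change pathProduct γ L' (pathProduct γ B g) = _
    rw [hblock.2, hprod, hih]
    rfl

/-- The finite set of the times when a transversal path crosses a wall. -/
theorem exists_crossing_times {W : Type*} {cone : W → Set (ι → ℝ)} {D : Set W}
    {γ : ℝ → ι → ℝ} (hfin : D.Finite) (hD : ∀ w ∈ D, IsWallCone (cone w))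
    (hγ : IsTransversalPath cone D γ) :
    ∃ ts : Finset ℝ, ∀ t, t ∈ ts ↔ t ∈ Set.Icc (0 : ℝ) 1 ∧ ∃ w ∈ D, γ t ∈ cone w := by
  have hf := (hγ.finite_crossings hfin hD).image Prod.fst
  refine ⟨hf.toFinset, fun t => ?_⟩
  rw [Set.Finite.mem_toFinset]
  constructor
  · rintro ⟨c, hc, rfl⟩
    exact ⟨hc.1, c.2, hc.2⟩
  · rintro ⟨h, w, hw⟩
    exact ⟨(t, w), ⟨h, hw⟩, rfl⟩

end Paths
end HDTVCluster

namespace HDTVCluster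

/-! ### Small translations of paths -/

section Perturbation

open Filter Topology MvPowerSeries

variable {k I ι : Type*} [Field k] [Fintype ι]

theorem crossFold_map {f f' : ℝ → MvPowerSeries I (AddMonoidAlgebra k (ι → ℤ))}
    {n n' : ℝ → ι → ℤ} (τ : ℝ → ℝ) (ts : List ℝ) (hf : ∀ t ∈ ts, f' (τ t) = f t)
    (hn : ∀ t ∈ ts, n' (τ t) = n t) (g : MvPowerSeries I (AddMonoidAlgebra k (ι → ℤ))) :
    crossFold f' n' (ts.map τ) g = crossFold f n ts g := by
  rw [crossFold, crossFold, List.foldl_map]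
  refine List.foldl_ext _ _ _ fun g t ht => ?_
  rw [hf t ht, hn t ht]

/-- A simultaneous choice of the normal vectors at all crossings. -/
theorem IsTransversalPath.exists_normals {W : Type*} {cone : W → Set (ι → ℝ)} {D : Set W}
    {γ : ℝ → ι → ℝ} (hD : ∀ w ∈ D, IsWallCone (cone w)) (hγ : IsTransversalPath cone D γ) :
    ∃ n : ℝ → ι → ℤ, ∀ t ∈ Set.Icc (0 : ℝ) 1, ∀ w ∈ D, γ t ∈ cone w →
      HasNormal (cone w) (n t) ∧ pair (n t) (deriv γ t) < 0 := by
  have : ∀ t : ℝ, ∃ n : ι → ℤ, t ∈ Set.Icc (0 : ℝ) 1 → ∀ w ∈ D, γ t ∈ cone w →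
      HasNormal (cone w) n ∧ pair n (deriv γ t) < 0 := by
    intro t
    by_cases h : t ∈ Set.Icc (0 : ℝ) 1 ∧ ∃ w ∈ D, γ t ∈ cone w
    · obtain ⟨ht, w, hw, htw⟩ := h
      obtain ⟨n, hn, hneg⟩ := hγ.exists_normal hD ht hw htw
      exact ⟨n, fun _ w' hw' htw' => ⟨hn.of_span_eq (hγ.span_eq hD ht hw hw' htw htw'), hneg⟩⟩
    · exact ⟨0, fun ht w hw htw => absurd ⟨ht, w, hw, htw⟩ h⟩
  choose n hn using this
  exact ⟨n, hn⟩

/-- Near the time of a crossing, the translated paths meet the same walls, at the unique time when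
they cross the hyperplane. -/
theorem IsTransversalPath.eventually_near_crossing {W : Type*} {cone : W → Set (ι → ℝ)} {D : Set W}
    {γ : ℝ → ι → ℝ} (hfin : D.Finite) (hD : ∀ w ∈ D, IsWallCone (cone w))
    (hγ : IsTransversalPath cone D γ) {t : ℝ} (ht : t ∈ Set.Ioo (0 : ℝ) 1) {n : ι → ℤ}
    (hn : pair n (deriv γ t) < 0) :
    ∀ᶠ ε in 𝓝[>] (0 : ℝ), ∀ᶠ v in 𝓝 (0 : ι → ℝ), ∀ s ∈ Set.Icc (t - ε) (t + ε),
      (∀ w ∈ D, γ s + v ∈ cone w ↔ γ t ∈ cone w ∧ γ s + v ∈ Submodule.span ℝ (cone w)) ∧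
      pair n (deriv γ s) < 0 ∧ s ∈ Set.Ioo (0 : ℝ) 1 := by
  have hc := hγ.contDiff.continuous
  have ht' : t ∈ Set.Icc (0 : ℝ) 1 := Set.Ioo_subset_Icc_self ht
  have h1 : Tendsto (fun p : ℝ × (ι → ℝ) => γ p.1 + p.2) (𝓝 t ×ˢ 𝓝 0) (𝓝 (γ t)) := by
    have hcont : Continuous fun p : ℝ × (ι → ℝ) => γ p.1 + p.2 := by fun_prop
    have h := hcont.tendsto (t, (0 : ι → ℝ))
    rw [nhds_prod_eq] at h
    simpa only [add_zero] using h
  have h2 := h1.eventually (eventually_mem_cone_iff hfin hD (hγ.avoids t ht'))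
  have h3 : ∀ᶠ s in 𝓝 t, pair n (deriv γ s) < 0 :=
    (((continuous_pair n).comp (hγ.contDiff.continuous_deriv le_rfl)).tendsto t).eventually_lt_const
      hn
  have h4 : ∀ᶠ s in 𝓝 t, s ∈ Set.Ioo (0 : ℝ) 1 := isOpen_Ioo.mem_nhds ht
  have h5 := h2.and (tendsto_fst.eventually (h3.and h4))
  obtain ⟨pa, ha, pb, hb, hab⟩ := eventually_prod_iff.1 h5
  obtain ⟨δ, hδ, hball⟩ := Metric.eventually_nhds_iff.1 ha
  filter_upwards [Ioo_mem_nhdsGT hδ] with ε hε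
  filter_upwards [hb] with v hv s hs
  refine hab (hball ?_) hv
  rw [Real.dist_eq, abs_lt]
  constructor <;> linarith [hs.1, hs.2, hε.2]

theorem exists_unique_zero {φ φ' : ℝ → ℝ} {a b : ℝ} (hab : a ≤ b)
    (h : ∀ s, HasDerivAt φ (φ' s) s) (hneg : ∀ s ∈ Set.Icc a b, φ' s < 0)
    (ha : 0 < φ a) (hb : φ b < 0) :
    ∃ t ∈ Set.Ioo a b, φ t = 0 ∧ ∀ s ∈ Set.Icc a b, φ s = 0 → s = t := by
  have hcont : ContinuousOn φ (Set.Icc a b) := fun s _ => (h s).continuousAt.continuousWithinAt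
  have hanti : StrictAntiOn φ (Set.Icc a b) := by
    refine strictAntiOn_of_deriv_neg (convex_Icc a b) hcont fun s hs => ?_
    rw [(h s).deriv]
    exact hneg s (interior_subset hs)
  obtain ⟨t, ht, h0⟩ := intermediate_value_Icc' hab hcont ⟨hb.le, ha.le⟩
  refine ⟨t, ⟨lt_of_le_of_ne ht.1 ?_, lt_of_le_of_ne ht.2 ?_⟩, h0, fun s hs hs0 =>
    hanti.injOn hs ht (hs0.trans h0.symm)⟩
  · rintro rfl; exact ha.ne' h0
  · rintro rfl; exact hb.ne h0

/-- Path ordered products do not change under small translations of the path. -/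
theorem IsTransversalPath.eventually_pathProduct_add [Finite I] {D : Set (Wall k I ι)}
    (hfin : D.Finite) (hD : ∀ w ∈ D, IsWall w) {γ : ℝ → ι → ℝ}
    (hγ : IsTransversalPath Wall.cone D γ) :
    ∀ᶠ v in 𝓝 (0 : ι → ℝ), ∀ L L', IsCrossingList Wall.cone D γ L →
      IsCrossingList Wall.cone D (fun t => γ t + v) L' →
      ∀ g, pathProduct γ L g = pathProduct (fun t => γ t + v) L' g := by
  classical
  have hDc : ∀ w ∈ D, IsWallCone w.cone := fun w hw => (hD w hw).isWallCone
  -- `Θ` is the set of times of crossing, with normal vectors `n t`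
  obtain ⟨Θ, hΘ⟩ := exists_crossing_times hfin hDc hγ
  obtain ⟨n, hn⟩ := hγ.exists_normals hDc
  have hcross : ∀ t ∈ Θ, t ∈ Set.Ioo (0 : ℝ) 1 ∧ pair (n t) (γ t) = 0 ∧
      pair (n t) (deriv γ t) < 0 := by
    intro t ht
    obtain ⟨h1, w, hw, htw⟩ := (hΘ t).1 ht
    have := hn t h1 w hw htw
    exact ⟨(hγ.crosses t h1 w hw htw).1, this.1.pair_eq_zero htw, this.2⟩
  -- `ε` is so small that the intervals of radius `ε` around the times of crossing are disjoint, and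
  -- that in each of them only the hyperplane at stake matters
  have hε1 : ∀ᶠ ε in 𝓝[>] (0 : ℝ), ∀ t ∈ Θ, ∀ᶠ v in 𝓝 (0 : ι → ℝ),
      ∀ s ∈ Set.Icc (t - ε) (t + ε),
      (∀ w ∈ D, γ s + v ∈ w.cone ↔ γ t ∈ w.cone ∧ γ s + v ∈ Submodule.span ℝ w.cone) ∧
      pair (n t) (deriv γ s) < 0 ∧ s ∈ Set.Ioo (0 : ℝ) 1 :=
    (eventually_all_finset Θ).2 fun t ht =>
      hγ.eventually_near_crossing hfin hDc (hcross t ht).1 (hcross t ht).2.2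
  have hε2 : ∀ᶠ ε in 𝓝[>] (0 : ℝ), ∀ t ∈ Θ, ∀ t' ∈ Θ, t < t' → t + ε < t' - ε := by
    refine (eventually_all_finset Θ).2 fun t _ => (eventually_all_finset Θ).2 fun t' _ => ?_
    by_cases h : t < t'
    · filter_upwards [Ioo_mem_nhdsGT (show (0 : ℝ) < (t' - t) / 2 by linarith)] with ε hε _
      linarith [hε.2]
    · exact Eventually.of_forall fun ε h' => absurd h' h
  obtain ⟨ε, ⟨hnear, hgap⟩, hε⟩ :=
    ((hε1.and hε2).and (eventually_mem_nhdsWithin (s := Set.Ioi (0 : ℝ)))).exists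
  replace hε : 0 < ε := hε
  rw [← eventually_all_finset] at hnear
  have hder : ∀ t ∈ Θ, ∀ s ∈ Set.Icc (t - ε) (t + ε), pair (n t) (deriv γ s) < 0 :=
    fun t ht s hs => (hnear.self_of_nhds t ht s hs).2.1
  have hφ : ∀ t s v, HasDerivAt (fun s => pair (n t) (γ s + v)) (pair (n t) (deriv γ s)) s :=
    fun t s v => hasDerivAt_pair ((hasDerivAt_of_contDiff hγ.contDiff s).add_const v) _
  -- a translated path is still on the original side of the hyperplane at the ends of the interval
  have hends : ∀ᶠ v in 𝓝 (0 : ι → ℝ), ∀ t ∈ Θ,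
      0 < pair (n t) (γ (t - ε) + v) ∧ pair (n t) (γ (t + ε) + v) < 0 := by
    refine (eventually_all_finset Θ).2 fun t ht => ?_
    have hanti : StrictAntiOn (fun s => pair (n t) (γ s + 0)) (Set.Icc (t - ε) (t + ε)) := by
      refine strictAntiOn_of_deriv_neg (convex_Icc _ _)
        (fun s _ => (hφ t s 0).continuousAt.continuousWithinAt) fun s hs => ?_
      rw [(hφ t s 0).deriv]
      exact hder t ht s (interior_subset hs)
    have h0 : pair (n t) (γ t + 0) = 0 := by rw [add_zero]; exact (hcross t ht).2.1
    have hm : t ∈ Set.Icc (t - ε) (t + ε) := ⟨by linarith, by linarith⟩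
    have h1 := hanti (Set.left_mem_Icc.2 (by linarith)) hm (show t - ε < t by linarith)
    have h2 := hanti hm (Set.right_mem_Icc.2 (by linarith)) (show t < t + ε by linarith)
    simp only [h0] at h1 h2
    have hc : ∀ x : ι → ℝ, Tendsto (fun v => pair (n t) (x + v)) (𝓝 0) (𝓝 (pair (n t) (x + 0))) :=
      fun x => ((continuous_pair (n t)).comp (continuous_const.add continuous_id)).tendsto 0
    exact ((hc _).eventually_const_lt h1).and ((hc _).eventually_lt_const h2)
  -- away from the intervals there are no crossings, by compactness
  have hK : IsCompact (Set.Icc (0 : ℝ) 1 \ ⋃ t ∈ Θ, Set.Ioo (t - ε) (t + ε)) :=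
    isCompact_Icc.diff (isOpen_biUnion fun t _ => isOpen_Ioo)
  have hout : ∀ᶠ v in 𝓝 (0 : ι → ℝ),
      ∀ s ∈ Set.Icc (0 : ℝ) 1 \ ⋃ t ∈ Θ, Set.Ioo (t - ε) (t + ε), ∀ w ∈ D, γ s + v ∉ w.cone := by
    refine hK.eventually_forall_of_forall_eventually fun s hs => ?_
    have hs' : ∀ w ∈ D, γ s ∉ w.cone := by
      intro w hw hsw
      have : s ∈ Θ := (hΘ s).2 ⟨hs.1, w, hw, hsw⟩
      exact hs.2 (Set.mem_biUnion this ⟨by linarith, by linarith⟩)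
    have h1 : Tendsto (fun p : (ι → ℝ) × ℝ => γ p.2 + p.1) (𝓝 (0, s)) (𝓝 (γ s)) := by
      have hc := hγ.contDiff.continuous
      have hcont : Continuous fun p : (ι → ℝ) × ℝ => γ p.2 + p.1 := by fun_prop
      simpa only [add_zero] using hcont.tendsto ((0 : ι → ℝ), s)
    filter_upwards [h1.eventually (eventually_mem_cone_iff hfin hDc (hγ.avoids s hs.1))]
      with p hp w hw hpw
    exact hs' w hw ((hp w hw).1 hpw).1
  filter_upwards [hnear, hends, hout] with v hnear hends hout L L' hL hL' g
  -- `τ t` is the time when the translated path crosses the hyperplane which `γ` crosses at time `t`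
  have hτ : ∀ t : ℝ, ∃ τ : ℝ, t ∈ Θ → τ ∈ Set.Ioo (t - ε) (t + ε) ∧ pair (n t) (γ τ + v) = 0 ∧
      ∀ s ∈ Set.Icc (t - ε) (t + ε), pair (n t) (γ s + v) = 0 → s = τ := by
    intro t
    by_cases ht : t ∈ Θ
    · obtain ⟨τ, h1, h2⟩ := exists_unique_zero (by linarith) (fun s => hφ t s v) (hder t ht)
        (hends t ht).1 (hends t ht).2
      exact ⟨τ, fun _ => ⟨h1, h2⟩⟩
    · exact ⟨0, fun h => absurd h ht⟩
  choose τ hτ using hτ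
  have hmono : ∀ t ∈ Θ, ∀ t' ∈ Θ, t < t' → τ t < τ t' := fun t ht t' ht' h => by
    linarith [hgap t ht t' ht' h, (hτ t ht).1.2, (hτ t' ht').1.1]
  have hinj : Set.InjOn τ Θ := by
    intro t ht t' ht' h
    rcases lt_trichotomy t t' with h' | h' | h'
    · exact absurd h (hmono t ht t' ht' h').ne
    · exact h'
    · exact absurd h.symm (hmono t' ht' t ht h').ne
  have hiff : ∀ t ∈ Θ, ∀ w ∈ D, γ (τ t) + v ∈ w.cone ↔ γ t ∈ w.cone := by
    intro t ht w hw
    rw [(hnear t ht (τ t) (Set.Ioo_subset_Icc_self (hτ t ht).1)).1 w hw]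
    refine and_iff_left_of_imp fun h => ?_
    exact ((hn t ((hΘ t).1 ht).1 w hw h).1.mem_span_iff _).2 (hτ t ht).2.1
  have hinv : ∀ t ∈ Θ, Function.invFunOn τ Θ (τ t) = t := fun t ht => hinj.leftInvOn_invFunOn ht
  set ts := Θ.sort (· ≤ ·) with hts
  have hmem : ∀ t, t ∈ ts ↔ t ∈ Θ := fun t => Finset.mem_sort _
  have hsorted : ts.Pairwise (· < ·) := (Finset.sortedLT_sort Θ).pairwise
  -- both path ordered products are the same product over the times of crossing
  have e1 := pathProduct_eq_crossFold hD (n := n) ts hsorted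
    (fun t ht => ((hΘ t).1 ((hmem t).1 ht)).1)
    (fun t ht => hn t ((hΘ t).1 ((hmem t).1 ht)).1) hL
    (fun t ht w hw htw => (hmem t).2 ((hΘ t).2 ⟨ht, w, hw, htw⟩)) g
  have hderiv : ∀ s, deriv (fun s => γ s + v) s = deriv γ s := fun s => by
    rw [deriv_add_const]
  have e2 := pathProduct_eq_crossFold hD (γ := fun s => γ s + v)
    (n := fun s => n (Function.invFunOn τ Θ s)) (ts.map τ)
    (List.pairwise_map.2 (hsorted.imp_of_mem fun ha hb h =>
      hmono _ ((hmem _).1 ha) _ ((hmem _).1 hb) h))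
    (by
      intro s hs
      obtain ⟨t, ht, rfl⟩ := List.mem_map.1 hs
      have ht := (hmem t).1 ht
      exact Set.Ioo_subset_Icc_self
        (hnear t ht _ (Set.Ioo_subset_Icc_self (hτ t ht).1)).2.2)
    (by
      intro s hs w hw hsw
      obtain ⟨t, ht, rfl⟩ := List.mem_map.1 hs
      have ht := (hmem t).1 ht
      rw [hderiv, hinv t ht]
      exact ⟨(hn t ((hΘ t).1 ht).1 w hw ((hiff t ht w hw).1 hsw)).1,
        hder t ht _ (Set.Ioo_subset_Icc_self (hτ t ht).1)⟩)
    hL'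
    (by
      intro s hs w hw hsw
      by_contra hsts
      refine hout s ⟨hs, fun hU => ?_⟩ w hw hsw
      obtain ⟨t, ht, hst⟩ := Set.mem_iUnion₂.1 hU
      have h1 := ((hnear t ht s (Set.Ioo_subset_Icc_self hst)).1 w hw).1 hsw
      have h2 := ((hn t ((hΘ t).1 ht).1 w hw h1.1).1.mem_span_iff _).1 h1.2
      have h3 := (hτ t ht).2.2 s (Set.Ioo_subset_Icc_self hst) h2
      exact hsts (List.mem_map.2 ⟨t, (hmem t).2 ht, h3.symm⟩)) g
  rw [e1, e2]
  refine (crossFold_map τ ts (fun t ht => ?_) (fun t ht => ?_) g).symm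
  · exact prodAt_congr fun w hw => hiff t ((hmem t).1 ht) w hw
  · exact congrArg n (hinv t ((hmem t).1 ht))

end Perturbation
end HDTVCluster

namespace HDTVCluster

/-! ### The logarithm of a scattering diagram -/

section LogAt

open Filter Topology MvPowerSeries

variable {k I ι : Type*} [Field k] [Fintype ι]

/-- The coefficient in degree `β` of the logarithmic derivative of the product of the functions of
the walls through `x`.  It is a sum over all walls through `x` of which only finitely many terms do
not vanish, so that, contrary to the product, it needs no truncation of the diagram. -/
noncomputable def logAt (D : Set (Wall k I ι)) (x : ι → ℝ) (β : I →₀ ℕ) :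
    AddMonoidAlgebra k (ι → ℤ) :=
  ∑ᶠ w ∈ {w ∈ D | x ∈ w.cone}, coeff β (logDer w.func)

theorem coeff_logDer_eq_zero {D : Set (Wall k I ι)} (hD : ∀ w ∈ D, IsWall w) {j : ℕ}
    {w : Wall k I ι} (hw : w ∈ D) (hwj : w ∉ trunc D j) {β : I →₀ ℕ} (hβ : β.degree < j) :
    coeff β (logDer w.func) = 0 := by
  have h : CongrMod j w.func 1 := by
    by_contra h
    exact hwj ⟨hw, h⟩
  have := h.logDer (hD w hw).coeff_zero (by simp) β hβ
  rwa [logDer_one, map_zero] at this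

theorem logAt_trunc {D : Set (Wall k I ι)} (hD : ∀ w ∈ D, IsWall w) (x : ι → ℝ) {j : ℕ}
    {β : I →₀ ℕ} (hβ : β.degree < j) : logAt (trunc D j) x β = logAt D x β := by
  refine finsum_mem_inter_support_eq' _ _ _ fun w hw => ?_
  refine ⟨fun h => ⟨h.1.1, h.2⟩, fun h => ⟨?_, h.2⟩⟩
  by_contra hwj
  exact hw (coeff_logDer_eq_zero hD h.1 hwj hβ)

theorem coeff_logDer_prodAt {T : Set (Wall k I ι)} (hfin : T.Finite) (hT : ∀ w ∈ T, IsWall w)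
    (x : ι → ℝ) (β : I →₀ ℕ) : coeff β (logDer (prodAt T x)) = logAt T x β := by
  have hS : {w ∈ T | x ∈ w.cone}.Finite := hfin.subset fun w hw => hw.1
  rw [prodAt, logAt, finprod_mem_eq_finite_toFinset_prod _ hS,
    finsum_mem_eq_finite_toFinset_sum _ hS, logDer_prod, map_sum]
  intro w hw
  exact (hT w ((Set.Finite.mem_toFinset hS).1 hw).1).coeff_zero

theorem coeff_logDer_prodAt_trunc {D : Set (Wall k I ι)} (hD : IsScatteringDiagram D) {j : ℕ}
    {β : I →₀ ℕ} (hβ : β.degree < j) (x : ι → ℝ) :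
    coeff β (logDer (prodAt (trunc D j) x)) = logAt D x β := by
  rw [coeff_logDer_prodAt (hD.2 j) (fun w hw => hD.1 w hw.1), logAt_trunc hD.1 x hβ]

/-- In characteristic `0`, the products of the functions of the walls through two points agree
modulo `𝔪 ^ j` if and only if the logarithms at these points agree in degrees below `j`. -/
theorem congrMod_prodAt_iff [CharZero k] {D D' : Set (Wall k I ι)} (hD : IsScatteringDiagram D)
    (hD' : IsScatteringDiagram D') {j : ℕ} {x x' : ι → ℝ} :
    CongrMod j (prodAt (trunc D j) x) (prodAt (trunc D' j) x') ↔
      ∀ β : I →₀ ℕ, β.degree < j → logAt D x β = logAt D' x' β := by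
  rw [congrMod_iff_logDer (coeff_zero_prodAt (fun w hw => hD.1 w hw.1) x)
    (coeff_zero_prodAt (fun w hw => hD'.1 w hw.1) x')]
  refine forall₂_congr fun β hβ => ?_
  rw [coeff_logDer_prodAt_trunc hD hβ, coeff_logDer_prodAt_trunc hD' hβ]

theorem logAt_support_finite {D : Set (Wall k I ι)} (hD : IsScatteringDiagram D) (x : ι → ℝ)
    (β : I →₀ ℕ) : ({w ∈ D | x ∈ w.cone} ∩
      Function.support fun w : Wall k I ι => coeff β (logDer w.func)).Finite := by
  refine (hD.2 (β.degree + 1)).subset fun w hw => ?_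
  by_contra hwj
  exact hw.2 (coeff_logDer_eq_zero hD.1 hw.1.1 hwj (Nat.lt_succ_self _))

theorem IsScatteringDiagram.mono {D D' : Set (Wall k I ι)} (hD : IsScatteringDiagram D)
    (h : D' ⊆ D) : IsScatteringDiagram D' :=
  ⟨fun w hw => hD.1 w (h hw), fun j => (hD.2 j).subset fun _ hw => ⟨h hw.1, hw.2⟩⟩

theorem IsScatteringDiagram.union {D D' : Set (Wall k I ι)} (hD : IsScatteringDiagram D)
    (hD' : IsScatteringDiagram D') : IsScatteringDiagram (D ∪ D') := by
  refine ⟨fun w hw => hw.elim (hD.1 w) (hD'.1 w), fun j => ((hD.2 j).union (hD'.2 j)).subset ?_⟩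
  rintro w ⟨hw | hw, h⟩
  · exact Or.inl ⟨hw, h⟩
  · exact Or.inr ⟨hw, h⟩

/-- If `D` contains `In`, then `logAt D` is the sum of the contributions of `In` and of the other
walls. -/
theorem logAt_eq_add {D In : Set (Wall k I ι)} (hD : IsScatteringDiagram D) (hIn : In ⊆ D)
    (x : ι → ℝ) (β : I →₀ ℕ) : logAt D x β = logAt In x β + logAt (D \ In) x β := by
  rw [logAt, logAt, logAt, ← finsum_mem_union']
  · congr! 3 with w
    simp only [Set.mem_ofPred_eq, Set.mem_union, Set.mem_sdiff]
    by_cases hw : w ∈ In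
    · simp [hw, hIn hw]
    · simp [hw]
  · exact Set.disjoint_left.2 fun w hw hw' => hw'.1.2 hw.1
  · exact logAt_support_finite (hD.mono hIn) x β
  · exact logAt_support_finite (hD.mono Set.sdiff_subset) x β

end LogAt
end HDTVCluster

namespace HDTVCluster

/-! ### Equivalence of scattering diagrams -/

section GenEq

open Filter Topology MvPowerSeries MeasureTheory

variable {k I ι : Type*} [Field k] [Fintype ι]

/-- The logarithms of two diagrams agree outside of a set of codimension two. -/
def GenEq (D D' : Set (Wall k I ι)) : Prop :=
  ∃ Z, Small Z ∧ ∀ x ∉ Z, ∀ β, logAt D x β = logAt D' x β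

theorem GenEq.symm {D D' : Set (Wall k I ι)} (h : GenEq D D') : GenEq D' D := by
  obtain ⟨Z, hZ, h⟩ := h
  exact ⟨Z, hZ, fun x hx β => (h x hx β).symm⟩

theorem GenEq.trans {D D' D'' : Set (Wall k I ι)} (h : GenEq D D') (h' : GenEq D' D'') :
    GenEq D D'' := by
  obtain ⟨Z, hZ, h⟩ := h
  obtain ⟨Z', hZ', h'⟩ := h'
  exact ⟨Z ∪ Z', hZ.union hZ', fun x hx β => (h x (fun hh => hx (Or.inl hh)) β).trans
    (h' x (fun hh => hx (Or.inr hh)) β)⟩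

/-- The singular loci of the truncations of two diagrams. -/
def singUnion (D D' : Set (Wall k I ι)) : Set (ι → ℝ) :=
  ⋃ j, singularLocus Wall.cone (trunc D j ∪ trunc D' j)

theorem IsScatteringDiagram.isWallCone {D : Set (Wall k I ι)} (hD : IsScatteringDiagram D) (j : ℕ)
    (w : Wall k I ι) (hw : w ∈ trunc D j) : IsWallCone w.cone :=
  (hD.1 w hw.1).isWallCone

theorem IsScatteringDiagram.isWallCone_union {D D' : Set (Wall k I ι)}
    (hD : IsScatteringDiagram D) (hD' : IsScatteringDiagram D') (j : ℕ)
    (w : Wall k I ι) (hw : w ∈ trunc D j ∪ trunc D' j) : IsWallCone w.cone :=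
  hw.elim (hD.isWallCone j w) (hD'.isWallCone j w)

theorem small_singUnion {D D' : Set (Wall k I ι)} (hD : IsScatteringDiagram D)
    (hD' : IsScatteringDiagram D') : Small (singUnion D D') :=
  Small.iUnion fun j => small_singularLocus ((hD.2 j).union (hD'.2 j)).countable
    (hD.isWallCone_union hD' j)

theorem singularLocus_mono {W : Type*} {cone : W → Set (ι → ℝ)} {D D' : Set W} (h : D ⊆ D') :
    singularLocus cone D ⊆ singularLocus cone D' := by
  rintro x (⟨w, hw, hx⟩ | ⟨w, hw, w', hw', hx⟩)
  · exact Or.inl ⟨w, h hw, hx⟩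
  · exact Or.inr ⟨w, h hw, w', h hw', hx⟩

theorem IsTransversalPath.mono {W : Type*} {cone : W → Set (ι → ℝ)} {D D' : Set W} {γ : ℝ → ι → ℝ}
    (hγ : IsTransversalPath cone D γ) (h : D' ⊆ D) : IsTransversalPath cone D' γ :=
  ⟨hγ.contDiff, fun t ht hs => hγ.avoids t ht (singularLocus_mono h hs),
    fun t ht w hw => hγ.crosses t ht w (h hw)⟩

theorem Equivalent.genEq [CharZero k] {D D' : Set (Wall k I ι)} (hD : IsScatteringDiagram D)
    (hD' : IsScatteringDiagram D') (h : Equivalent D D') : GenEq D D' := by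
  refine ⟨singUnion D D', small_singUnion hD hD', fun x hx β => ?_⟩
  simp only [singUnion, Set.mem_iUnion, not_exists] at hx
  have h1 := h (β.degree + 1) x
    (fun hs => hx (β.degree + 1) (singularLocus_mono Set.subset_union_left hs))
    (fun hs => hx (β.degree + 1) (singularLocus_mono Set.subset_union_right hs))
  exact (congrMod_prodAt_iff hD hD').1 h1 β (Nat.lt_succ_self _)

/-- Near a nonsingular point `x`, outside of a set of codimension two, there are points `y` on a
given affine hyperplane through `x` which lie on those walls through `x` whose hyperplanes
contain `y`, and on no other walls. -/
theorem exists_near_mem_hyperplane {W : Type*} {cone : W → Set (ι → ℝ)} {T T' : Set W}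
    (hT : T.Finite) (hTc : ∀ w ∈ T, IsWallCone (cone w)) (hT' : T'.Finite)
    (hTc' : ∀ w ∈ T', IsWallCone (cone w)) {x : ι → ℝ} (hx : x ∉ singularLocus cone T)
    (hx' : x ∉ singularLocus cone T') {n : ι → ℤ} (hn : IsPrimitive n) {Z : Set (ι → ℝ)}
    (hZ : Small Z) : ∃ y, pair n y = pair n x ∧ y ∉ Z ∧
      (∀ w ∈ T, y ∈ cone w ↔ x ∈ cone w ∧ y ∈ Submodule.span ℝ (cone w)) ∧
      (∀ w ∈ T', y ∈ cone w ↔ x ∈ cone w ∧ y ∈ Submodule.span ℝ (cone w)) := by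
  obtain ⟨y, hy, h1, h2⟩ := hZ.exists_mem_hyperplane hn.ne_zero
    ((eventually_mem_cone_iff hT hTc hx).and (eventually_mem_cone_iff hT' hTc' hx'))
  exact ⟨y, h1, h2, hy.1, hy.2⟩

theorem prodAt_eq_of_near {T : Set (Wall k I ι)} {x y : ι → ℝ} {n : ι → ℤ}
    (hn : ∀ w ∈ T, x ∈ w.cone → HasNormal w.cone n) (hxy : pair n y = pair n x)
    (hy : ∀ w ∈ T, y ∈ w.cone ↔ x ∈ w.cone ∧ y ∈ Submodule.span ℝ w.cone) :
    prodAt T y = prodAt T x := by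
  refine prodAt_congr fun w hw => (hy w hw).trans (and_iff_left_of_imp fun h => ?_)
  rw [(hn w hw h).mem_span_iff, hxy]
  exact (hn w hw h).pair_eq_zero h

/-- All walls through a nonsingular point have a common normal vector. -/
theorem exists_normal_at {W : Type*} {cone : W → Set (ι → ℝ)} {T : Set W}
    (hT : ∀ w ∈ T, IsWallCone (cone w)) {x : ι → ℝ} (hx : x ∉ singularLocus cone T)
    (h : ∃ w ∈ T, x ∈ cone w) : ∃ n, IsPrimitive n ∧ pair n x = 0 ∧
      ∀ w ∈ T, x ∈ cone w → HasNormal (cone w) n := by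
  obtain ⟨w, hw, hxw⟩ := h
  obtain ⟨n, hn⟩ := (hT w hw).exists_normal
  exact ⟨n, hn.primitive, hn.pair_eq_zero hxw, fun w' hw' hxw' => hn.of_span_eq
    (((notMem_singularLocus_iff hT).1 hx w hw hxw).2 w' hw' hxw')⟩

section

variable [CharZero k] {D D' : Set (Wall k I ι)}

theorem GenEq.congrMod_of_normal (h : GenEq D D') (hD : IsScatteringDiagram D)
    (hD' : IsScatteringDiagram D') {j : ℕ} {x : ι → ℝ}
    (hx : x ∉ singularLocus Wall.cone (trunc D j))
    (hx' : x ∉ singularLocus Wall.cone (trunc D' j)) {n : ι → ℤ} (hp : IsPrimitive n)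
    (hn : ∀ w ∈ trunc D j, x ∈ w.cone → HasNormal w.cone n)
    (hn' : ∀ w ∈ trunc D' j, x ∈ w.cone → HasNormal w.cone n) :
    CongrMod j (prodAt (trunc D j) x) (prodAt (trunc D' j) x) := by
  obtain ⟨Z, hZ, h⟩ := h
  obtain ⟨y, hy, hyZ, h1, h2⟩ := exists_near_mem_hyperplane (hD.2 j) (hD.isWallCone j) (hD'.2 j)
    (hD'.isWallCone j) hx hx' hp hZ
  rw [← prodAt_eq_of_near hn hy h1, ← prodAt_eq_of_near hn' hy h2]
  exact (congrMod_prodAt_iff hD hD').2 fun β _ => h y hyZ β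

/-- If the walls of `D` and those of `D'` through `x` lie in different hyperplanes, the product of
the functions of the walls of `D` through `x` is trivial: it does not change if `x` moves in the
hyperplane of the walls of `D`, where the walls of `D'` are left. -/
theorem GenEq.congrMod_one (h : GenEq D D') (hD : IsScatteringDiagram D)
    (hD' : IsScatteringDiagram D') {j : ℕ} {x : ι → ℝ}
    (hx : x ∉ singularLocus Wall.cone (trunc D j))
    (hx' : x ∉ singularLocus Wall.cone (trunc D' j)) {n n' : ι → ℤ} (hp : IsPrimitive n)
    (hp' : IsPrimitive n') (h1 : n' ≠ n) (h2 : n' ≠ -n) (h0 : pair n x = 0)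
    (hn : ∀ w ∈ trunc D j, x ∈ w.cone → HasNormal w.cone n)
    (hn' : ∀ w ∈ trunc D' j, x ∈ w.cone → HasNormal w.cone n') :
    CongrMod j (prodAt (trunc D j) x) 1 := by
  obtain ⟨Z, hZ, h⟩ := h
  obtain ⟨z, hz, hz'⟩ := exists_pair_ne_zero hp hp' h1 h2
  obtain ⟨y, hy, hyZ, h3, h4⟩ := exists_near_mem_hyperplane (hD.2 j) (hD.isWallCone j) (hD'.2 j)
    (hD'.isWallCone j) hx hx' hp (hZ.union (small_inter hp.ne_zero hz hz' 0 0))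
  have e1 : prodAt (trunc D' j) y = 1 := by
    refine prodAt_of_forall_notMem fun w hw hyw => ?_
    have hw' := hn' w hw ((h4 w hw).1 hyw).1
    exact hyZ (Or.inr ⟨hy.trans h0, hw'.pair_eq_zero hyw⟩)
  rw [← prodAt_eq_of_near hn hy h3, ← e1]
  exact (congrMod_prodAt_iff hD hD').2 fun β _ => h y (fun hh => hyZ (Or.inl hh)) β

/-- At a point outside of both singular loci, the walls of each diagram span one hyperplane.  If the
two hyperplanes agree, one moves to a general point inside of it, and otherwise both products are
trivial. -/
theorem GenEq.equivalent (h : GenEq D D') (hD : IsScatteringDiagram D)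
    (hD' : IsScatteringDiagram D') : Equivalent D D' := by
  intro j x hx hx'
  change CongrMod j (prodAt (trunc D j) x) (prodAt (trunc D' j) x)
  by_cases h1 : ∃ w ∈ trunc D j, x ∈ w.cone
  · obtain ⟨n, hp, h0, hn⟩ := exists_normal_at (hD.isWallCone j) hx h1
    by_cases h2 : ∃ w ∈ trunc D' j, x ∈ w.cone
    · obtain ⟨n', hp', h0', hn'⟩ := exists_normal_at (hD'.isWallCone j) hx' h2
      by_cases e1 : n' = n
      · exact h.congrMod_of_normal hD hD' hx hx' hp hn (e1 ▸ hn')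
      by_cases e2 : n' = -n
      · exact h.congrMod_of_normal hD hD' hx hx' hp hn fun w hw hxw => by
          simpa [e2] using (hn' w hw hxw).neg
      · exact (h.congrMod_one hD hD' hx hx' hp hp' e1 e2 h0 hn hn').trans
          (h.symm.congrMod_one hD' hD hx' hx hp' hp (fun e => e1 e.symm)
            (fun e => e2 (by rw [e, neg_neg])) h0' hn' hn).symm
    · push Not at h2
      exact h.congrMod_of_normal hD hD' hx hx' hp hn fun w hw hxw => absurd hxw (h2 w hw)
  · push Not at h1
    by_cases h2 : ∃ w ∈ trunc D' j, x ∈ w.cone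
    · obtain ⟨n', hp', h0', hn'⟩ := exists_normal_at (hD'.isWallCone j) hx' h2
      exact h.congrMod_of_normal hD hD' hx hx' hp' (fun w hw hxw => absurd hxw (h1 w hw)) hn'
    · push Not at h2
      rw [prodAt_of_forall_notMem h1, prodAt_of_forall_notMem h2]
      exact CongrMod.refl _ _

theorem equivalent_iff_genEq (hD : IsScatteringDiagram D) (hD' : IsScatteringDiagram D') :
    Equivalent D D' ↔ GenEq D D' :=
  ⟨fun h => h.genEq hD hD', fun h => h.equivalent hD hD'⟩

end

/-! ### Comparison of path ordered products -/

/-- Common times of crossing, and common normal vectors, for a path and one of its translates. -/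
theorem exists_common_times {W W' : Type*} {cone : W → Set (ι → ℝ)} {cone' : W' → Set (ι → ℝ)}
    {T : Set W} {T' : Set W'} (hT : T.Finite) (hTc : ∀ w ∈ T, IsWallCone (cone w))
    (hT' : T'.Finite) (hTc' : ∀ w ∈ T', IsWallCone (cone' w)) {γ γ' : ℝ → ι → ℝ}
    (hd : ∀ t, deriv γ' t = deriv γ t) (hγ : IsTransversalPath cone T γ)
    (hγ' : IsTransversalPath cone' T' γ')
    (hspan : ∀ t ∈ Set.Icc (0 : ℝ) 1, ∀ w ∈ T, ∀ w' ∈ T', γ t ∈ cone w → γ' t ∈ cone' w' →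
      Submodule.span ℝ (cone w) = Submodule.span ℝ (cone' w')) :
    ∃ (ts : List ℝ) (n : ℝ → ι → ℤ), ts.Pairwise (· < ·) ∧
      (∀ t ∈ ts, t ∈ Set.Icc (0 : ℝ) 1 ∧
        ((∃ w ∈ T, γ t ∈ cone w) ∨ ∃ w ∈ T', γ' t ∈ cone' w)) ∧
      (∀ t ∈ ts, ∀ w ∈ T, γ t ∈ cone w → HasNormal (cone w) (n t) ∧ pair (n t) (deriv γ t) < 0) ∧
      (∀ t ∈ ts, ∀ w ∈ T', γ' t ∈ cone' w →
        HasNormal (cone' w) (n t) ∧ pair (n t) (deriv γ' t) < 0) ∧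
      (∀ t ∈ Set.Icc (0 : ℝ) 1, ∀ w ∈ T, γ t ∈ cone w → t ∈ ts) ∧
      (∀ t ∈ Set.Icc (0 : ℝ) 1, ∀ w ∈ T', γ' t ∈ cone' w → t ∈ ts) := by
  classical
  obtain ⟨Θ, hΘ⟩ := exists_crossing_times hT hTc hγ
  obtain ⟨Θ', hΘ'⟩ := exists_crossing_times hT' hTc' hγ'
  obtain ⟨n, hn⟩ := hγ.exists_normals hTc
  obtain ⟨n', hn'⟩ := hγ'.exists_normals hTc'
  have hmem : ∀ t, t ∈ (Θ ∪ Θ').sort (· ≤ ·) ↔ t ∈ Set.Icc (0 : ℝ) 1 ∧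
      ((∃ w ∈ T, γ t ∈ cone w) ∨ ∃ w ∈ T', γ' t ∈ cone' w) := fun t => by
    rw [Finset.mem_sort, Finset.mem_union, hΘ, hΘ', and_or_left]
  refine ⟨(Θ ∪ Θ').sort (· ≤ ·), fun t => if ∃ w ∈ T, γ t ∈ cone w then n t else n' t,
    (Finset.sortedLT_sort _).pairwise, fun t ht => (hmem t).1 ht, fun t ht w hw htw => ?_,
    fun t ht w hw htw => ?_, fun t ht w hw htw => (hmem t).2 ⟨ht, Or.inl ⟨w, hw, htw⟩⟩,
    fun t ht w hw htw => (hmem t).2 ⟨ht, Or.inr ⟨w, hw, htw⟩⟩⟩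
  · beta_reduce
    rw [if_pos ⟨w, hw, htw⟩]
    exact hn t ((hmem t).1 ht).1 w hw htw
  · have ht' := ((hmem t).1 ht).1
    beta_reduce
    split_ifs with h
    · obtain ⟨w₀, hw₀, htw₀⟩ := h
      have h1 := hn t ht' w₀ hw₀ htw₀
      exact ⟨h1.1.of_span_eq (hspan t ht' w₀ hw₀ w hw htw₀ htw), by rw [hd]; exact h1.2⟩
    · exact hn' t ht' w hw htw

variable [CharZero k] [Finite I] {D D' : Set (Wall k I ι)}

theorem congrMod_pathProduct_of_logAt (hD : IsScatteringDiagram D) (hD' : IsScatteringDiagram D')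
    {j : ℕ} {γ : ℝ → ι → ℝ} (hγ : IsTransversalPath Wall.cone (trunc D j ∪ trunc D' j) γ)
    (h : ∀ t ∈ Set.Icc (0 : ℝ) 1, ∀ β, logAt D (γ t) β = logAt D' (γ t) β)
    {L L' : List (ℝ × Wall k I ι)} (hL : IsCrossingList Wall.cone (trunc D j) γ L)
    (hL' : IsCrossingList Wall.cone (trunc D' j) γ L')
    (g : MvPowerSeries I (AddMonoidAlgebra k (ι → ℤ))) :
    CongrMod j (pathProduct γ L g) (pathProduct γ L' g) := by
  obtain ⟨ts, n, h1, h2, h3, h4, h5, h6⟩ := exists_common_times (hD.2 j) (hD.isWallCone j)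
    (hD'.2 j) (hD'.isWallCone j) (fun _ => rfl) (hγ.mono Set.subset_union_left)
    (hγ.mono Set.subset_union_right) fun t ht w hw w' hw' htw htw' =>
      hγ.span_eq (hD.isWallCone_union hD' j) ht (Or.inl hw) (Or.inr hw') htw htw'
  rw [pathProduct_eq_crossFold (fun w hw => hD.1 w hw.1) ts h1 (fun t ht => (h2 t ht).1) h3 hL h5,
    pathProduct_eq_crossFold (fun w hw => hD'.1 w hw.1) ts h1 (fun t ht => (h2 t ht).1) h4 hL' h6]
  refine crossFold_congr n ts (fun t _ => coeff_zero_prodAt (fun w hw => hD.1 w hw.1) _)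
    (fun t _ => coeff_zero_prodAt (fun w hw => hD'.1 w hw.1) _) (fun t ht => ?_) (CongrMod.refl _ _)
  exact (congrMod_prodAt_iff hD hD').2 fun β _ => h t (h2 t ht).1 β

theorem ae_transversal (hD : IsScatteringDiagram D) (hD' : IsScatteringDiagram D') (j : ℕ)
    {γ : ℝ → ι → ℝ} (hγ : ContDiff ℝ 1 γ) :
    ∀ᵐ v : ι → ℝ, IsTransversalPath Wall.cone (trunc D j ∪ trunc D' j) (fun t => γ t + v) :=
  ae_isTransversalPath ((hD.2 j).union (hD'.2 j)).countable (hD.isWallCone_union hD' j) hγ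

/-- Two diagrams have the same path ordered products. -/
def PathEquivalent (D D' : Set (Wall k I ι)) : Prop :=
  ∀ (j : ℕ) (γ : ℝ → ι → ℝ), IsTransversalPath Wall.cone (trunc D j) γ →
    IsTransversalPath Wall.cone (trunc D' j) γ →
    ∀ L L', IsCrossingList Wall.cone (trunc D j) γ L →
      IsCrossingList Wall.cone (trunc D' j) γ L' →
      ∀ g, CongrMod j (pathProduct γ L g) (pathProduct γ L' g)

/-- After a small general translation, a path avoids the set of codimension two where the logarithms
differ. -/
theorem GenEq.pathEquivalent (h : GenEq D D') (hD : IsScatteringDiagram D)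
    (hD' : IsScatteringDiagram D') : PathEquivalent D D' := by
  intro j γ hγ hγ' L L' hL hL' g
  obtain ⟨Z, hZ, h⟩ := h
  have hW : ∀ w ∈ trunc D j, IsWall w := fun w hw => hD.1 w hw.1
  have hW' : ∀ w ∈ trunc D' j, IsWall w := fun w hw => hD'.1 w hw.1
  obtain ⟨v, ⟨h1, h2⟩, h3, h4⟩ := exists_of_ae_of_eventually
    ((ae_transversal hD hD' j hγ.contDiff).and (hZ.ae_forall_notMem hγ.contDiff))
    ((hγ.eventually_pathProduct_add (hD.2 j) hW).and (hγ'.eventually_pathProduct_add (hD'.2 j) hW'))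
  obtain ⟨K, hK⟩ := (h1.mono Set.subset_union_left).exists_crossingList (hD.2 j) (hD.isWallCone j)
  obtain ⟨K', hK'⟩ :=
    (h1.mono Set.subset_union_right).exists_crossingList (hD'.2 j) (hD'.isWallCone j)
  rw [h3 L K hL hK g, h4 L' K' hL' hK' g]
  exact congrMod_pathProduct_of_logAt hD hD' h1 (fun t _ β => h _ (h2 t) β) hK hK' g

/-- Consistency only depends on the equivalence class: the two paths are translated by the same
general vector, so that they keep common endpoints. -/
theorem GenEq.isConsistent (h : GenEq D D') (hD : IsScatteringDiagram D)
    (hD' : IsScatteringDiagram D') (hcons : IsConsistent D') : IsConsistent D := by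
  intro j γ γ' hγ hγ' h0 h1 L L' hL hL' g
  obtain ⟨Z, hZ, h⟩ := h
  have hW : ∀ w ∈ trunc D j, IsWall w := fun w hw => hD.1 w hw.1
  obtain ⟨v, ⟨⟨a1, a2⟩, a3, a4⟩, a5, a6⟩ := exists_of_ae_of_eventually
    (((ae_transversal hD hD' j hγ.contDiff).and (hZ.ae_forall_notMem hγ.contDiff)).and
      ((ae_transversal hD hD' j hγ'.contDiff).and (hZ.ae_forall_notMem hγ'.contDiff)))
    ((hγ.eventually_pathProduct_add (hD.2 j) hW).and (hγ'.eventually_pathProduct_add (hD.2 j) hW))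
  obtain ⟨K, hK⟩ := (a1.mono Set.subset_union_left).exists_crossingList (hD.2 j) (hD.isWallCone j)
  obtain ⟨K', hK'⟩ :=
    (a3.mono Set.subset_union_left).exists_crossingList (hD.2 j) (hD.isWallCone j)
  obtain ⟨E, hE⟩ :=
    (a1.mono Set.subset_union_right).exists_crossingList (hD'.2 j) (hD'.isWallCone j)
  obtain ⟨E', hE'⟩ :=
    (a3.mono Set.subset_union_right).exists_crossingList (hD'.2 j) (hD'.isWallCone j)
  rw [a5 L K hL hK g, a6 L' K' hL' hK' g]
  refine (congrMod_pathProduct_of_logAt hD hD' a1 (fun t _ β => h _ (a2 t) β) hK hE g).trans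
    (CongrMod.trans ?_ (congrMod_pathProduct_of_logAt hD hD' a3 (fun t _ β => h _ (a4 t) β)
      hK' hE' g).symm)
  exact hcons j _ _ (a1.mono Set.subset_union_right) (a3.mono Set.subset_union_right)
    (by simp only [h0]) (by simp only [h1]) E E' hE hE' g

/-- A short segment through a nonsingular point `x` on walls with normal vector `n`. -/
theorem exists_short_segment {W : Type*} {cone : W → Set (ι → ℝ)} {T : Set W} (hT : T.Finite)
    (hTc : ∀ w ∈ T, IsWallCone (cone w)) {x : ι → ℝ} (hx : x ∉ singularLocus cone T) {n : ι → ℤ}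
    (hp : IsPrimitive n) (h0 : pair n x = 0)
    (hn : ∀ w ∈ T, x ∈ cone w → HasNormal (cone w) n) :
    ∃ γ, IsTransversalPath cone T γ ∧ γ (1 / 2) = x ∧ pair n (deriv γ (1 / 2)) < 0 ∧
      ∀ t ∈ Set.Icc (0 : ℝ) 1, ∀ w ∈ T, γ t ∈ cone w → t = 1 / 2 := by
  obtain ⟨r, hr, hball⟩ := Metric.eventually_nhds_iff.1 (eventually_mem_cone_iff hT hTc hx)
  have hN := pair_toReal_self_pos hp.ne_zero
  have hδ : 0 < r / (‖toReal n‖ + 1) := by positivity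
  set δ := r / (‖toReal n‖ + 1) with hδ'
  have hδr : δ * ‖toReal n‖ < r := by
    rw [hδ', div_mul_eq_mul_div, div_lt_iff₀ (by positivity)]
    nlinarith [norm_nonneg (toReal n)]
  have hder : ∀ t, HasDerivAt (fun t : ℝ => x + (1 - 2 * t) • (δ • toReal n))
      ((-2 : ℝ) • (δ • toReal n)) t := by
    intro t
    have h1 : HasDerivAt (fun t : ℝ => 1 - 2 * t) (-2) t := by
      simpa using ((hasDerivAt_id t).const_mul (2 : ℝ)).const_sub 1
    exact (h1.smul_const _).const_add x
  have hlocal : ∀ t ∈ Set.Icc (0 : ℝ) 1, ∀ w ∈ T, x + (1 - 2 * t) • (δ • toReal n) ∈ cone w →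
      x ∈ cone w ∧ t = 1 / 2 := by
    intro t ht w hw htw
    have hd : dist (x + (1 - 2 * t) • (δ • toReal n)) x < r := by
      rw [dist_eq_norm, add_sub_cancel_left, norm_smul, norm_smul, Real.norm_of_nonneg hδ.le]
      refine lt_of_le_of_lt (mul_le_of_le_one_left (by positivity) ?_) hδr
      rw [Real.norm_eq_abs, abs_le]
      constructor <;> linarith [ht.1, ht.2]
    obtain ⟨h1, h2⟩ := (hball hd w hw).1 htw
    have h3 := ((hn w hw h1).mem_span_iff _).1 h2
    rw [pair_add, pair_smul, pair_smul, h0, zero_add, mul_eq_zero] at h3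
    refine ⟨h1, ?_⟩
    rcases h3 with h3 | h3
    · linarith
    · exact absurd h3 (by positivity)
  have hneg : ∀ t, pair n (deriv (fun t : ℝ => x + (1 - 2 * t) • (δ • toReal n)) t) < 0 := by
    intro t
    rw [(hder t).deriv, pair_smul, pair_smul]
    nlinarith [mul_pos hδ hN]
  have hhalf : x + (1 - 2 * (1 / 2) : ℝ) • (δ • toReal n) = x := by norm_num
  refine ⟨fun t => x + (1 - 2 * t) • (δ • toReal n), ⟨by fun_prop, fun t ht hs => ?_,
    fun t ht w hw htw => ?_⟩, hhalf, hneg _, fun t ht w hw htw => (hlocal t ht w hw htw).2⟩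
  · by_cases h : ∃ w ∈ T, x + (1 - 2 * t) • (δ • toReal n) ∈ cone w
    · obtain ⟨w, hw, htw⟩ := h
      have := (hlocal t ht w hw htw).2
      subst this
      rw [hhalf] at hs
      exact hx hs
    · push Not at h
      exact (notMem_singularLocus_iff hTc).2 (fun w hw htw => absurd htw (h w hw)) hs
  · obtain ⟨h1, h2⟩ := hlocal t ht w hw htw
    refine ⟨by rw [h2]; norm_num, fun h3 => ?_⟩
    exact (hneg t).ne (((hn w hw h1).mem_span_iff _).1 h3)

/-- A wall crossing determines the function: it is applied to `z^n`, where the exponent `⟨n, n⟩` of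
the function does not vanish. -/
theorem congrMod_of_wallCrossing {f f' : MvPowerSeries I (AddMonoidAlgebra k (ι → ℤ))}
    (hf : coeff 0 f = 1) (hf' : coeff 0 f' = 1) {n : ι → ℤ} (hn : n ≠ 0) {j : ℕ}
    (h : ∀ g, CongrMod j (wallCrossing f n g) (wallCrossing f' n g)) : CongrMod j f f' := by
  classical
  have hc : dotProduct n n ≠ 0 := fun h0 => by
    have := pair_toReal_self_pos hn
    rw [pair_toReal, h0] at this
    simp at this
  have h1 := h (monomial 0 (AddMonoidAlgebra.single n 1))
  have hw : ∀ f : MvPowerSeries I (AddMonoidAlgebra k (ι → ℤ)),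
      wallCrossing f n (monomial 0 (AddMonoidAlgebra.single n 1)) =
        monomial 0 (AddMonoidAlgebra.single n 1) * intPow f (dotProduct n n) := fun f =>
    wallCrossing_of_weight f fun β m hm => by rw [coeff_monomial_single_ne_zero hm]
  rw [hw, hw] at h1
  have h2 := (CongrMod.refl j (monomial 0 (AddMonoidAlgebra.single (-n) (1 : k)) :
    MvPowerSeries I (AddMonoidAlgebra k (ι → ℤ)))).mul h1
  rw [← mul_assoc, ← mul_assoc, monomial_mul_monomial, AddMonoidAlgebra.single_mul_single,
    neg_add_cancel, add_zero, one_mul] at h2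
  have h3 : (monomial 0 (AddMonoidAlgebra.single 0 (1 : k)) :
      MvPowerSeries I (AddMonoidAlgebra k (ι → ℤ))) = 1 := rfl
  rw [h3, one_mul, one_mul] at h2
  rw [congrMod_iff_logDer hf hf']
  have h4 := h2.logDer (coeff_zero_intPow hf _) (coeff_zero_intPow hf' _)
  rw [logDer_intPow hf, logDer_intPow hf'] at h4
  intro β hβ
  have h5 := h4 β hβ
  rw [map_zsmul, map_zsmul] at h5
  exact zsmul_right_injective hc h5

/-- The function at a nonsingular point is recovered from a short segment through this point. -/
theorem PathEquivalent.genEq (h : PathEquivalent D D') (hD : IsScatteringDiagram D)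
    (hD' : IsScatteringDiagram D') : GenEq D D' := by
  refine ⟨singUnion D D', small_singUnion hD hD', fun x hx β => ?_⟩
  simp only [singUnion, Set.mem_iUnion, not_exists] at hx
  set j := β.degree + 1
  refine (congrMod_prodAt_iff hD hD' (j := j)).1 ?_ β (Nat.lt_succ_self _)
  have hTc := hD.isWallCone_union hD' j
  by_cases hxw : ∃ w ∈ trunc D j ∪ trunc D' j, x ∈ w.cone
  · obtain ⟨n, hp, h0, hn⟩ := exists_normal_at hTc (hx j) hxw
    obtain ⟨γ, hγ, hγx, hneg, hγt⟩ :=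
      exists_short_segment ((hD.2 j).union (hD'.2 j)) hTc (hx j) hp h0 hn
    have hγ1 := hγ.mono Set.subset_union_left
    have hγ2 := hγ.mono Set.subset_union_right
    obtain ⟨L, hL⟩ := hγ1.exists_crossingList (hD.2 j) (hD.isWallCone j)
    obtain ⟨L', hL'⟩ := hγ2.exists_crossingList (hD'.2 j) (hD'.isWallCone j)
    refine congrMod_of_wallCrossing (coeff_zero_prodAt (fun w hw => hD.1 w hw.1) x)
      (coeff_zero_prodAt (fun w hw => hD'.1 w hw.1) x) hp.ne_zero fun g => ?_
    have h1 := h j γ hγ1 hγ2 L L' hL hL' g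
    have hIcc : ∀ t ∈ [(1 / 2 : ℝ)], t ∈ Set.Icc (0 : ℝ) 1 := by
      simp only [List.mem_singleton, forall_eq]; norm_num
    rw [pathProduct_eq_crossFold (n := fun _ => n) (fun w hw => hD.1 w hw.1) [1 / 2]
        (List.pairwise_singleton _ _) hIcc ?_ hL
        (fun t ht w hw htw => List.mem_singleton.2 (hγt t ht w (Or.inl hw) htw)),
      pathProduct_eq_crossFold (n := fun _ => n) (fun w hw => hD'.1 w hw.1) [1 / 2]
        (List.pairwise_singleton _ _) hIcc ?_ hL'
        (fun t ht w hw htw => List.mem_singleton.2 (hγt t ht w (Or.inr hw) htw))] at h1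
    · simpa only [crossFold, List.foldl_cons, List.foldl_nil, hγx] using h1
    · simp only [List.mem_singleton, forall_eq, hγx]
      exact fun w hw hxw => ⟨hn w (Or.inr hw) hxw, hneg⟩
    · simp only [List.mem_singleton, forall_eq, hγx]
      exact fun w hw hxw => ⟨hn w (Or.inl hw) hxw, hneg⟩
  · push Not at hxw
    rw [prodAt_of_forall_notMem fun w hw => hxw w (Or.inl hw),
      prodAt_of_forall_notMem fun w hw => hxw w (Or.inr hw)]
    exact CongrMod.refl _ _

theorem pathEquivalent_iff_genEq (hD : IsScatteringDiagram D) (hD' : IsScatteringDiagram D') :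
    PathEquivalent D D' ↔ GenEq D D' :=
  ⟨fun h => h.genEq hD hD', fun h => h.pathEquivalent hD hD'⟩

end GenEq
end HDTVCluster

namespace HDTVCluster

/-! ### Uniqueness of consistent completions -/

section Uniqueness

open Filter Topology MvPowerSeries MeasureTheory

variable {k I ι : Type*} [Field k] [Fintype ι]

theorem coeff_logAt_eq_zero {D : Set (Wall k I ι)} {x : ι → ℝ} {β : I →₀ ℕ} {m : ι → ℤ}
    (h : ∀ w ∈ D, x ∈ w.cone → (coeff β (logDer w.func)).coeff m = 0) :
    (logAt D x β).coeff m = 0 := by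
  refine finsum_mem_induction (fun a : AddMonoidAlgebra k (ι → ℤ) => a.coeff m = 0) (by simp) ?_ ?_
  · intro a b ha hb
    rw [AddMonoidAlgebra.coeff_add, Finsupp.add_apply, ha, hb, add_zero]
  · exact fun w hw => h w hw.1 hw.2

theorem logAt_congr {D D' : Set (Wall k I ι)} {x x' : ι → ℝ}
    (h : ∀ w, w ∈ D ∧ x ∈ w.cone ↔ w ∈ D' ∧ x' ∈ w.cone) (β : I →₀ ℕ) :
    logAt D x β = logAt D' x' β := by
  have : {w ∈ D | x ∈ w.cone} = {w ∈ D' | x' ∈ w.cone} := Set.ext h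
  rw [logAt, logAt, this]

theorem logAt_zero_index (D : Set (Wall k I ι)) (x : ι → ℝ) : logAt D x 0 = 0 :=
  finsum_mem_eq_zero_of_forall_eq_zero fun w _ => coeff_zero_logDer w.func

/-- The exponents of the logarithm of a wall function are multiples of `-m₀`. -/
theorem IsWall.exists_of_coeff_logDer_ne_zero {w : Wall k I ι} (hw : IsWall w) {β : I →₀ ℕ}
    {m : ι → ℤ} (h : (coeff β (logDer w.func)).coeff m ≠ 0) :
    ∃ r : ℕ, 1 ≤ r ∧ m = -((r : ℤ) • w.dir) := by
  classical
  let Q : AddSubmonoid ((I →₀ ℕ) × (ι → ℤ)) :=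
    { carrier := {p | p = 0 ∨ ∃ r : ℕ, 1 ≤ r ∧ p.2 = -((r : ℤ) • w.dir)}
      zero_mem' := Or.inl rfl
      add_mem' := by
        rintro p q (rfl | ⟨r, hr, hp⟩) (rfl | ⟨r', hr', hq⟩)
        · exact Or.inl (add_zero 0)
        · exact Or.inr ⟨r', hr', by rw [zero_add, hq]⟩
        · exact Or.inr ⟨r, hr, by rw [add_zero, hp]⟩
        · refine Or.inr ⟨r + r', by omega, ?_⟩
          rw [Prod.snd_add, hp, hq, Nat.cast_add, add_smul, neg_add] }
  have hQ : SuppIn Q w.func := by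
    intro γ m' hm'
    by_cases hγ : γ = 0
    · left
      rw [hγ, hw.coeff_zero, AddMonoidAlgebra.one_def, AddMonoidAlgebra.coeff_single,
        Finsupp.single_apply] at hm'
      split_ifs at hm' with h0
      · rw [hγ, ← h0]; rfl
      · exact absurd rfl hm'
    · exact Or.inr (hw.coeff_ne_zero γ hγ m' hm')
  rcases hQ.logDer hw.coeff_zero β m h with h0 | h0
  · have hβ : β = 0 := congrArg Prod.fst h0
    rw [hβ, coeff_zero_logDer] at h
    exact absurd rfl h
  · exact h0

theorem toReal_neg_smul (r : ℕ) (m : ι → ℤ) :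
    toReal (-((r : ℤ) • m)) = (r : ℝ) • toReal (-m) := by
  funext i
  simp [toReal]

theorem IsWall.toReal_mem_span {w : Wall k I ι} (hw : IsWall w) {β : I →₀ ℕ}
    {m : ι → ℤ} (h : (coeff β (logDer w.func)).coeff m ≠ 0) :
    toReal m ∈ Submodule.span ℝ w.cone := by
  obtain ⟨r, -, rfl⟩ := hw.exists_of_coeff_logDer_ne_zero h
  rw [toReal_neg_smul]
  refine Submodule.smul_mem _ _ ?_
  have : toReal (-w.dir) = -toReal w.dir := by funext i; simp [toReal]
  rw [this]
  exact Submodule.neg_mem _ hw.dir_tangent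

theorem IsWall.toReal_notMem {w : Wall k I ι} (hw : IsWall w) (hout : ¬ w.Incoming) {β : I →₀ ℕ}
    {m : ι → ℤ} (h : (coeff β (logDer w.func)).coeff m ≠ 0) : toReal m ∉ w.cone := by
  obtain ⟨r, hr, rfl⟩ := hw.exists_of_coeff_logDer_ne_zero h
  rw [toReal_neg_smul, smul_mem_iff_of_isRationalPolyhedralCone hw.rational (by positivity)]
  exact hout

/-- Far away in a direction which does not lie in the cone, one is outside of the cone. -/
theorem eventually_add_smul_notMem {d : Set (ι → ℝ)} (hd : IsRationalPolyhedralCone d)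
    {m : ι → ℝ} (hm : m ∉ d) (x : ι → ℝ) :
    ∀ᶠ S₀ in atTop, ∀ᶠ y in 𝓝 x, ∀ S : ℝ, S₀ ≤ S → y + S • m ∉ d := by
  obtain ⟨A, rfl⟩ := hd
  simp only [Set.mem_ofPred_eq, not_forall, not_le] at hm
  obtain ⟨a, ha, ham⟩ := hm
  filter_upwards [eventually_ge_atTop ((pair a x + 1) / (-pair a m))] with S₀ hS₀
  have h1 : ∀ᶠ y in 𝓝 x, pair a y < pair a x + 1 :=
    ((continuous_pair a).tendsto x).eventually_lt_const (lt_add_one _)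
  filter_upwards [h1] with y hy S hS hmem
  have h2 := hmem a ha
  rw [pair_add, pair_smul] at h2
  have h3 := hS₀.trans hS
  rw [div_le_iff₀ (by linarith)] at h3
  linarith

/-- Points which lie, up to translations, on two different ones of the hyperplanes spanned by walls,
form a small set. -/
theorem small_nonparallel {W W' : Type*} {cone : W → Set (ι → ℝ)} {cone' : W' → Set (ι → ℝ)}
    {T : Set W} {T' : Set W'} (hT : T.Countable) (hTc : ∀ w ∈ T, IsWallCone (cone w))
    (hT' : T'.Countable) (hTc' : ∀ w ∈ T', IsWallCone (cone' w)) (y y' : ι → ℝ) :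
    Small {x | ∃ w ∈ T, ∃ w' ∈ T', x + y ∈ Submodule.span ℝ (cone w) ∧
      x + y' ∈ Submodule.span ℝ (cone' w') ∧
      Submodule.span ℝ (cone w) ≠ Submodule.span ℝ (cone' w')} := by
  have h : ∀ w ∈ T, ∀ w' ∈ T', Small {x | x + y ∈ Submodule.span ℝ (cone w) ∧
      x + y' ∈ Submodule.span ℝ (cone' w') ∧
      Submodule.span ℝ (cone w) ≠ Submodule.span ℝ (cone' w')} := by
    intro w hw w' hw'
    obtain ⟨n, hn⟩ := (hTc w hw).exists_normal
    obtain ⟨n', hn'⟩ := (hTc' w' hw').exists_normal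
    by_cases hs : Submodule.span ℝ (cone w) = Submodule.span ℝ (cone' w')
    · simp only [hs, ne_eq, not_true_eq_false, and_false]
      exact small_empty
    obtain ⟨z, hz, hz'⟩ : ∃ z, pair n z = 0 ∧ pair n' z ≠ 0 := by
      refine exists_pair_ne_zero hn.primitive hn'.primitive (fun e => hs ?_) (fun e => hs ?_)
      · ext x
        rw [hn.mem_span_iff, hn'.mem_span_iff, e]
      · ext x
        rw [hn.mem_span_iff, hn'.mem_span_iff, e, neg_pair, neg_eq_zero]
    refine (small_inter hn.primitive.ne_zero hz hz' (-pair n y) (-pair n' y')).mono ?_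
    rintro x ⟨h1, h2, -⟩
    rw [hn.mem_span_iff, pair_add] at h1
    rw [hn'.mem_span_iff, pair_add] at h2
    exact ⟨by linarith, by linarith⟩
  refine (Small.biUnion hT fun w hw => Small.biUnion hT' fun w' hw' => h w hw w' hw').mono ?_
  rintro x ⟨w, hw, w', hw', hx⟩
  exact Set.mem_biUnion hw (Set.mem_biUnion hw' hx)

variable [CharZero k] [Finite I]

/-- First order comparison of the path ordered products of two diagrams which agree up to degree
`β`: the difference in degree `β` is a sum over all crossings. -/
theorem sum_crossings {D D' : Set (Wall k I ι)} (hD : IsScatteringDiagram D)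
    (hD' : IsScatteringDiagram D') {β : I →₀ ℕ} (hβ : β ≠ 0) {κ κ' : ℝ → ι → ℝ} {ts : List ℝ}
    {n : ℝ → ι → ℤ} (h1 : ts.Pairwise (· < ·)) (h2 : ∀ t ∈ ts, t ∈ Set.Icc (0 : ℝ) 1)
    (h3 : ∀ t ∈ ts, ∀ w ∈ trunc D (β.degree + 1), κ t ∈ w.cone →
      HasNormal w.cone (n t) ∧ pair (n t) (deriv κ t) < 0)
    (h4 : ∀ t ∈ ts, ∀ w ∈ trunc D' (β.degree + 1), κ' t ∈ w.cone →
      HasNormal w.cone (n t) ∧ pair (n t) (deriv κ' t) < 0)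
    (h5 : ∀ t ∈ Set.Icc (0 : ℝ) 1, ∀ w ∈ trunc D (β.degree + 1), κ t ∈ w.cone → t ∈ ts)
    (h6 : ∀ t ∈ Set.Icc (0 : ℝ) 1, ∀ w ∈ trunc D' (β.degree + 1), κ' t ∈ w.cone → t ∈ ts)
    (hlog : ∀ t ∈ ts, ∀ δ : I →₀ ℕ, δ.degree < β.degree → logAt D (κ t) δ = logAt D' (κ' t) δ)
    {L L' : List (ℝ × Wall k I ι)}
    (hL : IsCrossingList Wall.cone (trunc D (β.degree + 1)) κ L)
    (hL' : IsCrossingList Wall.cone (trunc D' (β.degree + 1)) κ' L') (m m₀ : ι → ℤ) :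
    (β.degree : k) * ((coeff β (pathProduct κ' L'
        (monomial 0 (AddMonoidAlgebra.single m 1)))).coeff (m + m₀) -
      (coeff β (pathProduct κ L (monomial 0 (AddMonoidAlgebra.single m 1)))).coeff (m + m₀)) =
    (ts.map fun t => dotProduct (n t) m •
      ((logAt D' (κ' t) β).coeff m₀ - (logAt D (κ t) β).coeff m₀)).sum := by
  classical
  set J := β.degree + 1
  have hβJ : β.degree < J := Nat.lt_succ_self _
  have hW : ∀ w ∈ trunc D J, IsWall w := fun w hw => hD.1 w hw.1
  have hW' : ∀ w ∈ trunc D' J, IsWall w := fun w hw => hD'.1 w hw.1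
  rw [pathProduct_eq_crossFold hW ts h1 h2 h3 hL h5,
    pathProduct_eq_crossFold hW' ts h1 h2 h4 hL' h6]
  have hc : ∀ t ∈ ts, CongrMod β.degree (prodAt (trunc D J) (κ t))
      (prodAt (trunc D' J) (κ' t)) := by
    intro t ht
    rw [congrMod_iff_logDer (coeff_zero_prodAt hW _) (coeff_zero_prodAt hW' _)]
    intro δ hδ
    rw [coeff_logDer_prodAt_trunc hD (hδ.trans hβJ), coeff_logDer_prodAt_trunc hD' (hδ.trans hβJ)]
    exact hlog t ht δ hδ
  -- the first order terms of the functions are those of their logarithms, up to the factor `|β|`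
  have hexp := coeff_crossFold_sub n hβ ts (fun t _ => coeff_zero_prodAt hW (κ t))
    (fun t _ => coeff_zero_prodAt hW' (κ' t)) hc
    (CongrMod.refl _ (monomial 0 (AddMonoidAlgebra.single m (1 : k)) :
      MvPowerSeries I (AddMonoidAlgebra k (ι → ℤ)))) (m := m) (by simp)
  rw [sub_self, zero_add] at hexp
  rw [← Finsupp.sub_apply, ← AddMonoidAlgebra.coeff_sub, hexp]
  have hterm : ∀ t ∈ ts, (β.degree : k) * (dotProduct (n t) m • (AddMonoidAlgebra.single m (1 : k) *
      (coeff β (prodAt (trunc D' J) (κ' t)) - coeff β (prodAt (trunc D J) (κ t))))).coeff (m + m₀) =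
      dotProduct (n t) m • ((logAt D' (κ' t) β).coeff m₀ - (logAt D (κ t) β).coeff m₀) := by
    intro t ht
    have e := coeff_logDer_sub (coeff_zero_prodAt hW' (κ' t)) (coeff_zero_prodAt hW (κ t))
      (hc t ht).symm
    rw [coeff_logDer_prodAt_trunc hD hβJ, coeff_logDer_prodAt_trunc hD' hβJ] at e
    rw [← Finsupp.sub_apply, ← AddMonoidAlgebra.coeff_sub, e, AddMonoidAlgebra.coeff_smul,
      Finsupp.smul_apply, AddMonoidAlgebra.coeff_single_mul_add, one_mul,
      mul_smul_comm, ← nsmul_eq_mul, ← nsmul_eq_mul, AddMonoidAlgebra.coeff_smul,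
      Finsupp.smul_apply]
  have hsum : ∀ l : List ℝ, (∀ t ∈ l, t ∈ ts) → (β.degree : k) *
      (l.map fun t => dotProduct (n t) m • (AddMonoidAlgebra.single m (1 : k) *
        (coeff β (prodAt (trunc D' J) (κ' t)) -
          coeff β (prodAt (trunc D J) (κ t))))).sum.coeff (m + m₀) =
      (l.map fun t => dotProduct (n t) m •
        ((logAt D' (κ' t) β).coeff m₀ - (logAt D (κ t) β).coeff m₀)).sum := by
    intro l hl
    induction l with
    | nil => simp
    | cons t l ih =>
      simp only [List.forall_mem_cons] at hl
      rw [List.map_cons, List.sum_cons, List.map_cons, List.sum_cons, AddMonoidAlgebra.coeff_add,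
        Finsupp.add_apply, mul_add, hterm t hl.1, ih hl.2]
  exact hsum ts fun t ht => ht

/-- The comparison of `sum_crossings`, for a path and its translate by `y₀` in general position. -/
theorem exists_sum_crossings {D D' : Set (Wall k I ι)} (hD : IsScatteringDiagram D)
    (hD' : IsScatteringDiagram D') {β : I →₀ ℕ} (hβ : β ≠ 0) {y₀ : ι → ℝ} {κ : ℝ → ι → ℝ}
    (hκ : IsTransversalPath Wall.cone (trunc D (β.degree + 1)) κ)
    (hκ' : IsTransversalPath Wall.cone (trunc D' (β.degree + 1)) fun t => κ t + y₀)
    (hspan : ∀ t, ∀ w ∈ trunc D (β.degree + 1), ∀ w' ∈ trunc D' (β.degree + 1),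
      κ t ∈ Submodule.span ℝ w.cone → κ t + y₀ ∈ Submodule.span ℝ w'.cone →
      Submodule.span ℝ w.cone = Submodule.span ℝ w'.cone)
    (hlog : ∀ t, ∀ δ : I →₀ ℕ, δ.degree < β.degree → logAt D (κ t) δ = logAt D' (κ t + y₀) δ) :
    ∃ (ts : List ℝ) (n : ℝ → ι → ℤ), ts.Pairwise (· < ·) ∧
      (∀ t ∈ ts, t ∈ Set.Icc (0 : ℝ) 1 ∧ n t ≠ 0 ∧
        ((∃ w ∈ trunc D (β.degree + 1), κ t ∈ w.cone) ∨
          ∃ w ∈ trunc D' (β.degree + 1), κ t + y₀ ∈ w.cone)) ∧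
      (∀ t ∈ Set.Icc (0 : ℝ) 1, ∀ w ∈ trunc D (β.degree + 1), κ t ∈ w.cone → t ∈ ts) ∧
      (∀ t ∈ Set.Icc (0 : ℝ) 1, ∀ w ∈ trunc D' (β.degree + 1), κ t + y₀ ∈ w.cone → t ∈ ts) ∧
      ∃ L L', IsCrossingList Wall.cone (trunc D (β.degree + 1)) κ L ∧
        IsCrossingList Wall.cone (trunc D' (β.degree + 1)) (fun t => κ t + y₀) L' ∧
        ∀ m m₀ : ι → ℤ, (β.degree : k) * ((coeff β (pathProduct (fun t => κ t + y₀) L'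
          (monomial 0 (AddMonoidAlgebra.single m 1)))).coeff (m + m₀) -
          (coeff β (pathProduct κ L (monomial 0 (AddMonoidAlgebra.single m 1)))).coeff (m + m₀)) =
        (ts.map fun t => dotProduct (n t) m •
          ((logAt D' (κ t + y₀) β).coeff m₀ - (logAt D (κ t) β).coeff m₀)).sum := by
  obtain ⟨ts, n, h1, h2, h3, h4, h5, h6⟩ := exists_common_times (hD.2 _) (hD.isWallCone _)
    (hD'.2 _) (hD'.isWallCone _) (fun t => by rw [deriv_add_const]) hκ hκ'
    fun t _ w hw w' hw' htw htw' => hspan t w hw w' hw' (Submodule.subset_span htw)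
      (Submodule.subset_span htw')
  obtain ⟨L, hL⟩ := hκ.exists_crossingList (hD.2 _) (hD.isWallCone _)
  obtain ⟨L', hL'⟩ := hκ'.exists_crossingList (hD'.2 _) (hD'.isWallCone _)
  refine ⟨ts, n, h1, fun t ht => ⟨(h2 t ht).1, ?_, (h2 t ht).2⟩, h5, h6, L, L', hL, hL',
    fun m m₀ => sum_crossings hD hD' hβ h1 (fun t ht => (h2 t ht).1) h3 h4 h5 h6
      (fun t _ => hlog t) hL hL' m m₀⟩
  rcases (h2 t ht).2 with ⟨w, hw, htw⟩ | ⟨w, hw, htw⟩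
  · exact (h3 t ht w hw htw).1.primitive.ne_zero
  · exact (h4 t ht w hw htw).1.primitive.ne_zero

theorem dotProduct_self_ne_zero {n : ι → ℤ} (hn : n ≠ 0) : dotProduct n n ≠ 0 := fun h => by
  have := pair_toReal_self_pos hn
  rw [pair_toReal, h] at this
  simp at this

/-- Only the walls of `In` contribute to a coefficient with exponent `m₀` of the logarithm, at the
points where the walls which do not contain `m₀` have been left. -/
theorem coeff_logAt_eq_of_outgoing {D In : Set (Wall k I ι)} (hD : IsScatteringDiagram D)
    (hIn : In ⊆ D) (hout : ∀ w ∈ D \ In, ¬ w.Incoming) {β : I →₀ ℕ} {x : ι → ℝ} {m₀ : ι → ℤ}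
    (h : ∀ w ∈ trunc D (β.degree + 1), toReal m₀ ∉ w.cone → x ∉ w.cone) :
    (logAt D x β).coeff m₀ = (logAt In x β).coeff m₀ := by
  rw [logAt_eq_add hD hIn, AddMonoidAlgebra.coeff_add, Finsupp.add_apply,
    coeff_logAt_eq_zero (D := D \ In), add_zero]
  intro w hw hxw
  by_contra hne
  refine h w ?_ ((hD.1 w hw.1).toReal_notMem (hout w hw) hne) hxw
  by_contra hwt
  exact hne (by rw [coeff_logDer_eq_zero hD.1 hw.1 hwt (Nat.lt_succ_self _)]; rfl)

theorem eventually_mem_submodule_imp (W : Submodule ℝ (ι → ℝ)) (x y₀ : ι → ℝ) :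
    ∀ᶠ y in 𝓝 x, y + y₀ ∈ W → x + y₀ ∈ W := by
  by_cases h : x + y₀ ∈ W
  · exact Eventually.of_forall fun _ _ => h
  · have hc : IsOpen {y | y + y₀ ∉ W} :=
      (W.closed_of_finiteDimensional.isOpen_compl).preimage (continuous_id.add continuous_const)
    filter_upwards [hc.mem_nhds h] with y hy h'
    exact absurd h' hy

theorem logAt_zero_of_forall_notMem {D : Set (Wall k I ι)} (hD : IsScatteringDiagram D) {β : I →₀ ℕ}
    {x : ι → ℝ} (h : ∀ w ∈ trunc D (β.degree + 1), x ∉ w.cone) : logAt D x β = 0 := by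
  rw [← coeff_logDer_prodAt_trunc hD (Nat.lt_succ_self _), prodAt_of_forall_notMem h, logDer_one,
    map_zero]

/-- The walls of the set `T` near `x`, and far away in the direction `m`, all up to a translation by
`y₀`: near `x`, one meets no wall which does not pass through `x`, and from `S₀ • m` on in the
direction `m` all walls which do not contain `m` have been left. -/
theorem exists_local_radius {T : Set (Wall k I ι)} (hT : T.Finite)
    (hTc : ∀ w ∈ T, IsWallCone w.cone) (m : ι → ℝ) {x y₀ : ι → ℝ}
    (hx : x + y₀ ∉ singularLocus Wall.cone T) :
    ∀ᶠ S₀ in atTop, ∀ᶠ y in 𝓝 x,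
      (∀ w ∈ T, y + y₀ ∈ w.cone ↔ x + y₀ ∈ w.cone ∧ y + y₀ ∈ Submodule.span ℝ w.cone) ∧
      (∀ w ∈ T, y + y₀ ∈ Submodule.span ℝ w.cone → x + y₀ ∈ Submodule.span ℝ w.cone) ∧
      ∀ w ∈ T, m ∉ w.cone → ∀ S : ℝ, S₀ ≤ S → y + y₀ + S • m ∉ w.cone := by
  have ht : Tendsto (fun y => y + y₀) (𝓝 x) (𝓝 (x + y₀)) :=
    (continuous_id.add continuous_const).tendsto x
  have h1 : ∀ᶠ S₀ in atTop, ∀ w ∈ T, m ∉ w.cone → ∀ᶠ y in 𝓝 x, ∀ S : ℝ, S₀ ≤ S →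
      y + y₀ + S • m ∉ w.cone := by
    refine (eventually_all_finite hT).2 fun w hw => ?_
    by_cases hm : m ∈ w.cone
    · exact Eventually.of_forall fun _ h => absurd hm h
    · filter_upwards [eventually_add_smul_notMem (hTc w hw).1 hm (x + y₀)] with S₀ hS₀ _
      exact ht.eventually hS₀
  filter_upwards [h1] with S₀ hS₀
  refine (ht.eventually (eventually_mem_cone_iff hT hTc hx)).and
    (((eventually_all_finite hT).2 fun w _ => eventually_mem_submodule_imp _ x y₀).and
      ((eventually_all_finite hT).2 fun w hw => ?_))
  by_cases hm : m ∈ w.cone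
  · exact Eventually.of_forall fun _ h => absurd hm h
  · filter_upwards [hS₀ w hw hm] with y hy _
    exact hy

end Uniqueness
end HDTVCluster

namespace HDTVCluster

/-! ### Uniqueness of consistent completions: the inductive step -/

section Uniqueness

open Filter Topology MvPowerSeries MeasureTheory

variable {k I ι : Type*} [Field k] [Fintype ι]

/-- Near a point `x` all of whose walls span the hyperplane `H`, up to a translation by `y₀`, one
meets walls only in `x + H`; this remains true after moving in a direction tangent to the wall. -/
theorem sub_mem_of_near {T : Set (Wall k I ι)} {m x y y₀ : ι → ℝ} {H : Submodule ℝ (ι → ℝ)}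
    (hH : ∀ w ∈ T, x + y₀ ∈ Submodule.span ℝ w.cone → Submodule.span ℝ w.cone = H)
    (h1 : ∀ w ∈ T, y + y₀ ∈ w.cone ↔ x + y₀ ∈ w.cone ∧ y + y₀ ∈ Submodule.span ℝ w.cone)
    (h2 : ∀ w ∈ T, y + y₀ ∈ Submodule.span ℝ w.cone → x + y₀ ∈ Submodule.span ℝ w.cone) :
    (∀ w ∈ T, y + y₀ ∈ w.cone → y - x ∈ H) ∧
    (y - x ∈ H → ∀ w ∈ T, y + y₀ ∈ w.cone ↔ x + y₀ ∈ w.cone) ∧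
    ∀ w ∈ T, m ∈ Submodule.span ℝ w.cone → ∀ S : ℝ, y + y₀ + S • m ∈ w.cone → y - x ∈ H := by
  have key : ∀ w ∈ T, y + y₀ ∈ Submodule.span ℝ w.cone → y - x ∈ H := by
    intro w hw hyw
    have hxw := h2 w hw hyw
    have := Submodule.sub_mem _ hyw hxw
    rwa [add_sub_add_right_eq_sub, hH w hw hxw] at this
  refine ⟨fun w hw hyw => key w hw (Submodule.subset_span hyw), fun hyx w hw => ?_,
    fun w hw hm S hyw => key w hw ?_⟩
  · rw [h1 w hw]
    refine and_iff_left_of_imp fun hxw => ?_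
    have hxs : x + y₀ ∈ Submodule.span ℝ w.cone := Submodule.subset_span hxw
    have e : y + y₀ = (y - x) + (x + y₀) := by abel
    rw [e]
    exact Submodule.add_mem _ (hH w hw hxs ▸ hyx) hxs
  · have := Submodule.sub_mem _ (Submodule.subset_span hyw) (Submodule.smul_mem _ S hm)
    rwa [add_sub_cancel_right] at this

variable [CharZero k] [Finite I]

/-- The points at which the comparison of `T` with the translate of `T'` may fail, because they lie
on different hyperplanes spanned by walls. -/
def nonparallelLocus (T T' : Set (Wall k I ι)) (y₀ : ι → ℝ) : Set (ι → ℝ) :=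
  {x | ∃ w ∈ T, ∃ w' ∈ T, x + 0 ∈ Submodule.span ℝ w.cone ∧ x + 0 ∈ Submodule.span ℝ w'.cone ∧
      Submodule.span ℝ w.cone ≠ Submodule.span ℝ w'.cone} ∪
  ({x | ∃ w ∈ T, ∃ w' ∈ T', x + 0 ∈ Submodule.span ℝ w.cone ∧ x + y₀ ∈ Submodule.span ℝ w'.cone ∧
      Submodule.span ℝ w.cone ≠ Submodule.span ℝ w'.cone} ∪
  {x | ∃ w ∈ T', ∃ w' ∈ T', x + y₀ ∈ Submodule.span ℝ w.cone ∧ x + y₀ ∈ Submodule.span ℝ w'.cone ∧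
      Submodule.span ℝ w.cone ≠ Submodule.span ℝ w'.cone})

theorem small_nonparallelLocus {T T' : Set (Wall k I ι)} (hT : T.Countable)
    (hTc : ∀ w ∈ T, IsWallCone w.cone) (hT' : T'.Countable) (hTc' : ∀ w ∈ T', IsWallCone w.cone)
    (y₀ : ι → ℝ) : Small (nonparallelLocus T T' y₀) :=
  (small_nonparallel hT hTc hT hTc 0 0).union
    ((small_nonparallel hT hTc hT' hTc' 0 y₀).union (small_nonparallel hT' hTc' hT' hTc' y₀ y₀))

/-- The hyperplane spanned by the walls of both diagrams at a point which is not in the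
`nonparallelLocus`. -/
theorem exists_hyperplane {T T' : Set (Wall k I ι)} (hTc : ∀ w ∈ T, IsWallCone w.cone)
    (hTc' : ∀ w ∈ T', IsWallCone w.cone) {x y₀ : ι → ℝ} (hx : x ∉ nonparallelLocus T T' y₀)
    (hw : (∃ w ∈ T, x ∈ w.cone) ∨ ∃ w ∈ T', x + y₀ ∈ w.cone) :
    ∃ (H : Submodule ℝ (ι → ℝ)) (n : ι → ℤ), n ≠ 0 ∧ (∀ y, y ∈ H ↔ pair n y = 0) ∧
      (∀ w ∈ T, x + 0 ∈ Submodule.span ℝ w.cone → Submodule.span ℝ w.cone = H) ∧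
      ∀ w ∈ T', x + y₀ ∈ Submodule.span ℝ w.cone → Submodule.span ℝ w.cone = H := by
  simp only [nonparallelLocus, Set.mem_union, Set.mem_ofPred_eq, not_or, not_exists, not_and,
    not_not] at hx
  obtain ⟨h1, h2, h3⟩ := hx
  rcases hw with ⟨w, hw, hxw⟩ | ⟨w, hw, hxw⟩
  · obtain ⟨n, hn⟩ := (hTc w hw).exists_normal
    have hxw : x + 0 ∈ Submodule.span ℝ w.cone := by
      rw [add_zero]; exact Submodule.subset_span hxw
    exact ⟨_, n, hn.primitive.ne_zero, hn.mem_span_iff, fun w' hw' h => h1 w' hw' w hw h hxw,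
      fun w' hw' h => (h2 w hw w' hw' hxw h).symm⟩
  · obtain ⟨n, hn⟩ := (hTc' w hw).exists_normal
    have hxw : x + y₀ ∈ Submodule.span ℝ w.cone := Submodule.subset_span hxw
    exact ⟨_, n, hn.primitive.ne_zero, hn.mem_span_iff, fun w' hw' h => h2 w' hw' w hw h hxw,
      fun w' hw' h => h3 w' hw' w hw h hxw⟩

theorem eq_singleton_of_pairwise_lt {ts : List ℝ} (h : ts.Pairwise (· < ·)) {t : ℝ}
    (hmem : t ∈ ts) (heq : ∀ s ∈ ts, s = t) : ts = [t] := by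
  match ts, h, hmem, heq with
  | [s], _, hmem, _ => rw [List.mem_singleton.1 hmem]
  | s :: s' :: l, h, _, heq =>
    have h1 := heq s (by simp)
    have h2 := heq s' (by simp)
    have h3 := (List.pairwise_cons.1 h).1 s' (by simp)
    exact absurd h3 (by rw [h1, h2]; exact lt_irrefl t)

/-- The inductive step of the uniqueness of consistent completions.  At a general point `x` of a
hyperplane, the coefficient with exponent `m₀` of the logarithm is computed by crossing the
hyperplane near `x`; by consistency, one can as well cross it far away in the direction `m₀`, where
all outgoing walls which contribute to this coefficient have been left. -/
theorem logAt_add_eq_of_lower {D D' In In' : Set (Wall k I ι)} (hD : IsScatteringDiagram D)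
    (hD' : IsScatteringDiagram D') (hc : IsConsistent D) (hc' : IsConsistent D') (hIn : In ⊆ D)
    (hIn' : In' ⊆ D') (hout : ∀ w ∈ D \ In, ¬ w.Incoming) (hout' : ∀ w ∈ D' \ In', ¬ w.Incoming)
    {y₀ : ι → ℝ} (hinit : ∀ x β, logAt In x β = logAt In' (x + y₀) β) {β : I →₀ ℕ} (hβ : β ≠ 0)
    {Z : Set (ι → ℝ)} (hZ : Small Z)
    (hlower : ∀ x ∉ Z, ∀ δ : I →₀ ℕ, δ.degree < β.degree → logAt D x δ = logAt D' (x + y₀) δ)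
    {x : ι → ℝ} (hx : x ∉ singularLocus Wall.cone (trunc D (β.degree + 1)))
    (hx' : x + y₀ ∉ singularLocus Wall.cone (trunc D' (β.degree + 1)))
    (hxn : x ∉ nonparallelLocus (trunc D (β.degree + 1)) (trunc D' (β.degree + 1)) y₀) :
    logAt D x β = logAt D' (x + y₀) β := by
  set T := trunc D (β.degree + 1) with hTdef
  set T' := trunc D' (β.degree + 1) with hTdef'
  have hTc : ∀ w ∈ T, IsWallCone w.cone := hD.isWallCone _
  have hTc' : ∀ w ∈ T', IsWallCone w.cone := hD'.isWallCone _
  have hTf : T.Finite := hD.2 _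
  have hTf' : T'.Finite := hD'.2 _
  by_cases hwall : (∃ w ∈ T, x ∈ w.cone) ∨ ∃ w ∈ T', x + y₀ ∈ w.cone
  swap
  · push Not at hwall
    rw [logAt_zero_of_forall_notMem hD hwall.1, logAt_zero_of_forall_notMem hD' hwall.2]
  obtain ⟨H, n, hn0, hHn, hH, hH'⟩ := exists_hyperplane hTc hTc' hxn hwall
  have hNsmall := small_nonparallelLocus hTf.countable hTc hTf'.countable hTc' y₀
  have hmemT : ∀ w ∈ D, ∀ m : ι → ℤ, (coeff β (logDer w.func)).coeff m ≠ 0 → w ∈ T := by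
    intro w hw m hne
    by_contra hwt
    exact hne (by rw [coeff_logDer_eq_zero hD.1 hw hwt (Nat.lt_succ_self _)]; rfl)
  have hmemT' : ∀ w ∈ D', ∀ m : ι → ℤ, (coeff β (logDer w.func)).coeff m ≠ 0 → w ∈ T' := by
    intro w hw m hne
    by_contra hwt
    exact hne (by rw [coeff_logDer_eq_zero hD'.1 hw hwt (Nat.lt_succ_self _)]; rfl)
  refine AddMonoidAlgebra.ext (Finsupp.ext fun m₀ => ?_)
  by_cases hm₀ : toReal m₀ ∈ H
  swap
  -- the exponents of the functions of the walls through `x` are tangent to `H`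
  · rw [coeff_logAt_eq_zero, coeff_logAt_eq_zero]
    · intro w hw hxw
      by_contra hne
      have h1 := (hD'.1 w hw).toReal_mem_span hne
      rw [hH' w (hmemT' w hw _ hne) (Submodule.subset_span hxw)] at h1
      exact hm₀ h1
    · intro w hw hxw
      by_contra hne
      have h1 := (hD.1 w hw).toReal_mem_span hne
      rw [hH w (hmemT w hw _ hne) (by rw [add_zero]; exact Submodule.subset_span hxw)] at h1
      exact hm₀ h1
  -- choice of the distance `S₀` and of the radius `r`
  have hx0 : x + 0 ∉ singularLocus Wall.cone T := by rwa [add_zero]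
  obtain ⟨S₀, ⟨hS, hS'⟩, hS0⟩ := (((exists_local_radius hTf hTc (toReal m₀) hx0).and
    (exists_local_radius hTf' hTc' (toReal m₀) hx')).and (eventually_ge_atTop 0)).exists
  obtain ⟨r, hr, hball⟩ := Metric.eventually_nhds_iff.1 (hS.and hS')
  have hN := pair_toReal_self_pos hn0
  obtain ⟨δ, hδ, hδr⟩ : ∃ δ : ℝ, 0 < δ ∧ δ * ‖toReal n‖ < r / 2 := by
    refine ⟨r / 2 / (‖toReal n‖ + 1), by positivity, ?_⟩
    rw [div_mul_eq_mul_div, div_lt_iff₀ (by positivity)]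
    nlinarith [norm_nonneg (toReal n)]
  -- the two curves, for `c = 0` and `c = 8 * S₀`, have common endpoints on the two sides of the
  -- hyperplane, and differ by `(8 * S₀ * (t * (1 - t))) • m₀`, which is at least `S₀ • m₀` for `t`
  -- between `1 / 4` and `3 / 4`
  let γ : ℝ → ℝ → ι → ℝ := fun c t =>
    x + (2 * t - 1) • (δ • toReal n) + (c * (t * (1 - t))) • toReal m₀
  have hγ : ∀ c, ContDiff ℝ 1 (γ c) := fun c => by fun_prop
  have hae : ∀ c, ∀ᵐ v : ι → ℝ, (IsTransversalPath Wall.cone T (fun t => γ c t + v) ∧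
      IsTransversalPath Wall.cone T' (fun t => γ c t + v + y₀)) ∧
      ∀ t, γ c t + v ∉ Z ∪ nonparallelLocus T T' y₀ := by
    intro c
    have h2 := ae_isTransversalPath hTf'.countable hTc' ((hγ c).add (contDiff_const (c := y₀)))
    filter_upwards [ae_isTransversalPath hTf.countable hTc (hγ c), h2,
      (hZ.union hNsmall).ae_forall_notMem (hγ c)] with v hv1 hv2 hv3
    refine ⟨⟨hv1, ?_⟩, hv3⟩
    have e : (fun t => γ c t + v + y₀) = fun t => γ c t + y₀ + v := by
      funext t; exact add_right_comm _ _ _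
    rw [e]
    exact hv2
  have hvn : ∀ᶠ v in 𝓝 (0 : ι → ℝ), |pair n v| < δ * pair n (toReal n) / 2 := by
    have h := ((continuous_pair n).abs.tendsto 0)
    rw [pair_zero, abs_zero] at h
    exact h.eventually_lt_const (by positivity)
  have hvr : ∀ᶠ v in 𝓝 (0 : ι → ℝ), ‖v‖ < r / 2 := by
    have h := (continuous_norm (E := ι → ℝ)).tendsto 0
    rw [norm_zero] at h
    exact h.eventually_lt_const (by positivity)
  -- a small vector `v` such that both curves are in general position after translation by `v`
  obtain ⟨v, ⟨⟨⟨a1, a2⟩, a3⟩, ⟨b1, b2⟩, b3⟩, hv1, hv2⟩ := exists_of_ae_of_eventually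
    ((hae 0).and (hae (8 * S₀))) (hvn.and hvr)
  let y : ℝ → ι → ℝ := fun t => x + (2 * t - 1) • (δ • toReal n) + v
  have hyγ : ∀ c t, γ c t + v = y t + (c * (t * (1 - t))) • toReal m₀ := fun c t =>
    add_right_comm _ _ _
  have hyx : ∀ t, pair n (y t - x) = (2 * t - 1) * (δ * pair n (toReal n)) + pair n v := by
    intro t
    have e : y t - x = (2 * t - 1) • (δ • toReal n) + v := by
      change x + (2 * t - 1) • (δ • toReal n) + v - x = _
      abel
    rw [e, pair_add, pair_smul, pair_smul]
  have hnear : ∀ t ∈ Set.Icc (0 : ℝ) 1, dist (y t) x < r := by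
    intro t ht
    have e : y t - x = (2 * t - 1) • (δ • toReal n) + v := by
      change x + (2 * t - 1) • (δ • toReal n) + v - x = _
      abel
    rw [dist_eq_norm, e]
    refine (norm_add_le _ _).trans_lt ?_
    rw [norm_smul, norm_smul, Real.norm_of_nonneg hδ.le]
    have : ‖2 * t - 1‖ ≤ 1 := by
      rw [Real.norm_eq_abs, abs_le]
      constructor <;> linarith [ht.1, ht.2]
    have := mul_le_of_le_one_left (by positivity : 0 ≤ δ * ‖toReal n‖) this
    linarith
  have hfacts : ∀ t ∈ Set.Icc (0 : ℝ) 1, _ := fun t ht =>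
    sub_mem_of_near (m := toReal m₀) hH (hball (hnear t ht)).1.1 (hball (hnear t ht)).1.2.1
  have hfacts' : ∀ t ∈ Set.Icc (0 : ℝ) 1, _ := fun t ht =>
    sub_mem_of_near (m := toReal m₀) hH' (hball (hnear t ht)).2.1 (hball (hnear t ht)).2.2.1
  simp only [add_zero] at hfacts hball
  -- the time `t₀` when the hyperplane is crossed
  have hδN : 0 < δ * pair n (toReal n) := by positivity
  obtain ⟨t₀, ht₀⟩ : ∃ t₀ : ℝ, (2 * t₀ - 1) * (δ * pair n (toReal n)) + pair n v = 0 :=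
    ⟨(1 - pair n v / (δ * pair n (toReal n))) / 2, by field_simp; ring⟩
  have hstar : ∀ t, y t - x ∈ H ↔ t = t₀ := by
    intro t
    rw [hHn, hyx]
    refine ⟨fun h => ?_, fun h => h ▸ ht₀⟩
    have : (2 * t - 2 * t₀) * (δ * pair n (toReal n)) = 0 := by linarith
    rcases mul_eq_zero.1 this with h' | h'
    · linarith
    · exact absurd h' hδN.ne'
  have hquarter : 1 / 4 < t₀ ∧ t₀ < 3 / 4 := by
    rw [abs_lt] at hv1
    constructor <;> nlinarith
  have ht₀I : t₀ ∈ Set.Icc (0 : ℝ) 1 := ⟨by linarith, by linarith⟩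
  -- comparison of the path ordered products along the two curves
  have hspan : ∀ z ∉ Z ∪ nonparallelLocus T T' y₀, ∀ w ∈ T, ∀ w' ∈ T',
      z ∈ Submodule.span ℝ w.cone → z + y₀ ∈ Submodule.span ℝ w'.cone →
      Submodule.span ℝ w.cone = Submodule.span ℝ w'.cone := by
    intro z hz w hw w' hw' h h'
    by_contra hne
    exact hz (Or.inr (Or.inr (Or.inl ⟨w, hw, w', hw', by rwa [add_zero], h', hne⟩)))
  obtain ⟨ts, ν, c1, c2, c3, c4, L, L', hL, hL', hsum⟩ := exists_sum_crossings hD hD' hβ a1 a2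
    (fun t => hspan _ (a3 t)) fun t => hlower _ fun h => a3 t (Or.inl h)
  obtain ⟨ts', ν', d1, d2, d3, d4, K, K', hK, hK', hsum'⟩ := exists_sum_crossings hD hD' hβ b1 b2
    (fun t => hspan _ (b3 t)) fun t => hlower _ fun h => b3 t (Or.inl h)
  have hγ0 : ∀ c : ℝ, γ c 0 + v = y 0 := fun c => by rw [hyγ]; simp
  have hγ1 : ∀ c : ℝ, γ c 1 + v = y 1 := fun c => by rw [hyγ]; simp
  have hcons : ∀ g, coeff β (pathProduct (fun t => γ 0 t + v) L g) =
      coeff β (pathProduct (fun t => γ (8 * S₀) t + v) K g) := fun g =>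
    hc _ _ _ a1 b1 (by simp only [hγ0]) (by simp only [hγ1]) L K hL hK g β (Nat.lt_succ_self _)
  have hcons' : ∀ g, coeff β (pathProduct (fun t => γ 0 t + v + y₀) L' g) =
      coeff β (pathProduct (fun t => γ (8 * S₀) t + v + y₀) K' g) := fun g =>
    hc' _ _ _ a2 b2 (by simp only [hγ0]) (by simp only [hγ1]) L' K' hL' hK' g β
      (Nat.lt_succ_self _)
  -- the curve which passes far away does not see the difference of the diagrams
  have hfar : ∀ t ∈ ts', (logAt D' (γ (8 * S₀) t + v + y₀) β).coeff m₀ -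
      (logAt D (γ (8 * S₀) t + v) β).coeff m₀ = 0 := by
    intro t ht
    have htI := (d2 t ht).1
    have e' : γ (8 * S₀) t + v + y₀ = y t + y₀ + (8 * S₀ * (t * (1 - t))) • toReal m₀ := by
      rw [hyγ, add_right_comm]
    rw [sub_eq_zero, e', hyγ]
    by_cases htt : t = t₀
    · have hSt : S₀ ≤ 8 * S₀ * (t * (1 - t)) := by
        have : (1 : ℝ) / 8 ≤ t * (1 - t) := by rw [htt]; nlinarith
        nlinarith
      rw [coeff_logAt_eq_of_outgoing hD hIn hout fun w hw hmw =>
          (hball (hnear t htI)).1.2.2 w hw hmw _ hSt,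
        coeff_logAt_eq_of_outgoing hD' hIn' hout' fun w hw hmw =>
          (hball (hnear t htI)).2.2.2 w hw hmw _ hSt, hinit, add_right_comm]
    · rw [coeff_logAt_eq_zero, coeff_logAt_eq_zero]
      · intro w hw hyw
        by_contra hne
        exact htt ((hstar t).1 ((hfacts t htI).2.2 w (hmemT w hw _ hne)
          ((hD.1 w hw).toReal_mem_span hne) _ hyw))
      · intro w hw hyw
        by_contra hne
        exact htt ((hstar t).1 ((hfacts' t htI).2.2 w (hmemT' w hw _ hne)
          ((hD'.1 w hw).toReal_mem_span hne) _ hyw))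
  have hy0 : ∀ t, γ 0 t + v = y t := fun t => by rw [hyγ, zero_mul, zero_smul, add_zero]
  simp only [hy0] at c2 c3 c4 hsum
  -- the short curve only crosses at the time `t₀`
  have hall : ∀ t ∈ ts, t = t₀ := by
    intro t ht
    obtain ⟨htI, -, ⟨w, hw, hyw⟩ | ⟨w, hw, hyw⟩⟩ := c2 t ht
    · exact (hstar t).1 ((hfacts t htI).1 w hw hyw)
    · exact (hstar t).1 ((hfacts' t htI).1 w hw hyw)
  have hmem : t₀ ∈ ts := by
    rcases hwall with ⟨w, hw, hxw⟩ | ⟨w, hw, hxw⟩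
    · exact c3 t₀ ht₀I w hw (((hfacts t₀ ht₀I).2.1 ((hstar t₀).2 rfl) w hw).2 hxw)
    · exact c4 t₀ ht₀I w hw (((hfacts' t₀ ht₀I).2.1 ((hstar t₀).2 rfl) w hw).2 hxw)
  have hts := eq_singleton_of_pairwise_lt c1 hmem hall
  have h1 := hsum (ν t₀) m₀
  have h2 := hsum' (ν t₀) m₀
  rw [List.sum_eq_zero (fun a ha => by
    obtain ⟨t, ht, rfl⟩ := List.mem_map.1 ha
    rw [hfar t ht, smul_zero]), ← hcons, ← hcons'] at h2
  simp only [hy0] at h2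
  rw [h2, hts, List.map_singleton, List.sum_singleton] at h1
  have h3 := (smul_eq_zero.1 h1.symm).resolve_left (dotProduct_self_ne_zero (c2 t₀ hmem).2.1)
  rw [sub_eq_zero] at h3
  have h4 : logAt D (y t₀) β = logAt D x β := by
    rw [← logAt_trunc hD.1 _ (Nat.lt_succ_self _), ← logAt_trunc hD.1 x (Nat.lt_succ_self _)]
    exact logAt_congr (fun w => and_congr_right fun hw =>
      (hfacts t₀ ht₀I).2.1 ((hstar t₀).2 rfl) w hw) β
  have h5 : logAt D' (y t₀ + y₀) β = logAt D' (x + y₀) β := by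
    rw [← logAt_trunc hD'.1 _ (Nat.lt_succ_self _),
      ← logAt_trunc hD'.1 (x + y₀) (Nat.lt_succ_self _)]
    exact logAt_congr (fun w => and_congr_right fun hw =>
      (hfacts' t₀ ht₀I).2.1 ((hstar t₀).2 rfl) w hw) β
  rw [← h4, ← h5]
  exact h3.symm

/-- Uniqueness of consistent completions, up to a translation under which the initial diagrams
correspond to each other. -/
theorem exists_small_logAt_add_eq {D D' In In' : Set (Wall k I ι)} (hD : IsScatteringDiagram D)
    (hD' : IsScatteringDiagram D') (hc : IsConsistent D) (hc' : IsConsistent D') (hIn : In ⊆ D)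
    (hIn' : In' ⊆ D') (hout : ∀ w ∈ D \ In, ¬ w.Incoming) (hout' : ∀ w ∈ D' \ In', ¬ w.Incoming)
    {y₀ : ι → ℝ} (hinit : ∀ x β, logAt In x β = logAt In' (x + y₀) β) :
    ∃ Z, Small Z ∧ ∀ x ∉ Z, ∀ β, logAt D x β = logAt D' (x + y₀) β := by
  have hstep : ∀ j : ℕ, ∃ Z, Small Z ∧ ∀ x ∉ Z, ∀ β : I →₀ ℕ, β.degree < j →
      logAt D x β = logAt D' (x + y₀) β := by
    intro j
    induction j with
    | zero => exact ⟨∅, small_empty, fun x _ β hβ => absurd hβ (Nat.not_lt_zero _)⟩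
    | succ j ih =>
      obtain ⟨Z, hZ, ih⟩ := ih
      refine ⟨Z ∪ (singularLocus Wall.cone (trunc D (j + 1)) ∪
        ({x | x + y₀ ∈ singularLocus Wall.cone (trunc D' (j + 1))} ∪
          nonparallelLocus (trunc D (j + 1)) (trunc D' (j + 1)) y₀)),
        hZ.union ((small_singularLocus (hD.2 _).countable (hD.isWallCone _)).union
          (((small_singularLocus (hD'.2 _).countable (hD'.isWallCone _)).preimage_add y₀).union
            (small_nonparallelLocus (hD.2 _).countable (hD.isWallCone _) (hD'.2 _).countable
              (hD'.isWallCone _) y₀))), fun x hx β hβ => ?_⟩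
      simp only [Set.mem_union, not_or] at hx
      obtain ⟨hx1, hx2, hx3, hx4⟩ := hx
      rcases Nat.lt_succ_iff_lt_or_eq.1 hβ with h | h
      · exact ih x hx1 β h
      · subst h
        by_cases hβ0 : β = 0
        · rw [hβ0, logAt_zero_index, logAt_zero_index]
        · exact logAt_add_eq_of_lower hD hD' hc hc' hIn hIn' hout hout' hinit hβ0 hZ ih hx2 hx3 hx4
  choose Z hZ h using hstep
  refine ⟨⋃ j, Z j, Small.iUnion hZ, fun x hx β => h (β.degree + 1) x (fun hh => hx ?_) β
    (Nat.lt_succ_self _)⟩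
  exact Set.mem_iUnion.2 ⟨_, hh⟩

theorem IsCompletion.genEq {In D D' : Set (Wall k I ι)} (h : IsCompletion In D)
    (h' : IsCompletion In D') : GenEq D D' := by
  obtain ⟨Z, hZ, hh⟩ := exists_small_logAt_add_eq (y₀ := 0) h.1 h'.1 h.2.2.1 h'.2.2.1 h.2.1 h'.2.1
    h.2.2.2 h'.2.2.2 fun x β => by rw [add_zero]
  exact ⟨Z, hZ, fun x hx β => by simpa using hh x hx β⟩

end Uniqueness
end HDTVCluster

namespace HDTVCluster

/-! ### The walls attached to `C`-walls -/

theorem single_right_injective {k M : Type*} [Semiring k] (m : M) :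
    Function.Injective (AddMonoidAlgebra.single m : k → AddMonoidAlgebra k M) := by
  intro a b h
  have := congrArg (fun x => x.coeff m) h
  simpa using this

theorem single_finset_sum {k M α : Type*} [Semiring k] (m : M) (s : Finset α) (f : α → k) :
    (AddMonoidAlgebra.single m (∑ a ∈ s, f a) : AddMonoidAlgebra k M) =
      ∑ a ∈ s, AddMonoidAlgebra.single m (f a) := by
  classical
  induction s using Finset.induction_on with
  | empty => simp
  | insert a s ha ih =>
    rw [Finset.sum_insert ha, Finset.sum_insert ha, AddMonoidAlgebra.single_add, ih]

section Projection

open Filter Topology MvPowerSeries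

variable {k I ι ι' : Type*} [Field k] [Fintype I] [Fintype ι] [Fintype ι'] [DecidableEq ι']

theorem Seed.incl_zero (s : Seed I ι') : s.incl 0 = 0 := by
  simp [Seed.incl]

theorem Seed.incl_add (s : Seed I ι') (a b : I →₀ ℕ) : s.incl (a + b) = s.incl a + s.incl b := by
  simp [Seed.incl, add_smul, Finset.sum_add_distrib]

theorem Seed.incl_apply_uf (s : Seed I ι') (a : I →₀ ℕ) (i : I) : s.incl a (s.uf i) = a i := by
  classical
  simp [Seed.incl, Seed.e, Finset.sum_apply, Pi.single_apply, s.uf.injective.eq_iff]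

theorem Seed.incl_apply_of_notMem (s : Seed I ι') (a : I →₀ ℕ) {j : ι'}
    (hj : j ∉ Set.range s.uf) : s.incl a j = 0 := by
  classical
  have : ∀ i, s.uf i ≠ j := fun i h => hj ⟨i, h⟩
  simp [Seed.incl, Seed.e, Finset.sum_apply, fun i => (this i).symm]

theorem Seed.incl_injective (s : Seed I ι') : Function.Injective (s.incl) := by
  intro a b h
  ext i
  have := congrFun h (s.uf i)
  rw [s.incl_apply_uf, s.incl_apply_uf] at this
  exact_mod_cast this

theorem Seed.p1_add (s : Seed I ι') (a b : ι' → ℤ) : s.p1 (a + b) = s.p1 a + s.p1 b := by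
  funext j
  simp [Seed.p1, add_mul, Finset.sum_add_distrib]

theorem Seed.p1_zero (s : Seed I ι') : s.p1 0 = 0 := by
  funext j
  simp [Seed.p1]

theorem Seed.dotProduct_p1 (s : Seed I ι') (n : ι' → ℤ) : dotProduct n (s.p1 n) = 0 := by
  have h : ∀ i j, s.form j i = -s.form i j := fun i j => congrFun (congrFun s.skew i) j
  have e : dotProduct n (s.p1 n) = -dotProduct n (s.p1 n) := by
    simp only [dotProduct, Seed.p1, Finset.mul_sum]
    conv_lhs => rw [Finset.sum_comm]
    rw [← Finset.sum_neg_distrib]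
    refine Finset.sum_congr rfl fun i _ => ?_
    rw [← Finset.sum_neg_distrib]
    refine Finset.sum_congr rfl fun j _ => ?_
    rw [h i j]
    ring
  omega

/-- The restriction of the exponent `p₁(β)` to a part of the coordinates. -/
def Seed.restrP (s : Seed I ι') (e : ι ↪ ι') (β : I →₀ ℕ) : ι → ℤ :=
  fun j => s.p1 (s.incl β) (e j)

theorem Seed.restrP_zero (s : Seed I ι') (e : ι ↪ ι') : s.restrP e 0 = 0 := by
  funext j
  simp [Seed.restrP, s.incl_zero, s.p1_zero]

theorem Seed.restrP_add (s : Seed I ι') (e : ι ↪ ι') (a b : I →₀ ℕ) :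
    s.restrP e (a + b) = s.restrP e a + s.restrP e b := by
  funext j
  simp [Seed.restrP, s.incl_add, s.p1_add]

theorem Seed.restrP_nsmul (s : Seed I ι') (e : ι ↪ ι') (r : ℕ) (a : I →₀ ℕ) :
    s.restrP e (r • a) = (r : ℤ) • s.restrP e a := by
  induction r with
  | zero => simp [s.restrP_zero]
  | succ r ih => rw [succ_nsmul, s.restrP_add, ih, Nat.cast_succ, add_smul, one_smul]

/-- The power series `z^m f`, for `f ∈ k⟦P⟧`. -/
noncomputable def Seed.shiftSeries (s : Seed I ι') (e : ι ↪ ι') (m : ι → ℤ)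
    (f : MvPowerSeries I k) : MvPowerSeries I (AddMonoidAlgebra k (ι → ℤ)) :=
  fun β => AddMonoidAlgebra.single (m + s.restrP e β) (coeff β f)

/-- The inclusion of `k⟦P⟧` in the ring of wall functions. -/
noncomputable def Seed.restrSeries (s : Seed I ι') (e : ι ↪ ι') (f : MvPowerSeries I k) :
    MvPowerSeries I (AddMonoidAlgebra k (ι → ℤ)) :=
  fun β => AddMonoidAlgebra.single (s.restrP e β) (coeff β f)

/-- The wall attached to a `C`-wall which is invariant under the translations by the vectors whose
coordinates in the image of `e` vanish: one forgets the other coordinates. -/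
noncomputable def Seed.restrWall (s : Seed I ι') (e : ι ↪ ι') (w : CWall k I ι') : Wall k I ι where
  cone := (fun x : ι' → ℝ => fun j => x (e j)) '' w.cone
  dir := -primitivePart (s.restrP e w.normal)
  func := s.restrSeries e w.func

variable (s : Seed I ι') (e : ι ↪ ι')

theorem Seed.coeff_shiftSeries (m : ι → ℤ) (f : MvPowerSeries I k) (β : I →₀ ℕ) :
    coeff β (s.shiftSeries e m f) = AddMonoidAlgebra.single (m + s.restrP e β) (coeff β f) := rfl

theorem Seed.coeff_restrSeries (f : MvPowerSeries I k) (β : I →₀ ℕ) :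
    coeff β (s.restrSeries e f) = AddMonoidAlgebra.single (s.restrP e β) (coeff β f) := rfl

theorem Seed.restrSeries_one : s.restrSeries e (1 : MvPowerSeries I k) = 1 := by
  classical
  ext1 β
  rw [s.coeff_restrSeries, coeff_one, coeff_one]
  split_ifs with h
  · rw [h, s.restrP_zero]; rfl
  · simp

theorem Seed.restrSeries_mul (f g : MvPowerSeries I k) :
    s.restrSeries e (f * g) = s.restrSeries e f * s.restrSeries e g := by
  classical
  ext1 β
  rw [s.coeff_restrSeries, coeff_mul, coeff_mul, single_finset_sum]
  refine Finset.sum_congr rfl fun p hp => ?_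
  rw [s.coeff_restrSeries, s.coeff_restrSeries, AddMonoidAlgebra.single_mul_single, ← s.restrP_add,
    Finset.HasAntidiagonal.mem_antidiagonal.1 hp]

theorem Seed.coeff_zero_restrSeries {f : MvPowerSeries I k} (hf : coeff 0 f = 1) :
    coeff 0 (s.restrSeries e f) = 1 := by
  rw [s.coeff_restrSeries, s.restrP_zero, hf]; rfl

theorem Seed.restrSeries_pow (f : MvPowerSeries I k) (r : ℕ) :
    s.restrSeries e (f ^ r) = s.restrSeries e f ^ r := by
  induction r with
  | zero => simp [s.restrSeries_one]
  | succ r ih => rw [pow_succ, pow_succ, s.restrSeries_mul, ih]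

theorem Seed.restrSeries_intPow {f : MvPowerSeries I k} (hf : coeff 0 f = 1) (z : ℤ) :
    s.restrSeries e (intPow f z) = intPow (s.restrSeries e f) z := by
  have hinv : s.restrSeries e (invOfUnit f 1) = invOfUnit (s.restrSeries e f) 1 := by
    have h1 : s.restrSeries e (invOfUnit f 1) * s.restrSeries e f = 1 := by
      rw [← s.restrSeries_mul, mul_comm, mul_invOfUnit f 1 (by simpa using hf), s.restrSeries_one]
    refine left_inv_eq_right_inv h1 (mul_invOfUnit _ 1 ?_)
    simpa using s.coeff_zero_restrSeries e hf
  unfold intPow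
  split_ifs
  · rw [s.restrSeries_pow]
  · rw [s.restrSeries_pow, hinv]

theorem Seed.congrMod_shiftSeries_iff (m : ι → ℤ) {f g : MvPowerSeries I k} {j : ℕ} :
    CongrMod j (s.shiftSeries e m f) (s.shiftSeries e m g) ↔ CongrMod j f g := by
  refine forall₂_congr fun β _ => ?_
  rw [s.coeff_shiftSeries, s.coeff_shiftSeries]
  exact (single_right_injective _).eq_iff

theorem Seed.congrMod_restrSeries_iff {f g : MvPowerSeries I k} {j : ℕ} :
    CongrMod j (s.restrSeries e f) (s.restrSeries e g) ↔ CongrMod j f g := by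
  refine forall₂_congr fun β _ => ?_
  rw [s.coeff_restrSeries, s.coeff_restrSeries]
  exact (single_right_injective _).eq_iff

theorem Seed.restrSeries_injective :
    Function.Injective (s.restrSeries e : MvPowerSeries I k → _) := by
  intro f g h
  ext β
  have := congrArg (coeff β) h
  rw [s.coeff_restrSeries, s.coeff_restrSeries] at this
  exact single_right_injective _ this

theorem Seed.restrSeries_euler (f : MvPowerSeries I k) :
    s.restrSeries e (euler f) = euler (s.restrSeries e f) := by
  ext1 β
  rw [s.coeff_restrSeries, coeff_euler, coeff_euler, s.coeff_restrSeries, ← nsmul_eq_mul,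
    ← nsmul_eq_mul, AddMonoidAlgebra.smul_single]

theorem Seed.logDer_restrSeries {f : MvPowerSeries I k} (hf : coeff 0 f = 1) :
    logDer (s.restrSeries e f) = s.restrSeries e (logDer f) := by
  refine eq_logDer (s.coeff_zero_restrSeries e hf) ?_
  rw [← s.restrSeries_mul, logDer_mul_self hf, s.restrSeries_euler]

end Projection
end HDTVCluster

namespace HDTVCluster

/-! ### Cylinders over cones -/

section Cylinder

open Filter Topology

variable {ι ι' : Type*} [Fintype ι] [Fintype ι'] (e : ι ↪ ι')

/-- The projection which forgets the coordinates outside of the image of `e`. -/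
noncomputable def proj : (ι' → ℝ) →ₗ[ℝ] (ι → ℝ) := LinearMap.funLeft ℝ ℝ e

/-- The section of `proj e` which fills in zeros. -/
noncomputable def lift : (ι → ℝ) →ₗ[ℝ] (ι' → ℝ) := Function.ExtendByZero.linearMap ℝ e

theorem proj_apply (x : ι' → ℝ) (j : ι) : proj e x j = x (e j) := rfl

theorem lift_apply (x : ι → ℝ) (j : ι) : lift e x (e j) = x j := e.injective.extend_apply x 0 j

theorem lift_apply_of_notMem (x : ι → ℝ) {j : ι'} (hj : j ∉ Set.range e) : lift e x j = 0 :=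
  Function.extend_apply' x (0 : ι' → ℝ) j hj

theorem proj_lift (x : ι → ℝ) : proj e (lift e x) = x := funext fun j => lift_apply e x j

theorem continuous_proj : Continuous (proj e) := (proj e).continuous_of_finiteDimensional

theorem map_proj_nhds (x : ι' → ℝ) : map (proj e) (𝓝 x) = 𝓝 (proj e x) :=
  ((proj e).isOpenMap_of_finiteDimensional fun x => ⟨lift e x, proj_lift e x⟩).map_nhds_eq
    (continuous_proj e).continuousAt

theorem pair_lift (n : ι' → ℤ) (x : ι → ℝ) : pair n (lift e x) = pair (fun j => n (e j)) x := by
  refine (Fintype.sum_of_injective e e.injective _ _ (fun j hj => ?_) fun j => ?_).symm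
  · rw [lift_apply_of_notMem e x hj, mul_zero]
  · rw [lift_apply]

theorem pair_proj {n : ι' → ℤ} (hn : ∀ j ∉ Set.range e, n j = 0) (x : ι' → ℝ) :
    pair (fun j => n (e j)) (proj e x) = pair n x := by
  refine Fintype.sum_of_injective e e.injective _ _ (fun j hj => ?_) fun j => rfl
  rw [hn j hj, Int.cast_zero, zero_mul]

theorem isPrimitive_comp {n : ι' → ℤ} (hn : ∀ j ∉ Set.range e, n j = 0) (hp : IsPrimitive n) :
    IsPrimitive fun j => n (e j) := by
  have h : (Finset.univ.gcd fun j => n (e j)) ∣ Finset.univ.gcd n := by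
    refine Finset.dvd_gcd fun j _ => ?_
    by_cases hj : j ∈ Set.range e
    · obtain ⟨i, rfl⟩ := hj
      exact Finset.gcd_dvd (f := fun j => n (e j)) (Finset.mem_univ i)
    · rw [hn j hj]; exact dvd_zero _
  rw [IsPrimitive] at hp ⊢
  rw [hp] at h
  rw [← Finset.normalize_gcd]
  exact normalize_eq_one.2 (isUnit_of_dvd_one h)

/-- Walls which are invariant under the translations by the kernel of `proj e`. -/
def IsCylinder (d : Set (ι' → ℝ)) : Prop :=
  IsWallCone d ∧ ∀ x ∈ d, ∀ x', proj e x' = proj e x → x' ∈ d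

variable {e} {d d' : Set (ι' → ℝ)}

theorem IsCylinder.proj_mem_iff (hd : IsCylinder e d) {x : ι' → ℝ} :
    proj e x ∈ proj e '' d ↔ x ∈ d := by
  constructor
  · rintro ⟨x', hx', h⟩
    exact hd.2 x' hx' x h.symm
  · exact fun h => ⟨x, h, rfl⟩

theorem IsCylinder.normal_eq_zero (hd : IsCylinder e d) {n : ι' → ℤ} (hn : HasNormal d n) {j : ι'}
    (hj : j ∉ Set.range e) : n j = 0 := by
  classical
  have h0 := zero_mem_of_isRationalPolyhedralCone hd.1.1
  have h1 : (Pi.single j 1 : ι' → ℝ) ∈ d := by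
    refine hd.2 0 h0 _ (funext fun i => ?_)
    rw [proj_apply, proj_apply, Pi.single_apply, if_neg fun h => hj ⟨i, h⟩]
    rfl
  have h2 := hn.pair_eq_zero h1
  simpa [pair, Pi.single_apply] using h2

theorem IsCylinder.hasNormal_proj (hd : IsCylinder e d) {n : ι' → ℤ} (hn : HasNormal d n) :
    HasNormal (proj e '' d) fun j => n (e j) := by
  have h0 : ∀ j ∉ Set.range e, n j = 0 := fun j hj => hd.normal_eq_zero hn hj
  refine ⟨isPrimitive_comp e h0 hn.primitive, fun x => ?_⟩
  rw [Submodule.span_image, Submodule.mem_map]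
  constructor
  · rintro ⟨x', hx', rfl⟩
    rw [pair_proj e h0]
    exact (hn.mem_span_iff _).1 hx'
  · intro h
    refine ⟨lift e x, (hn.mem_span_iff _).2 ?_, proj_lift e x⟩
    rw [pair_lift]
    exact h

theorem IsCylinder.isWallCone_proj (hd : IsCylinder e d) : IsWallCone (proj e '' d) := by
  classical
  obtain ⟨n, hn⟩ := hd.1.exists_normal
  refine ⟨?_, (hd.hasNormal_proj hn).coneDim⟩
  obtain ⟨A, hA⟩ := hd.1.1
  refine ⟨A.image fun a j => a (e j), Set.ext fun x => ?_⟩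
  rw [← proj_lift e x, hd.proj_mem_iff, hA]
  simp only [Set.mem_ofPred_eq, Finset.forall_mem_image, pair_lift, proj_lift]

theorem IsCylinder.proj_mem_span_iff (hd : IsCylinder e d) {x : ι' → ℝ} :
    proj e x ∈ Submodule.span ℝ (proj e '' d) ↔ x ∈ Submodule.span ℝ d := by
  obtain ⟨n, hn⟩ := hd.1.exists_normal
  rw [(hd.hasNormal_proj hn).mem_span_iff, hn.mem_span_iff,
    pair_proj e fun j hj => hd.normal_eq_zero hn hj]

theorem IsCylinder.span_proj_eq_iff (hd : IsCylinder e d) (hd' : IsCylinder e d') :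
    Submodule.span ℝ (proj e '' d) = Submodule.span ℝ (proj e '' d') ↔
      Submodule.span ℝ d = Submodule.span ℝ d' := by
  constructor
  · intro h
    ext x
    rw [← hd.proj_mem_span_iff, ← hd'.proj_mem_span_iff, h]
  · intro h
    ext x
    rw [← proj_lift e x, hd.proj_mem_span_iff, hd'.proj_mem_span_iff, h]

theorem proj_notMem_singularLocus_iff {W : Type*} {cone : W → Set (ι' → ℝ)} {T : Set W}
    (hT : ∀ w ∈ T, IsCylinder e (cone w)) {x : ι' → ℝ} :
    proj e x ∉ singularLocus (fun w => proj e '' cone w) T ↔ x ∉ singularLocus cone T := by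
  rw [notMem_singularLocus_iff fun w hw => (hT w hw).1,
    notMem_singularLocus_iff fun w hw => (hT w hw).isWallCone_proj]
  refine forall₂_congr fun w hw => ?_
  rw [(hT w hw).proj_mem_iff]
  refine imp_congr_right fun _ => and_congr ?_ (forall₂_congr fun w' hw' => ?_)
  · rw [← map_proj_nhds, eventually_map]
    simp only [(hT w hw).proj_mem_iff, (hT w hw).proj_mem_span_iff]
  · rw [(hT w' hw').proj_mem_iff, (hT w hw).span_proj_eq_iff (hT w' hw')]

theorem contDiff_proj {γ : ℝ → ι' → ℝ} (hγ : ContDiff ℝ 1 γ) :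
    ContDiff ℝ 1 fun t => proj e (γ t) :=
  (LinearMap.toContinuousLinearMap (proj e)).contDiff.comp hγ

theorem contDiff_lift {γ : ℝ → ι → ℝ} (hγ : ContDiff ℝ 1 γ) :
    ContDiff ℝ 1 fun t => lift e (γ t) :=
  (LinearMap.toContinuousLinearMap (lift e)).contDiff.comp hγ

theorem deriv_proj {γ : ℝ → ι' → ℝ} (hγ : ContDiff ℝ 1 γ) (t : ℝ) :
    deriv (fun t => proj e (γ t)) t = proj e (deriv γ t) :=
  ((LinearMap.toContinuousLinearMap (proj e)).hasFDerivAt.comp_hasDerivAt t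
    (hasDerivAt_of_contDiff hγ t)).deriv

theorem isTransversalPath_proj_iff {W : Type*} {cone : W → Set (ι' → ℝ)} {T : Set W}
    (hT : ∀ w ∈ T, IsCylinder e (cone w)) {γ : ℝ → ι' → ℝ} (hγ : ContDiff ℝ 1 γ) :
    IsTransversalPath (fun w => proj e '' cone w) T (fun t => proj e (γ t)) ↔
      IsTransversalPath cone T γ := by
  have h1 : ∀ t, ∀ w ∈ T, (proj e (γ t) ∈ proj e '' cone w →
      t ∈ Set.Ioo (0 : ℝ) 1 ∧ deriv (fun t => proj e (γ t)) t ∉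
        Submodule.span ℝ (proj e '' cone w)) ↔
      (γ t ∈ cone w → t ∈ Set.Ioo (0 : ℝ) 1 ∧ deriv γ t ∉ Submodule.span ℝ (cone w)) := by
    intro t w hw
    rw [(hT w hw).proj_mem_iff, deriv_proj hγ, (hT w hw).proj_mem_span_iff]
  constructor
  · rintro ⟨-, h2, h3⟩
    exact ⟨hγ, fun t ht => (proj_notMem_singularLocus_iff hT).1 (h2 t ht),
      fun t ht w hw => (h1 t w hw).1 (h3 t ht w hw)⟩
  · rintro ⟨-, h2, h3⟩
    exact ⟨contDiff_proj hγ, fun t ht => (proj_notMem_singularLocus_iff hT).2 (h2 t ht),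
      fun t ht w hw => (h1 t w hw).2 (h3 t ht w hw)⟩

theorem singularLocus_image {W W' : Type*} (f : W → W') (cone : W' → Set (ι → ℝ)) (T : Set W) :
    singularLocus cone (f '' T) = singularLocus (fun w => cone (f w)) T := by
  ext x
  simp [singularLocus]

theorem isTransversalPath_image_iff {W W' : Type*} (f : W → W') (cone : W' → Set (ι → ℝ))
    (T : Set W) (γ : ℝ → ι → ℝ) :
    IsTransversalPath cone (f '' T) γ ↔ IsTransversalPath (fun w => cone (f w)) T γ := by
  constructor
  · rintro ⟨h1, h2, h3⟩
    exact ⟨h1, by simpa only [singularLocus_image] using h2, by simpa using h3⟩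
  · rintro ⟨h1, h2, h3⟩
    exact ⟨h1, by simpa only [singularLocus_image] using h2, by simpa using h3⟩

theorem isCrossingList_image {W W' : Type*} {f : W → W'} {cone : W' → Set (ι → ℝ)} {T : Set W}
    (hf : Set.InjOn f T) {γ : ℝ → ι → ℝ} {L : List (ℝ × W)}
    (hL : IsCrossingList (fun w => cone (f w)) T γ L) :
    IsCrossingList cone (f '' T) γ (L.map fun c => (c.1, f c.2)) := by
  obtain ⟨h1, h2, h3⟩ := hL
  refine ⟨List.Nodup.map_on ?_ h1, List.pairwise_map.2 h2, fun c => ?_⟩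
  · intro x hx y hy hxy
    rw [Prod.mk.injEq] at hxy
    exact Prod.ext hxy.1 (hf ((h3 x).1 hx).2.1 ((h3 y).1 hy).2.1 hxy.2)
  · rw [List.mem_map]
    constructor
    · rintro ⟨c', hc', rfl⟩
      obtain ⟨h4, h5, h6⟩ := (h3 c').1 hc'
      exact ⟨h4, ⟨_, h5, rfl⟩, h6⟩
    · rintro ⟨h4, ⟨w, hw, h5⟩, h6⟩
      refine ⟨(c.1, w), (h3 _).2 ⟨h4, hw, ?_⟩, Prod.ext rfl h5⟩
      change γ c.1 ∈ cone (f w)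
      rwa [h5]

end Cylinder
end HDTVCluster

namespace HDTVCluster

/-! ### Comparison of `C`-scattering diagrams with scattering diagrams -/

section Transfer

open Filter Topology MvPowerSeries

variable {k I ι ι' : Type*} [Field k] [Fintype I] [Fintype ι] [Fintype ι'] [DecidableEq ι']
  {s : Seed I ι'} {e : ι ↪ ι'}

theorem IsCWall.isWallCone {w : CWall k I ι'} (hw : IsCWall s w) : IsWallCone w.cone :=
  ⟨hw.rational, hw.codim_one⟩

theorem IsCWall.hasNormal {w : CWall k I ι'} (hw : IsCWall s w) :
    HasNormal w.cone (s.incl w.normal) :=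
  HasNormal.of_subset_perp hw.codim_one hw.primitive hw.subset_perp

theorem Seed.restrWall_cone (w : CWall k I ι') : (s.restrWall e w).cone = proj e '' w.cone := rfl

theorem toReal_restrP (β : I →₀ ℕ) :
    toReal (s.restrP e β) = proj e (toReal (s.p1 (s.incl β))) := rfl

theorem dotProduct_restrP {w : CWall k I ι'} (hw : IsCWall s w) (hc : IsCylinder e w.cone)
    (m : ι' → ℤ) : dotProduct (fun j => s.incl w.normal (e j)) (fun j => m (e j)) =
      dotProduct (s.incl w.normal) m := by
  refine Fintype.sum_of_injective e e.injective _ _ (fun j hj => ?_) fun j => rfl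
  rw [hc.normal_eq_zero hw.hasNormal hj, zero_mul]

/-- The direction is tangent to the wall as `⟨n, p₁(n)⟩ = 0`, and a function of `t^n z^{p₁(n)}` has
exponents in the direction of `p₁(n)`, by the definition of the primitive part. -/
theorem Seed.isWall_restrWall {w : CWall k I ι'} (hw : IsCWall s w) (hc : IsCylinder e w.cone) :
    IsWall (s.restrWall e w) where
  rational := hc.isWallCone_proj.1
  codim_one := hc.isWallCone_proj.2
  dir_eq := by
    by_cases h : s.restrP e w.normal = 0
    · exact Or.inl (by rw [Seed.restrWall, h, primitivePart_zero, neg_zero])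
    · exact Or.inr (isPrimitive_primitivePart h).neg
  dir_tangent := by
    rw [s.restrWall_cone, (hc.hasNormal_proj hw.hasNormal).mem_span_iff, pair_toReal]
    have h1 : dotProduct (fun j => s.incl w.normal (e j)) (s.restrP e w.normal) = 0 :=
      (dotProduct_restrP hw hc _).trans (s.dotProduct_p1 _)
    change ((dotProduct _ (-primitivePart (s.restrP e w.normal)) : ℤ) : ℝ) = 0
    rw [Int.cast_eq_zero, dotProduct_neg, neg_eq_zero]
    by_cases h : s.restrP e w.normal = 0
    · rw [h, primitivePart_zero, dotProduct_zero]
    · rw [← gcd_smul_primitivePart (s.restrP e w.normal), dotProduct_smul, smul_eq_mul] at h1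
      exact (mul_eq_zero.1 h1).resolve_left (gcd_pos h).ne'
  coeff_zero := s.coeff_zero_restrSeries e hw.coeff_zero
  coeff_ne_zero := by
    classical
    intro β hβ m hm
    change (coeff β (s.restrSeries e w.func)).coeff m ≠ 0 at hm
    rw [s.coeff_restrSeries, AddMonoidAlgebra.coeff_single, Finsupp.single_apply] at hm
    split_ifs at hm with h
    · obtain ⟨r, hr, hβr⟩ := hw.coeff_ne_zero β hβ hm
      have hm' : m = (r : ℤ) • s.restrP e w.normal := by rw [← h, hβr, s.restrP_nsmul]
      change ∃ r : ℕ, 1 ≤ r ∧ m = -((r : ℤ) • -primitivePart (s.restrP e w.normal))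
      by_cases h0 : s.restrP e w.normal = 0
      · exact ⟨r, hr, by rw [hm', h0, primitivePart_zero]; simp⟩
      · have hg := gcd_pos h0
        obtain ⟨g, hg'⟩ := Int.eq_ofNat_of_zero_le hg.le
        refine ⟨r * g, ?_, ?_⟩
        · have : 0 < g := by omega
          exact Nat.one_le_iff_ne_zero.2 (by positivity)
        · rw [hm', smul_neg, neg_neg, Nat.cast_mul, mul_smul]
          congr 1
          rw [← hg', gcd_smul_primitivePart]
    · exact absurd rfl hm

theorem Seed.incoming_restrWall_iff {w : CWall k I ι'} (hc : IsCylinder e w.cone) :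
    w.Incoming s ↔ (s.restrWall e w).Incoming := by
  have h1 : w.Incoming s ↔ toReal (s.restrP e w.normal) ∈ proj e '' w.cone := by
    rw [toReal_restrP, hc.proj_mem_iff]
    rfl
  have h2 : (s.restrWall e w).Incoming ↔
      toReal (primitivePart (s.restrP e w.normal)) ∈ proj e '' w.cone := by
    change toReal (- -primitivePart (s.restrP e w.normal)) ∈ proj e '' w.cone ↔ _
    rw [neg_neg]
  rw [h1, h2]
  by_cases h : s.restrP e w.normal = 0
  · rw [h, primitivePart_zero]
  · have e1 : toReal (s.restrP e w.normal) =
        ((Finset.univ.gcd (s.restrP e w.normal) : ℤ) : ℝ) •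
          toReal (primitivePart (s.restrP e w.normal)) := by
      conv_lhs => rw [← gcd_smul_primitivePart (s.restrP e w.normal)]
      funext j
      simp [toReal]
    rw [e1, smul_mem_iff_of_isRationalPolyhedralCone hc.isWallCone_proj.1]
    exact_mod_cast gcd_pos h

/-- There is no ambiguity of sign, as the normal vectors of `C`-walls are positive. -/
theorem IsCWall.normal_eq {w w' : CWall k I ι'} (hw : IsCWall s w) (hw' : IsCWall s w')
    (h : Submodule.span ℝ w.cone ≤ Submodule.span ℝ w'.cone) : w.normal = w'.normal := by
  rcases hw.hasNormal.eq_or_eq_neg hw'.hasNormal h with h1 | h1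
  · exact (s.incl_injective h1).symm
  · exfalso
    refine hw.primitive.ne_zero ?_
    have h2 : w.normal = 0 := by
      ext i
      have := congrFun h1 (s.uf i)
      rw [Pi.neg_apply, s.incl_apply_uf, s.incl_apply_uf] at this
      simp only [Finsupp.coe_zero, Pi.zero_apply]
      omega
    rw [h2, s.incl_zero]

/-- Distinct walls have distinct images, so that no multiplicities are lost. -/
theorem Seed.injOn_restrWall {D : Set (CWall k I ι')} (hD : ∀ w ∈ D, IsCWall s w)
    (hc : ∀ w ∈ D, IsCylinder e w.cone) : Set.InjOn (s.restrWall e) D := by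
  intro w hw w' hw' h
  have h1 : proj e '' w.cone = proj e '' w'.cone := congrArg Wall.cone h
  have h2 : w.cone = w'.cone := by
    ext x
    rw [← (hc w hw).proj_mem_iff, ← (hc w' hw').proj_mem_iff, h1]
  have h3 := (hD w hw).normal_eq (hD w' hw') (by rw [h2])
  have h4 : w.func = w'.func := s.restrSeries_injective e (congrArg Wall.func h)
  cases w; cases w'
  simp only at h2 h3 h4
  rw [h2, h3, h4]

theorem Seed.trunc_restrWall (D : Set (CWall k I ι')) (j : ℕ) :
    trunc (s.restrWall e '' D) j = s.restrWall e '' ctrunc D j := by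
  have h : ∀ w : CWall k I ι', CongrMod j (s.restrWall e w).func 1 ↔ CongrMod j w.func 1 := by
    intro w
    rw [← s.restrSeries_one e]
    exact s.congrMod_restrSeries_iff e
  ext w
  constructor
  · rintro ⟨⟨w, hw, rfl⟩, hj⟩
    exact ⟨w, ⟨hw, fun h' => hj ((h w).2 h')⟩, rfl⟩
  · rintro ⟨w, ⟨hw, hj⟩, rfl⟩
    exact ⟨⟨w, hw, rfl⟩, fun h' => hj ((h w).1 h')⟩

theorem Seed.isScatteringDiagram_restrWall {D : Set (CWall k I ι')}
    (hD : IsCScatteringDiagram s D) (hc : ∀ w ∈ D, IsCylinder e w.cone) :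
    IsScatteringDiagram (s.restrWall e '' D) := by
  refine ⟨?_, fun j => ?_⟩
  · rintro _ ⟨w, hw, rfl⟩
    exact s.isWall_restrWall (hD.1 w hw) (hc w hw)
  · rw [s.trunc_restrWall]
    exact (hD.2 j).image _

/-- Forgetting coordinates intertwines the wall crossings. -/
theorem Seed.wallCrossing_shiftSeries {w : CWall k I ι'} (hw : IsCWall s w)
    (hc : IsCylinder e w.cone) (ε : ℤ) (m : ι' → ℤ) (h : MvPowerSeries I k) :
    wallCrossing (s.restrSeries e w.func) (ε • fun j => s.incl w.normal (e j))
      (s.shiftSeries e (fun j => m (e j)) h) =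
    s.shiftSeries e (fun j => m (e j)) (w.cross s ε m h) := by
  classical
  ext1 β
  rw [coeff_wallCrossing, s.coeff_shiftSeries]
  have hcr : coeff β (w.cross s ε m h) = ∑ p ∈ Finset.HasAntidiagonal.antidiagonal β,
      coeff p.1 h * coeff p.2
        (intPow w.func (ε * dotProduct (s.incl w.normal) (m + s.p1 (s.incl p.1)))) := by
    rw [coeff_apply, CWall.cross]
  rw [hcr, single_finset_sum]
  refine Finset.sum_congr rfl fun p hp => ?_
  rw [s.coeff_shiftSeries, AddMonoidAlgebra.coeff_single, Finsupp.sum_single_index (by simp)]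
  have hdot : dotProduct (ε • fun j => s.incl w.normal (e j))
      ((fun j => m (e j)) + s.restrP e p.1) =
      ε * dotProduct (s.incl w.normal) (m + s.p1 (s.incl p.1)) := by
    rw [smul_dotProduct, smul_eq_mul, ← dotProduct_restrP hw hc]
    rfl
  rw [hdot, ← s.restrSeries_intPow e hw.coeff_zero, s.coeff_restrSeries,
    AddMonoidAlgebra.single_mul_single, add_assoc, ← s.restrP_add,
    Finset.HasAntidiagonal.mem_antidiagonal.1 hp]

theorem Seed.signedNormal_restrWall {w : CWall k I ι'} (hw : IsCWall s w)
    (hc : IsCylinder e w.cone) {γ : ℝ → ι' → ℝ} (hγ : ContDiff ℝ 1 γ) {t : ℝ}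
    (ht : deriv γ t ∉ Submodule.span ℝ w.cone) :
    signedNormal (s.restrWall e w).cone (deriv (fun t => proj e (γ t)) t) =
      w.crossSign s γ t • fun j => s.incl w.normal (e j) := by
  have hn := hc.hasNormal_proj hw.hasNormal
  have hp : pair (fun j => s.incl w.normal (e j)) (deriv (fun t => proj e (γ t)) t) =
      pair (s.incl w.normal) (deriv γ t) := by
    rw [deriv_proj hγ, pair_proj e fun j hj => hc.normal_eq_zero hw.hasNormal hj]
  rw [hw.hasNormal.mem_span_iff] at ht
  rw [CWall.crossSign, s.restrWall_cone]
  rcases lt_or_gt_of_ne ht with h | h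
  · rw [sign_neg h, hn.signedNormal_eq (by rw [hp]; exact h)]
    simp
  · rw [sign_pos h, hn.neg.signedNormal_eq (by rw [neg_pair, hp]; linarith)]
    simp

/-- The path ordered products of a `C`-scattering diagram are those of the attached scattering
diagram. -/
theorem Seed.pathProduct_restrWall {T : Set (CWall k I ι')} (hT : ∀ w ∈ T, IsCWall s w)
    (hc : ∀ w ∈ T, IsCylinder e w.cone) {γ : ℝ → ι' → ℝ} (hγ : IsTransversalPath CWall.cone T γ)
    {L : List (ℝ × CWall k I ι')} (hL : IsCrossingList CWall.cone T γ L) (m : ι' → ℤ)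
    (h : MvPowerSeries I k) :
    pathProduct (fun t => proj e (γ t)) (L.map fun c => (c.1, s.restrWall e c.2))
      (s.shiftSeries e (fun j => m (e j)) h) =
    s.shiftSeries e (fun j => m (e j)) (cpathProduct s γ L m h) := by
  have hmem : ∀ c ∈ L, c.2 ∈ T ∧ deriv γ c.1 ∉ Submodule.span ℝ c.2.cone := by
    intro c hcL
    obtain ⟨h1, h2, h3⟩ := (hL.2.2 c).1 hcL
    exact ⟨h2, (hγ.crosses c.1 h1 c.2 h2 h3).2⟩
  clear hL
  rw [pathProduct, cpathProduct, List.foldl_map]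
  induction L generalizing h with
  | nil => rfl
  | cons c L ih =>
    simp only [List.forall_mem_cons] at hmem
    obtain ⟨⟨h1, h2⟩, h3⟩ := hmem
    rw [List.foldl_cons, List.foldl_cons, ← ih _ h3,
      s.signedNormal_restrWall (hT _ h1) (hc _ h1) hγ.contDiff h2]
    congr 1
    exact s.wallCrossing_shiftSeries (hT _ h1) (hc _ h1) _ m h

theorem isFiltered_pathProduct {T : Set (Wall k I ι)} (hT : ∀ w ∈ T, IsWall w) {γ : ℝ → ι → ℝ}
    {L : List (ℝ × Wall k I ι)} (hL : IsCrossingList Wall.cone T γ L) :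
    IsFiltered (pathProduct γ L) := by
  have hmem : ∀ c ∈ L, coeff 0 c.2.func = 1 := fun c hc => (hT _ ((hL.2.2 c).1 hc).2.1).coeff_zero
  clear hL
  induction L with
  | nil => exact ⟨fun _ _ => rfl, fun _ _ _ h => h⟩
  | cons c L ih =>
    simp only [List.forall_mem_cons] at hmem
    have h1 := isFiltered_wallCrossing hmem.1 (signedNormal c.2.cone (deriv γ c.1))
    have h2 := ih hmem.2
    refine ⟨fun g g' => ?_, fun j g g' h => ?_⟩
    · change pathProduct γ L (wallCrossing _ _ (g + g')) =
        pathProduct γ L (wallCrossing _ _ g) + pathProduct γ L (wallCrossing _ _ g')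
      rw [h1.add, h2.add]
    · exact h2.congr j _ _ (h1.congr j _ _ h)

/-- Path ordered products do not depend on the order of simultaneous crossings. -/
theorem pathProduct_eq_of_isCrossingList {T : Set (Wall k I ι)} (hf : T.Finite)
    (hT : ∀ w ∈ T, IsWall w) {γ : ℝ → ι → ℝ} (hγ : IsTransversalPath Wall.cone T γ)
    {L L' : List (ℝ × Wall k I ι)} (hL : IsCrossingList Wall.cone T γ L)
    (hL' : IsCrossingList Wall.cone T γ L') (g : MvPowerSeries I (AddMonoidAlgebra k (ι → ℤ))) :
    pathProduct γ L g = pathProduct γ L' g := by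
  have hTc : ∀ w ∈ T, IsWallCone w.cone := fun w hw => (hT w hw).isWallCone
  obtain ⟨ts, n, h1, h2, h3, -, h5, -⟩ := exists_common_times hf hTc hf hTc (fun _ => rfl) hγ hγ
    fun t ht w hw w' hw' h h' => hγ.span_eq hTc ht hw hw' h h'
  rw [pathProduct_eq_crossFold hT ts h1 (fun t ht => (h2 t ht).1) h3 hL h5,
    pathProduct_eq_crossFold hT ts h1 (fun t ht => (h2 t ht).1) h3 hL' h5]

theorem Seed.exists_shiftSeries_eq (s : Seed I ι') (e : ι ↪ ι') (β : I →₀ ℕ) (m : ι → ℤ) (c : k) :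
    ∃ m' : ι' → ℤ, (monomial β (AddMonoidAlgebra.single m c) :
      MvPowerSeries I (AddMonoidAlgebra k (ι → ℤ))) =
        s.shiftSeries e (fun j => m' (e j)) (monomial β c) := by
  classical
  refine ⟨Function.extend e (m - s.restrP e β) 0, ?_⟩
  have h1 : (fun j => Function.extend e (m - s.restrP e β) 0 (e j)) = m - s.restrP e β :=
    funext fun j => e.injective.extend_apply _ _ j
  rw [h1]
  ext1 γ
  rw [s.coeff_shiftSeries, coeff_monomial, coeff_monomial]
  split_ifs with h
  · rw [h, sub_add_cancel]
  · simp

theorem Seed.isTransversalPath_restrWall_iff {D : Set (CWall k I ι')}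
    (hc : ∀ w ∈ D, IsCylinder e w.cone) {j : ℕ} {γ : ℝ → ι' → ℝ} (hγ : ContDiff ℝ 1 γ) :
    IsTransversalPath Wall.cone (trunc (s.restrWall e '' D) j) (fun t => proj e (γ t)) ↔
      IsTransversalPath CWall.cone (ctrunc D j) γ := by
  rw [s.trunc_restrWall, isTransversalPath_image_iff]
  exact isTransversalPath_proj_iff (fun w hw => hc w hw.1) hγ

theorem Seed.isCrossingList_restrWall {D : Set (CWall k I ι')} (hD : IsCScatteringDiagram s D)
    (hc : ∀ w ∈ D, IsCylinder e w.cone) {j : ℕ} {γ : ℝ → ι' → ℝ} {L : List (ℝ × CWall k I ι')}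
    (hL : IsCrossingList CWall.cone (ctrunc D j) γ L) :
    IsCrossingList Wall.cone (trunc (s.restrWall e '' D) j) (fun t => proj e (γ t))
      (L.map fun c => (c.1, s.restrWall e c.2)) := by
  rw [s.trunc_restrWall]
  refine isCrossingList_image ((s.injOn_restrWall hD.1 hc).mono fun w hw => hw.1)
    ⟨hL.1, hL.2.1, fun c => (hL.2.2 c).trans ?_⟩
  refine and_congr_right fun _ => and_congr_right fun hw => ?_
  exact ((hc _ hw.1).proj_mem_iff (x := γ c.1)).symm

/-- The path ordered products of the scattering diagram attached to `D` are determined by those of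
`D`, for every order of the simultaneous crossings. -/
theorem Seed.pathProduct_monomial {D : Set (CWall k I ι')} (hD : IsCScatteringDiagram s D)
    (hc : ∀ w ∈ D, IsCylinder e w.cone) {j : ℕ} {γ : ℝ → ι' → ℝ}
    (hγ : IsTransversalPath CWall.cone (ctrunc D j) γ)
    {L : List (ℝ × CWall k I ι')} (hL : IsCrossingList CWall.cone (ctrunc D j) γ L)
    {K : List (ℝ × Wall k I ι)}
    (hK : IsCrossingList Wall.cone (trunc (s.restrWall e '' D) j) (fun t => proj e (γ t)) K)
    (m : ι' → ℤ) (h : MvPowerSeries I k) :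
    pathProduct (fun t => proj e (γ t)) K (s.shiftSeries e (fun j => m (e j)) h) =
      s.shiftSeries e (fun j => m (e j)) (cpathProduct s γ L m h) := by
  have hS := s.isScatteringDiagram_restrWall hD hc
  rw [← s.pathProduct_restrWall (fun w hw => hD.1 w hw.1) (fun w hw => hc w hw.1) hγ hL m h]
  exact pathProduct_eq_of_isCrossingList (hS.2 j) (fun w hw => hS.1 w hw.1)
    ((s.isTransversalPath_restrWall_iff hc hγ.contDiff).2 hγ) hK
    (s.isCrossingList_restrWall hD hc hL) _

/-- Every path downstairs is the projection of a path upstairs. -/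
theorem Seed.isTransversalPath_lift {D : Set (CWall k I ι')} (hc : ∀ w ∈ D, IsCylinder e w.cone)
    {j : ℕ} {γ : ℝ → ι → ℝ} (hγ : IsTransversalPath Wall.cone (trunc (s.restrWall e '' D) j) γ) :
    IsTransversalPath CWall.cone (ctrunc D j) (fun t => lift e (γ t)) := by
  rw [← s.isTransversalPath_restrWall_iff hc (contDiff_lift hγ.contDiff)]
  simpa only [proj_lift] using hγ

theorem IsCScatteringDiagram.exists_crossingList {D : Set (CWall k I ι')}
    (hD : IsCScatteringDiagram s D) {j : ℕ} {γ : ℝ → ι' → ℝ}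
    (hγ : IsTransversalPath CWall.cone (ctrunc D j) γ) :
    ∃ L, IsCrossingList CWall.cone (ctrunc D j) γ L :=
  hγ.exists_crossingList (hD.2 j) fun w hw => (hD.1 w hw.1).isWallCone

theorem Seed.pathEquivalent_restrWall_iff {D D' : Set (CWall k I ι')}
    (hD : IsCScatteringDiagram s D) (hc : ∀ w ∈ D, IsCylinder e w.cone)
    (hD' : IsCScatteringDiagram s D') (hc' : ∀ w ∈ D', IsCylinder e w.cone) :
    PathEquivalent (s.restrWall e '' D) (s.restrWall e '' D') ↔ CEquivalent s D D' := by
  have hS := s.isScatteringDiagram_restrWall hD hc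
  have hS' := s.isScatteringDiagram_restrWall hD' hc'
  constructor
  · intro h j γ hγ hγ' L L' hL hL' m f
    have h1 := h j _ ((s.isTransversalPath_restrWall_iff hc hγ.contDiff).2 hγ)
      ((s.isTransversalPath_restrWall_iff hc' hγ.contDiff).2 hγ') _ _
      (s.isCrossingList_restrWall hD hc hL) (s.isCrossingList_restrWall hD' hc' hL')
      (s.shiftSeries e (fun j => m (e j)) f)
    rw [s.pathProduct_restrWall (fun w hw => hD.1 w hw.1) (fun w hw => hc w hw.1) hγ hL,
      s.pathProduct_restrWall (fun w hw => hD'.1 w hw.1) (fun w hw => hc' w hw.1) hγ' hL'] at h1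
    exact (s.congrMod_shiftSeries_iff e _).1 h1
  · intro h j γ hγ hγ' K K' hK hK' g
    have hl := s.isTransversalPath_lift hc hγ
    have hl' := s.isTransversalPath_lift hc' hγ'
    obtain ⟨L, hL⟩ := hD.exists_crossingList hl
    obtain ⟨L', hL'⟩ := hD'.exists_crossingList hl'
    refine (isFiltered_pathProduct (fun w hw => hS.1 w hw.1) hK).congr_of_monomial
      (isFiltered_pathProduct (fun w hw => hS'.1 w hw.1) hK') (fun β m c => ?_) g
    obtain ⟨m', hm'⟩ := s.exists_shiftSeries_eq e β m c
    have e1 : γ = fun t => proj e (lift e (γ t)) := by simp only [proj_lift]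
    rw [e1] at hK hK'
    rw [hm', e1, s.pathProduct_monomial hD hc hl hL hK, s.pathProduct_monomial hD' hc' hl' hL' hK']
    exact (s.congrMod_shiftSeries_iff e _).2 (h j _ hl hl' L L' hL hL' m' _)

theorem Seed.isConsistent_restrWall_iff {D : Set (CWall k I ι')}
    (hD : IsCScatteringDiagram s D) (hc : ∀ w ∈ D, IsCylinder e w.cone) :
    IsConsistent (s.restrWall e '' D) ↔ IsCConsistent s D := by
  have hS := s.isScatteringDiagram_restrWall hD hc
  constructor
  · intro h j γ γ' hγ hγ' h0 h1 L L' hL hL' m f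
    have h2 := h j _ _ ((s.isTransversalPath_restrWall_iff hc hγ.contDiff).2 hγ)
      ((s.isTransversalPath_restrWall_iff hc hγ'.contDiff).2 hγ') (by simp only [h0])
      (by simp only [h1]) _ _
      (s.isCrossingList_restrWall hD hc hL) (s.isCrossingList_restrWall hD hc hL')
      (s.shiftSeries e (fun j => m (e j)) f)
    rw [s.pathProduct_restrWall (fun w hw => hD.1 w hw.1) (fun w hw => hc w hw.1) hγ hL,
      s.pathProduct_restrWall (fun w hw => hD.1 w hw.1) (fun w hw => hc w hw.1) hγ' hL'] at h2
    exact (s.congrMod_shiftSeries_iff e _).1 h2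
  · intro h j γ γ' hγ hγ' h0 h1 K K' hK hK' g
    have hl := s.isTransversalPath_lift hc hγ
    have hl' := s.isTransversalPath_lift hc hγ'
    obtain ⟨L, hL⟩ := hD.exists_crossingList hl
    obtain ⟨L', hL'⟩ := hD.exists_crossingList hl'
    refine (isFiltered_pathProduct (fun w hw => hS.1 w hw.1) hK).congr_of_monomial
      (isFiltered_pathProduct (fun w hw => hS.1 w hw.1) hK') (fun β m c => ?_) g
    obtain ⟨m', hm'⟩ := s.exists_shiftSeries_eq e β m c
    have e1 : γ = fun t => proj e (lift e (γ t)) := by simp only [proj_lift]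
    have e2 : γ' = fun t => proj e (lift e (γ' t)) := by simp only [proj_lift]
    rw [e1] at hK
    rw [e2] at hK'
    rw [hm', e1, e2, s.pathProduct_monomial hD hc hl hL hK,
      s.pathProduct_monomial hD hc hl' hL' hK']
    exact (s.congrMod_shiftSeries_iff e _).2
      (h j _ _ hl hl' (by simp only [h0]) (by simp only [h1]) L L' hL hL' m' _)

end Transfer
end HDTVCluster

namespace HDTVCluster

/-! ### The map `Ψ` -/

section Psi

open Filter Topology MvPowerSeries

variable {k I ι ι' : Type*} [Field k] [Fintype I] [Fintype ι] [Fintype ι'] [DecidableEq ι']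

/-- For the identity embedding, every wall is a cylinder.  This reduces statements about
`C`-scattering diagrams to the corresponding ones about scattering diagrams. -/
theorem isCylinder_refl_iff {d : Set (ι' → ℝ)} :
    IsCylinder (Function.Embedding.refl ι') d ↔ IsWallCone d :=
  ⟨fun h => h.1, fun h => ⟨h, fun x hx x' hx' => by
    have : x' = x := hx'
    rwa [this]⟩⟩

theorem IsCScatteringDiagram.isCylinder_refl {s : Seed I ι'} {D : Set (CWall k I ι')}
    (hD : IsCScatteringDiagram s D) (w : CWall k I ι') (hw : w ∈ D) :
    IsCylinder (Function.Embedding.refl ι') w.cone :=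
  isCylinder_refl_iff.2 (hD.1 w hw).isWallCone

/-- The logarithm at `x` of a set of `C`-walls. -/
noncomputable def clogAt (D : Set (CWall k I ι')) (x : ι' → ℝ) (β : I →₀ ℕ) : k :=
  ∑ᶠ w ∈ {w ∈ D | x ∈ w.cone}, coeff β (logDer w.func)

theorem coeff_logDer_cwall_eq_zero {s : Seed I ι'} {D : Set (CWall k I ι')}
    (hD : ∀ w ∈ D, IsCWall s w) {w : CWall k I ι'} (hw : w ∈ D) {j : ℕ} (hwj : w ∉ ctrunc D j)
    {β : I →₀ ℕ} (hβ : β.degree < j) : coeff β (logDer w.func) = 0 := by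
  have h : CongrMod j w.func 1 := by
    by_contra h
    exact hwj ⟨hw, h⟩
  have := h.logDer (hD w hw).coeff_zero (by simp) β hβ
  rwa [logDer_one, map_zero] at this

theorem finite_coeff_logDer_ne_zero {s : Seed I ι'} {D : Set (CWall k I ι')}
    (hD : IsCScatteringDiagram s D) (β : I →₀ ℕ) :
    {w ∈ D | coeff β (logDer w.func) ≠ 0}.Finite := by
  refine (hD.2 (β.degree + 1)).subset fun w hw => ?_
  by_contra hwj
  exact hw.2 (coeff_logDer_cwall_eq_zero hD.1 hw.1 hwj (Nat.lt_succ_self _))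

theorem clogAt_eq_add {s : Seed I ι'} {D In : Set (CWall k I ι')} (hD : IsCScatteringDiagram s D)
    (hIn : In ⊆ D) (x : ι' → ℝ) (β : I →₀ ℕ) :
    clogAt D x β = clogAt In x β + clogAt (D \ In) x β := by
  have hf := finite_coeff_logDer_ne_zero hD β
  rw [clogAt, clogAt, clogAt, ← finsum_mem_union']
  · congr! 3 with w
    simp only [Set.mem_ofPred_eq, Set.mem_union, Set.mem_sdiff]
    by_cases hw : w ∈ In
    · simp [hw, hIn hw]
    · simp [hw]
  · exact Set.disjoint_left.2 fun w hw hw' => hw'.1.2 hw.1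
  · exact hf.subset fun w hw => ⟨hIn hw.1.1, hw.2⟩
  · exact hf.subset fun w hw => ⟨hw.1.1.1, hw.2⟩

theorem Seed.logAt_restrWall {s : Seed I ι'} {e : ι ↪ ι'} {D : Set (CWall k I ι')}
    (hD : IsCScatteringDiagram s D) (hc : ∀ w ∈ D, IsCylinder e w.cone) (x : ι' → ℝ)
    (β : I →₀ ℕ) : logAt (s.restrWall e '' D) (proj e x) β =
      AddMonoidAlgebra.single (s.restrP e β) (clogAt D x β) := by
  have hset : {w ∈ s.restrWall e '' D | proj e x ∈ w.cone} =
      s.restrWall e '' {w ∈ D | x ∈ w.cone} := by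
    ext w
    constructor
    · rintro ⟨⟨w, hw, rfl⟩, hx⟩
      exact ⟨w, ⟨hw, (hc w hw).proj_mem_iff.1 hx⟩, rfl⟩
    · rintro ⟨w, ⟨hw, hx⟩, rfl⟩
      exact ⟨⟨w, hw, rfl⟩, (hc w hw).proj_mem_iff.2 hx⟩
  rw [logAt, hset, finsum_mem_image ((s.injOn_restrWall hD.1 hc).mono fun w hw => hw.1)]
  have hfin : ({w ∈ D | x ∈ w.cone} ∩
      Function.support fun w : CWall k I ι' => coeff β (logDer w.func)).Finite :=
    (finite_coeff_logDer_ne_zero hD β).subset fun w hw => ⟨hw.1.1, hw.2⟩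
  have h := AddMonoidHom.map_finsum_mem' (AddMonoidAlgebra.singleAddHom (s.restrP e β)) hfin
  change _ = AddMonoidAlgebra.singleAddHom (s.restrP e β) (clogAt D x β)
  rw [clogAt, h]
  refine finsum_mem_congr rfl fun w hw => ?_
  change coeff β (logDer (s.restrSeries e w.func)) = _
  rw [s.logDer_restrSeries e (hD.1 w hw.1).coeff_zero]
  rfl

/-- Equality outside of a set of codimension two of the logarithms of two sets of `C`-walls. -/
def CGenEq (D D' : Set (CWall k I ι')) : Prop :=
  ∃ Z, Small Z ∧ ∀ x ∉ Z, ∀ β, clogAt D x β = clogAt D' x β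

theorem Seed.genEq_restrWall_refl_iff {s : Seed I ι'} {D D' : Set (CWall k I ι')}
    (hD : IsCScatteringDiagram s D) (hD' : IsCScatteringDiagram s D') :
    GenEq (s.restrWall (Function.Embedding.refl ι') '' D)
      (s.restrWall (Function.Embedding.refl ι') '' D') ↔ CGenEq D D' := by
  refine exists_congr fun Z => and_congr_right fun _ => forall₃_congr fun x _ β => ?_
  have h := s.logAt_restrWall hD hD.isCylinder_refl x β
  have h' := s.logAt_restrWall hD' hD'.isCylinder_refl x β
  have hx : proj (Function.Embedding.refl ι') x = x := rfl
  rw [hx] at h h'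
  rw [h, h']
  exact (single_right_injective _).eq_iff

section

variable [CharZero k] {s : Seed I ι'} {e : ι ↪ ι'} {D D' : Set (CWall k I ι')}

/-- Equivalence of `C`-scattering diagrams in terms of the attached scattering diagrams. -/
theorem Seed.genEq_restrWall_iff (hD : IsCScatteringDiagram s D)
    (hc : ∀ w ∈ D, IsCylinder e w.cone) (hD' : IsCScatteringDiagram s D')
    (hc' : ∀ w ∈ D', IsCylinder e w.cone) :
    GenEq (s.restrWall e '' D) (s.restrWall e '' D') ↔ CEquivalent s D D' := by
  rw [← s.pathEquivalent_restrWall_iff hD hc hD' hc']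
  exact (pathEquivalent_iff_genEq (s.isScatteringDiagram_restrWall hD hc)
    (s.isScatteringDiagram_restrWall hD' hc')).symm

theorem cEquivalent_iff_cGenEq (hD : IsCScatteringDiagram s D) (hD' : IsCScatteringDiagram s D') :
    CEquivalent s D D' ↔ CGenEq D D' := by
  rw [← s.genEq_restrWall_iff hD hD.isCylinder_refl hD' hD'.isCylinder_refl,
    s.genEq_restrWall_refl_iff hD hD']

theorem CGenEq.isCConsistent (h : CGenEq D D') (hD : IsCScatteringDiagram s D)
    (hD' : IsCScatteringDiagram s D') (hcons : IsCConsistent s D') : IsCConsistent s D := by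
  rw [← s.genEq_restrWall_refl_iff hD hD'] at h
  rw [← s.isConsistent_restrWall_iff hD hD.isCylinder_refl]
  rw [← s.isConsistent_restrWall_iff hD' hD'.isCylinder_refl] at hcons
  exact h.isConsistent (s.isScatteringDiagram_restrWall hD hD.isCylinder_refl)
    (s.isScatteringDiagram_restrWall hD' hD'.isCylinder_refl) hcons

end

variable [DecidableEq ι]

theorem Seed.incl_prin (s : Seed I ι) (β : I →₀ ℕ) : s.prin.incl β = Sum.elim (s.incl β) 0 := by
  funext j
  rcases j with j | j
  · simp [Seed.incl, Seed.e, Seed.prin, Finset.sum_apply, Pi.single_apply]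
  · simp [Seed.incl, Seed.e, Seed.prin, Finset.sum_apply]

theorem Seed.restrP_prin (s : Seed I ι) (β : I →₀ ℕ) :
    s.prin.restrP Function.Embedding.inl β = s.p1 (s.incl β) := by
  funext j
  change s.prin.p1 (s.prin.incl β) (Sum.inl j) = _
  rw [s.incl_prin]
  simp [Seed.p1, Seed.prin, Fintype.sum_sum_type]

theorem psiWall_eq (s : Seed I ι) (w : CWall k I (ι ⊕ ι)) :
    psiWall s w = s.prin.restrWall Function.Embedding.inl w := by
  have h : toPrin s w.func = s.prin.restrSeries Function.Embedding.inl w.func := by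
    funext β
    rw [toPrin, Seed.restrSeries, s.restrP_prin]
  rw [psiWall, Seed.restrWall, s.restrP_prin, h]
  rfl

theorem psi_eq (s : Seed I ι) (D : Set (CWall k I (ι ⊕ ι))) :
    Psi s D = s.prin.restrWall Function.Embedding.inl '' D := by
  rw [Psi]
  exact Set.image_congr fun w _ => psiWall_eq s w

theorem IsCPrinDiagram.isCylinder {s : Seed I ι} {D : Set (CWall k I (ι ⊕ ι))}
    (hD : IsCPrinDiagram s D) (w : CWall k I (ι ⊕ ι)) (hw : w ∈ D) :
    IsCylinder (Function.Embedding.inl : ι ↪ ι ⊕ ι) w.cone := by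
  refine ⟨(hD.1.1 w hw).isWallCone, fun x hx x' hx' => ?_⟩
  have h := (hD.2 w hw).2 x hx fun j => x' (Sum.inr j) - x (Sum.inr j)
  have e1 : x + Sum.elim (0 : ι → ℝ) (fun j => x' (Sum.inr j) - x (Sum.inr j)) = x' := by
    funext j
    rcases j with j | j
    · have := congrFun hx' j
      simp only [proj_apply, Function.Embedding.inl_apply] at this
      simp [this]
    · simp
  rwa [e1] at h

/-- Walls which are invariant under `N_ℝ` are those of `C_prin`-scattering diagrams. -/
theorem isCPrinDiagram_of_isCylinder {s : Seed I ι} {D : Set (CWall k I (ι ⊕ ι))}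
    (hD : IsCScatteringDiagram s.prin D)
    (hc : ∀ w ∈ D, IsCylinder (Function.Embedding.inl : ι ↪ ι ⊕ ι) w.cone) :
    IsCPrinDiagram s D := by
  refine ⟨hD, fun w hw => ⟨⟨s.incl w.normal, fun h0 => ?_, ?_⟩, fun x hx y => ?_⟩⟩
  · refine (hD.1 w hw).primitive.ne_zero ?_
    rw [s.incl_prin, h0]
    funext j
    rcases j with j | j <;> rfl
  · rw [← s.incl_prin]
    exact (hD.1 w hw).subset_perp
  · refine (hc w hw).2 x hx _ (funext fun j => ?_)
    simp [proj_apply]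

section

variable [CharZero k] {s : Seed I ι} {D D' : Set (CWall k I (ι ⊕ ι))}

theorem IsCPrinDiagram.isScatteringDiagram_psi (hD : IsCPrinDiagram s D) :
    IsScatteringDiagram (Psi s D) := by
  rw [psi_eq]
  exact s.prin.isScatteringDiagram_restrWall hD.1 hD.isCylinder

theorem IsCPrinDiagram.incoming_iff (hD : IsCPrinDiagram s D) {w : CWall k I (ι ⊕ ι)}
    (hw : w ∈ D) : w.Incoming s.prin ↔ (psiWall s w).Incoming := by
  rw [psiWall_eq]
  exact s.prin.incoming_restrWall_iff (hD.isCylinder w hw)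

theorem IsCPrinDiagram.genEq_psi_iff (hD : IsCPrinDiagram s D) (hD' : IsCPrinDiagram s D') :
    GenEq (Psi s D) (Psi s D') ↔ CEquivalent s.prin D D' := by
  rw [psi_eq, psi_eq]
  exact s.prin.genEq_restrWall_iff hD.1 hD.isCylinder hD'.1 hD'.isCylinder

theorem IsCPrinDiagram.equivalent_psi_iff (hD : IsCPrinDiagram s D) (hD' : IsCPrinDiagram s D') :
    CEquivalent s.prin D D' ↔ Equivalent (Psi s D) (Psi s D') := by
  rw [← hD.genEq_psi_iff hD',
    equivalent_iff_genEq hD.isScatteringDiagram_psi hD'.isScatteringDiagram_psi]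

theorem IsCPrinDiagram.isConsistent_psi_iff (hD : IsCPrinDiagram s D) :
    IsCConsistent s.prin D ↔ IsConsistent (Psi s D) := by
  rw [psi_eq, s.prin.isConsistent_restrWall_iff hD.1 hD.isCylinder]

end

end Psi
end HDTVCluster

namespace HDTVCluster

/-! ### Replacing cones by cylinders -/

section Shear

open Filter Topology

variable {ι ι' : Type*} [Fintype ι] [Fintype ι'] {e : ι ↪ ι'}

/-- Up to a positive factor, the projection along the kernel of `proj e` to a rational complement
which contains the given vector `P`. -/
theorem exists_integral_projection (e : ι ↪ ι') {P : ι' → ℤ} {j : ι} (hP : P (e j) ≠ 0) :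
    ∃ (a : ℝ) (T : (ι' → ℝ) →ₗ[ℝ] (ι' → ℝ)) (Tt : (ι' → ℤ) → (ι' → ℤ)), 0 < a ∧
      (∀ b x, pair (Tt b) x = pair b (T x)) ∧ (∀ x, proj e (T x) = a • proj e x) ∧
      (∀ x x', proj e x = proj e x' → T x = T x') ∧ T (toReal P) = a • toReal P := by
  classical
  let q : ℤ := P (e j)
  have hq : (q : ℝ) ≠ 0 := by exact_mod_cast hP
  -- the coordinate `e j` is used to deform the section `lift e` to one whose image contains `P`
  let T : (ι' → ℝ) →ₗ[ℝ] (ι' → ℝ) := ((q : ℝ) ^ 2) • (lift e ∘ₗ proj e) +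
    (LinearMap.proj (e j) : (ι' → ℝ) →ₗ[ℝ] ℝ).smulRight
      ((q : ℝ) • (toReal P - lift e (proj e (toReal P))))
  have hT : ∀ x, T x = (q : ℝ) ^ 2 • lift e (proj e x) +
      x (e j) • (q : ℝ) • (toReal P - lift e (proj e (toReal P))) := fun x => rfl
  let r : (ι' → ℤ) → (ι' → ℤ) := fun b i => if i ∈ Set.range e then b i else 0
  have hr0 : ∀ b, ∀ i ∉ Set.range e, r b i = 0 := fun b i hi => if_neg hi
  have hr1 : ∀ b i, r b (e i) = b (e i) := fun b i => if_pos ⟨i, rfl⟩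
  have hr : ∀ b x, pair (r b) x = pair b (lift e (proj e x)) := by
    intro b x
    rw [pair_lift, ← pair_proj e (hr0 b)]
    simp only [hr1]
  refine ⟨(q : ℝ) ^ 2, T, fun b => q ^ 2 • r b +
    (q * dotProduct (b - r b) P) • Pi.single (e j) 1, by positivity, fun b x => ?_, fun x => ?_,
    fun x x' h => ?_, ?_⟩
  · have h1 : pair (Pi.single (e j) 1 : ι' → ℤ) x = x (e j) := by
      simp [pair, Pi.single_apply]
    have h3 : ((dotProduct (b - r b) P : ℤ) : ℝ) =
        pair b (toReal P) - pair b (lift e (proj e (toReal P))) := by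
      rw [← hr, sub_dotProduct, Int.cast_sub, pair_toReal, pair_toReal]
    rw [add_pair, smul_pair, smul_pair, h1, hr, hT, pair_add, pair_smul, pair_smul, pair_smul,
      pair_sub, ← h3]
    push_cast
    ring
  · rw [hT, map_add, map_smul, map_smul, map_smul, map_sub, proj_lift, proj_lift, sub_self,
      smul_zero, smul_zero, add_zero]
  · have hj := congrFun h j
    rw [proj_apply, proj_apply] at hj
    rw [hT, hT, h, hj]
  · have hPj : toReal P (e j) = q := rfl
    rw [hT, hPj, smul_smul, ← sq, smul_sub, add_sub_cancel]

/-- Given finitely many cones in a hyperplane `n^⊥` which contains the kernel `K` of `proj e`, and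
a vector `P ∈ n^⊥` outside of `K`, one gets cones which are invariant under `K` by intersecting with
a complement of `K` containing `P`, and adding `K`.  The complement is moved by a small general
vector of `K`, and the cones which do not meet the moved complement in codimension one are
discarded.  Then the remaining cylinders through a general `x` are those of the cones which contain
all points of `n^⊥` near a certain element of `x + K`. -/
theorem exists_cylinders {n P : ι' → ℤ} (hn : IsPrimitive n)
    (hn0 : ∀ j ∉ Set.range e, n j = 0) {j : ι} (hP : P (e j) ≠ 0)
    {F : Set (Set (ι' → ℝ))} (hF : F.Finite) (hFn : ∀ d ∈ F, IsWallCone d ∧ HasNormal d n) :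
    ∃ (C : Set (ι' → ℝ) → Set (ι' → ℝ)) (G : Set (Set (ι' → ℝ))),
      (∀ d ∈ F, d ∈ G → IsCylinder e (C d) ∧ C d ⊆ perp n ∧ (toReal P ∈ C d → toReal P ∈ d)) ∧
      ∃ Z, Small Z ∧ ∀ x ∉ Z, pair n x = 0 → ∃ z, proj e z = proj e x ∧
        ∀ᶠ y in 𝓝 z, pair n y = 0 → ∀ d ∈ F, (y ∈ d ↔ d ∈ G ∧ x ∈ C d) := by
  classical
  obtain ⟨a, T, Tt, ha, hTt, hproj, hdep, hTP⟩ := exists_integral_projection e hP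
  choose! B hBpos hBeq using fun d (hd : d ∈ F) => (hFn d hd).1.exists_forms (hFn d hd).2
  let V : Finset (ι' → ℤ) := hF.toFinset.biUnion B
  have hV : ∀ d ∈ F, ∀ b ∈ B d, b ∈ V := fun d hd b hb =>
    Finset.mem_biUnion.2 ⟨d, hF.mem_toFinset.2 hd, hb⟩
  have hnT : ∀ x, pair n (T x) = a * pair n x := fun x => by
    rw [← pair_proj e hn0, hproj, pair_smul, pair_proj e hn0]
  have hnK : ∀ x, proj e x = 0 → pair n x = 0 := fun x hx => by
    rw [← pair_proj e hn0, hx, pair_zero]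
  -- the forms which vanish on the complement of `K` in `n^⊥`
  let N : Set (ι' → ℤ) := {b | ∀ x, pair n x = 0 → pair b (T x) = 0}
  have hNK : ∀ b ∈ V, b ∈ N → ∃ y ∈ LinearMap.ker (proj e), pair b y ≠ 0 := by
    intro b hb hbN
    by_contra! hcon
    obtain ⟨d, hd, hbd⟩ := Finset.mem_biUnion.1 hb
    have hd := hF.mem_toFinset.1 hd
    obtain ⟨x, hx, hpos⟩ := hBpos d hd b hbd
    have h1 := hbN x ((hFn d hd).2.pair_eq_zero hx)
    have h2 := hcon (a • x - T x) (by
      rw [LinearMap.mem_ker, map_sub, hproj, map_smul, sub_self])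
    rw [pair_sub, pair_smul, h1, sub_zero] at h2
    exact (mul_pos ha hpos).ne' h2
  have : Finite {b // b ∈ V ∧ b ∈ N} := (V.finite_toSet.subset fun b hb => hb.1).to_subtype
  -- the general vector of `K` by which the complement is moved
  obtain ⟨y0, hy0, hy0ne⟩ := Module.Dual.exists_forall_mem_ne_zero_of_forall_exists
    (LinearMap.ker (proj e)) (fun b : {b // b ∈ V ∧ b ∈ N} => pairL b.1) fun b => by
      obtain ⟨y, hy, hne⟩ := hNK b.1 b.2.1 b.2.2
      exact ⟨y, hy, hne⟩
  have hy0ne : ∀ b ∈ V, b ∈ N → pair b y0 ≠ 0 := fun b hb hbN => hy0ne ⟨b, hb, hbN⟩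
  have hy0 : proj e y0 = 0 := hy0
  refine ⟨fun d => T ⁻¹' d, {d | IsWallCone (T ⁻¹' d) ∧ ∀ b ∈ B d, b ∈ N → 0 < pair b y0},
    fun d hd hdG => ⟨⟨hdG.1, fun x hx x' hx' => ?_⟩, fun x hx => ?_, fun h => ?_⟩,
    ⋃ b ∈ {b | b ∈ V ∧ b ∉ N}, {x | pair n x = 0 ∧ pair (Tt b) x = 0}, ?_, fun x hx hnx => ?_⟩
  · rw [Set.mem_preimage, hdep x' x hx']
    exact hx
  · have h1 := (hFn d hd).2.pair_eq_zero hx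
    rw [hnT] at h1
    exact (mul_eq_zero.1 h1).resolve_left ha.ne'
  · rw [Set.mem_preimage, hTP] at h
    exact (smul_mem_iff_of_isRationalPolyhedralCone (hFn d hd).1.1 ha).1 h
  · refine Small.biUnion (V.finite_toSet.subset fun b hb => hb.1).countable fun b hb => ?_
    have h1 : ∃ x, pair n x = 0 ∧ pair b (T x) ≠ 0 := by
      by_contra! hcon
      exact hb.2 hcon
    obtain ⟨x, hx, hbx⟩ := h1
    rw [← hTt] at hbx
    exact small_inter hn.ne_zero hx hbx 0 0
  · have hxne : ∀ b ∈ V, b ∉ N → pair b (T x) ≠ 0 := fun b hb hbN h0 =>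
      hx (Set.mem_biUnion (x := b) ⟨hb, hbN⟩ ⟨hnx, by rw [hTt, h0]⟩)
    -- the sign of a form at a point near the complement
    have hev : ∀ᶠ ε : ℝ in 𝓝[>] 0, ∀ b ∈ V, (pair b (a⁻¹ • T x + ε • y0) ≠ 0 ∧
        (0 < pair b (a⁻¹ • T x + ε • y0) ↔ 0 ≤ pair b (T x) ∧ (b ∈ N → 0 < pair b y0))) := by
      rw [Filter.eventually_all_finset]
      intro b hb
      by_cases hbN : b ∈ N
      · filter_upwards [self_mem_nhdsWithin] with ε hε
        have hε : 0 < ε := hε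
        rw [pair_add, pair_smul, pair_smul, hbN x hnx, mul_zero, zero_add]
        refine ⟨mul_ne_zero hε.ne' (hy0ne b hb hbN), ?_⟩
        rw [mul_pos_iff_of_pos_left hε]
        simp [hbN]
      · have hcont : Tendsto (fun ε : ℝ => pair b (a⁻¹ • T x + ε • y0)) (𝓝[>] 0)
            (𝓝 (a⁻¹ * pair b (T x))) := by
          refine tendsto_nhdsWithin_of_tendsto_nhds ?_
          have : Continuous fun ε : ℝ => pair b (a⁻¹ • T x + ε • y0) :=
            (continuous_pair b).comp (by fun_prop)
          simpa [pair_smul] using this.tendsto 0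
        have hai : 0 < a⁻¹ := inv_pos.2 ha
        rcases lt_or_gt_of_ne (hxne b hb hbN) with h | h
        · filter_upwards [hcont.eventually_lt_const (mul_neg_of_pos_of_neg hai h)] with ε hε
          exact ⟨hε.ne, iff_of_false hε.not_gt fun h' => h.not_ge h'.1⟩
        · filter_upwards [hcont.eventually_const_lt (mul_pos hai h)] with ε hε
          exact ⟨hε.ne', iff_of_true hε ⟨h.le, fun h' => absurd h' hbN⟩⟩
    -- the element of `x + K` which lies in the moved complement
    obtain ⟨ε, hε⟩ := hev.exists
    refine ⟨a⁻¹ • T x + ε • y0, ?_, ?_⟩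
    · rw [map_add, map_smul, map_smul, hproj, hy0, smul_zero, add_zero, smul_smul,
        inv_mul_cancel₀ ha.ne', one_smul]
    · have hev' : ∀ᶠ y in 𝓝 (a⁻¹ • T x + ε • y0), ∀ b ∈ V, (0 ≤ pair b y ↔
          0 < pair b (a⁻¹ • T x + ε • y0)) := by
        rw [Filter.eventually_all_finset]
        intro b hb
        have hcont := (continuous_pair b).tendsto (a⁻¹ • T x + ε • y0)
        rcases lt_or_gt_of_ne (hε b hb).1 with h | h
        · filter_upwards [hcont.eventually_lt_const h] with y hy
          exact iff_of_false hy.not_ge h.not_gt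
        · filter_upwards [hcont.eventually_const_lt h] with y hy
          exact iff_of_true hy.le h
      filter_upwards [hev'] with y hy hny d hd
      have h1 : y ∈ d ↔ ∀ b ∈ B d, 0 ≤ pair b (T x) ∧ (b ∈ N → 0 < pair b y0) := by
        conv_lhs => rw [hBeq d hd]
        simp only [Set.mem_ofPred_eq, hny, true_and]
        exact forall₂_congr fun b hb => (hy b (hV d hd b hb)).trans (hε b (hV d hd b hb)).2
      have hTd : ∀ u, T u ∈ d ↔ pair n u = 0 ∧ ∀ b ∈ B d, 0 ≤ pair b (T u) := by
        intro u
        conv_lhs => rw [hBeq d hd]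
        simp only [Set.mem_ofPred_eq, hnT, mul_eq_zero, ha.ne', false_or]
      rw [h1]
      constructor
      -- if `d` contains the points near `z`, then `T x` satisfies strictly the inequalities which do
      -- not vanish on the complement, so that `T ⁻¹' d` has codimension one
      · intro h
        have hmem : T x ∈ d := (hTd x).2 ⟨hnx, fun b hb => (h b hb).1⟩
        refine ⟨⟨⟨?_, ?_⟩, fun b hb => (h b hb).2⟩, hmem⟩
        · obtain ⟨A, hA⟩ := (hFn d hd).1.1
          refine ⟨A.image Tt, Set.ext fun u => ?_⟩
          rw [Set.mem_preimage, hA]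
          simp only [Set.mem_ofPred_eq, Finset.forall_mem_image, hTt]
        · have hsub : T ⁻¹' d ⊆ perp n := fun u hu => ((hTd u).1 hu).1
          refine HasNormal.coneDim (n := n) ⟨hn, fun u => ⟨fun hu => ?_, fun hu => ?_⟩⟩
          · exact Submodule.span_le (p := LinearMap.ker (pairL n)).2 hsub hu
          · refine le_span_of_eventually (W := LinearMap.ker (pairL n)) (x := x) hnx ?_ hu
            have hev2 : ∀ᶠ u in 𝓝 x, ∀ b ∈ B d, b ∉ N → 0 < pair b (T u) := by
              rw [Filter.eventually_all_finset]
              intro b hb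
              by_cases hbN : b ∈ N
              · exact Eventually.of_forall fun u h => absurd hbN h
              · have hpos := lt_of_le_of_ne (h b hb).1 (hxne b (hV d hd b hb) hbN).symm
                have hc : Continuous fun u => pair b (T u) :=
                  (continuous_pair b).comp T.continuous_of_finiteDimensional
                filter_upwards [(hc.tendsto x).eventually_const_lt hpos] with u hu _
                exact hu
            filter_upwards [hev2] with u hu hnu
            refine (hTd u).2 ⟨hnu, fun b hb => ?_⟩
            by_cases hbN : b ∈ N
            · exact (hbN u hnu).ge
            · exact (hu b hb hbN).le
      · rintro ⟨⟨-, hG⟩, hmem⟩ b hb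
        exact ⟨((hTd x).1 hmem).2 b hb, hG b hb⟩

end Shear
end HDTVCluster

namespace HDTVCluster

/-! ### Exponentials of monomials -/

section ExpMonomial

open MvPowerSeries

variable {k I : Type*} [Field k]

/-- The exponential of `c t^β`, for `β ≠ 0`. -/
noncomputable def expMonomial (β : I →₀ ℕ) (c : k) : MvPowerSeries I k :=
  open Classical in
  fun γ => if γ = (γ.degree / β.degree) • β then
    c ^ (γ.degree / β.degree) / ((γ.degree / β.degree).factorial : k) else 0

theorem degree_pos_of_ne_zero {β : I →₀ ℕ} (hβ : β ≠ 0) : 0 < β.degree :=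
  Nat.pos_of_ne_zero fun h => hβ (β.degree_eq_zero_iff.1 h)

theorem coeff_expMonomial_nsmul {β : I →₀ ℕ} (hβ : β ≠ 0) (c : k) (r : ℕ) :
    coeff (r • β) (expMonomial β c) = c ^ r / (r.factorial : k) := by
  have h : (r • β).degree / β.degree = r := by
    rw [map_nsmul, smul_eq_mul, Nat.mul_div_cancel _ (degree_pos_of_ne_zero hβ)]
  classical
  change ite _ _ _ = _
  rw [h, if_pos rfl]

theorem coeff_expMonomial_eq_zero {β γ : I →₀ ℕ} (c : k) (h : ∀ r : ℕ, γ ≠ r • β) :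
    coeff γ (expMonomial β c) = 0 :=
  if_neg (h _)

theorem coeff_zero_expMonomial {β : I →₀ ℕ} (hβ : β ≠ 0) (c : k) :
    coeff 0 (expMonomial β c) = 1 := by
  simpa using coeff_expMonomial_nsmul hβ c 0

theorem logDer_expMonomial [CharZero k] {β : I →₀ ℕ} (hβ : β ≠ 0) (c : k) :
    logDer (expMonomial β c) = monomial β ((β.degree : k) * c) := by
  classical
  refine eq_logDer (coeff_zero_expMonomial hβ c) ?_
  ext γ
  rw [coeff_euler, coeff_monomial_mul]
  by_cases hγ : ∃ r : ℕ, γ = r • β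
  · obtain ⟨r, rfl⟩ := hγ
    rw [coeff_expMonomial_nsmul hβ]
    cases r with
    | zero =>
      rw [zero_smul, if_neg fun h => hβ (le_antisymm h bot_le)]
      simp
    | succ r =>
      have h : (r + 1) • β - β = r • β := by rw [succ_nsmul, add_tsub_cancel_right]
      rw [if_pos (by rw [succ_nsmul]; exact le_add_self), h, coeff_expMonomial_nsmul hβ, map_nsmul,
        smul_eq_mul, Nat.factorial_succ]
      push_cast
      have h1 : (r.factorial : k) ≠ 0 := by exact_mod_cast r.factorial_ne_zero
      have h2 : ((r : k) + 1) ≠ 0 := by exact_mod_cast r.succ_ne_zero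
      field_simp
      ring
  · push Not at hγ
    rw [coeff_expMonomial_eq_zero c hγ, mul_zero]
    split_ifs with h
    · rw [coeff_expMonomial_eq_zero c fun r hr => hγ (r + 1) ?_, mul_zero]
      rw [succ_nsmul, ← hr, tsub_add_cancel_of_le h]
    · rfl

end ExpMonomial

/-! ### Diagrams of cylinders -/

section CylinderDiagram

open Filter Topology MvPowerSeries

variable {k I ι ι' : Type*} [Field k] [Fintype I] [Fintype ι] [Fintype ι'] [DecidableEq ι']
  {s : Seed I ι'} {e : ι ↪ ι'}

/-- The logarithm as a sum over the finite set of walls which contribute in degree `β`. -/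
theorem clogAt_eq_sum {R : Set (CWall k I ι')} {β : I →₀ ℕ}
    (hfin : {w ∈ R | coeff β (logDer w.func) ≠ 0}.Finite) (p : CWall k I ι' → Prop)
    [DecidablePred p] (x : ι' → ℝ)
    (hp : ∀ w ∈ R, coeff β (logDer w.func) ≠ 0 → (x ∈ w.cone ↔ p w)) :
    clogAt R x β = ∑ w ∈ hfin.toFinset.filter p, coeff β (logDer w.func) := by
  rw [clogAt]
  refine finsum_mem_eq_sum_of_inter_support_eq _ ?_
  ext w
  simp only [Set.mem_inter_iff, Set.mem_ofPred_eq, Function.mem_support, Finset.coe_filter,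
    Set.Finite.mem_toFinset]
  constructor
  · rintro ⟨⟨h1, h2⟩, h3⟩
    exact ⟨⟨⟨h1, h3⟩, (hp w h1 h3).1 h2⟩, h3⟩
  · rintro ⟨⟨⟨h1, h3⟩, h2⟩, -⟩
    exact ⟨⟨h1, (hp w h1 h3).2 h2⟩, h3⟩

theorem clogAt_eq_zero {R : Set (CWall k I ι')} {β : I →₀ ℕ} {x : ι' → ℝ}
    (h : ∀ w ∈ R, coeff β (logDer w.func) ≠ 0 → x ∉ w.cone) : clogAt R x β = 0 := by
  rw [clogAt]
  refine finsum_mem_eq_zero_of_forall_eq_zero fun w hw => ?_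
  by_contra h0
  exact h w hw.1 h0 hw.2

/-- All walls which contribute to the logarithm in degree `β` have the same normal vector, the
primitive vector proportional to `β`. -/
theorem IsCWall.normal_eq_of_coeff_ne_zero {w w' : CWall k I ι'} (hw : IsCWall s w)
    (hw' : IsCWall s w') {β : I →₀ ℕ} {r r' : ℕ} (h : β = r • w.normal)
    (hr' : 1 ≤ r') (h' : β = r' • w'.normal) : w.normal = w'.normal := by
  have key : ∀ (m : I →₀ ℕ) (r : ℕ) (x : ι' → ℝ), pair (s.incl (r • m)) x =
      r * pair (s.incl m) x := by
    intro m r x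
    induction r with
    | zero => simp [s.incl_zero, pair]
    | succ r ih =>
      have : s.incl ((r + 1) • m) = s.incl (r • m) + s.incl m := by rw [succ_nsmul, s.incl_add]
      rw [this, add_pair, ih]
      push_cast
      ring
  refine hw.normal_eq hw' fun x hx => ?_
  rw [hw'.hasNormal.mem_span_iff]
  rw [hw.hasNormal.mem_span_iff] at hx
  have h1 := key w.normal r x
  rw [← h, h', key, hx, mul_zero] at h1
  exact (mul_eq_zero.1 h1).resolve_left (by exact_mod_cast (Nat.one_le_iff_ne_zero.1 hr'))

/-- The logarithm of the function of a `C`-wall only has terms in the degrees `r n`, `r ≥ 1`. -/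
theorem exists_nsmul_of_coeff_logDer_ne_zero {w : CWall k I ι'} (hw : IsCWall s w) {β : I →₀ ℕ}
    (h : coeff β (logDer w.func) ≠ 0) : β ≠ 0 ∧ ∃ r : ℕ, 1 ≤ r ∧ β = r • w.normal := by
  classical
  -- induction on the degree, by comparing coefficients in `logDer f * f = euler f`
  have key : ∀ (d : ℕ) (β : I →₀ ℕ), β.degree = d → coeff β (logDer w.func) ≠ 0 →
      β ≠ 0 ∧ ∃ r : ℕ, 1 ≤ r ∧ β = r • w.normal := by
    intro d
    induction d using Nat.strong_induction_on with
    | _ d ih =>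
      intro β hd hl
      have hβ : β ≠ 0 := by
        rintro rfl
        exact hl (coeff_zero_logDer _)
      refine ⟨hβ, ?_⟩
      by_contra hcon
      have hf : coeff β w.func = 0 := by
        by_contra h0
        exact hcon (hw.coeff_ne_zero β hβ h0)
      have h1 := congrArg (coeff β) (logDer_mul_self hw.coeff_zero)
      rw [coeff_euler, hf, mul_zero, coeff_mul, Finset.sum_eq_single (β, 0), hw.coeff_zero,
        mul_one] at h1
      · exact hl h1
      · rintro ⟨a, b⟩ hab hne
        rw [Finset.HasAntidiagonal.mem_antidiagonal] at hab
        dsimp only at hab ⊢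
        by_contra hprod
        have hb : b ≠ 0 := by
          rintro rfl
          exact hne (by rw [← hab, add_zero])
        obtain ⟨r', hr', hbr⟩ := hw.coeff_ne_zero b hb (right_ne_zero_of_mul hprod)
        have hlt : a.degree < d := by
          rw [← hd, ← hab, map_add]
          exact Nat.lt_add_of_pos_right (degree_pos_of_ne_zero hb)
        obtain ⟨-, r, hr, har⟩ := ih _ hlt a rfl (left_ne_zero_of_mul hprod)
        exact hcon ⟨r + r', le_add_right hr, by rw [← hab, har, hbr, add_smul]⟩
      · exact fun h => absurd (Finset.HasAntidiagonal.mem_antidiagonal.2 (add_zero β)) h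
  exact key _ β rfl h

variable [CharZero k]

/-- The outgoing walls of degree `β` can be replaced by walls which are cylinders, if their
contribution is invariant under the translations in the kernel of `proj e`. -/
theorem exists_cylinder_walls (huf : ∀ i, s.uf i ∈ Set.range e) {R : Set (CWall k I ι')}
    (hR : IsCScatteringDiagram s R) (hout : ∀ w ∈ R, ¬ w.Incoming s) (β : I →₀ ℕ)
    (hinv : ∀ y, proj e y = 0 → ∃ Z, Small Z ∧ ∀ x ∉ Z, clogAt R x β = clogAt R (x + y) β) :
    ∃ N : Set (CWall k I ι'), N.Finite ∧
      (∀ w ∈ N, IsCWall s w ∧ IsCylinder e w.cone ∧ ¬ w.Incoming s ∧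
        β ≠ 0 ∧ ∃ c : k, c ≠ 0 ∧ w.func = expMonomial β c) ∧
      ∃ Z, Small Z ∧ ∀ x ∉ Z, clogAt N x β = clogAt R x β := by
  classical
  have hfin := finite_coeff_logDer_ne_zero hR β
  by_cases hne : ∀ w ∈ R, coeff β (logDer w.func) = 0
  · refine ⟨∅, Set.finite_empty, fun w hw => hw.elim, ∅, small_empty, fun x _ => ?_⟩
    rw [clogAt_eq_zero fun w hw => hw.elim, clogAt_eq_zero fun w hw h => absurd (hne w hw) h]
  push Not at hne
  obtain ⟨w₀, hw₀, hβ₀⟩ := hne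
  obtain ⟨hβ, r₀, hr₀, hr₀β⟩ := exists_nsmul_of_coeff_logDer_ne_zero (hR.1 w₀ hw₀) hβ₀
  have hnormal : ∀ w ∈ R, coeff β (logDer w.func) ≠ 0 → w.normal = w₀.normal := by
    intro w hw h
    obtain ⟨-, r, -, hrβ⟩ := exists_nsmul_of_coeff_logDer_ne_zero (hR.1 w hw) h
    exact (hR.1 w hw).normal_eq_of_coeff_ne_zero (hR.1 w₀ hw₀) hrβ hr₀ hr₀β
  let n := s.incl w₀.normal
  let P := s.p1 n
  -- a countable dense set of translations
  obtain ⟨Y, hYc, hYd⟩ := TopologicalSpace.exists_countable_dense (LinearMap.ker (proj e))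
  choose! Z hZ hZeq using hinv
  have hZ0 : Small (⋃ y ∈ Y, Z (y : ι' → ℝ)) := Small.biUnion hYc fun y _ => hZ y y.2
  -- at a general `x`, the invariance lets one move `x` into any open subset of `x + ker (proj e)`
  have hmove : ∀ x ∉ ⋃ y ∈ Y, Z (y : ι' → ℝ), ∀ z, proj e z = proj e x → ∀ U ∈ 𝓝 z,
      ∃ u ∈ U, proj e u = proj e x ∧ clogAt R x β = clogAt R u β := by
    intro x hx z hz U hU
    have hcont : Tendsto (fun y : LinearMap.ker (proj e) => x + (y : ι' → ℝ))
        (𝓝 ⟨z - x, by rw [LinearMap.mem_ker, map_sub, hz, sub_self]⟩) (𝓝 z) := by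
      have h : Continuous fun y : LinearMap.ker (proj e) => x + (y : ι' → ℝ) := by fun_prop
      simpa using h.tendsto ⟨z - x, by rw [LinearMap.mem_ker, map_sub, hz, sub_self]⟩
    obtain ⟨y, hyY, hyU⟩ := hYd.inter_nhds_nonempty (hcont hU)
    exact ⟨x + y, hyU, by rw [map_add, y.2, add_zero],
      hZeq y y.2 x fun h => hx (Set.mem_biUnion hyY h)⟩
  have hout' : ∀ w ∈ R, coeff β (logDer w.func) ≠ 0 → toReal P ∉ w.cone := by
    intro w hw h
    have := hout w hw
    rwa [CWall.Incoming, hnormal w hw h] at this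
  by_cases hPj : ∀ j, P (e j) = 0
  · -- translating by a large multiple of `P` one gets out of all walls
    refine ⟨∅, Set.finite_empty, fun w hw => hw.elim, _, hZ0, fun x hx => ?_⟩
    rw [clogAt_eq_zero fun w hw => hw.elim]
    have hev : ∀ᶠ S₀ : ℝ in atTop, ∀ w ∈ {w ∈ R | coeff β (logDer w.func) ≠ 0},
        ∀ᶠ y in 𝓝 x, ∀ S : ℝ, S₀ ≤ S → y + S • toReal P ∉ w.cone :=
      (Filter.eventually_all_finite hfin).2 fun w hw =>
        eventually_add_smul_notMem (hR.1 w hw.1).rational (hout' w hw.1 hw.2) x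
    obtain ⟨S, hS⟩ := hev.exists
    have hS := (Filter.eventually_all_finite hfin).2 hS
    have hcont : Tendsto (fun u => u - S • toReal P) (𝓝 (x + S • toReal P)) (𝓝 x) := by
      have h : Continuous fun u : ι' → ℝ => u - S • toReal P := by fun_prop
      simpa using h.tendsto (x + S • toReal P)
    have hP0 : proj e (toReal P) = 0 := funext fun j => by
      rw [proj_apply, toReal, hPj j]
      simp
    obtain ⟨u, hu, -, hxu⟩ := hmove x hx (x + S • toReal P)
      (by rw [map_add, map_smul, hP0, smul_zero, add_zero]) _ (hcont.eventually hS)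
    rw [hxu]
    refine (clogAt_eq_zero fun w hw h => ?_).symm
    have := hu w ⟨hw, h⟩ S le_rfl
    rwa [sub_add_cancel] at this
  push Not at hPj
  obtain ⟨j, hPj⟩ := hPj
  have hn0 : ∀ i ∉ Set.range e, n i = 0 := fun i hi =>
    s.incl_apply_of_notMem _ fun ⟨i', h'⟩ => hi (h' ▸ huf i')
  obtain ⟨C, G, hC, Z1, hZ1, hsame⟩ := exists_cylinders (hR.1 w₀ hw₀).primitive hn0 hPj
    (hfin.image CWall.cone) (by
      rintro _ ⟨w, hw, rfl⟩
      have h := (hR.1 w hw.1).hasNormal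
      rw [hnormal w hw.1 hw.2] at h
      exact ⟨(hR.1 w hw.1).isWallCone, h⟩)
  -- the new walls: each cylinder `A` carries the exponential of `c A t^β`, where `c A` is, up to the
  -- factor `|β|`, the sum of the contributions of the walls which are replaced by `A`
  let W := hfin.toFinset.filter fun w => w.cone ∈ G
  have hW : ∀ w, w ∈ W ↔ (w ∈ R ∧ coeff β (logDer w.func) ≠ 0) ∧ w.cone ∈ G := fun w => by
    rw [Finset.mem_filter, Set.Finite.mem_toFinset]; rfl
  let c : Set (ι' → ℝ) → k := fun A =>
    (∑ w ∈ W.filter fun w => C w.cone = A, coeff β (logDer w.func)) / (β.degree : k)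
  have hdeg : (β.degree : k) ≠ 0 := by exact_mod_cast (degree_pos_of_ne_zero hβ).ne'
  let 𝒜 := W.image fun w => C w.cone
  let f : Set (ι' → ℝ) → CWall k I ι' := fun A => ⟨A, w₀.normal, expMonomial β (c A)⟩
  have hf : Function.Injective f := fun A A' h => congrArg CWall.cone h
  refine ⟨f '' {A ∈ (𝒜 : Set (Set (ι' → ℝ))) | c A ≠ 0},
    (𝒜.finite_toSet.subset fun A hA => hA.1).image f, ?_, Z1 ∪ ⋃ y ∈ Y, Z (y : ι' → ℝ),
    hZ1.union hZ0, fun x hx => ?_⟩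
  · rintro _ ⟨A, ⟨hA, hcA⟩, rfl⟩
    obtain ⟨w, hw, rfl⟩ := Finset.mem_image.1 (Finset.mem_coe.1 hA)
    rw [hW] at hw
    obtain ⟨h1, h2, h3⟩ := hC w.cone ⟨w, hw.1, rfl⟩ hw.2
    refine ⟨⟨h1.1.1, h1.1.2, (hR.1 w₀ hw₀).primitive, h2, coeff_zero_expMonomial hβ _,
      fun γ hγ hne => ?_⟩, h1, fun h => hout' w hw.1.1 hw.1.2 (h3 h), hβ, _, hcA, rfl⟩
    by_contra hcon
    refine hne (coeff_expMonomial_eq_zero _ fun r hr => hcon ⟨r * r₀, ?_, ?_⟩)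
    · rcases Nat.eq_zero_or_pos r with h0 | h0
      · exact absurd (by rw [hr, h0, zero_smul]) hγ
      · exact Nat.mul_pos h0 hr₀
    · rw [hr, hr₀β, mul_smul]
  · rw [Set.mem_union, not_or] at hx
    have hRx : clogAt R x β = ∑ w ∈ W.filter fun w => x ∈ C w.cone, coeff β (logDer w.func) := by
      by_cases hnx : pair n x = 0
      · obtain ⟨z, hz, hev⟩ := hsame x hx.1 hnx
        obtain ⟨u, hu, hpu, hxu⟩ := hmove x hx.2 z hz _ hev
        have hnu : pair n u = 0 := by
          rw [← pair_proj e hn0, hpu, pair_proj e hn0, hnx]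
        rw [hxu, clogAt_eq_sum hfin (fun w => w.cone ∈ G ∧ x ∈ C w.cone) u fun w hw h =>
          hu hnu w.cone ⟨w, ⟨hw, h⟩, rfl⟩, Finset.filter_filter]
      · rw [clogAt_eq_zero fun w hw h hxw => hnx ?_, Finset.sum_eq_zero fun w hw => ?_]
        · rw [Finset.mem_filter, hW] at hw
          exact absurd ((hC w.cone ⟨w, hw.1.1, rfl⟩ hw.1.2).2.1 hw.2) hnx
        · have := (hR.1 w hw).subset_perp hxw
          rwa [hnormal w hw h] at this
    have hset : {w ∈ f '' {A ∈ (𝒜 : Set (Set (ι' → ℝ))) | c A ≠ 0} | x ∈ w.cone} =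
        f '' {A ∈ (𝒜 : Set (Set (ι' → ℝ))) | c A ≠ 0 ∧ x ∈ A} := by
      ext w
      constructor
      · rintro ⟨⟨A, hA, rfl⟩, hxA⟩
        exact ⟨A, ⟨hA.1, hA.2, hxA⟩, rfl⟩
      · rintro ⟨A, hA, rfl⟩
        exact ⟨⟨A, ⟨hA.1, hA.2.1⟩, rfl⟩, hA.2.2⟩
    have hcoeff : ∀ A, coeff β (logDer (f A).func) =
        ∑ w ∈ W.filter fun w => C w.cone = A, coeff β (logDer w.func) := by
      intro A
      change coeff β (logDer (expMonomial β (c A))) = _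
      rw [logDer_expMonomial hβ, coeff_monomial_same, mul_div_cancel₀ _ hdeg]
    rw [hRx, clogAt, hset, finsum_mem_image hf.injOn,
      finsum_mem_eq_sum_of_inter_support_eq (t := 𝒜.filter fun A => x ∈ A) _ ?_]
    · simp only [hcoeff]
      rw [← Finset.sum_fiberwise_of_maps_to (s := W.filter fun w => x ∈ C w.cone)
        (t := 𝒜.filter fun A => x ∈ A) (g := fun w => C w.cone)]
      · refine Finset.sum_congr rfl fun A hA => Finset.sum_congr ?_ fun _ _ => rfl
        ext w
        simp only [Finset.mem_filter] at hA ⊢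
        refine ⟨fun h => ⟨⟨h.1, ?_⟩, h.2⟩, fun h => ⟨h.1.1, h.2⟩⟩
        rw [h.2]
        exact hA.2
      · intro w hw
        rw [Finset.mem_filter] at hw ⊢
        exact ⟨Finset.mem_image_of_mem _ hw.1, hw.2⟩
    · ext A
      simp only [Set.mem_inter_iff, Set.mem_ofPred_eq, Function.mem_support, Finset.coe_filter,
        Finset.mem_coe]
      refine ⟨fun h => ⟨⟨h.1.1, h.1.2.2⟩, h.2⟩, fun h => ⟨⟨h.1.1, fun h0 => h.2 ?_, h.1.2⟩, h.2⟩⟩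
      rw [hcoeff]
      exact (div_eq_zero_iff.1 h0).resolve_right hdeg

end CylinderDiagram
end HDTVCluster

namespace HDTVCluster

/-! ### Completions of diagrams of hyperplanes -/

section Completion

open Filter Topology MvPowerSeries

variable {k I ι ι' : Type*} [Field k] [Fintype I] [Fintype ι] [Fintype ι'] [DecidableEq ι']
  {s : Seed I ι'} {e : ι ↪ ι'}

theorem IsCScatteringDiagram.mono {D D' : Set (CWall k I ι')} (hD : IsCScatteringDiagram s D)
    (h : D' ⊆ D) : IsCScatteringDiagram s D' :=
  ⟨fun w hw => hD.1 w (h hw), fun j => (hD.2 j).subset fun _ hw => ⟨h hw.1, hw.2⟩⟩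

theorem clogAt_add_of_isCylinder {D : Set (CWall k I ι')} (hc : ∀ w ∈ D, IsCylinder e w.cone)
    {y : ι' → ℝ} (hy : proj e y = 0) (x : ι' → ℝ) (β : I →₀ ℕ) :
    clogAt D x β = clogAt D (x + y) β := by
  have h : {w ∈ D | x ∈ w.cone} = {w ∈ D | x + y ∈ w.cone} := by
    ext w
    refine and_congr_right fun hw => ?_
    have hp : proj e (x + y) = proj e x := by rw [map_add, hy, add_zero]
    rw [← (hc w hw).proj_mem_iff, ← (hc w hw).proj_mem_iff (x := x + y), hp]
  rw [clogAt, clogAt, h]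

/-- The exponential of a monomial of degree at least `j` is trivial modulo `𝔪 ^ j`. -/
theorem congrMod_expMonomial {β : I →₀ ℕ} (hβ : β ≠ 0) (c : k) {j : ℕ} (hj : j ≤ β.degree) :
    CongrMod j (expMonomial β c) 1 := by
  classical
  intro γ hγ
  rw [coeff_one]
  split_ifs with h0
  · rw [h0, coeff_zero_expMonomial hβ]
  · refine coeff_expMonomial_eq_zero c fun r hr => ?_
    rcases Nat.eq_zero_or_pos r with h | h
    · exact h0 (by rw [hr, h, zero_smul])
    · rw [hr, map_nsmul, smul_eq_mul] at hγ
      have := Nat.le_mul_of_pos_left β.degree h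
      omega

variable [CharZero k]

/-- The logarithm of the outgoing part of a consistent completion of a diagram of cylinders is
invariant under the translations in the kernel of `proj e`: the translated completion is a
completion of the same diagram. -/
theorem IsCCompletion.exists_small_clogAt_add_eq {Din D₀ : Set (CWall k I ι')}
    (h : IsCCompletion s Din D₀) (hc : ∀ w ∈ Din, IsCylinder e w.cone) {y : ι' → ℝ}
    (hy : proj e y = 0) :
    ∃ Z, Small Z ∧ ∀ x ∉ Z, ∀ β, clogAt (D₀ \ Din) x β = clogAt (D₀ \ Din) (x + y) β := by
  obtain ⟨hD, hIn, hcons, hout⟩ := h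
  have hlog : ∀ {D : Set (CWall k I ι')}, IsCScatteringDiagram s D → ∀ x β,
      logAt (s.restrWall (Function.Embedding.refl ι') '' D) x β =
        AddMonoidAlgebra.single (s.restrP (Function.Embedding.refl ι') β) (clogAt D x β) :=
    fun hD x β => s.logAt_restrWall hD hD.isCylinder_refl x β
  have hDin := hD.mono hIn
  have hS := s.isScatteringDiagram_restrWall hD hD.isCylinder_refl
  have hC := (s.isConsistent_restrWall_iff hD hD.isCylinder_refl).2 hcons
  have hO : ∀ w ∈ s.restrWall (Function.Embedding.refl ι') '' D₀ \
      s.restrWall (Function.Embedding.refl ι') '' Din, ¬ w.Incoming := by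
    rintro _ ⟨⟨w, hw, rfl⟩, hw'⟩
    rw [← s.incoming_restrWall_iff (hD.isCylinder_refl w hw)]
    exact hout w ⟨hw, fun h => hw' ⟨w, h, rfl⟩⟩
  obtain ⟨Z, hZ, hZeq⟩ := exists_small_logAt_add_eq hS hS hC hC (Set.image_mono hIn)
    (Set.image_mono hIn) hO hO (y₀ := y) fun x β => by
      rw [hlog hDin, hlog hDin, clogAt_add_of_isCylinder hc hy]
  refine ⟨Z, hZ, fun x hx β => ?_⟩
  have h1 := hZeq x hx β
  rw [hlog hD, hlog hD] at h1
  have h2 := single_right_injective _ h1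
  rw [clogAt_eq_add hD hIn, clogAt_eq_add hD hIn (x + y), clogAt_add_of_isCylinder hc hy x] at h2
  exact add_left_cancel h2

/-- A consistent completion of a diagram of hyperplanes containing the kernel of `proj e` can be
replaced by one all of whose walls are cylinders.  The functions of the new walls are exponentials;
their terms of degree `2 • β` show that they are not of the form `1 + t_i z^{v_i}`. -/
theorem IsCCompletion.exists_cylinders (huf : ∀ i, s.uf i ∈ Set.range e)
    {Din D₀ : Set (CWall k I ι')} (h : IsCCompletion s Din D₀)
    (hc : ∀ w ∈ Din, IsCylinder e w.cone) (hfull : ∀ w ∈ Din, w.cone = perp (s.incl w.normal)) :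
    ∃ D, IsCScatteringDiagram s D ∧ (∀ w ∈ D, IsCylinder e w.cone) ∧ Din ⊆ D ∧
      (∀ w ∈ D \ Din, ¬ w.Incoming s ∧ ∃ β : I →₀ ℕ, β ≠ 0 ∧ coeff (2 • β) w.func ≠ 0) ∧
      CGenEq D D₀ := by
  classical
  have hR := h.1.mono (Set.sdiff_subset (s := D₀) (t := Din))
  have hN := fun β => exists_cylinder_walls huf hR h.2.2.2 β fun y hy => by
    obtain ⟨Z, hZ, hZeq⟩ := h.exists_small_clogAt_add_eq hc hy
    exact ⟨Z, hZ, fun x hx => hZeq x hx β⟩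
  choose N hNfin hNw Z hZ hNeq using hN
  -- the walls of `Din` contain `p₁(n)`, hence are incoming, contrary to the new ones
  have hdisj : ∀ w ∈ ⋃ β, N β, w ∉ Din := by
    intro w hw hwD
    obtain ⟨β, hw⟩ := Set.mem_iUnion.1 hw
    refine (hNw β w hw).2.2.1 ?_
    rw [CWall.Incoming, hfull w hwD]
    change pair _ _ = 0
    rw [pair_toReal, s.dotProduct_p1, Int.cast_zero]
  have hD : IsCScatteringDiagram s (Din ∪ ⋃ β, N β) := by
    refine ⟨?_, fun j => ?_⟩
    · rintro w (hw | hw)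
      · exact (h.1.mono h.2.1).1 w hw
      · obtain ⟨β, hw⟩ := Set.mem_iUnion.1 hw
        exact (hNw β w hw).1
    · have hfin : {β : I →₀ ℕ | β.degree < j}.Finite := Finsupp.finite_of_degree_lt j
      refine (((h.1.mono h.2.1).2 j).union (hfin.biUnion fun β _ => hNfin β)).subset ?_
      rintro w ⟨hw | hw, hwj⟩
      · exact Or.inl ⟨hw, hwj⟩
      · obtain ⟨β, hw⟩ := Set.mem_iUnion.1 hw
        refine Or.inr (Set.mem_biUnion (x := β) ?_ hw)
        by_contra hβj
        obtain ⟨-, -, -, hβ, c, -, hwc⟩ := hNw β w hw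
        exact hwj (hwc ▸ congrMod_expMonomial hβ c (not_lt.1 hβj))
  refine ⟨_, hD, ?_, Set.subset_union_left, ?_, ⋃ β, Z β, Small.iUnion hZ, fun x hx β => ?_⟩
  · rintro w (hw | hw)
    · exact hc w hw
    · obtain ⟨β, hw⟩ := Set.mem_iUnion.1 hw
      exact (hNw β w hw).2.1
  · rintro w ⟨hw | hw, hw'⟩
    · exact absurd hw hw'
    · obtain ⟨β, hw⟩ := Set.mem_iUnion.1 hw
      obtain ⟨-, -, hwo, hβ, c, hc0, hwc⟩ := hNw β w hw
      refine ⟨hwo, β, hβ, ?_⟩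
      rw [hwc, coeff_expMonomial_nsmul hβ]
      exact div_ne_zero (pow_ne_zero _ hc0) (by exact_mod_cast (Nat.factorial_pos 2).ne')
  · have hd : (Din ∪ ⋃ β, N β) \ Din = ⋃ β, N β := by
      rw [Set.union_sdiff_left]
      exact sdiff_eq_left.2 (Set.disjoint_left.2 hdisj)
    rw [clogAt_eq_add hD Set.subset_union_left, hd, clogAt_eq_add h.1 h.2.1,
      ← hNeq β x fun hxZ => hx (Set.mem_iUnion.2 ⟨β, hxZ⟩)]
    -- the walls in degree `β` of the union are those of `N β`
    congr 1
    refine finsum_mem_inter_support_eq' _ _ _ fun w hw => ?_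
    refine and_congr_left fun _ => ⟨fun hwN => ?_, fun hwN => Set.mem_iUnion.2 ⟨β, hwN⟩⟩
    obtain ⟨β', hw'⟩ := Set.mem_iUnion.1 hwN
    obtain ⟨-, -, -, hβ, c, -, hwc⟩ := hNw β' w hw'
    rw [Function.mem_support, hwc, logDer_expMonomial hβ, coeff_monomial] at hw
    split_ifs at hw with heq
    · rwa [heq]
    · exact absurd rfl hw

end Completion

section PsiCompletion

variable {k I ι : Type*} [Field k] [CharZero k] [Fintype I] [Fintype ι] [DecidableEq ι]
  {s : Seed I ι}

/-- The class of a consistent completion of a `C_prin`-diagram of hyperplanes contains a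
`C_prin`-diagram. -/
theorem IsCCompletion.exists_isCPrinDiagram {Din D₀ : Set (CWall k I (ι ⊕ ι))}
    (h : IsCCompletion s.prin Din D₀) (hDin : IsCPrinDiagram s Din)
    (hfull : ∀ w ∈ Din, w.cone = perp (s.prin.incl w.normal)) :
    ∃ D, IsCPrinDiagram s D ∧ CEquivalent s.prin D D₀ ∧ IsCCompletion s.prin Din D ∧
      ∀ w ∈ D \ Din, ∃ β : I →₀ ℕ, β ≠ 0 ∧ MvPowerSeries.coeff (2 • β) w.func ≠ 0 := by
  obtain ⟨D, hD, hDc, hIn, hout, hgen⟩ := h.exists_cylinders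
    (e := (Function.Embedding.inl : ι ↪ ι ⊕ ι)) (fun i => ⟨s.uf i, rfl⟩) hDin.isCylinder hfull
  exact ⟨D, isCPrinDiagram_of_isCylinder hD hDc, (cEquivalent_iff_cGenEq hD h.1).2 hgen,
    ⟨hD, hIn, hgen.isCConsistent hD h.1 h.2.2.1, fun w hw => (hout w hw).1⟩,
    fun w hw => (hout w hw).2⟩

/-- By uniqueness of consistent completions, it suffices to consider one `C_prin`-diagram `D₁` in
the class of `D₀`, and one consistent completion `D'`. -/
theorem psiMapsToCompletion_of_genEq {D₀ D₁ : Set (CWall k I (ι ⊕ ι))} {Din D' : Set (Wall k I ι)}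
    (h₀ : IsCScatteringDiagram s.prin D₀) (h₁ : IsCPrinDiagram s D₁)
    (h₁₀ : CEquivalent s.prin D₁ D₀) (hD' : IsCompletion Din D') (h : GenEq (Psi s D₁) D') :
    PsiMapsToCompletion s D₀ Din := by
  refine ⟨⟨D₁, h₁, h₁₀⟩, fun D hD hDD₀ => ?_⟩
  have key : ∀ D'', IsCompletion Din D'' → Equivalent (Psi s D) D'' := by
    intro D'' hD''
    rw [equivalent_iff_genEq hD.isScatteringDiagram_psi hD''.1]
    have h2 : CEquivalent s.prin D D₁ := by
      rw [cEquivalent_iff_cGenEq hD.1 h₁.1]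
      rw [cEquivalent_iff_cGenEq h₁.1 h₀] at h₁₀
      rw [cEquivalent_iff_cGenEq hD.1 h₀] at hDD₀
      obtain ⟨Z, hZ, h⟩ := hDD₀
      obtain ⟨Z', hZ', h'⟩ := h₁₀
      exact ⟨Z ∪ Z', hZ.union hZ', fun x hx β => by
        rw [h x (fun hz => hx (Or.inl hz)), h' x fun hz => hx (Or.inr hz)]⟩
    exact (((hD.genEq_psi_iff h₁).2 h2).trans h).trans (hD'.genEq hD'')
  exact ⟨⟨D', hD', key D' hD'⟩, key⟩

theorem psiMapsToCompletion_psi {Din D₀ : Set (CWall k I (ι ⊕ ι))} (hDin : IsCPrinDiagram s Din)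
    (hfull : ∀ w ∈ Din, w.cone = perp (s.prin.incl w.normal))
    (h : IsCCompletion s.prin Din D₀) : PsiMapsToCompletion s D₀ (Psi s Din) := by
  obtain ⟨D, hD, hDD₀, hcomp, -⟩ := h.exists_isCPrinDiagram hDin hfull
  refine psiMapsToCompletion_of_genEq (D' := Psi s D) h.1 hD hDD₀
    ⟨hD.isScatteringDiagram_psi, Set.image_mono hcomp.2.1,
      hD.isConsistent_psi_iff.1 hcomp.2.2.1, ?_⟩ ⟨∅, small_empty, fun _ _ _ => rfl⟩
  rintro _ ⟨⟨w, hw, rfl⟩, hw'⟩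
  rw [← hD.incoming_iff hw]
  exact hcomp.2.2.2 w ⟨hw, fun h => hw' ⟨w, h, rfl⟩⟩

end PsiCompletion
end HDTVCluster

namespace HDTVCluster

/-! ### Intersection numbers in toric divisors -/

section IntersectionNumber

open AddMonoidAlgebra

variable {k ι : Type*} [Field k] [Fintype ι] {v : ι → ℤ} {σ : Set (ι → ℝ)} {n₀ : ι → ℤ}

theorem sup_eq_top_of_one_add_mem {R : Type*} [CommRing R] {J J' : Ideal R} {a : R}
    (h : 1 + a ∈ J) (h' : a ∈ J') : J ⊔ J' = ⊤ := by
  rw [Ideal.eq_top_iff_one]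
  have := (J ⊔ J').sub_mem (Ideal.mem_sup_left h) (Ideal.mem_sup_right h')
  rwa [add_sub_cancel_right] at this

/-- The closure of `1 + z^{n₀} = 0` does not meet the orbit of a cone on which `n₀` has a constant
sign and does not vanish. -/
theorem intersectionNumber_eq_zero (hn₀ : n₀ ∈ divisorChars v)
    (h : (∀ x ∈ σ, 0 ≤ pair n₀ x) ∨ ∀ x ∈ σ, pair n₀ x ≤ 0) (hne : ∃ x ∈ σ, pair n₀ x ≠ 0) :
    intersectionNumber v σ (1 + single ⟨n₀, hn₀⟩ 1 : AddMonoidAlgebra k (divisorChars v)) = 0 := by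
  suffices htop : hypersurfaceIdeal v σ (1 + single ⟨n₀, hn₀⟩ 1 : AddMonoidAlgebra k _) ⊔
      orbitIdeal k v σ = ⊤ by
    rw [intersectionNumber, htop]
    have := Ideal.Quotient.subsingleton_iff.2
      (rfl : (⊤ : Ideal (AddMonoidAlgebra k (chartMonoid v σ))) = ⊤)
    exact Module.finrank_zero_of_subsingleton
  obtain ⟨x₀, hx₀, hne⟩ := hne
  -- whichever of `± n₀` is nonnegative on `σ` gives a function vanishing on the orbit
  have key : ∀ n : chartMonoid v σ, pair n.1.1 x₀ ≠ 0 →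
      (1 + single n.1 1 : AddMonoidAlgebra k (divisorChars v)) ∈
        Ideal.span {(1 + single ⟨n₀, hn₀⟩ 1 : AddMonoidAlgebra k (divisorChars v))} →
      hypersurfaceIdeal v σ (1 + single ⟨n₀, hn₀⟩ 1 : AddMonoidAlgebra k _) ⊔
        orbitIdeal k v σ = ⊤ := by
    intro n hn hmem
    have h1 : (1 + single n 1 : AddMonoidAlgebra k (chartMonoid v σ)) ∈
        hypersurfaceIdeal v σ (1 + single ⟨n₀, hn₀⟩ 1 : AddMonoidAlgebra k _) := by
      rw [hypersurfaceIdeal, Ideal.mem_comap, map_add, map_one]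
      simpa using hmem
    have h2 : (single n 1 : AddMonoidAlgebra k (chartMonoid v σ)) ∈ orbitIdeal k v σ :=
      Ideal.subset_span ⟨n, ⟨x₀, hx₀, hn⟩, rfl⟩
    exact sup_eq_top_of_one_add_mem h1 h2
  rcases h with h | h
  · exact key ⟨⟨n₀, hn₀⟩, h⟩ hne (Ideal.subset_span rfl)
  · refine key ⟨-⟨n₀, hn₀⟩, fun x hx => ?_⟩ ?_ ?_
    · change 0 ≤ pair (-n₀) x
      rw [neg_pair]
      exact neg_nonneg.2 (h x hx)
    · change pair (-n₀) x₀ ≠ 0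
      rw [neg_pair]
      exact neg_ne_zero.2 hne
    · refine Ideal.mem_span_singleton.2 ⟨single (-⟨n₀, hn₀⟩) 1, ?_⟩
      rw [add_mul, one_mul, single_mul_single, add_neg_cancel, mul_one, one_def, add_comm]

/-- The closure of `1 + z^{n₀} = 0` meets the orbit of a cone `σ` of codimension one in `n₀^⊥`
transversally in one point: the functions on the orbit are the Laurent polynomials in `z^{n₀}`. -/
theorem intersectionNumber_eq_one (hn₀ : n₀ ∈ divisorChars v) (h0 : n₀ ≠ 0)
    (hσ : ∀ x ∈ σ, pair n₀ x = 0)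
    (hn : ∀ n : ι → ℤ, (∀ x ∈ σ, pair n x = 0) → ∃ a : ℤ, n = a • n₀) :
    intersectionNumber v σ (1 + single ⟨n₀, hn₀⟩ 1 : AddMonoidAlgebra k (divisorChars v)) = 1 := by
  classical
  have hinj : ∀ a b : ℤ, a • n₀ = b • n₀ → a = b := by
    intro a b hab
    obtain ⟨j, hj⟩ := Function.ne_iff.1 h0
    have := congrFun hab j
    simp only [Pi.smul_apply, smul_eq_mul] at this
    exact mul_right_cancel₀ hj this
  -- the linear functional `z^{a n₀} ↦ (-1)^a` which kills all other monomials
  let χ : divisorChars v → k := fun n => if h : ∃ a : ℤ, n.1 = a • n₀ then (-1) ^ h.choose else 0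
  have hχ1 : ∀ (n : divisorChars v) (a : ℤ), n.1 = a • n₀ → χ n = (-1) ^ a := by
    intro n a ha
    have hex : ∃ a : ℤ, n.1 = a • n₀ := ⟨a, ha⟩
    have : hex.choose = a := hinj _ _ (hex.choose_spec.symm.trans ha)
    simp only [χ]
    rw [dif_pos hex, this]
  have hχ0 : ∀ n : divisorChars v, (∀ a : ℤ, n.1 ≠ a • n₀) → χ n = 0 := fun n h =>
    dif_neg fun ⟨a, ha⟩ => h a ha
  have hχadd : ∀ n : divisorChars v, χ (⟨n₀, hn₀⟩ + n) = -χ n := by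
    intro n
    by_cases h : ∃ a : ℤ, n.1 = a • n₀
    · obtain ⟨a, ha⟩ := h
      rw [hχ1 n a ha, hχ1 _ (1 + a) (by rw [add_smul, one_smul, ← ha]; rfl),
        zpow_add₀ (neg_ne_zero.2 one_ne_zero), zpow_one, neg_one_mul]
    · push Not at h
      rw [hχ0 n h, hχ0 _ fun a ha => h (a - 1) ?_, neg_zero]
      rw [sub_smul, one_smul, ← ha]
      exact (add_sub_cancel_left n₀ n.1).symm
  let ψ : AddMonoidAlgebra k (divisorChars v) →ₗ[k] k :=
    Finsupp.linearCombination k χ ∘ₗ (coeffLinearEquiv k).toLinearMap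
  have hψ : ∀ n c, ψ (single n c) = c * χ n := fun n c => Finsupp.linearCombination_single k c n
  have hψg : ∀ q, ψ ((1 + single ⟨n₀, hn₀⟩ 1) * q) = 0 := by
    intro q
    induction q using AddMonoidAlgebra.induction_linear with
    | zero => rw [mul_zero, map_zero]
    | add f g hf hg => rw [mul_add, map_add, hf, hg, add_zero]
    | single n c =>
      rw [add_mul, one_mul, single_mul_single, map_add, hψ, hψ, hχadd, one_mul]
      ring
  let Φ := mapDomainRingHom k (chartMonoid v σ).subtype
  let J := hypersurfaceIdeal v σ (1 + single ⟨n₀, hn₀⟩ 1 : AddMonoidAlgebra k _) ⊔ orbitIdeal k v σ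
  have hΦ : ∀ n c, Φ (single n c) = single n.1 c := fun n c => by
    simp [Φ]
  have hJ : ∀ f ∈ J, ψ (Φ f) = 0 := by
    intro f hf
    obtain ⟨g, hg, g', hg', rfl⟩ := Submodule.mem_sup.1 hf
    have e1 : ψ (Φ g) = 0 := by
      obtain ⟨q, hq⟩ := Ideal.mem_span_singleton.1 (Ideal.mem_comap.1 hg)
      rw [hq, hψg]
    have e2 : ψ (Φ g') = 0 := by
      have hall : ∀ h, ψ (Φ (h * g')) = 0 := by
        refine Submodule.span_induction (p := fun g' _ => ∀ h, ψ (Φ (h * g')) = 0) ?_ ?_ ?_ ?_ hg'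
        · rintro _ ⟨n, ⟨x, hx, hnx⟩, rfl⟩ h
          induction h using AddMonoidAlgebra.induction_linear with
          | zero => rw [zero_mul, map_zero, map_zero]
          | add f g hf hg => rw [add_mul, map_add, map_add, hf, hg, add_zero]
          | single m c =>
            rw [single_mul_single, hΦ, hψ, hχ0, mul_zero]
            intro a ha
            have h1 : pair (m.1.1 + n.1.1) x = 0 := by
              have h2 : m.1.1 + n.1.1 = a • n₀ := ha
              rw [h2, smul_pair, hσ x hx, mul_zero]
            rw [add_pair] at h1
            have h3 := m.2 x hx
            have h4 := lt_of_le_of_ne (n.2 x hx) hnx.symm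
            linarith
        · intro h
          rw [mul_zero, map_zero, map_zero]
        · intro f g _ _ hf hg h
          rw [mul_add, map_add, map_add, hf, hg, add_zero]
        · intro a f _ hf h
          rw [smul_eq_mul, ← mul_assoc, hf]
      simpa using hall 1
    rw [map_add, map_add, e1, e2, add_zero]
  -- so `1` is not in the ideal, and modulo the ideal every monomial is a multiple of `1`
  have hone : (1 : AddMonoidAlgebra k (chartMonoid v σ)) ∉ J := by
    intro h1
    have := hJ 1 h1
    rw [one_def, hΦ, hψ, hχ1 _ 0 (by simp)] at this
    simp at this
  have hpow : ∀ a : ℤ, (single (a • ⟨n₀, hn₀⟩) 1 - (-1 : k) ^ a • 1 :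
      AddMonoidAlgebra k (divisorChars v)) ∈ Ideal.span {1 + single ⟨n₀, hn₀⟩ 1} := by
    have hstep : ∀ a : ℤ, (single ((a + 1) • ⟨n₀, hn₀⟩) 1 - (-1 : k) ^ (a + 1) • 1 :
        AddMonoidAlgebra k (divisorChars v)) =
          single (a • ⟨n₀, hn₀⟩) 1 * (1 + single ⟨n₀, hn₀⟩ 1) -
            (single (a • ⟨n₀, hn₀⟩) 1 - (-1 : k) ^ a • 1) := by
      intro a
      rw [zpow_add₀ (neg_ne_zero.2 one_ne_zero), zpow_one, mul_neg_one, neg_smul, mul_add, mul_one,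
        single_mul_single, add_smul, one_smul, mul_one]
      abel
    have hmem : ∀ a : ℤ, (single (a • ⟨n₀, hn₀⟩) 1 * (1 + single ⟨n₀, hn₀⟩ 1) :
        AddMonoidAlgebra k (divisorChars v)) ∈ Ideal.span {1 + single ⟨n₀, hn₀⟩ 1} := fun a =>
      Ideal.mul_mem_left _ _ (Ideal.subset_span rfl)
    intro a
    induction a using Int.induction_on with
    | zero =>
      rw [zero_smul, zpow_zero, one_smul, one_def, sub_self]
      exact Ideal.zero_mem _
    | succ i ih =>
      rw [hstep]
      exact Ideal.sub_mem _ (hmem _) ih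
    | pred i ih =>
      have h := hstep (-(i : ℤ) - 1)
      rw [sub_add_cancel] at h
      rw [h] at ih
      have := Ideal.sub_mem _ (hmem (-(i : ℤ) - 1)) ih
      rwa [sub_sub_cancel] at this
  have hmono : ∀ n : chartMonoid v σ, ∃ c : k,
      (single n 1 - c • (1 : AddMonoidAlgebra k (chartMonoid v σ))) ∈ J := by
    intro n
    by_cases hnσ : ∃ x ∈ σ, pair n.1.1 x ≠ 0
    · refine ⟨0, ?_⟩
      rw [zero_smul, sub_zero]
      exact Ideal.mem_sup_right (Ideal.subset_span ⟨n, hnσ, rfl⟩)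
    · push Not at hnσ
      obtain ⟨a, ha⟩ := hn _ hnσ
      refine ⟨(-1) ^ a, Ideal.mem_sup_left ?_⟩
      rw [hypersurfaceIdeal, Ideal.mem_comap, map_sub]
      change Φ _ - Φ _ ∈ _
      have h1 : Φ ((-1 : k) ^ a • 1) = (-1 : k) ^ a • 1 := by
        rw [one_def, smul_single, hΦ, one_def, smul_single]
        rfl
      rw [hΦ, h1, show n.1 = a • ⟨n₀, hn₀⟩ from Subtype.ext ha]
      exact hpow a
  refine finrank_eq_one (Ideal.Quotient.mk J 1) (fun h => hone (Ideal.Quotient.eq_zero_iff_mem.1 h))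
    fun q => ?_
  obtain ⟨f, rfl⟩ := Ideal.Quotient.mk_surjective q
  induction f using AddMonoidAlgebra.induction_linear with
  | zero => exact ⟨0, by rw [zero_smul, map_zero]⟩
  | add f g hf hg =>
    obtain ⟨c, hc⟩ := hf
    obtain ⟨c', hc'⟩ := hg
    exact ⟨c + c', by rw [add_smul, hc, hc', map_add]⟩
  | single n c =>
    obtain ⟨c', hc'⟩ := hmono n
    refine ⟨c * c', ?_⟩
    have h1 := Ideal.Quotient.eq.2 hc'
    have h2 : ∀ (a : k) f, Ideal.Quotient.mk J (a • f) = a • Ideal.Quotient.mk J f :=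
      fun a f => rfl
    have h3 : (single n c : AddMonoidAlgebra k (chartMonoid v σ)) = c • single n 1 := by
      rw [smul_single, smul_eq_mul, mul_one]
    rw [h3, h2, h1, h2, mul_smul]

end IntersectionNumber
end HDTVCluster

namespace HDTVCluster

/-! ### Smooth fans -/

section Fan

variable {ι : Type*} [Fintype ι] {σ τ : Set (ι → ℝ)} {S : Set (Set (ι → ℝ))}

theorem IsSmoothCone.isRationalPolyhedralCone (h : IsSmoothCone σ) :
    IsRationalPolyhedralCone σ := by
  classical
  obtain ⟨b, J, rfl⟩ := h
  -- the coordinates with respect to the basis `b`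
  let l : ι → ι → ℤ := fun j i => b.repr (Pi.single i 1) j
  have hrec : ∀ x : ι → ℝ, x = ∑ j, pair (l j) x • toReal (b j) := by
    intro x
    funext i'
    have h1 : ∀ i, ∑ j, (l j i : ℝ) * (b j i' : ℝ) = (Pi.single i 1 : ι → ℝ) i' := by
      intro i
      have := congrFun (b.sum_repr (Pi.single i 1)) i'
      simp only [Finset.sum_apply, Pi.smul_apply, smul_eq_mul] at this
      have h2 := congrArg (Int.cast : ℤ → ℝ) this
      push_cast at h2
      rw [h2, Pi.single_apply, Pi.single_apply]
      split_ifs <;> simp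
    simp only [Finset.sum_apply, Pi.smul_apply, smul_eq_mul, pair, Finset.sum_mul, toReal]
    rw [Finset.sum_comm]
    have h3 : ∀ i, ∑ j, (l j i : ℝ) * x i * (b j i' : ℝ) = x i * (Pi.single i 1 : ι → ℝ) i' := by
      intro i
      rw [← h1 i, Finset.mul_sum]
      exact Finset.sum_congr rfl fun j _ => by ring
    simp only [h3, Pi.single_apply, mul_ite, mul_one, mul_zero]
    rw [Finset.sum_ite_eq, if_pos (Finset.mem_univ _)]
  have hdual : ∀ i j, pair (l j) (toReal (b i)) = if i = j then 1 else 0 := by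
    intro i j
    have h1 : b.repr (b i) j = ∑ i', b i i' * l j i' := by
      conv_lhs => rw [← Finset.univ_sum_single (b i)]
      rw [map_sum, Finsupp.finsetSum_apply]
      refine Finset.sum_congr rfl fun i' _ => ?_
      have : (Pi.single i' (b i i') : ι → ℤ) = b i i' • Pi.single i' 1 := by
        rw [← Pi.single_smul, smul_eq_mul, mul_one]
      rw [this, map_smul, Finsupp.smul_apply, smul_eq_mul]
    rw [Module.Basis.repr_self, Finsupp.single_apply] at h1
    have h2 := congrArg (Int.cast : ℤ → ℝ) h1
    push_cast at h2
    rw [pair, h2]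
    exact Finset.sum_congr rfl fun i' _ => by rw [toReal, mul_comm]
  refine ⟨Finset.univ.image l ∪ (Finset.univ.filter fun j => j ∉ J).image fun j => -l j,
    Set.ext fun x => ?_⟩
  simp only [Set.mem_ofPred_eq, Finset.mem_union, Finset.mem_image, Finset.mem_univ, true_and,
    Finset.mem_filter]
  constructor
  · rintro ⟨a, ha, rfl⟩
    have hp : ∀ j, pair (l j) (∑ i ∈ J, a i • toReal (b i)) = if j ∈ J then a j else 0 := by
      intro j
      rw [pair_sum]
      simp only [pair_smul, hdual, mul_ite, mul_one, mul_zero]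
      rw [Finset.sum_ite_eq']
    rintro n (⟨j, rfl⟩ | ⟨j, hj, rfl⟩)
    · rw [hp]
      split_ifs
      exacts [ha j, le_rfl]
    · rw [neg_pair, hp, if_neg hj, neg_zero]
  · intro h
    refine ⟨fun j => pair (l j) x, fun j => h _ (Or.inl ⟨j, rfl⟩), ?_⟩
    conv_lhs => rw [hrec x]
    refine (Finset.sum_subset (Finset.subset_univ J) fun j _ hj => ?_).symm
    have h1 := h _ (Or.inl ⟨j, rfl⟩)
    have h2 := h _ (Or.inr ⟨j, hj, rfl⟩)
    rw [neg_pair] at h2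
    rw [le_antisymm (neg_nonneg.1 h2) h1, zero_smul]

/-- A smooth cone has a point in its relative interior: a face which contains it is the whole
cone. -/
theorem IsSmoothCone.exists_interior (h : IsSmoothCone σ) :
    ∃ p ∈ σ, ∀ u : ι → ℝ, (∀ x ∈ σ, 0 ≤ dotProduct u x) → dotProduct u p = 0 →
      ∀ x ∈ σ, dotProduct u x = 0 := by
  classical
  obtain ⟨b, J, rfl⟩ := h
  refine ⟨∑ j ∈ J, toReal (b j), ⟨fun _ => 1, fun _ => zero_le_one, by simp⟩, fun u hu hp => ?_⟩
  have hpos : ∀ j ∈ J, 0 ≤ dotProduct u (toReal (b j)) := by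
    intro j hj
    refine hu _ ⟨Pi.single j 1, fun i => ?_, ?_⟩
    · rw [Pi.single_apply]
      split_ifs <;> simp
    · simp [Pi.single_apply, hj]
  rw [dotProduct_sum, Finset.sum_eq_zero_iff_of_nonneg hpos] at hp
  rintro _ ⟨a, -, rfl⟩
  rw [dotProduct_sum]
  exact Finset.sum_eq_zero fun j hj => by rw [dotProduct_smul, hp j hj, smul_zero]

/-- A linear form whose zero set is a union of cones of the fan has a constant sign on every
cone. -/
theorem IsSmoothProjectiveFan.sign_of_perp (hS : IsSmoothProjectiveFan S) {n : ι → ℤ}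
    {C : Set (Set (ι → ℝ))} (hC : C ⊆ S) (hn : ⋃₀ C = perp n) (hσ : σ ∈ S)
    (hne : ¬ σ ⊆ perp n) : (∀ x ∈ σ, 0 ≤ pair n x) ∨ ∀ x ∈ σ, pair n x ≤ 0 := by
  by_contra! hcon
  obtain ⟨⟨y, hy, hyn⟩, x, hx, hxn⟩ := hcon
  have hrat := (hS.smooth σ hσ).isRationalPolyhedralCone
  obtain ⟨p, hp, hint⟩ := (hS.smooth σ hσ).exists_interior
  -- a point of the relative interior of `σ` at which the form vanishes
  obtain ⟨q, hq, hz⟩ : ∃ q ∈ σ, pair n (p + q) = 0 := by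
    rcases le_total 0 (pair n p) with h | h
    · refine ⟨(pair n p / -pair n y) • y, smul_mem_of_isRationalPolyhedralCone hrat hy
        (div_nonneg h (neg_nonneg.2 hyn.le)), ?_⟩
      rw [pair_add, pair_smul]
      have := hyn.ne
      field_simp
      ring
    · refine ⟨(-pair n p / pair n x) • x, smul_mem_of_isRationalPolyhedralCone hrat hx
        (div_nonneg (neg_nonneg.2 h) hxn.le), ?_⟩
      rw [pair_add, pair_smul]
      have := hxn.ne'
      field_simp
      ring
  have hzC : p + q ∈ ⋃₀ C := by
    rw [hn]
    exact hz
  obtain ⟨τ, hτ, hzτ⟩ := hzC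
  obtain ⟨u, hu, hface⟩ := hS.inter_face σ hσ τ (hC hτ)
  have hzσ : p + q ∈ σ ∩ τ := ⟨add_mem_of_isRationalPolyhedralCone hrat hp hq, hzτ⟩
  rw [hface] at hzσ
  have h0 := hzσ.2
  rw [dotProduct_add] at h0
  have hup : dotProduct u p = 0 := by
    have := hu p hp
    have := hu q hq
    linarith
  refine hne fun w hw => ?_
  have hwστ : w ∈ σ ∩ τ := by
    rw [hface]
    exact ⟨hw, hint u hu hup w hw⟩
  rw [← hn]
  exact ⟨τ, hτ, hwστ.2⟩

/-- Distinct cones of codimension one meet in codimension two. -/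
theorem IsSmoothProjectiveFan.small_inter (hS : IsSmoothProjectiveFan S) (hσ : σ ∈ S) (hτ : τ ∈ S)
    (hσ1 : IsCodimOne σ) (hτ1 : IsCodimOne τ) (hne : σ ≠ τ) : Small (σ ∩ τ) := by
  have key : ∀ {σ τ : Set (ι → ℝ)}, σ ∈ S → τ ∈ S → IsCodimOne σ → ¬ σ ⊆ τ → Small (σ ∩ τ) := by
    intro σ τ hσ hτ hσ1 hsub
    obtain ⟨u, hu, hface⟩ := hS.inter_face σ hσ τ hτ
    let φ : (ι → ℝ) →ₗ[ℝ] ℝ := dotProductBilin ℝ ℝ u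
    have hφ : ∀ x, φ x = dotProduct u x := fun x => rfl
    have hlt : Submodule.span ℝ σ ⊓ LinearMap.ker φ < Submodule.span ℝ σ := by
      refine lt_of_le_of_ne inf_le_left fun h => hsub fun x hx => ?_
      have h1 : x ∈ Submodule.span ℝ σ ⊓ LinearMap.ker φ := by
        rw [h]
        exact Submodule.subset_span hx
      have h2 : x ∈ σ ∩ τ := by
        rw [hface]
        exact ⟨hx, h1.2⟩
      exact h2.2
    have hfin := Submodule.finrank_lt_finrank_of_lt hlt
    have hσ1' : Module.finrank ℝ (Submodule.span ℝ σ) + 1 = Fintype.card ι := hσ1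
    refine (small_submodule (W := Submodule.span ℝ σ ⊓ LinearMap.ker φ) (by omega)).mono ?_
    rw [hface]
    exact fun x hx => ⟨Submodule.subset_span hx.1, hx.2⟩
  by_cases h : σ ⊆ τ
  · rw [Set.inter_comm]
    exact key hτ hσ hτ1 fun h' => hne (h.antisymm h')
  · exact key hσ hτ hσ1 h

end Fan
end HDTVCluster

namespace HDTVCluster

/-! ### The HDTV scattering diagram -/

section HDTV

open MvPowerSeries

variable {k I ι : Type*} [Field k] [Fintype I] [Fintype ι] [DecidableEq ι] {s : Seed I ι}

theorem Seed.incl_single (s : Seed I ι) (i : I) : s.incl (Finsupp.single i 1) = s.e i := by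
  classical
  rw [Seed.incl, Finset.sum_eq_single i]
  · simp
  · intro j _ hj
    simp [hj.symm]
  · simp

theorem isPrimitive_e (s : Seed I ι) (i : I) : IsPrimitive (s.e i) := by
  have h : Finset.univ.gcd (s.e i) ∣ 1 := by
    have := Finset.gcd_dvd (f := s.e i) (Finset.mem_univ (s.uf i))
    simpa [Seed.e] using this
  rw [IsPrimitive, ← Finset.normalize_gcd]
  exact normalize_eq_one.2 (isUnit_of_dvd_one h)

theorem hasNormal_perp {n : ι → ℤ} (hn : IsPrimitive n) : HasNormal (perp n) n :=
  ⟨hn, fun x => by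
    have : Submodule.span ℝ (perp n) = LinearMap.ker (pairL n) :=
      Submodule.span_eq (LinearMap.ker (pairL n))
    rw [this]
    rfl⟩

theorem isWallCone_perp {n : ι → ℤ} (hn : IsPrimitive n) : IsWallCone (perp n) := by
  classical
  refine ⟨⟨{n, -n}, Set.ext fun x => ?_⟩, (hasNormal_perp hn).coneDim⟩
  simp only [Finset.mem_insert, Finset.mem_singleton, forall_eq_or_imp, forall_eq, neg_pair,
    Set.mem_ofPred_eq]
  exact ⟨fun h => ⟨ge_of_eq h, by rw [show pair n x = 0 from h, neg_zero]⟩,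
    fun h => le_antisymm (neg_nonneg.1 h.2) h.1⟩

/-- The function `1 + t_i z^{v_i}`. -/
noncomputable def Seed.initialFunc (k : Type*) [Field k] (s : Seed I ι) (i : I) :
    MvPowerSeries I (AddMonoidAlgebra k (ι → ℤ)) :=
  1 + C (AddMonoidAlgebra.single (s.v i) 1) * X i

theorem coeff_one_add_C_mul_X {R : Type*} [Semiring R] [DecidableEq I] (a : R) (i : I)
    (β : I →₀ ℕ) : coeff β (1 + C a * X i : MvPowerSeries I R) =
      (if β = 0 then 1 else 0) + if β = Finsupp.single i 1 then a else 0 := by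
  rw [map_add, coeff_one, coeff_C_mul, coeff_X, mul_ite, mul_one, mul_zero]

theorem initialFunc_injective (k : Type*) [Field k] (s : Seed I ι) :
    Function.Injective (s.initialFunc k) := by
  classical
  intro i j h
  have h1 := congrArg (coeff (Finsupp.single i 1)) h
  rw [Seed.initialFunc, Seed.initialFunc, coeff_one_add_C_mul_X, coeff_one_add_C_mul_X,
    if_neg (by simp), if_pos rfl, zero_add, zero_add] at h1
  by_contra hij
  rw [if_neg fun h2 => hij (Finsupp.single_left_injective one_ne_zero h2),
    AddMonoidAlgebra.single_eq_zero] at h1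
  exact one_ne_zero h1

theorem coeff_two_nsmul_initialFunc (s : Seed I ι) (i : I) {β : I →₀ ℕ} (hβ : β ≠ 0) :
    coeff (2 • β) (s.initialFunc k i) = 0 := by
  classical
  rw [Seed.initialFunc, coeff_one_add_C_mul_X, if_neg fun h => hβ ?_, if_neg fun h => ?_, add_zero]
  · have := congrFun (congrArg DFunLike.coe h) i
    simp only [Finsupp.smul_apply, Finsupp.single_eq_same, smul_eq_mul] at this
    omega
  · exact (smul_eq_zero.1 h).resolve_left two_ne_zero

theorem toPrin_initial (s : Seed I ι) (i : I) :
    toPrin s (1 + X i : MvPowerSeries I k) = s.initialFunc k i := by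
  classical
  ext1 β
  change AddMonoidAlgebra.single _ _ = _
  have h := coeff_one_add_C_mul_X (1 : k) i β
  rw [map_one, one_mul] at h
  rw [Seed.initialFunc, coeff_one_add_C_mul_X, h]
  by_cases h0 : β = 0
  · have h1 : (0 : I →₀ ℕ) ≠ Finsupp.single i 1 := by simp [eq_comm]
    rw [h0, if_pos rfl, if_neg h1, if_pos rfl, if_neg h1, add_zero, add_zero, s.incl_zero,
      s.p1_zero, AddMonoidAlgebra.one_def]
  · rw [if_neg h0, if_neg h0, zero_add, zero_add]
    split_ifs with h1
    · rw [h1, s.incl_single]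
      congr 1
      funext j
      simp [Seed.p1, Seed.e, Seed.v, Pi.single_apply]
    · exact AddMonoidAlgebra.single_zero _

theorem isCPrinDiagram_clusterInitial (k : Type*) [Field k] (s : Seed I ι) :
    IsCPrinDiagram s (clusterInitial k s.prin) := by
  classical
  have he : ∀ i, s.prin.e i = Sum.elim (s.e i) 0 := fun i => by
    rw [← s.prin.incl_single, s.incl_prin, s.incl_single]
  refine ⟨⟨?_, fun j => ?_⟩, ?_⟩
  · rintro _ ⟨i, rfl⟩
    have hcone := isWallCone_perp (isPrimitive_e s.prin i)
    refine ⟨hcone.1, hcone.2, ?_, ?_, ?_, fun β hβ h => ⟨1, le_rfl, ?_⟩⟩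
    · rw [s.prin.incl_single]
      exact isPrimitive_e s.prin i
    · rw [s.prin.incl_single]
    · simp
    · have h1 := coeff_one_add_C_mul_X (1 : k) i β
      rw [map_one, one_mul, if_neg hβ, zero_add] at h1
      rw [h1] at h
      rw [one_smul]
      by_contra h2
      exact h (if_neg h2)
  · refine (Set.finite_range fun i : I => (⟨perp (s.prin.e i), Finsupp.single i 1, 1 + X i⟩ :
      CWall k I (ι ⊕ ι))).subset ?_
    rintro _ ⟨⟨i, rfl⟩, -⟩
    exact ⟨i, rfl⟩
  · rintro _ ⟨i, rfl⟩
    refine ⟨⟨s.e i, (isPrimitive_e s i).ne_zero, ?_⟩, fun x hx y => ?_⟩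
    · rw [← he]
    · have h1 : pair (s.prin.e i) (Sum.elim (0 : ι → ℝ) y) = 0 := by
        rw [he]
        simp [pair, Fintype.sum_sum_type]
      change pair _ _ = 0
      rw [pair_add, h1, add_zero]
      exact hx

/-- The walls of the image under `Ψ` of the initial cluster scattering diagram. -/
theorem psi_clusterInitial (k : Type*) [Field k] (hX : s.XAssumptions) :
    Psi s (clusterInitial k s.prin) =
      Set.range fun i => (⟨perp (s.e i), -s.v i, s.initialFunc k i⟩ : Wall k I ι) := by
  have hw : ∀ i, psiWall s (⟨perp (s.prin.e i), Finsupp.single i 1, 1 + X i⟩ :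
      CWall k I (ι ⊕ ι)) = ⟨perp (s.e i), -s.v i, s.initialFunc k i⟩ := by
    intro i
    have h1 : s.p1 (s.e i) = s.v i := by
      funext j
      simp [Seed.p1, Seed.e, Seed.v, Pi.single_apply]
    have h2 : (fun x : ι ⊕ ι → ℝ => fun j => x (Sum.inl j)) '' perp (s.prin.e i) =
        perp (s.e i) := by
      have hp : ∀ x : ι ⊕ ι → ℝ, pair (s.prin.e i) x = pair (s.e i) fun j => x (Sum.inl j) := by
        intro x
        rw [← s.prin.incl_single, s.incl_prin, s.incl_single]
        simp [pair, Fintype.sum_sum_type]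
      ext x
      constructor
      · rintro ⟨x', hx', rfl⟩
        change pair _ _ = 0
        rw [← hp]
        exact hx'
      · intro hx
        refine ⟨Sum.elim x 0, ?_, rfl⟩
        change pair _ _ = 0
        rw [hp]
        exact hx
    rw [psiWall, toPrin_initial, h2, s.incl_single, h1,
      primitivePart_of_isPrimitive (hX.primitive i)]
  ext w
  constructor
  · rintro ⟨_, ⟨i, rfl⟩, rfl⟩
    exact ⟨i, (hw i).symm⟩
  · rintro ⟨i, rfl⟩
    exact ⟨_, ⟨i, rfl⟩, hw i⟩

/-- The initial HDTV diagram: all intersection numbers are `0` or `1`. -/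
theorem mem_xHDTVInitial_iff {S : Set (Set (ι → ℝ))} (hS : s.IsXToricModel S) {w : Wall k I ι} :
    w ∈ s.xHDTVInitial k S ↔ ∃ i, ∃ σ ∈ S, IsCodimOne σ ∧ toReal (s.v i) ∈ σ ∧
      σ ⊆ perp (s.e i) ∧ w = ⟨σ, -s.v i, s.initialFunc k i⟩ := by
  classical
  refine exists_congr fun i => exists_congr fun σ => and_congr_right fun hσ =>
    and_congr_right fun hσ1 => and_congr_right fun _ => ?_
  by_cases hsub : σ ⊆ perp (s.e i)
  -- a form which vanishes on `σ` vanishes on `e_i^⊥`, hence is a multiple of `e_i`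
  · have hn := HasNormal.of_subset_perp hσ1 (isPrimitive_e s i) hsub
    have h1 : intersectionNumber (s.v i) σ (s.xEquation k i) = 1 := by
      refine intersectionNumber_eq_one _ (isPrimitive_e s i).ne_zero hsub fun n h => ?_
      refine ⟨n (s.uf i), funext fun j => ?_⟩
      by_cases hj : j = s.uf i
      · simp [Seed.e, hj]
      · have h2 : (Pi.single j 1 : ι → ℝ) ∈ Submodule.span ℝ σ := by
          rw [hn.mem_span_iff]
          simp [pair, Seed.e, Pi.single_apply, hj]
        have h3 : Submodule.span ℝ σ ≤ LinearMap.ker (pairL n) := Submodule.span_le.2 h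
        have h4 : pair n (Pi.single j 1 : ι → ℝ) = 0 := h3 h2
        have h5 : n j = 0 := by simpa [pair, Pi.single_apply] using h4
        simp [Seed.e, hj, h5]
    rw [h1, pow_one]
    exact ⟨fun h => ⟨hsub, h.2⟩, fun h => ⟨one_pos, h.2⟩⟩
  · obtain ⟨C, hC, -, hCe⟩ := hS.perp_eq i
    have hne : ∃ x ∈ σ, pair (s.e i) x ≠ 0 := by
      by_contra! h
      exact hsub h
    have h0 : intersectionNumber (s.v i) σ (s.xEquation k i) = 0 :=
      intersectionNumber_eq_zero _ (hS.fan.sign_of_perp hC hCe hσ hsub) hne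
    rw [h0]
    exact iff_of_false (fun h => lt_irrefl _ h.1) fun h => hsub h.1

/-- The walls `(e_i^⊥, 1 + t_i z^{v_i})`, cut into the cones of the fan. -/
def fanDiagram (k : Type*) [Field k] (s : Seed I ι) (S : Set (Set (ι → ℝ))) : Set (Wall k I ι) :=
  {w | ∃ i, ∃ σ ∈ S, IsCodimOne σ ∧ σ ⊆ perp (s.e i) ∧ w = ⟨σ, -s.v i, s.initialFunc k i⟩}

variable [CharZero k]

theorem isScatteringDiagram_fanDiagram (hX : s.XAssumptions) {S : Set (Set (ι → ℝ))}
    (hS : s.IsXToricModel S) : IsScatteringDiagram (fanDiagram k s S) := by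
  have hpsi := (isCPrinDiagram_clusterInitial k s).isScatteringDiagram_psi
  rw [psi_clusterInitial k hX] at hpsi
  refine ⟨?_, fun j => ?_⟩
  · rintro _ ⟨i, σ, hσ, hσ1, hsub, rfl⟩
    have hw := hpsi.1 _ ⟨i, rfl⟩
    have hn := HasNormal.of_subset_perp hσ1 (isPrimitive_e s i) hsub
    refine ⟨(hS.fan.smooth σ hσ).isRationalPolyhedralCone, hσ1, hw.dir_eq, ?_, hw.coeff_zero,
      hw.coeff_ne_zero⟩
    change toReal (-s.v i) ∈ _
    rw [hn.mem_span_iff, pair_toReal, dotProduct_neg, s.e_mem_divisorChars i]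
    simp
  · refine ((Set.finite_univ (α := I)).prod hS.fan.finite |>.image fun p =>
      (⟨p.2, -s.v p.1, s.initialFunc k p.1⟩ : Wall k I ι)).subset ?_
    rintro _ ⟨⟨i, σ, hσ, -, -, rfl⟩, -⟩
    exact ⟨(i, σ), ⟨Set.mem_univ _, hσ⟩, rfl⟩

/-- A general point of `e_i^⊥` lies in exactly one of the cones of codimension one of the fan which
are contained in `e_i^⊥`. -/
theorem genEq_fanDiagram (hX : s.XAssumptions) {S : Set (Set (ι → ℝ))} (hS : s.IsXToricModel S) :
    GenEq (Psi s (clusterInitial k s.prin)) (fanDiagram k s S) := by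
  refine ⟨⋃ p ∈ {p : Set (ι → ℝ) × Set (ι → ℝ) | p ∈ S ×ˢ S ∧ IsCodimOne p.1 ∧ IsCodimOne p.2 ∧
    p.1 ≠ p.2}, p.1 ∩ p.2, ?_, fun x hx β => ?_⟩
  · refine Small.biUnion ((hS.fan.finite.prod hS.fan.finite).subset fun p hp => hp.1).countable ?_
    exact fun p hp => hS.fan.small_inter hp.1.1 hp.1.2 hp.2.1 hp.2.2.1 hp.2.2.2
  have hex : ∀ i, x ∈ perp (s.e i) → ∃ σ ∈ S, IsCodimOne σ ∧ σ ⊆ perp (s.e i) ∧ x ∈ σ := by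
    intro i hxi
    obtain ⟨C, hC, hC1, hCe⟩ := hS.perp_eq i
    rw [← hCe] at hxi
    obtain ⟨σ, hσ, hxσ⟩ := hxi
    refine ⟨σ, hC hσ, hC1 σ hσ, ?_, hxσ⟩
    rw [← hCe]
    exact Set.subset_sUnion_of_mem hσ
  choose! σ hσS hσ1 hσe hxσ using hex
  have h1 : {w ∈ Psi s (clusterInitial k s.prin) | x ∈ w.cone} =
      (fun i => (⟨perp (s.e i), -s.v i, s.initialFunc k i⟩ : Wall k I ι)) ''
        {i | x ∈ perp (s.e i)} := by
    rw [psi_clusterInitial k hX]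
    ext w
    constructor
    · rintro ⟨⟨i, rfl⟩, hxi⟩
      exact ⟨i, hxi, rfl⟩
    · rintro ⟨i, hxi, rfl⟩
      exact ⟨⟨i, rfl⟩, hxi⟩
  have h2 : {w ∈ fanDiagram k s S | x ∈ w.cone} =
      (fun i => (⟨σ i, -s.v i, s.initialFunc k i⟩ : Wall k I ι)) '' {i | x ∈ perp (s.e i)} := by
    ext w
    constructor
    · rintro ⟨⟨i, τ, hτ, hτ1, hτe, rfl⟩, hxτ⟩
      have hxi := hτe hxτ
      have hτσ : τ = σ i := by
        by_contra hne
        exact hx (Set.mem_biUnion (x := (τ, σ i)) ⟨⟨hτ, hσS i hxi⟩, hτ1, hσ1 i hxi, hne⟩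
          ⟨hxτ, hxσ i hxi⟩)
      exact ⟨i, hxi, by rw [hτσ]⟩
    · rintro ⟨i, hxi, rfl⟩
      exact ⟨⟨i, σ i, hσS i hxi, hσ1 i hxi, hσe i hxi, rfl⟩, hxσ i hxi⟩
  rw [logAt, logAt, h1, h2, finsum_mem_image, finsum_mem_image]
  · exact fun i _ j _ h => initialFunc_injective k s (congrArg Wall.func h)
  · exact fun i _ j _ h => initialFunc_injective k s (congrArg Wall.func h)

/-- The outgoing walls of the image under `Ψ` of a cluster scattering diagram, together with the
hyperplanes `e_i^⊥` cut into the cones of the fan, form a consistent completion of the initial HDTV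
diagram: the pieces of `e_i^⊥` which do not contain `v_i` are outgoing. -/
theorem psiMapsToCompletion_xHDTVInitial (hX : s.XAssumptions) {S : Set (Set (ι → ℝ))}
    (hS : s.IsXToricModel S) {D₀ : Set (CWall k I (ι ⊕ ι))} (h : IsClusterDiagram s.prin D₀) :
    PsiMapsToCompletion s D₀ (s.xHDTVInitial k S) := by
  have hIn := isCPrinDiagram_clusterInitial k s
  obtain ⟨D, hD, hDD₀, hcomp, hcoeff⟩ := IsCCompletion.exists_isCPrinDiagram h hIn (by
    rintro _ ⟨i, rfl⟩
    rw [s.prin.incl_single])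
  let A := fanDiagram k s S
  let B := Psi s D \ Psi s (clusterInitial k s.prin)
  have hPsi := hD.isScatteringDiagram_psi
  have hA : IsScatteringDiagram A := isScatteringDiagram_fanDiagram hX hS
  have hAB : IsScatteringDiagram (A ∪ B) := hA.union (hPsi.mono Set.sdiff_subset)
  -- the new walls have exponentials as functions, and hence are not among the walls of `A`
  have hB : (A ∪ B) \ A = B := by
    rw [Set.union_sdiff_left, sdiff_eq_left, Set.disjoint_left]
    rintro _ ⟨⟨w, hw, rfl⟩, hw'⟩ ⟨i, σ, -, -, -, hwi⟩
    obtain ⟨β, hβ, hne⟩ := hcoeff w ⟨hw, fun h => hw' ⟨w, h, rfl⟩⟩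
    have h1 : coeff (2 • β) (psiWall s w).func = 0 := by
      rw [hwi]
      exact coeff_two_nsmul_initialFunc s i hβ
    exact hne (AddMonoidAlgebra.single_eq_zero.1 h1)
  obtain ⟨Z, hZ, hZeq⟩ := genEq_fanDiagram (k := k) hX hS
  have hsub : Psi s (clusterInitial k s.prin) ⊆ Psi s D := Set.image_mono hcomp.2.1
  have hgen : GenEq (Psi s D) (A ∪ B) := ⟨Z, hZ, fun x hx β => by
    rw [logAt_eq_add hPsi hsub, logAt_eq_add hAB Set.subset_union_left, hB,
      hZeq x hx]⟩
  refine psiMapsToCompletion_of_genEq h.1 hD hDD₀ (D' := A ∪ B) ⟨hAB, ?_, ?_, ?_⟩ hgen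
  · intro w hw
    obtain ⟨i, σ, hσ, hσ1, -, hsub, rfl⟩ := (mem_xHDTVInitial_iff hS).1 hw
    exact Or.inl ⟨i, σ, hσ, hσ1, hsub, rfl⟩
  · exact hgen.symm.isConsistent hAB hPsi (hD.isConsistent_psi_iff.1 hcomp.2.2.1)
  · rintro w ⟨hw | hw, hw'⟩ hinc
    · obtain ⟨i, σ, hσ, hσ1, hsub, rfl⟩ := hw
      refine hw' ((mem_xHDTVInitial_iff hS).2 ⟨i, σ, hσ, hσ1, ?_, hsub, rfl⟩)
      have h1 : toReal (- -s.v i) ∈ σ := hinc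
      rwa [neg_neg] at h1
    · obtain ⟨⟨w, hwD, rfl⟩, hwI⟩ := hw
      rw [← hD.incoming_iff hwD] at hinc
      exact hcomp.2.2.2 w ⟨hwD, fun h => hwI ⟨w, h, rfl⟩⟩ hinc

end HDTV
end HDTVCluster

theorem mainTheorem3 {k : Type*} [Field k] [IsAlgClosed k] [CharZero k]
    {I ι : Type*} [Fintype I] [Fintype ι] [DecidableEq ι] (s : HDTVCluster.Seed I ι) :
    -- `Ψ(D)` is a scattering diagram, and `Ψ` respects incoming and outgoing walls
    (∀ D : Set (HDTVCluster.CWall k I (ι ⊕ ι)), HDTVCluster.IsCPrinDiagram s D →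
      HDTVCluster.IsScatteringDiagram (HDTVCluster.Psi s D) ∧
      ∀ w ∈ D, (w.Incoming s.prin ↔ (HDTVCluster.psiWall s w).Incoming)) ∧
    -- `Ψ` is well defined and injective on equivalence classes
    (∀ D D' : Set (HDTVCluster.CWall k I (ι ⊕ ι)), HDTVCluster.IsCPrinDiagram s D →
      HDTVCluster.IsCPrinDiagram s D' →
      (HDTVCluster.CEquivalent s.prin D D' ↔
        HDTVCluster.Equivalent (HDTVCluster.Psi s D) (HDTVCluster.Psi s D'))) ∧
    -- `D` is consistent if and only if `Ψ(D)` is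
    (∀ D : Set (HDTVCluster.CWall k I (ι ⊕ ι)), HDTVCluster.IsCPrinDiagram s D →
      (HDTVCluster.IsCConsistent s.prin D ↔
        HDTVCluster.IsConsistent (HDTVCluster.Psi s D))) ∧
    -- `S(Ψ(Din)) = Ψ(S(Din))`
    (∀ Din : Set (HDTVCluster.CWall k I (ι ⊕ ι)), HDTVCluster.IsCPrinDiagram s Din →
      (∀ w ∈ Din, w.cone = HDTVCluster.perp (s.prin.incl w.normal)) →
      ∀ D₀, HDTVCluster.IsCCompletion s.prin Din D₀ →
        HDTVCluster.PsiMapsToCompletion s D₀ (HDTVCluster.Psi s Din)) ∧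
    -- `Ψ` maps the `𝒜_prin` cluster scattering diagram to the HDTV scattering diagram
    (s.XAssumptions → ∀ S : Set (Set (ι → ℝ)), s.IsXToricModel S →
      ∀ D₀ : Set (HDTVCluster.CWall k I (ι ⊕ ι)), HDTVCluster.IsClusterDiagram s.prin D₀ →
        HDTVCluster.PsiMapsToCompletion s D₀ (s.xHDTVInitial k S)) := by
  refine ⟨fun D hD => ⟨hD.isScatteringDiagram_psi, fun w hw => hD.incoming_iff hw⟩,
    fun D D' hD hD' => hD.equivalent_psi_iff hD', fun D hD => hD.isConsistent_psi_iff,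
    fun Din hDin hfull D₀ h => HDTVCluster.psiMapsToCompletion_psi hDin hfull h,
    fun hX S hS D₀ h => HDTVCluster.psiMapsToCompletion_xHDTVInitial hX hS h⟩
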